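/- Let $n\ge 1$ and $G=\mathrm{SL}(n+1,\mathbb R)$, with matrix indices $0,\dots,n$. Let $\mathcal T$ be $[0,\infty)$ or any subnet (for instance a sequence $t\to\infty$) of it. For $t\in\mathcal T$ let $r_1(t)\ge\dots\ge r_n(t)\ge 0$ with $\sum_i r_i(t)=nt$, and assume that for some $1\le n_0\le n$ we have $r_{n_0}(t)\to\infty$ and $r_i(t)\to 0$ for all $i>n_0$, as $t\to\infty$ in $\mathcal T$. For $\mathbf x\in\mathbb R^n$ put $$a_t=\mathrm{diag}(e^{nt},e^{-r_1(t)},\dots,e^{-r_n(t)}),\qquad u(\mathbf x)=\begin{pmatrix}1&\mathbf x\\0&I_n\end{pmatrix},$$ and let $$G_{n_0}=\left\{\begin{pmatrix}C&D\\0&I_{n-n_0}\end{pmatrix}: C\in \mathrm{SL}(n_0+1,\mathbb R)\right\},\qquad Q=\left\{\begin{pmatrix}A&0\\y&1\end{pmatrix}: A\in\mathrm{SL}(n,\mathbb R),\ y\in\mathbb R^n\right\},\qquad Q_{n_0}=Q\cap G_{n_0}.$$ Say that $\{a_t\}$ is non-uniform if $r_1(t)-r_n(t)\to\infty$. Let $k\ge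 n$, $s_0\in(0,1)$, and let $\phi:(0,1)\to\mathbb R^n$ be $C^k$ in a neighbourhood of $s_0$ and ordered regular at $s_0$; that is, for each $1\le i\le n$ the span of $\phi^{(1)}(s_0),\dots,\phi^{(i)}(s_0)$ projects onto $\mathbb R^i$ under $(x_1,\dots,x_n)\mapsto(x_1,\dots,x_i)$. At each point $s$ where $\phi$ is ordered regular there are a unique upper triangular unipotent matrix $B(s)$ and unique $\kappa_i(s)\ne 0$ such that $(\phi^{(i)}(s)/i!)B(s)^{-1}\in\kappa_i(s)\mathbf e_i+\mathrm{span}\{\mathbf e_1,\dots,\mathbf e_{i-1}\}$ for $1\le i\le n$. Let $\kappa_{i,j}(s)$ be the $i$-th coordinate of $(\phi^{(j)}(s)/j!)B(s)^{-1}$, and let $$R_s(h)=\sum_{i=1}^n\Bigl(\kappa_i(s)h^i+\sum_{j=i+1}^k\kappa_{i,j}(s)h^j\Bigr)\mathbf e_i,$$ which is the order-$k$ Taylor polynomial of $h\mapsto(\phi(s+h)-\phi(s))B(s)^{-1}$. For $t\in\mathcal T$ let $\alpha_t\ge 1$, and let $s_t\in(0,1)$ with $s_t\to s_0$, be such that either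 $\alpha_t=1$ and $s_t=s_0$ for all $t$, or $\alpha_t\to\infty$ and $\alpha_te^{-t}\to 0$. Write $R=R_{s_t}$ ($\phi$ is ordered regular at $s_t$ for all large $t$). Let $V$ be a finite dimensional real normed space with a continuous linear representation of $G$, and let $J\subset(0,\infty)$ be a compact interval of positive length. Then the following hold. (A) There exist $D_2>0$ and $T$ such that for all $v\in V$ and all $t\ge T$ in $\mathcal T$, $$\sup_{\eta\in J}\|a_tu(R(\alpha_te^{-t}\eta))v\|\ge D_2\|v\|.$$ (B) Suppose that $t_i\to\infty$ is a sequence (or subnet) in $\mathcal T$, that $v_i\to v$ in $V$, and that $M>0$ satisfies $\sup_{\eta\in J}\|a_{t_i}u(R(\alpha_{t_i}e^{-t_i}\eta))v_i\|\le M$ for all $i$. Then: (1) if $\alpha_{t_i}\to\infty$, then $v$ is fixed by $G_{n_0}$; (2) if $\{a_t\}$ is non-uniform, then $v$ is fixed by $Q_{n_0}$. -/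

import Mathlib

open Filter Topology

namespace ShrinkingCurves

/-! ### The elements `u(x)` and `a_t` of `SL(n+1, ℝ)` -/

/-- The matrix with first row `(1, x₁, …, xₙ)` and identity rows below it. -/
def horoMatrix {n : ℕ} (x : Fin n → ℝ) : Matrix (Fin (n + 1)) (Fin (n + 1)) ℝ :=
  Matrix.of fun i j => if i = 0 then (Fin.cons 1 x : Fin (n + 1) → ℝ) j else if i = j then 1 else 0

theorem det_horoMatrix {n : ℕ} (x : Fin n → ℝ) : (horoMatrix x).det = 1 := by
  rw [Matrix.det_of_isUpperTriangular]
  · refine Finset.prod_eq_one fun i _ => ?_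
    by_cases h : i = 0
    · subst h; simp [horoMatrix]
    · simp [horoMatrix, h]
  · intro i j hij
    have hij' : j < i := hij
    have h0 : i ≠ 0 := by
      rintro rfl
      exact absurd hij' (Fin.not_lt_zero j)
    simp [horoMatrix, h0, hij'.ne']

/-- `u(x)` as an element of `SL(n+1, ℝ)`. -/
def horo {n : ℕ} (x : Fin n → ℝ) : Matrix.SpecialLinearGroup (Fin (n + 1)) ℝ :=
  ⟨horoMatrix x, det_horoMatrix x⟩

/-- `a = diag(e^{nt}, e^{-r₁}, …, e^{-rₙ})`, an element of `SL(n+1, ℝ)` because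
`r₁ + ⋯ + rₙ = n t`.  The number `rᵢ` is `r ⟨i - 1, _⟩`. -/
noncomputable def expandingDiag {n : ℕ} (t : ℝ) (r : Fin n → ℝ) (h : ∑ i, r i = n * t) :
    Matrix.SpecialLinearGroup (Fin (n + 1)) ℝ :=
  ⟨Matrix.diagonal (Fin.cons (Real.exp (n * t)) fun i => Real.exp (-r i)), by
    rw [Matrix.det_diagonal, Fin.prod_univ_succ]
    simp only [Fin.cons_zero, Fin.cons_succ]
    rw [← Real.exp_sum, ← Real.exp_add, Finset.sum_neg_distrib, h, add_neg_cancel, Real.exp_zero]⟩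

/-! ### The subgroups `G_{n₀}`, `Q` and `Q_{n₀}` -/

/-- `G_{n₀}`: the matrices of block form `[C D; 0 I]` in `SL(n+1, ℝ)` with `C` of size `n₀ + 1`;
that is, the rows with index `i > n₀` (indices run over `0, …, n`) are those of the identity.
Then `det C = 1` automatically. -/
def subgroupG (n n₀ : ℕ) : Subgroup (Matrix.SpecialLinearGroup (Fin (n + 1)) ℝ) where
  carrier := {g | ∀ i : Fin (n + 1), n₀ < (i : ℕ) → ∀ j, g.1 i j = (1 : Matrix _ _ ℝ) i j}
  one_mem' := fun i _ j => rfl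
  mul_mem' := by
    intro g g' hg hg' i hi j
    rw [Matrix.SpecialLinearGroup.coe_mul, Matrix.mul_apply]
    simp only [hg i hi, Matrix.one_apply, ite_mul, one_mul, zero_mul, Finset.sum_ite_eq,
      Finset.mem_univ, if_true]
    simpa only [Matrix.one_apply] using hg' i hi j
  inv_mem' := by
    intro g hg i hi j
    have h : (g.1 * (g⁻¹).1) i j = (1 : Matrix _ _ ℝ) i j := by
      rw [← Matrix.SpecialLinearGroup.coe_mul, mul_inv_cancel]; rfl
    rw [Matrix.mul_apply] at h
    simpa [hg i hi, Matrix.one_apply] using h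

/-- `Q`: the matrices of block form `[A 0; y 1]` with `A ∈ SL(n, ℝ)`, `y ∈ ℝⁿ`;
that is, the last column is that of the identity.  Then `det A = 1` automatically. -/
def subgroupQ (n : ℕ) : Subgroup (Matrix.SpecialLinearGroup (Fin (n + 1)) ℝ) where
  carrier := {g | ∀ i : Fin (n + 1), g.1 i (Fin.last n) = (1 : Matrix _ _ ℝ) i (Fin.last n)}
  one_mem' := fun i => rfl
  mul_mem' := by
    intro g g' hg hg' i
    rw [Matrix.SpecialLinearGroup.coe_mul, Matrix.mul_apply]
    simp only [hg' _, Matrix.one_apply, mul_ite, mul_one, mul_zero, Finset.sum_ite_eq',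
      Finset.mem_univ, if_true]
    simpa only [Matrix.one_apply] using hg i
  inv_mem' := by
    intro g hg i
    have h : ((g⁻¹).1 * g.1) i (Fin.last n) = (1 : Matrix _ _ ℝ) i (Fin.last n) := by
      rw [← Matrix.SpecialLinearGroup.coe_mul, inv_mul_cancel]; rfl
    rw [Matrix.mul_apply] at h
    simpa [hg _, Matrix.one_apply] using h

/-- `Q_{n₀} = Q ∩ G_{n₀}`. -/
def subgroupQn (n n₀ : ℕ) : Subgroup (Matrix.SpecialLinearGroup (Fin (n + 1)) ℝ) :=
  subgroupQ n ⊓ subgroupG n n₀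

/-! ### Ordered regularity and the adapted Taylor polynomial -/

/-- `φ` is ordered regular at `s`: for each `i ≤ n` the span of `φ⁽¹⁾(s), …, φ⁽ⁱ⁾(s)` projects
onto `ℝⁱ` under `(x₁, …, xₙ) ↦ (x₁, …, xᵢ)`. -/
def OrderedRegularAt {n : ℕ} (φ : ℝ → Fin n → ℝ) (s : ℝ) : Prop :=
  ∀ (i : ℕ) (hi : i ≤ n),
    Submodule.map (LinearMap.funLeft ℝ ℝ (Fin.castLE hi))
      (Submodule.span ℝ (Set.range fun j : Fin i => iteratedDeriv ((j : ℕ) + 1) φ s)) = ⊤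

/-- The Taylor coefficient `φ⁽ʲ⁾(s) / j!`. -/
noncomputable def taylorVec {n : ℕ} (φ : ℝ → Fin n → ℝ) (s : ℝ) (j : ℕ) : Fin n → ℝ :=
  ((j.factorial : ℝ)⁻¹) • iteratedDeriv j φ s

/-- `B` is upper triangular unipotent and, for `1 ≤ i ≤ n`, the row vector `(φ⁽ⁱ⁾(s)/i!) B⁻¹` lies
in `κᵢ eᵢ + span {e₁, …, eᵢ₋₁}` for some `κᵢ ≠ 0`. -/
def IsAdaptedFrame {n : ℕ} (φ : ℝ → Fin n → ℝ) (s : ℝ) (B : Matrix (Fin n) (Fin n) ℝ) : Prop :=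
  (∀ i, B i i = 1) ∧ (∀ i j, j < i → B i j = 0) ∧
    ∀ i : Fin n, Matrix.vecMul (taylorVec φ s ((i : ℕ) + 1)) B⁻¹ i ≠ 0 ∧
      ∀ j, i < j → Matrix.vecMul (taylorVec φ s ((i : ℕ) + 1)) B⁻¹ j = 0

/-- The inverse of an upper triangular unipotent matrix is upper triangular unipotent. -/
theorem unipotent_inv {n : ℕ} {B : Matrix (Fin n) (Fin n) ℝ} (h1 : ∀ i, B i i = 1)
    (h2 : ∀ i j, j < i → B i j = 0) :
    IsUnit B.det ∧ (∀ i, B⁻¹ i i = 1) ∧ ∀ i j, j < i → B⁻¹ i j = 0 := by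
  have hT : B.BlockTriangular id := fun i j hij => h2 i j hij
  have hdet : B.det = 1 := by
    rw [Matrix.det_of_isUpperTriangular hT]; simp [h1]
  have hu : IsUnit B.det := by rw [hdet]; exact isUnit_one
  have : Invertible B := B.invertibleOfIsUnitDet hu
  have hTi : B⁻¹.BlockTriangular id := Matrix.blockTriangular_inv_of_blockTriangular hT
  refine ⟨hu, fun i => ?_, fun i j hij => hTi hij⟩
  have h : (B * B⁻¹) i i = 1 := by rw [Matrix.mul_nonsing_inv _ hu]; simp
  rw [Matrix.mul_apply, Finset.sum_eq_single i] at h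
  · simpa [h1] using h
  · intro l _ hl
    rcases lt_or_gt_of_ne hl with hl | hl
    · rw [h2 i l hl, zero_mul]
    · rw [hTi hl, mul_zero]
  · simp

/-- At an ordered regular point the leading blocks of the matrix of derivatives are injective. -/
theorem OrderedRegularAt.eq_zero {n : ℕ} {φ : ℝ → Fin n → ℝ} {s : ℝ} (h : OrderedRegularAt φ s)
    {m : ℕ} (hm : m ≤ n) (x : Fin n → ℝ) (hx : ∀ l : Fin n, m ≤ (l : ℕ) → x l = 0)
    (h0 : ∀ i : Fin m, iteratedDeriv ((i : ℕ) + 1) φ s ⬝ᵥ x = 0) : x = 0 := by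
  have key : ∀ w : Fin m → ℝ, ∑ l, w l * x (Fin.castLE hm l) = 0 := by
    intro w
    have hw : w ∈ Submodule.map (LinearMap.funLeft ℝ ℝ (Fin.castLE hm))
      (Submodule.span ℝ (Set.range fun j : Fin m => iteratedDeriv ((j : ℕ) + 1) φ s)) := by
      rw [h m hm]; trivial
    obtain ⟨z, hz, rfl⟩ := hw
    have hz0 : z ⬝ᵥ x = 0 := by
      induction hz using Submodule.span_induction with
      | mem z hz => obtain ⟨j, rfl⟩ := hz; exact h0 j
      | zero => simp
      | add a b _ _ ha hb => rw [add_dotProduct, ha, hb, add_zero]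
      | smul c a _ ha => rw [smul_dotProduct, ha, smul_zero]
    rw [← hz0]
    refine Fintype.sum_of_injective (Fin.castLE hm) (Fin.castLE_injective hm) _ _ ?_ ?_
    · intro l hl
      rw [hx l, mul_zero]
      by_contra hlt
      exact hl ⟨⟨l, not_le.mp hlt⟩, rfl⟩
    · intro l; rfl
  funext l
  by_cases hl : (l : ℕ) < m
  · have := key (Pi.single ⟨l, hl⟩ 1)
    simpa [Pi.single_apply] using this
  · exact hx l (not_lt.mp hl)

/-- At an ordered regular point there is an adapted frame. -/
theorem OrderedRegularAt.exists_isAdaptedFrame {n : ℕ} {φ : ℝ → Fin n → ℝ} {s : ℝ}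
    (h : OrderedRegularAt φ s) : ∃ B, IsAdaptedFrame φ s B := by
  have col : ∀ j : Fin n, ∃ x : Fin n → ℝ, x j = 1 ∧ (∀ l, j < l → x l = 0) ∧
      (∀ i : Fin n, i < j → iteratedDeriv ((i : ℕ) + 1) φ s ⬝ᵥ x = 0) ∧
      iteratedDeriv ((j : ℕ) + 1) φ s ⬝ᵥ x ≠ 0 := by
    intro j
    have hj : (j : ℕ) + 1 ≤ n := j.2
    let ext : (Fin ((j : ℕ) + 1) → ℝ) →ₗ[ℝ] (Fin n → ℝ) :=
      { toFun := fun y l => if hl : (l : ℕ) < j + 1 then y ⟨l, hl⟩ else 0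
        map_add' := by
          intro a b; ext l
          by_cases hl : (l : ℕ) < j + 1 <;> simp only [hl, dif_pos, dif_neg, Pi.add_apply,
            not_false_eq_true, add_zero]
        map_smul' := by
          intro a b; ext l
          by_cases hl : (l : ℕ) < j + 1 <;> simp only [hl, dif_pos, dif_neg, Pi.smul_apply, Pi.add_apply,
            not_false_eq_true, RingHom.id_apply, smul_zero, add_zero] }
    let A : (Fin ((j : ℕ) + 1) → ℝ) →ₗ[ℝ] (Fin ((j : ℕ) + 1) → ℝ) :=
      { toFun := fun y i => iteratedDeriv ((i : ℕ) + 1) φ s ⬝ᵥ ext y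
        map_add' := by intro a b; ext i; simp [dotProduct_add]
        map_smul' := by intro a b; ext i; simp [dotProduct_smul] }
    have hext0 : ∀ y (l : Fin n), (j : ℕ) + 1 ≤ l → ext y l = 0 := by
      intro y l hl; exact dif_neg (not_lt.mpr hl)
    have hinj : Function.Injective A := by
      rw [injective_iff_map_eq_zero]
      intro y hy
      have := h.eq_zero hj (ext y) (hext0 y) (fun i => congrFun hy i)
      funext l
      have h2 := congrFun this ⟨l, l.2.trans_le hj⟩
      have h3 : ext y ⟨l, l.2.trans_le hj⟩ = y l := dif_pos l.2
      rw [h3] at h2; exact h2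
    obtain ⟨y, hy⟩ := (LinearMap.injective_iff_surjective.mp hinj) (Pi.single (Fin.last _) 1)
    have hyi : ∀ i : Fin n, i < j → iteratedDeriv ((i : ℕ) + 1) φ s ⬝ᵥ ext y = 0 := by
      intro i hi
      have := congrFun hy ⟨i, Nat.lt_succ_of_lt hi⟩
      rw [Pi.single_eq_of_ne] at this
      · exact this
      · intro he
        have := congrArg Fin.val he
        simp at this
        omega
    have hyj : iteratedDeriv ((j : ℕ) + 1) φ s ⬝ᵥ ext y = 1 := by
      have := congrFun hy (Fin.last _)
      rw [Pi.single_eq_same] at this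
      exact this
    have hne : ext y j ≠ 0 := by
      intro h0
      have hz := h.eq_zero (m := j) j.2.le (ext y) ?_ (fun i => hyi ⟨i, i.2.trans j.2⟩ i.2)
      · rw [hz] at hyj; simp at hyj
      · intro l hl
        rcases hl.lt_or_eq with hl | hl
        · exact hext0 y l hl
        · rw [← Fin.ext hl]; exact h0
    refine ⟨(ext y j)⁻¹ • ext y, ?_, ?_, ?_, ?_⟩
    · simp [hne]
    · intro l hl; simp [hext0 y l hl]
    · intro i hi; rw [dotProduct_smul, hyi i hi, smul_zero]
    · rw [dotProduct_smul, hyj]; simpa using hne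
  choose c hc1 hc2 hc3 hc4 using col
  obtain ⟨hu, hd, ht⟩ := unipotent_inv (B := Matrix.of fun l j => c j l) (fun i => hc1 i)
    (fun i j hij => hc2 j i hij)
  have hv : ∀ i j : Fin n,
      Matrix.vecMul (taylorVec φ s ((i : ℕ) + 1)) (Matrix.of fun l j => c j l) j =
      ((((i : ℕ) + 1).factorial : ℝ)⁻¹) * (iteratedDeriv ((i : ℕ) + 1) φ s ⬝ᵥ c j) := by
    intro i j
    rw [taylorVec, Matrix.smul_vecMul]
    rfl
  refine ⟨(Matrix.of fun l j => c j l)⁻¹, hd, ht, fun i => ?_⟩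
  rw [Matrix.nonsing_inv_nonsing_inv _ hu]
  refine ⟨?_, fun j hij => ?_⟩
  · rw [hv]
    exact mul_ne_zero (inv_ne_zero (by positivity)) (hc4 i)
  · rw [hv, hc3 j i hij, mul_zero]

/-- The adapted frame is unique. -/
theorem OrderedRegularAt.isAdaptedFrame_unique {n : ℕ} {φ : ℝ → Fin n → ℝ} {s : ℝ}
    (h : OrderedRegularAt φ s) {B B' : Matrix (Fin n) (Fin n) ℝ} (hB : IsAdaptedFrame φ s B)
    (hB' : IsAdaptedFrame φ s B') : B = B' := by
  obtain ⟨hu, hd, ht⟩ := unipotent_inv hB.1 hB.2.1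
  obtain ⟨hu', hd', ht'⟩ := unipotent_inv hB'.1 hB'.2.1
  have hinv : B⁻¹ = B'⁻¹ := by
    have hz : ∀ j : Fin n, (fun l => B⁻¹ l j) - (fun l => B'⁻¹ l j) = 0 := by
      intro j
      refine h.eq_zero (m := j) j.2.le _ ?_ ?_
      · intro l hl
        rcases hl.lt_or_eq with hl | hl
        · simp [ht l j hl, ht' l j hl]
        · have : j = l := Fin.ext hl
          subst this; simp [hd, hd']
      · intro i
        have e := (hB.2.2 ⟨i, i.2.trans j.2⟩).2 j i.2
        have e' := (hB'.2.2 ⟨i, i.2.trans j.2⟩).2 j i.2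
        rw [taylorVec, Matrix.smul_vecMul] at e e'
        have hf : ((((i : ℕ) + 1).factorial : ℝ)⁻¹) ≠ 0 := inv_ne_zero (by positivity)
        have e1 : iteratedDeriv ((i : ℕ) + 1) φ s ⬝ᵥ (fun l => B⁻¹ l j) = 0 :=
          (mul_eq_zero.mp e).resolve_left hf
        have e1' : iteratedDeriv ((i : ℕ) + 1) φ s ⬝ᵥ (fun l => B'⁻¹ l j) = 0 :=
          (mul_eq_zero.mp e').resolve_left hf
        rw [dotProduct_sub, e1, e1', sub_zero]
    ext l j
    exact sub_eq_zero.mp (congrFun (hz j) l)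
  rw [← Matrix.nonsing_inv_nonsing_inv _ hu, hinv, Matrix.nonsing_inv_nonsing_inv _ hu']

open Classical in
/-- `B(s)`: the unique adapted frame at an ordered regular point `s` (and `1` elsewhere). -/
noncomputable def adaptedFrame {n : ℕ} (φ : ℝ → Fin n → ℝ) (s : ℝ) : Matrix (Fin n) (Fin n) ℝ :=
  if h : OrderedRegularAt φ s then h.exists_isAdaptedFrame.choose else 1

theorem OrderedRegularAt.isAdaptedFrame {n : ℕ} {φ : ℝ → Fin n → ℝ} {s : ℝ}
    (h : OrderedRegularAt φ s) : IsAdaptedFrame φ s (adaptedFrame φ s) := by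
  rw [adaptedFrame, dif_pos h]
  exact h.exists_isAdaptedFrame.choose_spec

/-- `κ_{i,j}(s)`: the `i`-th coordinate of `(φ⁽ʲ⁾(s)/j!) B(s)⁻¹`.  In the `0`-based indexing of
coordinates, the numbers `κᵢ(s)` are `adaptedCoeff φ s i (i + 1)`. -/
noncomputable def adaptedCoeff {n : ℕ} (φ : ℝ → Fin n → ℝ) (s : ℝ) (i : Fin n) (j : ℕ) : ℝ :=
  Matrix.vecMul (taylorVec φ s j) (adaptedFrame φ s)⁻¹ i

/-- `R_s(h)`, whose `i`-th coordinate (`1 ≤ i ≤ n`) is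
`κᵢ(s) hⁱ + ∑_{j = i + 1}^{k} κ_{i,j}(s) hʲ`. -/
noncomputable def taylorCurve {n : ℕ} (φ : ℝ → Fin n → ℝ) (k : ℕ) (s h : ℝ) : Fin n → ℝ :=
  fun i => ∑ j ∈ Finset.Icc ((i : ℕ) + 1) k, adaptedCoeff φ s i j * h ^ j

/-- `R_s(h)` is the `k`-th order Taylor polynomial of `h ↦ φ(s + h) - φ(s)`, multiplied on the
right by `B(s)⁻¹`. -/
theorem OrderedRegularAt.taylorCurve_eq {n : ℕ} {φ : ℝ → Fin n → ℝ} {s : ℝ}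
    (hs : OrderedRegularAt φ s) (k : ℕ) (h : ℝ) :
    taylorCurve φ k s h =
      Matrix.vecMul (∑ j ∈ Finset.Icc 1 k, h ^ j • taylorVec φ s j) (adaptedFrame φ s)⁻¹ := by
  funext i
  rw [taylorCurve, Matrix.sum_vecMul, Finset.sum_apply]
  simp only [Matrix.smul_vecMul, Pi.smul_apply, smul_eq_mul]
  have hsub : Finset.Icc ((i : ℕ) + 1) k ⊆ Finset.Icc 1 k :=
    Finset.Icc_subset_Icc (by omega) le_rfl
  rw [← Finset.sum_subset hsub]
  · exact Finset.sum_congr rfl fun j _ => mul_comm _ _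
  · intro j hj hj'
    simp only [Finset.mem_Icc] at hj hj'
    have hji : j - 1 < (i : ℕ) := by omega
    have e := (hs.isAdaptedFrame.2.2 ⟨j - 1, hji.trans i.2⟩).2 i hji
    have hj1 : j - 1 + 1 = j := by omega
    simp only [hj1] at e
    rw [e, mul_zero]

/-! ### Non-uniformity -/

/-- `{a_t}` is non-uniform: `liminf (r₁(t) - rₙ(t)) = ∞`, that is, `r₁(t) - rₙ(t) → ∞`. -/
def NonUniform {n : ℕ} (hn : 0 < n) {ι : Type*} [Preorder ι] (r : ι → Fin n → ℝ) : Prop :=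
  Tendsto (fun t => r t ⟨0, hn⟩ - r t ⟨n - 1, Nat.sub_lt hn one_pos⟩) atTop atTop

end ShrinkingCurves

/-! Reduction to tensor powers. Matrix coefficients of a continuous representation of `SL` are
polynomials in the matrix entries (`matrixCoeff_mem_adjoin`), so equivariant maps from `V` to tensor
powers of the standard representation separate points (`exists_equivariant_ne_zero`). It is enough
to treat a tensor power, with coordinates indexed by multi-indices `I`, weights `cnt I`, and the
grading `wt idx I` by the sum of the indices. This grading fits the curve: the `i`-th coordinate of
`R(h)` is `h^i` times a polynomial with constant term `κ_i ≠ 0`.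

Passage to a model. Let `m` be the lowest `idx`-degree of the nonzero limit `v` and `w` its
component of degree `m`. The `J`-th coordinate of `u(R(h)) v_t` is a polynomial in `h` whose
coefficient of order `m - wt idx J` tends to the `J`-th coordinate of `u(κ) w`. Values on an
interval control coefficients, so a bound on the trajectory of `v_t` bounds the exponential factor
attached to each nonzero coordinate of `u(κ) w` (`exists_growth`, the growth condition).
Equivalently, the explicit vectors `a_t u(κ_i h^i) w` are bounded.

Lower bound. For a vector `w` homogeneous for an injective grading let `χ` be the point nearest to
the origin in the convex hull of its weights. Then `‖g w‖²` is at least a constant times a product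
of powers of the principal minors of `gᵀ g` on the superlevel sets of `χ`, with positive exponents
except perhaps on the full index set, where the minor is `1` (`exists_kempf_ness_bound`). For `g =
a_t u(κ_i h^i)` all these minors are bounded below (`Regime.exists_pos_le_gramMinor`), which gives
(A). If the vectors stay bounded, no minor that occurs can tend to infinity, which forces `χ` to be
constant on the indices `0, …, n₀` when `α → ∞`. When only `r₁ - rₙ → ∞`, the same holds if `n₀ <
n`, while for `n₀ = n` the last coordinate of `χ` may be larger.

Invariance. Pairing `u(κ) w` with `E_{0i} w_χ` gives `0` by the growth condition and `κ_i ‖E_{0i}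
w_χ‖²` by a degree count, so `E_{0i}` annihilates suitable weight components; constancy of `χ` and
the `sl₂` relation then dispose of `E_{i0}` (`killed_of_nearest`). For `n₀ < n` the argument is run
on the part with fewest indices up to `n₀`, and the remaining `E_{0j}` are treated by `high_killed`.
For `n₀ = n` with a larger last coordinate, a matrix that exchanges the indices `0` and `n` restores
the argument (`exists_killed_of_gap`). A component found in this way is fixed by the required
subgroup and has a bounded trajectory of its own, so it can be subtracted, and induction on the
support finishes (`fixed_of_step`). -/

set_option linter.unusedSectionVars false

namespace ShrinkingCurves

/-! ### Tensor powers of the standard representation -/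

section TensorPower

variable {ι : Type*} [Fintype ι] [DecidableEq ι] {D : ℕ}

/-- The action of a matrix on the `D`-th tensor power of `ℝ^ι`, in coordinates. -/
def tpow (D : ℕ) (M : Matrix ι ι ℝ) : Matrix (Fin D → ι) (Fin D → ι) ℝ :=
  Matrix.of fun J I => ∏ s, M (J s) (I s)

/-- The infinitesimal action of a matrix on the `D`-th tensor power of `ℝ^ι`. -/
def tder (D : ℕ) (X : Matrix ι ι ℝ) : Matrix (Fin D → ι) (Fin D → ι) ℝ :=
  Matrix.of fun J I => ∑ s, (∏ s' ∈ Finset.univ.erase s, (1 : Matrix ι ι ℝ) (J s') (I s')) *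
    X (J s) (I s)

/-- The value at a multi-index of the weight `f`. -/
def wt (f : ι → ℝ) (I : Fin D → ι) : ℝ := ∑ s, f (I s)

/-- The number of occurrences of each index in a multi-index. -/
def cnt (I : Fin D → ι) (i : ι) : ℝ := wt (Pi.single i 1) I

theorem tpow_apply (M : Matrix ι ι ℝ) (J I : Fin D → ι) :
    tpow D M J I = ∏ s, M (J s) (I s) := rfl

theorem wt_eq_sum_cnt (f : ι → ℝ) (I : Fin D → ι) : wt f I = ∑ i, cnt I i * f i := by
  simp only [cnt, wt, Finset.sum_mul]
  rw [Finset.sum_comm]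
  refine Finset.sum_congr rfl fun s _ => ?_
  simp [Pi.single_apply]

theorem wt_add (f g : ι → ℝ) (I : Fin D → ι) : wt (f + g) I = wt f I + wt g I := by
  simp [wt, Finset.sum_add_distrib]

theorem wt_smul (c : ℝ) (f : ι → ℝ) (I : Fin D → ι) : wt (c • f) I = c * wt f I := by
  simp [wt, Finset.mul_sum]

theorem sum_cnt (I : Fin D → ι) : ∑ i, cnt I i = D := by
  have := wt_eq_sum_cnt (fun _ => 1) I
  simpa [wt] using this.symm

theorem tpow_mul (M M' : Matrix ι ι ℝ) : tpow D (M * M') = tpow D M * tpow D M' := by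
  ext J I
  simp only [tpow_apply, Matrix.mul_apply, Finset.prod_univ_sum, Fintype.piFinset_univ,
    Finset.prod_mul_distrib]

theorem tpow_diagonal (d : ι → ℝ) :
    tpow D (Matrix.diagonal d) = Matrix.diagonal fun I => ∏ s, d (I s) := by
  ext J I
  rw [tpow_apply]
  by_cases h : J = I
  · subst h; simp
  · rw [Matrix.diagonal_apply_ne _ h]
    obtain ⟨s, hs⟩ := Function.ne_iff.mp h
    exact Finset.prod_eq_zero (Finset.mem_univ s) (Matrix.diagonal_apply_ne _ hs)

theorem tpow_one : tpow D (1 : Matrix ι ι ℝ) = 1 := by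
  rw [← Matrix.diagonal_one, tpow_diagonal]; simp

theorem tpow_diagonal_exp (f : ι → ℝ) :
    tpow D (Matrix.diagonal fun i => Real.exp (f i)) =
      Matrix.diagonal fun I => Real.exp (wt f I) := by
  rw [tpow_diagonal]; simp [wt, Real.exp_sum]

theorem tpow_transpose (M : Matrix ι ι ℝ) : tpow D M.transpose = (tpow D M).transpose := rfl

theorem tder_transpose (X : Matrix ι ι ℝ) : tder D X.transpose = (tder D X).transpose := by
  ext J I
  simp only [tder, Matrix.of_apply, Matrix.transpose_apply]
  refine Finset.sum_congr rfl fun s _ => ?_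
  congr 1
  refine Finset.prod_congr rfl fun s' _ => ?_
  simp [Matrix.one_apply, eq_comm]

theorem tder_add (X Y : Matrix ι ι ℝ) : tder D (X + Y) = tder D X + tder D Y := by
  ext J I
  simp [tder, mul_add, Finset.sum_add_distrib]

theorem tder_smul (c : ℝ) (X : Matrix ι ι ℝ) : tder D (c • X) = c • tder D X := by
  ext J I
  simp [tder, Finset.mul_sum, mul_left_comm]

/-- `tder` as a linear map. -/
def tderₗ (D : ℕ) : Matrix ι ι ℝ →ₗ[ℝ] Matrix (Fin D → ι) (Fin D → ι) ℝ where
  toFun := tder D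
  map_add' := tder_add
  map_smul' := tder_smul

theorem tder_sum {σ : Type*} (s : Finset σ) (X : σ → Matrix ι ι ℝ) :
    tder D (∑ i ∈ s, X i) = ∑ i ∈ s, tder D (X i) := map_sum (tderₗ D) X s

theorem tder_diagonal (d : ι → ℝ) :
    tder D (Matrix.diagonal d) = Matrix.diagonal fun I => wt d I := by
  ext J I
  simp only [tder, Matrix.of_apply]
  by_cases h : J = I
  · subst h; simp [wt]
  · rw [Matrix.diagonal_apply_ne _ h]
    refine Finset.sum_eq_zero fun s _ => ?_
    obtain ⟨s', hs'⟩ := Function.ne_iff.mp h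
    by_cases hss : s' = s
    · subst hss; rw [Matrix.diagonal_apply_ne _ hs', mul_zero]
    · rw [Finset.prod_eq_zero (i := s') (f := fun s' => (1 : Matrix ι ι ℝ) (J s') (I s'))
        (Finset.mem_erase.mpr ⟨hss, Finset.mem_univ s'⟩) (Matrix.one_apply_ne hs'), zero_mul]

/-- The grading: an entry of `tder D X` can be nonzero only if one index is changed, along
a nonzero entry of `X`. -/
theorem wt_of_tder_ne_zero {X : Matrix ι ι ℝ} {J I : Fin D → ι} (h : tder D X J I ≠ 0) :
    ∃ i j, X i j ≠ 0 ∧ ∀ f : ι → ℝ, wt f J = wt f I + f i - f j := by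
  rw [tder, Matrix.of_apply] at h
  obtain ⟨s, -, hs⟩ := Finset.exists_ne_zero_of_sum_ne_zero h
  refine ⟨J s, I s, right_ne_zero_of_mul hs, fun f => ?_⟩
  have h1 := left_ne_zero_of_mul hs
  rw [Finset.prod_ne_zero_iff] at h1
  rw [wt, wt, ← Finset.add_sum_erase _ _ (Finset.mem_univ s),
    ← Finset.add_sum_erase (a := s) _ (fun s => f (I s)) (Finset.mem_univ s)]
  have : ∑ x ∈ Finset.univ.erase s, f (J x) = ∑ x ∈ Finset.univ.erase s, f (I x) := by
    refine Finset.sum_congr rfl fun s' hs' => ?_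
    have := h1 s' hs'
    rw [Matrix.one_apply] at this
    simp only [ne_eq, ite_eq_right_iff, one_ne_zero, imp_false, not_not] at this
    rw [this]
  rw [this]; ring

/-- This links `tder` to `tpow`; the conjugation and commutator identities for `tder` are obtained
from it by differentiating multiplicative identities for `tpow`. -/
theorem hasDerivAt_tpow {M : ℝ → Matrix ι ι ℝ} {X : Matrix ι ι ℝ} {x : ℝ} (h1 : M x = 1)
    (h : ∀ i j, HasDerivAt (fun ε => M ε i j) (X i j) x) (J I : Fin D → ι) :
    HasDerivAt (fun ε => tpow D (M ε) J I) (tder D X J I) x := by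
  have := HasDerivAt.fun_finsetProd (u := (Finset.univ : Finset (Fin D)))
    (f := fun s ε => M ε (J s) (I s)) (f' := fun s => X (J s) (I s)) (x := x)
    fun s _ => h (J s) (I s)
  simpa [h1, tder, tpow] using this

theorem hasDerivAt_one_add_smul (X : Matrix ι ι ℝ) (i j : ι) :
    HasDerivAt (fun ε : ℝ => (1 + ε • X) i j) (X i j) 0 := by
  have := ((hasDerivAt_id (0 : ℝ)).mul_const (X i j)).const_add ((1 : Matrix ι ι ℝ) i j)
  simpa using this

theorem hasDerivAt_tpow_one_add_smul (X : Matrix ι ι ℝ) (J I : Fin D → ι) :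
    HasDerivAt (fun ε : ℝ => tpow D (1 + ε • X) J I) (tder D X J I) 0 :=
  hasDerivAt_tpow (by simp) (hasDerivAt_one_add_smul X) J I

theorem hasDerivAt_mul_left {m : Type*} [Fintype m] {M : ℝ → Matrix m m ℝ} {X : Matrix m m ℝ}
    {x : ℝ} (A : Matrix m m ℝ) (h : ∀ i j, HasDerivAt (fun ε => M ε i j) (X i j) x) (i j : m) :
    HasDerivAt (fun ε => (A * M ε) i j) ((A * X) i j) x := by
  simp only [Matrix.mul_apply]
  exact HasDerivAt.fun_sum fun k _ => (h k j).const_mul _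

theorem hasDerivAt_mul_right {m : Type*} [Fintype m] {M : ℝ → Matrix m m ℝ} {X : Matrix m m ℝ}
    {x : ℝ} (A : Matrix m m ℝ) (h : ∀ i j, HasDerivAt (fun ε => M ε i j) (X i j) x) (i j : m) :
    HasDerivAt (fun ε => (M ε * A) i j) ((X * A) i j) x := by
  simp only [Matrix.mul_apply]
  exact HasDerivAt.fun_sum fun k _ => (h i k).mul_const _

/-- Differentiate `tpow` of `g (1 + ε X) = (1 + ε X') g` at `ε = 0`. Invertibility of `g` plays no
role. -/
theorem tpow_mul_tder {g X X' : Matrix ι ι ℝ} (h : g * X = X' * g) :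
    tpow D g * tder D X = tder D X' * tpow D g := by
  ext J I
  have h1 := hasDerivAt_mul_left (tpow D g) (hasDerivAt_tpow_one_add_smul (D := D) X) J I
  have h2 := hasDerivAt_mul_right (tpow D g) (hasDerivAt_tpow_one_add_smul (D := D) X') J I
  refine h1.unique (h2.congr_of_eventuallyEq (Eventually.of_forall fun ε => ?_))
  simp only [← tpow_mul]
  rw [mul_add, add_mul, Matrix.mul_smul, Matrix.smul_mul, h, mul_one, one_mul]

/-- The bracket relation for a square-zero `Y`, which covers root vectors. When `Y² = 0`, moving `X`
across `1 + ε Y` produces exactly `X + ε [Y, X] - ε² Y X Y`; the first-order term in `ε` is the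
claim. -/
theorem tder_mul_tder {X Y : Matrix ι ι ℝ} (hY : Y * Y = 0) :
    tder D Y * tder D X = tder D X * tder D Y + tder D (Y * X - X * Y) := by
  ext J I
  have h1 := hasDerivAt_mul_right (tder D X) (hasDerivAt_tpow_one_add_smul (D := D) Y) J I
  have h2 := (hasDerivAt_mul_left (tder D X) (hasDerivAt_tpow_one_add_smul (D := D) Y) J I)
  have h3 := (hasDerivAt_id (0 : ℝ)).mul
    (hasDerivAt_mul_left (tder D (Y * X - X * Y)) (hasDerivAt_tpow_one_add_smul (D := D) Y) J I)
  have h4 := ((hasDerivAt_id (0 : ℝ)).mul (hasDerivAt_id (0 : ℝ))).mul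
    (hasDerivAt_mul_left (tder D (-(Y * X * Y))) (hasDerivAt_tpow_one_add_smul (D := D) Y) J I)
  have h5 := h1.unique (((h2.add h3).add h4).congr_of_eventuallyEq
    (Eventually.of_forall fun ε => ?_))
  · rw [h5]; simp [tpow_one]
  · have hc : (1 + ε • Y) * X = (X + ε • (Y * X - X * Y) + (ε * ε) • (-(Y * X * Y))) *
        (1 + ε • Y) := by
      have e1 : X * Y * Y = 0 := by rw [mul_assoc, hY, mul_zero]
      have e2 : Y * X * Y * Y = 0 := by rw [mul_assoc, hY, mul_zero]
      simp only [add_mul, mul_add, one_mul, mul_one, Matrix.smul_mul, Matrix.mul_smul, sub_mul,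
        neg_mul, e1, e2, smul_zero, neg_zero, smul_neg, smul_smul, smul_sub, sub_zero]
      abel
    have := congrFun₂ (tpow_mul_tder (D := D) hc) J I
    rw [tder_add, tder_add, tder_smul, tder_smul] at this
    simp only [Pi.add_apply, Pi.mul_apply, id]
    rw [this, add_mul, add_mul, Matrix.smul_mul, Matrix.smul_mul]
    simp

end TensorPower

end ShrinkingCurves

namespace ShrinkingCurves

section TensorVector

variable {ι : Type*} [Fintype ι] [DecidableEq ι] {D : ℕ}

theorem mulVec_dotProduct {m : Type*} [Fintype m] (M : Matrix m m ℝ) (u v : m → ℝ) :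
    (M.mulVec u) ⬝ᵥ v = u ⬝ᵥ (M.transpose.mulVec v) := by
  rw [dotProduct_comm, Matrix.dotProduct_mulVec, dotProduct_comm, Matrix.mulVec_transpose]

theorem tpow_dotProduct (M : Matrix ι ι ℝ) (u v : (Fin D → ι) → ℝ) :
    ((tpow D M).mulVec u) ⬝ᵥ v = u ⬝ᵥ ((tpow D M.transpose).mulVec v) := by
  rw [mulVec_dotProduct, tpow_transpose]

theorem tder_dotProduct (M : Matrix ι ι ℝ) (u v : (Fin D → ι) → ℝ) :
    ((tder D M).mulVec u) ⬝ᵥ v = u ⬝ᵥ ((tder D M.transpose).mulVec v) := by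
  rw [mulVec_dotProduct, tder_transpose]

theorem dotProduct_eq_zero_of_disjoint {m : Type*} [Fintype m] {u v : m → ℝ}
    (h : ∀ I, u I ≠ 0 → v I ≠ 0 → False) : u ⬝ᵥ v = 0 :=
  Finset.sum_eq_zero fun I _ => by
    by_contra h'
    exact h I (left_ne_zero_of_mul h') (right_ne_zero_of_mul h')

theorem exists_of_mulVec_ne_zero {m : Type*} [Fintype m] {M : Matrix m m ℝ} {v : m → ℝ} {J : m}
    (h : M.mulVec v J ≠ 0) : ∃ I, M J I ≠ 0 ∧ v I ≠ 0 := by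
  obtain ⟨I, -, hI⟩ := Finset.exists_ne_zero_of_sum_ne_zero h
  exact ⟨I, left_ne_zero_of_mul hI, right_ne_zero_of_mul hI⟩

theorem wt_le_of_tpow_ne_zero {M : Matrix ι ι ℝ} {f : ι → ℝ}
    (hM : ∀ i j, M i j ≠ 0 → f j ≤ f i) {J I : Fin D → ι} (h : tpow D M J I ≠ 0) :
    wt f I ≤ wt f J := by
  rw [tpow_apply, Finset.prod_ne_zero_iff] at h
  exact Finset.sum_le_sum fun s hs => hM _ _ (h s hs)

theorem wt_eq_of_tpow_ne_zero {M : Matrix ι ι ℝ} {f : ι → ℝ}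
    (hM : ∀ i j, M i j ≠ 0 → f j = f i) {J I : Fin D → ι} (h : tpow D M J I ≠ 0) :
    wt f I = wt f J := by
  rw [tpow_apply, Finset.prod_ne_zero_iff] at h
  exact Finset.sum_congr rfl fun s hs => hM _ _ (h s hs)

/-- Since `Y² = 0`, the matrices `1 + ε Y` form a one-parameter group, and `1 + ε Y = (1 + x Y)(1 +
(ε - x) Y)` reduces the derivative at `x` to the one at `0`. -/
theorem hasDerivAt_tpow_one_add_smul' {Y : Matrix ι ι ℝ} (hY : Y * Y = 0) (x : ℝ)
    (J I : Fin D → ι) :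
    HasDerivAt (fun ε : ℝ => tpow D (1 + ε • Y) J I) ((tpow D (1 + x • Y) * tder D Y : Matrix (Fin D → ι) (Fin D → ι) ℝ) J I) x := by
  have h := hasDerivAt_mul_left (tpow D (1 + x • Y)) (hasDerivAt_tpow_one_add_smul (D := D) Y) J I
  rw [← sub_self x] at h
  refine (h.comp_sub_const x x).congr_of_eventuallyEq (Eventually.of_forall fun ε => ?_)
  simp only [← tpow_mul]
  congr 2
  rw [mul_add, add_mul, add_mul, one_mul, one_mul, mul_one, Matrix.smul_mul x, Matrix.mul_smul,
    hY, smul_zero, smul_zero, add_zero, sub_smul]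
  abel

theorem hasDerivAt_dotProduct_tpow {Y : Matrix ι ι ℝ} (hY : Y * Y = 0) (q y : (Fin D → ι) → ℝ)
    (x : ℝ) :
    HasDerivAt (fun ε : ℝ => q ⬝ᵥ (tpow D (1 + ε • Y)).mulVec y)
      (q ⬝ᵥ (tpow D (1 + x • Y)).mulVec ((tder D Y).mulVec y)) x := by
  rw [Matrix.mulVec_mulVec]
  simp only [Matrix.mulVec, dotProduct]
  exact HasDerivAt.fun_sum fun J _ => (HasDerivAt.fun_sum fun I _ =>
    (hasDerivAt_tpow_one_add_smul' hY x J I).mul_const _).const_mul _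

/-- The orbit map of the one-parameter group has derivative `tpow (1 + x Y) (tder Y v) = 0`, hence
is constant. This turns annihilation by root vectors into invariance under unipotents. -/
theorem tpow_one_add_mulVec_eq_self {Y : Matrix ι ι ℝ} (hY : Y * Y = 0) {v : (Fin D → ι) → ℝ}
    (hv : (tder D Y).mulVec v = 0) : (tpow D (1 + Y)).mulVec v = v := by
  funext J
  have h : ∀ x : ℝ, HasDerivAt (fun ε : ℝ => Pi.single J 1 ⬝ᵥ (tpow D (1 + ε • Y)).mulVec v) 0 x := by
    intro x
    simpa [hv] using hasDerivAt_dotProduct_tpow hY (Pi.single J 1) v x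
  have := is_const_of_deriv_eq_zero (fun x => (h x).differentiableAt) (fun x => (h x).deriv) 1 0
  simpa [tpow_one] using this

/-- If `Y` raises a grading by at least `a`, then pairing with a vector in degrees below `ν + 2a`
only sees the part of `1 + Y` of order at most one. -/
theorem dotProduct_tpow_one_add {Y : Matrix ι ι ℝ} (hY : Y * Y = 0) {f : ι → ℝ} {a ν : ℝ}
    (ha : 0 ≤ a) (hf : ∀ i j, Y i j ≠ 0 → f j + a ≤ f i) {q y : (Fin D → ι) → ℝ}
    (hy : ∀ I, y I ≠ 0 → ν ≤ wt f I) (hq : ∀ I, q I ≠ 0 → wt f I < ν + 2 * a) :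
    q ⬝ᵥ (tpow D (1 + Y)).mulVec y = q ⬝ᵥ y + q ⬝ᵥ (tder D Y).mulVec y := by
  have raise : ∀ (ν : ℝ) (y : (Fin D → ι) → ℝ), (∀ I, y I ≠ 0 → ν ≤ wt f I) →
      ∀ I, (tder D Y).mulVec y I ≠ 0 → ν + a ≤ wt f I := by
    intro ν y hy I hI
    obtain ⟨K, h1, h2⟩ := exists_of_mulVec_ne_zero hI
    obtain ⟨i, j, hij, h3⟩ := wt_of_tder_ne_zero h1
    have := hf i j hij; have := hy K h2; rw [h3 f]; linarith
  -- Two applications of `tder Y` put `y` in degrees at least `ν + 2a`, and `1 + x Y` never lowers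
  -- degrees. So the second derivative of the pairing vanishes and the pairing is affine in `x`.
  have hzero : ∀ x : ℝ, q ⬝ᵥ (tpow D (1 + x • Y)).mulVec
      ((tder D Y).mulVec ((tder D Y).mulVec y)) = 0 := by
    intro x
    refine dotProduct_eq_zero_of_disjoint fun I h1 h2 => ?_
    obtain ⟨K, h3, h4⟩ := exists_of_mulVec_ne_zero h2
    have h5 := raise _ _ (raise _ _ hy) K h4
    have h6 : wt f K ≤ wt f I := by
      refine wt_le_of_tpow_ne_zero (fun i j hij => ?_) h3
      by_cases h : i = j
      · rw [h]
      · have : Y i j ≠ 0 := by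
          rintro h0; exact hij (by simp [h, h0])
        linarith [hf i j this]
    linarith [hq I h1]
  have hc : ∀ x : ℝ, q ⬝ᵥ (tpow D (1 + x • Y)).mulVec ((tder D Y).mulVec y) =
      q ⬝ᵥ (tder D Y).mulVec y := by
    intro x
    have h : ∀ x : ℝ, HasDerivAt (fun ε : ℝ => q ⬝ᵥ (tpow D (1 + ε • Y)).mulVec
        ((tder D Y).mulVec y)) 0 x := fun x => by
      have := hasDerivAt_dotProduct_tpow hY q ((tder D Y).mulVec y) x
      rwa [hzero] at this
    have := is_const_of_deriv_eq_zero (fun x => (h x).differentiableAt) (fun x => (h x).deriv) x 0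
    simpa [tpow_one] using this
  have h : ∀ x : ℝ, HasDerivAt (fun ε : ℝ => q ⬝ᵥ (tpow D (1 + ε • Y)).mulVec y -
      ε * (q ⬝ᵥ (tder D Y).mulVec y)) 0 x := fun x => by
    have h1 := hasDerivAt_dotProduct_tpow hY q y x
    rw [hc] at h1
    have h2 := h1.fun_sub ((hasDerivAt_id x).mul_const (q ⬝ᵥ (tder D Y).mulVec y))
    simpa using h2
  have := is_const_of_deriv_eq_zero (fun x => (h x).differentiableAt) (fun x => (h x).deriv) 1 0
  simp only [one_smul, one_mul, zero_smul, add_zero, tpow_one, Matrix.one_mulVec, zero_mul,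
    sub_zero] at this
  linarith

/-! ### Weight vectors -/

/-- The component of weight `χ`. -/
noncomputable def wpart (χ : ι → ℝ) (w : (Fin D → ι) → ℝ) : (Fin D → ι) → ℝ :=
  Set.indicator {I | cnt I = χ} w

theorem wpart_ne_zero {χ : ι → ℝ} {w : (Fin D → ι) → ℝ} {I : Fin D → ι} (h : wpart χ w I ≠ 0) :
    cnt I = χ ∧ w I ≠ 0 := by
  rw [wpart, ne_eq, Set.indicator_apply_eq_zero] at h
  push Not at h
  exact h

theorem wt_of_cnt_eq {χ : ι → ℝ} {I : Fin D → ι} (h : cnt I = χ) (f : ι → ℝ) :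
    wt f I = ∑ i, χ i * f i := by rw [wt_eq_sum_cnt, h]

theorem cnt_of_tder_single_ne_zero {i j : ι} {c : ℝ} {J I : Fin D → ι}
    (h : tder D (Matrix.single i j c) J I ≠ 0) (f : ι → ℝ) : wt f J = wt f I + f i - f j := by
  obtain ⟨i', j', h1, h2⟩ := wt_of_tder_ne_zero h
  have : i = i' ∧ j = j' := by
    by_contra h3
    exact h1 (Matrix.single_apply_of_ne _ _ _ _ _ h3)
  rw [h2 f, this.1, this.2]

theorem wt_of_tder_single_wpart_ne_zero {i j : ι} {c : ℝ} {χ : ι → ℝ} {w : (Fin D → ι) → ℝ}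
    {J : Fin D → ι} (h : (tder D (Matrix.single i j c)).mulVec (wpart χ w) J ≠ 0) (f : ι → ℝ) :
    wt f J = ∑ k, χ k * f k + f i - f j := by
  obtain ⟨I, h1, h2⟩ := exists_of_mulVec_ne_zero h
  rw [cnt_of_tder_single_ne_zero h1, wt_of_cnt_eq (wpart_ne_zero h2).1]

/-- `E_ij` shifts all weights by the same vector, so the images of the other weight components have
weights different from that of the image of `wpart χ w`, and are orthogonal to it. -/
theorem dotProduct_tder_single_wpart (i j : ι) (χ : ι → ℝ) (w : (Fin D → ι) → ℝ) :
    (tder D (Matrix.single i j 1)).mulVec (wpart χ w) ⬝ᵥ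
      (tder D (Matrix.single i j 1)).mulVec w =
    (tder D (Matrix.single i j 1)).mulVec (wpart χ w) ⬝ᵥ
      (tder D (Matrix.single i j 1)).mulVec (wpart χ w) := by
  rw [← sub_eq_zero, ← dotProduct_sub, ← Matrix.mulVec_sub]
  refine dotProduct_eq_zero_of_disjoint fun J h1 h2 => ?_
  obtain ⟨K, h3, h4⟩ := exists_of_mulVec_ne_zero h2
  have : cnt K = χ := by
    funext k
    have e1 := wt_of_tder_single_wpart_ne_zero h1 (Pi.single k 1)
    rw [cnt_of_tder_single_ne_zero h3] at e1
    have e2 : ∑ l, χ l * (Pi.single k 1 : ι → ℝ) l = χ k := by simp [Pi.single_apply]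
    rw [e2] at e1
    have : wt (Pi.single k 1) K = χ k := by linarith
    exact this
  apply h4
  simp [wpart, this]

/-- The `sl₂` relation: `E_ij` and `E_ji` are adjoint to each other, and `[E_ji, E_ij] = E_jj -
E_ii` acts on the weight `χ` by `χ j - χ i`. -/
theorem tder_single_dotProduct_self {χ : ι → ℝ} {v : (Fin D → ι) → ℝ}
    (hv : ∀ I, v I ≠ 0 → cnt I = χ) {i j : ι} (hij : i ≠ j) :
    (tder D (Matrix.single i j 1)).mulVec v ⬝ᵥ (tder D (Matrix.single i j 1)).mulVec v =
    (tder D (Matrix.single j i 1)).mulVec v ⬝ᵥ (tder D (Matrix.single j i 1)).mulVec v +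
      (χ j - χ i) * (v ⬝ᵥ v) := by
  have hdiag : ∀ k, (tder D (Matrix.single k k (1 : ℝ))).mulVec v = χ k • v := by
    intro k
    have : Matrix.single k k (1 : ℝ) = Matrix.diagonal (Pi.single k 1) := by
      rw [Matrix.diagonal_single]
    rw [this, tder_diagonal]
    funext I
    rw [Matrix.mulVec_diagonal, Pi.smul_apply, smul_eq_mul]
    by_cases h : v I = 0
    · simp [h]
    · rw [← hv I h]; rfl
  rw [tder_dotProduct, tder_dotProduct _ v, Matrix.transpose_single, Matrix.transpose_single,
    Matrix.mulVec_mulVec, Matrix.mulVec_mulVec, tder_mul_tder, Matrix.add_mulVec, dotProduct_add]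
  · congr 1
    rw [Matrix.single_mul_single_same, Matrix.single_mul_single_same, sub_eq_add_neg,
      tder_add, ← neg_one_smul ℝ (Matrix.single i i _), tder_smul, Matrix.add_mulVec,
      Matrix.smul_mulVec, mul_one, hdiag, hdiag, dotProduct_add, dotProduct_smul, dotProduct_smul,
      dotProduct_smul, smul_eq_mul, smul_eq_mul, smul_eq_mul]
    ring
  · exact Matrix.single_mul_single_of_ne _ _ _ _ hij _

end TensorVector

end ShrinkingCurves

namespace ShrinkingCurves

/-! ### Block triangular Cholesky factors and block spectral decompositions. -/

section LinearAlgebra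

/-- The determinant of a block triangular matrix only depends on its diagonal blocks. -/
theorem det_eq_det_diagonalBlocks {m : Type*} [Fintype m] [DecidableEq m] {M : Matrix m m ℝ}
    {b : m → ℝ} (hM : M.BlockTriangular b) :
    M.det = (Matrix.of fun i j => if b i = b j then M i j else 0).det := by
  classical
  have h2 : (Matrix.of fun i j => if b i = b j then M i j else 0 : Matrix m m ℝ).BlockTriangular
      b := by
    intro i j hij
    simp [hij.ne']
  rw [hM.det, h2.det]
  refine Finset.prod_congr rfl fun a _ => ?_
  congr 1
  ext ⟨i, hi⟩ ⟨j, hj⟩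
  simp [Matrix.toSquareBlock_def, hi, hj]

/-- From the decomposition `S = L D Lᵀ`, take `q = √D Lᵀ`. -/
theorem exists_cholesky {m : Type*} [Fintype m] [LinearOrder m] [WellFoundedLT m]
    [LocallyFiniteOrderBot m]
    {S : Matrix m m ℝ} (hS : S.PosDef) :
    ∃ q : Matrix m m ℝ, S = q.transpose * q ∧ ∀ i j, j < i → q i j = 0 := by
  have hli : (LDL.lowerInv hS).BlockTriangular OrderDual.toDual := fun i j hij =>
    LDL.lowerInv_triangular hS hij
  have hl : (LDL.lower hS).BlockTriangular OrderDual.toDual :=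
    Matrix.blockTriangular_inv_of_blockTriangular hli
  have hd : (LDL.diag hS).PosDef := by
    rw [LDL.diag_eq_lowerInv_conj]
    exact hS.mul_mul_conjTranspose_same
      (Matrix.vecMul_injective_of_isUnit (isUnit_of_invertible (LDL.lowerInv hS)))
  have hpos : ∀ i, 0 < LDL.diagEntries hS i := fun i => by
    have := hd.diag_pos (i := i)
    simpa [LDL.diag] using this
  refine ⟨Matrix.diagonal (fun i => Real.sqrt (LDL.diagEntries hS i)) *
    (LDL.lower hS).transpose, ?_, fun i j hij => ?_⟩
  · rw [Matrix.transpose_mul, Matrix.transpose_transpose, Matrix.diagonal_transpose, mul_assoc,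
      ← mul_assoc (Matrix.diagonal _), Matrix.diagonal_mul_diagonal]
    simp only [Real.mul_self_sqrt (hpos _).le]
    have := LDL.lower_conj_diag hS
    rw [Matrix.conjTranspose_eq_transpose_of_trivial, mul_assoc] at this
    exact this.symm
  · rw [Matrix.diagonal_mul, Matrix.transpose_apply, hl (show OrderDual.toDual i < _ from hij), mul_zero]

/-- A Cholesky factor which is block triangular with respect to a given function. -/
theorem exists_blockTriangular_cholesky {N : ℕ} (b : Fin N → ℝ) {g : Matrix (Fin N) (Fin N) ℝ}
    (hg : IsUnit g) :
    ∃ q : Matrix (Fin N) (Fin N) ℝ, g.transpose * g = q.transpose * q ∧ q.BlockTriangular b := by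
  -- After sorting the indices by `b` an ordinary Cholesky factor works. Ties are harmless, because
  -- block triangularity only constrains pairs with strictly different `b`.
  set σ := Tuple.sort b
  have hσ : Monotone (b ∘ σ) := Tuple.monotone_sort b
  have hP : (g.transpose * g).PosDef := by
    have := Matrix.PosDef.conjTranspose_mul_self g (Matrix.mulVec_injective_of_isUnit hg)
    rwa [Matrix.conjTranspose_eq_transpose_of_trivial] at this
  have hS : ((g.transpose * g).submatrix σ σ).PosDef := hP.submatrix σ.injective
  obtain ⟨q, h1, h2⟩ := exists_cholesky hS
  refine ⟨q.submatrix σ.symm σ.symm, ?_, fun i j hij => ?_⟩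
  · rw [Matrix.transpose_submatrix, Matrix.submatrix_mul_equiv, ← h1, Matrix.submatrix_submatrix]
    simp
  · refine h2 _ _ ?_
    by_contra hle
    have := hσ (not_lt.mp hle)
    simp at this
    exact absurd hij (not_lt.mpr this)

/-- A spectral decomposition of a positive definite block diagonal matrix, by eigenvectors
supported in the blocks. -/
theorem exists_block_spectral {m : Type*} [Fintype m] [DecidableEq m] {P : Matrix m m ℝ}
    (hP : P.PosDef) {b : m → ℝ} (hb : ∀ i j, P i j ≠ 0 → b i = b j) :
    ∃ (U : Matrix m m ℝ) (d β : m → ℝ), U * U.transpose = 1 ∧ U.transpose * U = 1 ∧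
      P = U * Matrix.diagonal d * U.transpose ∧ (∀ k, 0 < d k) ∧
      ∀ i k, U i k ≠ 0 → b i = β k := by
  have hfin : (spectrum ℝ P).Finite := Matrix.finite_real_spectrum
  -- Diagonalise `P + K diag(b)` instead of `P`: the two summands commute. An eigenvector meeting
  -- two blocks would make `K` a quotient of a difference of eigenvalues of `P` by a difference of
  -- values of `b`; `K` is chosen outside this finite set.
  obtain ⟨K, hK⟩ : ∃ K : ℝ, K ∉ (fun z : (ℝ × ℝ) × (m × m) =>
      (z.1.1 - z.1.2) / (b z.2.1 - b z.2.2)) '' ((spectrum ℝ P ×ˢ spectrum ℝ P) ×ˢ Set.univ) :=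
    (((hfin.prod hfin).prod Set.finite_univ).image _).exists_notMem
  set M : Matrix m m ℝ := P + Matrix.diagonal fun i => K * b i with hMdef
  have hPh : P.transpose = P := by
    have := hP.isHermitian
    rwa [Matrix.IsHermitian, Matrix.conjTranspose_eq_transpose_of_trivial] at this
  have hM : M.IsHermitian := by
    rw [Matrix.IsHermitian, Matrix.conjTranspose_eq_transpose_of_trivial, hMdef,
      Matrix.transpose_add, hPh, Matrix.diagonal_transpose]
  set U : Matrix m m ℝ := (hM.eigenvectorUnitary : Matrix m m ℝ) with hU
  have hUU : U * U.transpose = 1 := by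
    have := Matrix.mem_unitaryGroup_iff.mp hM.eigenvectorUnitary.2
    rwa [Matrix.star_eq_conjTranspose, Matrix.conjTranspose_eq_transpose_of_trivial] at this
  have hUU' : U.transpose * U = 1 := by
    have := Matrix.mem_unitaryGroup_iff'.mp hM.eigenvectorUnitary.2
    rwa [Matrix.star_eq_conjTranspose, Matrix.conjTranspose_eq_transpose_of_trivial] at this
  have heig : ∀ i k, ∑ j, P i j * U j k = (hM.eigenvalues k - K * b i) * U i k := by
    intro i k
    have := congrFun (hM.mulVec_eigenvectorBasis k) i
    have h2 : ∀ j, (hM.eigenvectorBasis k).ofLp j = U j k := fun j => rfl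
    have hmul : ∀ v, M.mulVec v = P.mulVec v + (Matrix.diagonal fun i => K * b i).mulVec v :=
      fun v => Matrix.add_mulVec _ _ _
    rw [hmul] at this
    simp only [Pi.add_apply, Matrix.mulVec_diagonal, Pi.smul_apply, h2, smul_eq_mul] at this
    have h3 : ∑ j, P i j * U j k = P.mulVec (hM.eigenvectorBasis k).ofLp i := rfl
    rw [h3]; linarith
  -- The restriction of the `k`-th eigenvector to the block of `i` is still an eigenvector of `P`,
  -- with this eigenvalue.
  have hspec : ∀ i k, U i k ≠ 0 → hM.eigenvalues k - K * b i ∈ spectrum ℝ P := by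
    intro i k hik
    rw [← Matrix.spectrum_toLin', ← Module.End.hasEigenvalue_iff_mem_spectrum]
    refine Module.End.hasEigenvalue_of_hasEigenvector
      (x := fun j => if b j = b i then U j k else 0) ⟨?_, ?_⟩
    · rw [Module.End.mem_eigenspace_iff, Matrix.toLin'_apply]
      funext l
      simp only [Matrix.mulVec, dotProduct, Pi.smul_apply, smul_eq_mul, mul_ite, mul_zero]
      by_cases hl : b l = b i
      · rw [if_pos hl, ← hl, ← heig]
        refine Finset.sum_congr rfl fun j _ => ?_
        by_cases hP0 : P l j = 0
        · simp [hP0]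
        · rw [if_pos (hb l j hP0).symm]
      · rw [if_neg hl]
        refine Finset.sum_eq_zero fun j _ => ?_
        split_ifs with hj
        · by_contra h0
          exact hl ((hb l j (left_ne_zero_of_mul h0)).trans hj)
        · rfl
    · intro h0
      have := congrFun h0 i
      simp at this
      exact hik this
  have hsame : ∀ i j k, U i k ≠ 0 → U j k ≠ 0 → b i = b j := by
    intro i j k hi hj
    by_contra hne
    refine hK ⟨((hM.eigenvalues k - K * b j, hM.eigenvalues k - K * b i), (i, j)),
      ⟨⟨hspec j k hj, hspec i k hi⟩, trivial⟩, ?_⟩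
    have : b i - b j ≠ 0 := sub_ne_zero.mpr hne
    field_simp
    ring
  have hcol : ∀ k, ∃ i, U i k ≠ 0 := by
    intro k
    by_contra! h
    have := congrFun₂ hUU' k k
    simp [Matrix.mul_apply, h] at this
  choose ib hib using hcol
  have hβ : ∀ i k, U i k ≠ 0 → b i = b (ib k) := fun i k h => hsame i (ib k) k h (hib k)
  set d : m → ℝ := fun k => hM.eigenvalues k - K * b (ib k)
  have hPU : P * U = U * Matrix.diagonal d := by
    ext i k
    rw [Matrix.mul_apply, heig, Matrix.mul_diagonal]
    by_cases h : U i k = 0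
    · simp [h]
    · rw [hβ i k h, mul_comm]
  have hP' : P = U * Matrix.diagonal d * U.transpose := by
    rw [← hPU, mul_assoc, hUU, mul_one]
  refine ⟨U, d, fun k => b (ib k), hUU, hUU', hP', fun k => ?_, hβ⟩
  have hD : (Matrix.diagonal d).PosDef := by
    have h1 : Matrix.diagonal d = U.conjTranspose * P * U := by
      rw [Matrix.conjTranspose_eq_transpose_of_trivial, mul_assoc, hPU, ← mul_assoc, hUU', one_mul]
    rw [h1]
    refine hP.conjTranspose_mul_mul_same (Matrix.mulVec_injective_of_isUnit ?_)
    exact ⟨⟨U, U.transpose, hUU, hUU'⟩, rfl⟩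
  have := hD.diag_pos (i := k)
  simpa using this

/-- Replace by `1` the eigenvalues belonging to blocks outside `s`. The new matrix is `P` on the
selected blocks and the identity elsewhere, so its determinant is the wanted minor. -/
theorem det_submatrix_of_block_spectral {m : Type*} [Fintype m] [DecidableEq m]
    {P U : Matrix m m ℝ} {b d β : m → ℝ} (hUU : U * U.transpose = 1)
    (hP : P = U * Matrix.diagonal d * U.transpose) (hβ : ∀ i k, U i k ≠ 0 → b i = β k)
    (s : ℝ → Prop) [DecidablePred s] :
    (P.submatrix (Subtype.val : {i // s (b i)} → m) Subtype.val).det =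
      ∏ k, if s (β k) then d k else 1 := by
  set d' : m → ℝ := fun k => if s (β k) then d k else 1
  set P' : Matrix m m ℝ := U * Matrix.diagonal d' * U.transpose
  have hdet : P'.det = ∏ k, d' k := by
    have hu : U.det * U.transpose.det = 1 := by rw [← Matrix.det_mul, hUU, Matrix.det_one]
    rw [Matrix.det_mul, Matrix.det_mul, Matrix.det_diagonal]
    linear_combination (∏ k, d' k) * hu
  have hent : ∀ (f : m → ℝ) i j, (U * Matrix.diagonal f * U.transpose) i j =
      ∑ k, U i k * f k * U j k := by
    intro f i j
    rw [Matrix.mul_apply]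
    simp [Matrix.mul_diagonal]
  have hent' : ∀ i j, P' i j = ∑ k, U i k * d' k * U j k := hent d'
  have hne : ∀ i, ¬ s (b i) → ∀ j, P' i j = (1 : Matrix m m ℝ) i j := by
    intro i hi j
    rw [← hUU, hent', Matrix.mul_apply]
    refine Finset.sum_congr rfl fun k _ => ?_
    by_cases h : U i k = 0
    · simp [h]
    · have : d' k = 1 := if_neg (by rw [← hβ i k h]; exact hi)
      rw [this, mul_one, Matrix.transpose_apply]
  rw [← hdet, Matrix.twoBlockTriangular_det P' (fun i => s (b i))]
  · have h1 : P'.toSquareBlockProp (fun i => ¬ s (b i)) = 1 := by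
      ext i j
      rw [Matrix.toSquareBlockProp_def, Matrix.of_apply, hne _ i.2, Matrix.one_apply,
        Matrix.one_apply]
      simp [Subtype.ext_iff]
    rw [h1, Matrix.det_one, mul_one]
    congr 1
    ext i j
    rw [Matrix.toSquareBlockProp_def, Matrix.of_apply, Matrix.submatrix_apply, hP, hent, hent']
    refine Finset.sum_congr rfl fun k _ => ?_
    by_cases h : U i.1 k = 0
    · simp [h]
    · have : d' k = d k := if_pos (by rw [← hβ _ k h]; exact i.2)
      rw [this]
  · intro i hi j hj
    rw [hne i hi, Matrix.one_apply_ne]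
    rintro rfl
    exact hi hj

end LinearAlgebra

/-! ### Convexity of the norm for positive definite matrices. -/

section Jensen

variable {ι : Type*} [Fintype ι] [DecidableEq ι] {D : ℕ}

theorem tder_dotProduct_eq_sum {w : (Fin D → ι) → ℝ} {χ : ι → ℝ} {c : ℝ}
    (hmom : ∀ i j, (tder D (Matrix.single i j 1)).mulVec w ⬝ᵥ w = if i = j then χ i * c else 0)
    (X : Matrix ι ι ℝ) : (tder D X).mulVec w ⬝ᵥ w = (∑ i, X i i * χ i) * c := by
  have hX : X = ∑ i, ∑ j, X i j • Matrix.single i j (1 : ℝ) := by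
    conv_lhs => rw [Matrix.matrix_eq_sum_single X]
    simp
  conv_lhs => rw [hX]
  simp only [tder_sum, tder_smul, Matrix.sum_mulVec, Matrix.smul_mulVec, sum_dotProduct,
    smul_dotProduct, hmom, smul_eq_mul, mul_ite, mul_zero, Finset.sum_ite_eq, Finset.mem_univ,
    if_true, Finset.sum_mul, mul_assoc]

/-- The convexity estimate for a vector whose moment matrix is diagonal. -/
theorem exp_le_tpow_dotProduct {w : (Fin D → ι) → ℝ} {χ : ι → ℝ} (hw : w ≠ 0)
    (hmom : ∀ i j, (tder D (Matrix.single i j 1)).mulVec w ⬝ᵥ w =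
      if i = j then χ i * (w ⬝ᵥ w) else 0)
    {P U : Matrix ι ι ℝ} {d x : ι → ℝ} (hUU : U * U.transpose = 1) (hUU' : U.transpose * U = 1)
    (hP : P = U * Matrix.diagonal d * U.transpose) (hd : ∀ k, 0 < d k)
    (hx : ∀ i k, U i k ≠ 0 → χ i = x k) :
    w ⬝ᵥ w * Real.exp (∑ k, x k * Real.log (d k)) ≤ (tpow D P).mulVec w ⬝ᵥ w := by
  set L : ι → ℝ := fun k => Real.log (d k)
  set y := (tpow D U.transpose).mulVec w
  have hyy : y ⬝ᵥ y = w ⬝ᵥ w := by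
    rw [tpow_dotProduct, Matrix.transpose_transpose, Matrix.mulVec_mulVec, ← tpow_mul, hUU,
      tpow_one, Matrix.one_mulVec]
  have hpos : 0 < w ⬝ᵥ w := by
    refine lt_of_le_of_ne (Finset.sum_nonneg fun i _ => mul_self_nonneg _) fun h => hw ?_
    exact dotProduct_self_eq_zero.mp h.symm
  have h1 : (tpow D P).mulVec w ⬝ᵥ w = ∑ I, Real.exp (wt L I) * (y I * y I) := by
    have hexp : Matrix.diagonal d = Matrix.diagonal fun i => Real.exp (L i) := by
      congr 1; funext i; rw [Real.exp_log (hd i)]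
    rw [hP, tpow_mul, tpow_mul, ← Matrix.mulVec_mulVec, ← Matrix.mulVec_mulVec, tpow_dotProduct,
      hexp, tpow_diagonal_exp]
    simp only [dotProduct, Matrix.mulVec_diagonal, mul_assoc]
    rfl
  -- The mean exponent is the pairing of `log P = U diag(L) Uᵀ` with the moment matrix of `w`. That
  -- matrix is diagonal with entries proportional to `χ`, and `χ` is constant on the support of each
  -- column of `U`.
  have h2 : ∑ I, wt L I * (y I * y I) = (∑ k, x k * L k) * (w ⬝ᵥ w) := by
    have e1 : (tder D (Matrix.diagonal L)).mulVec y ⬝ᵥ y = ∑ I, wt L I * (y I * y I) := by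
      rw [tder_diagonal]
      simp only [dotProduct, Matrix.mulVec_diagonal, mul_assoc]
    have e2 : tpow D U.transpose * tder D (U * Matrix.diagonal L * U.transpose) =
        tder D (Matrix.diagonal L) * tpow D U.transpose := by
      refine tpow_mul_tder ?_
      rw [← mul_assoc, ← mul_assoc, hUU', one_mul]
    rw [← e1, Matrix.mulVec_mulVec, ← e2, ← Matrix.mulVec_mulVec, tpow_dotProduct,
      Matrix.transpose_transpose, Matrix.mulVec_mulVec, ← tpow_mul, hUU, tpow_one,
      Matrix.one_mulVec, tder_dotProduct_eq_sum hmom]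
    congr 1
    have hent : ∀ i, (U * Matrix.diagonal L * U.transpose) i i * χ i =
        ∑ k, U i k * U i k * (x k * L k) := by
      intro i
      rw [Matrix.mul_apply, Finset.sum_mul]
      refine Finset.sum_congr rfl fun k _ => ?_
      rw [Matrix.mul_diagonal, Matrix.transpose_apply]
      by_cases h : U i k = 0
      · simp [h]
      · rw [hx i k h]; ring
    simp only [hent]
    rw [Finset.sum_comm]
    refine Finset.sum_congr rfl fun k _ => ?_
    have := congrFun₂ hUU' k k
    rw [Matrix.mul_apply, Matrix.one_apply_eq] at this
    simp only [Matrix.transpose_apply] at this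
    rw [← Finset.sum_mul, this, one_mul]
  -- Jensen's inequality for the probability weights `y_I² / ‖w‖²`; they sum to one because `U` is
  -- orthogonal.
  have hJ := convexOn_exp.map_sum_le (t := Finset.univ) (w := fun I => (y I * y I) / (w ⬝ᵥ w))
    (p := fun I => wt L I) (fun I _ => div_nonneg (mul_self_nonneg _) hpos.le)
    (by rw [← Finset.sum_div]; exact (congrArg (· / (w ⬝ᵥ w)) hyy).trans (div_self hpos.ne')) (fun _ _ => trivial)
  simp only [smul_eq_mul, div_mul_eq_mul_div] at hJ
  rw [← Finset.sum_div, ← Finset.sum_div, le_div_iff₀ hpos] at hJ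
  have e3 : (∑ I, y I * y I * wt L I) / (w ⬝ᵥ w) = ∑ k, x k * L k := by
    rw [div_eq_iff hpos.ne', ← h2]
    exact Finset.sum_congr rfl fun I _ => mul_comm _ _
  rw [e3] at hJ
  rw [h1, mul_comm]
  refine hJ.trans (le_of_eq (Finset.sum_congr rfl fun I _ => mul_comm _ _))

end Jensen

end ShrinkingCurves

namespace ShrinkingCurves

/-! ### Nearest points, faces and critical points for finite sets of weights. -/

section ConvexGeometry

variable {ι : Type*} [Fintype ι] {S : Type*} [Fintype S]

/-- The point of a polytope nearest to the origin. -/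
theorem exists_nearest_point [Nonempty S] (c : S → ι → ℝ) :
    ∃ p : S → ℝ, (∀ I, 0 ≤ p I) ∧ ∑ I, p I = 1 ∧
      ∀ I, (∑ K, p K • c K) ⬝ᵥ (∑ K, p K • c K) ≤ c I ⬝ᵥ (∑ K, p K • c K) := by
  classical
  let F : (S → ℝ) → ℝ := fun p => (∑ K, p K • c K) ⬝ᵥ (∑ K, p K • c K)
  have hF : Continuous F := by
    simp only [F, dotProduct, Finset.sum_apply, Pi.smul_apply, smul_eq_mul]
    fun_prop
  obtain ⟨p, hp, hmin⟩ := (isCompact_stdSimplex ℝ S).exists_isMinOn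
    ⟨_, single_mem_stdSimplex ℝ (Classical.arbitrary S)⟩ hF.continuousOn
  refine ⟨p, hp.1, hp.2, fun I => ?_⟩
  set χ := ∑ K, p K • c K with hχ
  set e := c I - χ with he
  -- Compare the minimiser with the point moved by `ε` towards the vertex `c I`, and divide by `ε`;
  -- the limit `ε → 0` is the variational inequality.
  have key : ∀ ε : ℝ, 0 < ε → ε ≤ 1 → 0 ≤ 2 * (e ⬝ᵥ χ) + ε * (e ⬝ᵥ e) := by
    intro ε h0 h1
    have hq : (1 - ε) • p + ε • (Pi.single I 1 : S → ℝ) ∈ stdSimplex ℝ S :=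
      (convex_stdSimplex ℝ S) hp (single_mem_stdSimplex ℝ I) (by linarith) h0.le (by ring)
    have h2 : F p ≤ F ((1 - ε) • p + ε • (Pi.single I 1 : S → ℝ)) := hmin hq
    have h3 : ∑ K, ((1 - ε) • p + ε • (Pi.single I 1 : S → ℝ)) K • c K = χ + ε • e := by
      have : ∑ K, (Pi.single I 1 : S → ℝ) K • c K = c I := by
        simp [Pi.single_apply, ite_smul]
      simp only [Pi.add_apply, Pi.smul_apply, smul_eq_mul, add_smul, Finset.sum_add_distrib,
        mul_smul, ← Finset.smul_sum, this, ← hχ, he]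
      module
    simp only [F, h3, ← hχ] at h2
    simp only [add_dotProduct, dotProduct_add, smul_dotProduct, dotProduct_smul, smul_eq_mul,
      dotProduct_comm χ e] at h2
    have : 0 ≤ ε * (2 * (e ⬝ᵥ χ) + ε * (e ⬝ᵥ e)) := by linarith
    exact nonneg_of_mul_nonneg_right this h0
  have hlim : Tendsto (fun ε : ℝ => 2 * (e ⬝ᵥ χ) + ε * (e ⬝ᵥ e)) (𝓝[>] 0)
      (𝓝 (2 * (e ⬝ᵥ χ) + 0 * (e ⬝ᵥ e))) :=
    (Continuous.tendsto (by fun_prop) 0).mono_left nhdsWithin_le_nhds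
  have := ge_of_tendsto hlim (by
    filter_upwards [Ioc_mem_nhdsGT (zero_lt_one : (0 : ℝ) < 1)] with ε hε using key ε hε.1 hε.2)
  rw [he, sub_dotProduct] at this
  linarith

/-- A linear functional that is nonpositive on finitely many vectors and cuts out their smallest
possible face. -/
theorem exists_minimal_face (e : S → ι → ℝ) :
    ∃ lam : ι → ℝ, (∀ I, lam ⬝ᵥ e I ≤ 0) ∧ ∀ y : ι → ℝ,
      (∀ I, lam ⬝ᵥ e I = 0 → y ⬝ᵥ e I ≤ 0) → ∀ I, lam ⬝ᵥ e I = 0 → y ⬝ᵥ e I = 0 := by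
  classical
  let A : (ι → ℝ) → Finset S := fun x => Finset.univ.filter fun I => x ⬝ᵥ e I < 0
  -- `lam` is taken among the nonpositive functionals so as to be strictly negative on as many
  -- vectors as possible.
  let T : Set ℕ := {k | ∃ x : ι → ℝ, (∀ I, x ⬝ᵥ e I ≤ 0) ∧ (A x).card = k}
  have hT : T.Nonempty := ⟨_, 0, by simp, rfl⟩
  have hTb : BddAbove T := ⟨Fintype.card S, by
    rintro k ⟨x, -, rfl⟩; exact Finset.card_le_univ _⟩
  obtain ⟨lam, h1, h2⟩ := Nat.sSup_mem hT hTb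
  have hmax : ∀ y : ι → ℝ, (∀ I, y ⬝ᵥ e I ≤ 0) → ∀ I, lam ⬝ᵥ e I = 0 → y ⬝ᵥ e I = 0 := by
    intro y hy I hI
    by_contra hne
    have hlt : y ⬝ᵥ e I < 0 := lt_of_le_of_ne (hy I) hne
    have hss : A lam ⊂ A (lam + y) := by
      refine Finset.ssubset_iff_subset_ne.mpr ⟨fun K hK => ?_, fun h => ?_⟩
      · simp only [A, Finset.mem_filter, Finset.mem_univ, true_and, add_dotProduct] at hK ⊢
        linarith [hy K]
      · have : I ∈ A (lam + y) := by
          simp only [A, Finset.mem_filter, Finset.mem_univ, true_and, add_dotProduct]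
          linarith
        rw [← h] at this
        simp [A, hI] at this
    have h3 : (A (lam + y)).card ≤ sSup T := le_csSup hTb ⟨lam + y, fun K => by
      rw [add_dotProduct]; linarith [h1 K, hy K], rfl⟩
    have := Finset.card_lt_card hss
    omega
  refine ⟨lam, h1, fun y hy I hI => ?_⟩
  -- A functional that is nonpositive only on the face becomes nonpositive everywhere after adding a
  -- large multiple of `lam`, without changing its values on the face.
  obtain ⟨K, hK⟩ : ∃ K : ℝ, ∀ J, lam ⬝ᵥ e J < 0 → K * (lam ⬝ᵥ e J) + y ⬝ᵥ e J ≤ 0 := by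
    refine ⟨∑ J, |y ⬝ᵥ e J / (lam ⬝ᵥ e J)|, fun J hJ => ?_⟩
    have h3 : |y ⬝ᵥ e J / (lam ⬝ᵥ e J)| ≤ ∑ J, |y ⬝ᵥ e J / (lam ⬝ᵥ e J)| :=
      Finset.single_le_sum (f := fun J => |y ⬝ᵥ e J / (lam ⬝ᵥ e J)|)
        (fun J _ => abs_nonneg _) (Finset.mem_univ J)
    have h4 := (neg_le_abs _).trans h3
    have h5 := mul_le_mul_of_nonpos_right h4 hJ.le
    rw [neg_mul, div_mul_cancel₀ _ hJ.ne] at h5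
    linarith
  have h0 := hmax (K • lam + y) (fun J => by
    rw [add_dotProduct, smul_dotProduct, smul_eq_mul]
    rcases (h1 J).lt_or_eq with h | h
    · exact hK J h
    · rw [h, mul_zero, zero_add]; exact hy J h) I hI
  rwa [add_dotProduct, smul_dotProduct, hI, smul_zero, zero_add] at h0

/-- A positive combination of exponentials has a critical point when no direction is weakly
decreasing for all of them and strictly decreasing for one of them. -/
theorem exists_critical_point [Nonempty S] (e : S → ι → ℝ) {a : S → ℝ} (ha : ∀ I, 0 < a I)
    (he : ∀ y : ι → ℝ, (∀ I, y ⬝ᵥ e I ≤ 0) → ∀ I, y ⬝ᵥ e I = 0) :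
    ∃ x : ι → ℝ, ∀ y : ι → ℝ, ∑ I, a I * Real.exp (x ⬝ᵥ e I) * (y ⬝ᵥ e I) = 0 := by
  classical
  let Lm : (ι → ℝ) →ₗ[ℝ] (S → ℝ) :=
    { toFun := fun x I => x ⬝ᵥ e I
      map_add' := fun x y => by funext I; simp [add_dotProduct]
      map_smul' := fun c x => by funext I; simp [smul_dotProduct] }
  let R : Submodule ℝ (S → ℝ) := LinearMap.range Lm
  have hRc : IsClosed (R : Set (S → ℝ)) := R.closed_of_finiteDimensional
  let mx : (S → ℝ) → ℝ := fun z => Finset.univ.sup' Finset.univ_nonempty z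
  have hmx : Continuous mx := by
    refine Continuous.finset_sup'_apply Finset.univ_nonempty fun I _ => continuous_apply I
  have hpos : ∀ z ∈ R, z ≠ 0 → 0 < mx z := by
    rintro _ ⟨x, rfl⟩ hz
    by_contra hle
    refine hz (funext fun I => he x (fun I => ?_) I)
    exact (Finset.le_sup' (Lm x) (Finset.mem_univ I)).trans (not_lt.mp hle)
  -- Coercivity: by `he` a nonzero vector of the range has a positive coordinate, and compactness of
  -- the unit sphere makes this uniform. Hence the sum of exponentials has bounded sublevel sets on
  -- the range and attains its minimum there.
  obtain ⟨ε, hε, hεz⟩ : ∃ ε > 0, ∀ z ∈ R, ε * ‖z‖ ≤ mx z := by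
    have hK : IsCompact (Metric.sphere (0 : S → ℝ) 1 ∩ R) := (isCompact_sphere 0 1).inter_right hRc
    have hex : ∃ ε > 0, ∀ z ∈ Metric.sphere (0 : S → ℝ) 1 ∩ (R : Set (S → ℝ)), ε ≤ mx z := by
      rcases (Metric.sphere (0 : S → ℝ) 1 ∩ (R : Set (S → ℝ))).eq_empty_or_nonempty with h | h
      · exact ⟨1, one_pos, fun z hz => by rw [h] at hz; exact hz.elim⟩
      · obtain ⟨z0, hz0, hmin⟩ := hK.exists_isMinOn h hmx.continuousOn
        refine ⟨mx z0, hpos z0 hz0.2 ?_, fun z hz => hmin hz⟩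
        rintro rfl
        simpa using hz0.1
    obtain ⟨ε, hε, h⟩ := hex
    refine ⟨ε, hε, fun z hz => ?_⟩
    by_cases h0 : z = 0
    · subst h0
      have : mx 0 = 0 := by simp [mx]
      simp [this]
    · have hn : 0 < ‖z‖ := norm_pos_iff.mpr h0
      have h1 := h (‖z‖⁻¹ • z) ⟨by simp [norm_smul, hn.ne'], R.smul_mem _ hz⟩
      have h2 : mx (‖z‖⁻¹ • z) ≤ ‖z‖⁻¹ * mx z := by
        refine Finset.sup'_le _ _ fun I _ => ?_
        rw [Pi.smul_apply, smul_eq_mul]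
        exact mul_le_mul_of_nonneg_left (Finset.le_sup' z (Finset.mem_univ I)) (by positivity)
      have h3 := mul_le_mul_of_nonneg_left (h1.trans h2) hn.le
      rw [← mul_assoc, mul_inv_cancel₀ hn.ne', one_mul] at h3
      linarith
  let G : (S → ℝ) → ℝ := fun z => ∑ I, a I * Real.exp (z I)
  have hG : Continuous G := by fun_prop
  have hG0 : 0 < G 0 := by
    simp only [G, Pi.zero_apply, Real.exp_zero, mul_one]
    exact Finset.sum_pos (fun I _ => ha I) Finset.univ_nonempty
  let C : ℝ := ∑ I, |Real.log (G 0 / a I)|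
  have hsub : ∀ z ∈ R, G z ≤ G 0 → ‖z‖ ≤ C / ε := by
    intro z hz hGz
    rw [le_div_iff₀ hε, mul_comm]
    refine (hεz z hz).trans (Finset.sup'_le _ _ fun I _ => ?_)
    have h1 : a I * Real.exp (z I) ≤ G 0 :=
      (Finset.single_le_sum (f := fun I => a I * Real.exp (z I))
        (fun I _ => mul_nonneg (ha I).le (Real.exp_pos _).le) (Finset.mem_univ I)).trans hGz
    have h2 : z I ≤ Real.log (G 0 / a I) := by
      rw [Real.le_log_iff_exp_le (div_pos hG0 (ha I)), le_div_iff₀ (ha I), mul_comm]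
      exact h1
    exact h2.trans ((le_abs_self _).trans (Finset.single_le_sum
      (f := fun I => |Real.log (G 0 / a I)|) (fun I _ => abs_nonneg _) (Finset.mem_univ I)))
  have hcomp : IsCompact (Metric.closedBall (0 : S → ℝ) (C / ε) ∩ R) :=
    (isCompact_closedBall 0 _).inter_right hRc
  have h0mem : (0 : S → ℝ) ∈ Metric.closedBall (0 : S → ℝ) (C / ε) ∩ (R : Set (S → ℝ)) :=
    ⟨by simpa using hsub 0 R.zero_mem le_rfl, R.zero_mem⟩
  obtain ⟨z, ⟨-, x, rfl⟩, hmin⟩ := hcomp.exists_isMinOn ⟨0, h0mem⟩ hG.continuousOn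
  have hglob : ∀ x', G (Lm x) ≤ G (Lm x') := by
    intro x'
    by_cases h : G (Lm x') ≤ G 0
    · exact hmin ⟨by simpa using hsub _ ⟨x', rfl⟩ h, ⟨x', rfl⟩⟩
    · exact (hmin h0mem).trans (not_le.mp h).le
  refine ⟨x, fun y => ?_⟩
  have hd : HasDerivAt (fun s : ℝ => G (Lm (x + s • y)))
      (∑ I, a I * (Real.exp (x ⬝ᵥ e I) * (y ⬝ᵥ e I))) 0 := by
    refine HasDerivAt.fun_sum fun I _ => HasDerivAt.const_mul _ ?_
    have h1 : HasDerivAt (fun s : ℝ => x ⬝ᵥ e I + s * (y ⬝ᵥ e I)) (y ⬝ᵥ e I) 0 := by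
      simpa using ((hasDerivAt_id (0 : ℝ)).mul_const (y ⬝ᵥ e I)).const_add (x ⬝ᵥ e I)
    have h2 := h1.exp
    simp only [zero_mul, add_zero] at h2
    refine h2.congr_of_eventuallyEq (Eventually.of_forall fun s => ?_)
    simp [Lm, add_dotProduct, smul_dotProduct]
  have hloc : IsLocalMin (fun s : ℝ => G (Lm (x + s • y))) 0 :=
    Eventually.of_forall fun s => by simpa using hglob (x + s • y)
  have := hloc.hasDerivAt_eq_zero hd
  simpa [mul_assoc] using this

/-- Writing a function as a combination of indicator functions of superlevel sets. -/
theorem exists_layer_coeff (s : Finset ℝ) :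
    ∃ c : ℝ → ℝ, (∀ x ∈ s, ∑ y ∈ s, (if y ≤ x then c y else 0) = x) ∧
      ∀ x ∈ s, (∃ y ∈ s, y < x) → 0 < c x := by
  induction s using Finset.induction_on_max with
  | empty => exact ⟨0, by simp, by simp⟩
  | insert a s has ih =>
    obtain ⟨c, h1, h2⟩ := ih
    have ha : a ∉ s := fun h => lt_irrefl _ (has a h)
    -- The new top value `a` receives its distance to the previous maximum. For the smallest value
    -- the coefficient is the value itself, of arbitrary sign, hence the restriction in the
    -- positivity claim.
    refine ⟨fun y => if y = a then a - ∑ y ∈ s, c y else c y, fun x hx => ?_, fun x hx hxy => ?_⟩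
    · rw [Finset.sum_insert ha]
      have e1 : ∑ y ∈ s, (if y ≤ x then (if y = a then a - ∑ y ∈ s, c y else c y) else 0) =
          ∑ y ∈ s, if y ≤ x then c y else 0 :=
        Finset.sum_congr rfl fun y hy => by rw [if_neg (has y hy).ne]
      rw [e1]
      rcases Finset.mem_insert.mp hx with rfl | hx
      · have e2 : ∑ y ∈ s, (if y ≤ x then c y else 0) = ∑ y ∈ s, c y :=
          Finset.sum_congr rfl fun y hy => if_pos (has y hy).le
        rw [e2]; simp
      · rw [if_neg (not_le.mpr (has x hx)), zero_add, h1 x hx]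
    · rcases Finset.mem_insert.mp hx with rfl | hx
      · obtain ⟨y, hy, hyx⟩ := hxy
        have hys : y ∈ s := (Finset.mem_insert.mp hy).resolve_left hyx.ne
        have hm := h1 (s.max' ⟨y, hys⟩) (Finset.max'_mem _ _)
        have e2 : ∑ y' ∈ s, (if y' ≤ s.max' ⟨y, hys⟩ then c y' else 0) = ∑ y ∈ s, c y :=
          Finset.sum_congr rfl fun y' hy' => if_pos (Finset.le_max' _ _ hy')
        rw [e2] at hm
        simp only [if_true, hm]
        have := has _ (Finset.max'_mem s ⟨y, hys⟩)
        linarith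
      · have hxa := has x hx
        obtain ⟨y, hy, hyx⟩ := hxy
        simp only [hxa.ne, if_false]
        exact h2 x hx ⟨y, (Finset.mem_insert.mp hy).resolve_left (hyx.trans hxa).ne, hyx⟩

end ConvexGeometry

end ShrinkingCurves

namespace ShrinkingCurves

/-! ### The lower bound for vectors homogeneous for an injective grading. -/

section KempfNess

/-- The columns of `M` with index in `p` are supported on rows in `p`, so their inner products only
involve the `p × p` block. -/
theorem transpose_mul_self_submatrix {m : Type*} [Fintype m] [DecidableEq m] {M : Matrix m m ℝ}
    {p : m → Prop} [DecidablePred p] (h : ∀ k i, M k i ≠ 0 → p i → p k) :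
    (M.transpose * M).submatrix (Subtype.val : {i // p i} → m) (Subtype.val : {i // p i} → m) =
      (M.submatrix (Subtype.val : {i // p i} → m) (Subtype.val : {i // p i} → m)).transpose *
        M.submatrix (Subtype.val : {i // p i} → m) (Subtype.val : {i // p i} → m) := by
  ext ⟨i, hi⟩ ⟨j, hj⟩
  simp only [Matrix.submatrix_apply, Matrix.mul_apply, Matrix.transpose_apply]
  symm
  refine Fintype.sum_of_injective Subtype.val Subtype.val_injective _ _ (fun k hk => ?_)
    (fun k => rfl)
  by_cases h0 : M k i = 0
  · rw [h0, zero_mul]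
  · exact absurd ⟨⟨k, h k i h0 hi⟩, rfl⟩ hk

theorem mulVec_dotProduct_self {m : Type*} [Fintype m] (M : Matrix m m ℝ) (v : m → ℝ) :
    M.mulVec v ⬝ᵥ M.mulVec v = (M.transpose * M).mulVec v ⬝ᵥ v := by
  rw [mulVec_dotProduct, Matrix.mulVec_mulVec, dotProduct_comm]

theorem tpow_dotProduct_self {ι : Type*} [Fintype ι] [DecidableEq ι] {D : ℕ} (M : Matrix ι ι ℝ)
    (v : (Fin D → ι) → ℝ) : (tpow D M).mulVec v ⬝ᵥ (tpow D M).mulVec v =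
      (tpow D (M.transpose * M)).mulVec v ⬝ᵥ v := by
  rw [mulVec_dotProduct_self, tpow_mul, tpow_transpose]

/-- The leading part of `tpow D q` with respect to a grading. -/
theorem tpow_diagonalBlocks_le {ι : Type*} [Fintype ι] [DecidableEq ι] {D : ℕ} {q : Matrix ι ι ℝ}
    {b : ι → ℝ} (hq : q.BlockTriangular b) {w : (Fin D → ι) → ℝ} {M₀ : ℝ}
    (hw : ∀ I, w I ≠ 0 → wt b I ≤ M₀) :
    (tpow D (Matrix.of fun i j => if b i = b j then q i j else 0)).mulVec
        (Set.indicator {I | wt b I = M₀} w) ⬝ᵥ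
      (tpow D (Matrix.of fun i j => if b i = b j then q i j else 0)).mulVec
        (Set.indicator {I | wt b I = M₀} w) ≤
      (tpow D q).mulVec w ⬝ᵥ (tpow D q).mulVec w := by
  set qL : Matrix ι ι ℝ := Matrix.of fun i j => if b i = b j then q i j else 0
  have hqL : ∀ i j, qL i j ≠ 0 → b j = b i := by
    intro i j h
    by_contra hne
    exact h (if_neg (Ne.symm hne))
  have hq' : ∀ i j, q i j ≠ 0 → b i ≤ b j := fun i j h => by
    by_contra hlt
    exact h (hq (not_le.mp hlt))
  -- The comparison is made coordinate by coordinate. `q` never raises `b`, so in the top degree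
  -- `M₀` only the top part of `w` contributes, and only through the diagonal blocks; in other
  -- degrees the left side vanishes.
  refine Finset.sum_le_sum fun J _ => ?_
  by_cases hJ : wt b J = M₀
  · refine le_of_eq ?_
    have : (tpow D qL).mulVec (Set.indicator {I | wt b I = M₀} w) J = (tpow D q).mulVec w J := by
      refine Finset.sum_congr rfl fun I _ => ?_
      show tpow D qL J I * _ = tpow D q J I * _
      by_cases hI0 : w I = 0
      · simp [Set.indicator_apply, hI0]
      by_cases hI : wt b I = M₀
      · rw [Set.indicator_of_mem (by exact hI)]
        congr 1
        by_cases hall : ∀ s, b (J s) = b (I s)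
        · rw [tpow_apply, tpow_apply]
          exact Finset.prod_congr rfl fun s _ => if_pos (hall s)
        · push Not at hall
          obtain ⟨s, hs⟩ := hall
          have h1 : tpow D qL J I = 0 := Finset.prod_eq_zero (Finset.mem_univ s) (if_neg hs)
          rw [h1]
          by_contra hne
          have hne' := Ne.symm hne
          rw [tpow_apply, Finset.prod_ne_zero_iff] at hne'
          have hle : ∀ s ∈ Finset.univ, b (J s) ≤ b (I s) := fun s hs => hq' _ _ (hne' s hs)
          have := (Finset.sum_eq_sum_iff_of_le hle).mp (hJ.trans hI.symm) s (Finset.mem_univ s)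
          exact hs this
      · rw [Set.indicator_of_notMem (by exact hI), mul_zero]
        have h1 : tpow D q J I = 0 := by
          by_contra hne
          rw [tpow_apply, ← ne_eq, Finset.prod_ne_zero_iff] at hne
          have : wt b J ≤ wt b I := Finset.sum_le_sum fun s hs => hq' _ _ (hne s hs)
          exact hI (le_antisymm (hw I hI0) (hJ ▸ this))
        rw [h1, zero_mul]
    rw [this]
  · have : (tpow D qL).mulVec (Set.indicator {I | wt b I = M₀} w) J = 0 := by
      by_contra hne
      obtain ⟨I, h1, h2⟩ := exists_of_mulVec_ne_zero hne
      have h3 : wt b I = M₀ := by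
        by_contra h
        exact h2 (Set.indicator_of_notMem (by exact h) _)
      exact hJ ((wt_eq_of_tpow_ne_zero hqL h1).symm.trans h3)
    rw [this, zero_mul]
    exact mul_self_nonneg _

/-- A vector homogeneous for an injective grading has no off-diagonal moments. -/
theorem tder_single_dotProduct_of_homogeneous {ι : Type*} [Fintype ι] [DecidableEq ι] {D : ℕ}
    {δ : ι → ℝ} (hδ : Function.Injective δ) {m : ℝ} {w : (Fin D → ι) → ℝ}
    (hw : ∀ I, w I ≠ 0 → wt δ I = m) {i j : ι} (hij : i ≠ j) :
    (tder D (Matrix.single i j 1)).mulVec w ⬝ᵥ w = 0 := by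
  refine dotProduct_eq_zero_of_disjoint fun J h1 h2 => ?_
  obtain ⟨I, h3, h4⟩ := exists_of_mulVec_ne_zero h1
  have := cnt_of_tder_single_ne_zero h3 δ
  rw [hw J h2, hw I h4] at this
  exact hij (hδ (by linarith))

theorem tder_single_self_dotProduct {ι : Type*} [Fintype ι] [DecidableEq ι] {D : ℕ}
    (w : (Fin D → ι) → ℝ) (i : ι) :
    (tder D (Matrix.single i i 1)).mulVec w ⬝ᵥ w = ∑ I, cnt I i * (w I * w I) := by
  have : Matrix.single i i (1 : ℝ) = Matrix.diagonal (Pi.single i 1) := by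
    rw [Matrix.diagonal_single]
  rw [this, tder_diagonal]
  simp only [dotProduct, Matrix.mulVec_diagonal, mul_assoc]
  rfl

/-- The convexity estimate in terms of the principal minors on superlevel sets of `χ`. -/
theorem prod_det_rpow_le_tpow_dotProduct {ι : Type*} [Fintype ι] [DecidableEq ι] {D : ℕ}
    {w : (Fin D → ι) → ℝ} {χ : ι → ℝ} (hw : w ≠ 0)
    (hmom : ∀ i j, (tder D (Matrix.single i j 1)).mulVec w ⬝ᵥ w =
      if i = j then χ i * (w ⬝ᵥ w) else 0) {c : ℝ → ℝ}
    (hc : ∀ x ∈ Finset.univ.image χ,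
      ∑ y ∈ Finset.univ.image χ, (if y ≤ x then c y else 0) = x)
    {P : Matrix ι ι ℝ} (hP : P.PosDef) (hPχ : ∀ i j, P i j ≠ 0 → χ i = χ j) :
    w ⬝ᵥ w * ∏ y ∈ Finset.univ.image χ,
      (P.submatrix (Subtype.val : {i // y ≤ χ i} → ι) Subtype.val).det ^ c y ≤
      (tpow D P).mulVec w ⬝ᵥ w := by
  obtain ⟨U, d, β, hUU, hUU', hPU, hd, hβ⟩ := exists_block_spectral hP hPχ
  refine le_trans (le_of_eq ?_) (exp_le_tpow_dotProduct hw hmom hUU hUU' hPU hd hβ)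
  congr 1
  have hβmem : ∀ k, β k ∈ Finset.univ.image χ := by
    intro k
    obtain ⟨i, hi⟩ : ∃ i, U i k ≠ 0 := by
      by_contra! h
      have := congrFun₂ hUU' k k
      simp [Matrix.mul_apply, h] at this
    exact Finset.mem_image.mpr ⟨i, Finset.mem_univ _, hβ i k hi⟩
  have hdet : ∀ y, (P.submatrix (Subtype.val : {i // y ≤ χ i} → ι) Subtype.val).det =
      Real.exp (∑ k, if y ≤ β k then Real.log (d k) else 0) := by
    intro y
    rw [det_submatrix_of_block_spectral hUU hPU hβ (fun r => y ≤ r), Real.exp_sum]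
    refine Finset.prod_congr rfl fun k _ => ?_
    split_ifs
    · rw [Real.exp_log (hd k)]
    · rw [Real.exp_zero]
  simp only [hdet, ← Real.exp_mul]
  rw [← Real.exp_sum]
  congr 1
  simp only [Finset.sum_mul]
  rw [Finset.sum_comm]
  refine Finset.sum_congr rfl fun k _ => ?_
  conv_rhs => rw [← hc (β k) (hβmem k), Finset.sum_mul]
  refine Finset.sum_congr rfl fun y _ => ?_
  split_ifs <;> ring

/-- **The Kempf–Ness lower bound.** -/
theorem exists_kempf_ness_bound {N D : ℕ} {δ : Fin N → ℝ} (hδ : Function.Injective δ) {m : ℝ}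
    {w : (Fin D → Fin N) → ℝ} (hw0 : w ≠ 0) (hw : ∀ I, w I ≠ 0 → wt δ I = m) :
    ∃ (p : (Fin D → Fin N) → ℝ) (χ : Fin N → ℝ) (c : ℝ → ℝ) (C : ℝ),
      (∀ I, 0 ≤ p I) ∧ (∀ I, p I ≠ 0 → w I ≠ 0) ∧ ∑ I, p I = 1 ∧ χ = ∑ I, p I • cnt I ∧
      (∀ I, w I ≠ 0 → χ ⬝ᵥ χ ≤ cnt I ⬝ᵥ χ) ∧ (∀ i j, χ i < χ j → 0 < c (χ j)) ∧ 0 < C ∧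
      ∀ g : Matrix (Fin N) (Fin N) ℝ, g.det = 1 →
        C * ∏ y ∈ Finset.univ.image χ, ((g.transpose * g).submatrix
          (Subtype.val : {i // y ≤ χ i} → Fin N) Subtype.val).det ^ c y ≤
        (tpow D g).mulVec w ⬝ᵥ (tpow D g).mulVec w := by
  classical
  obtain ⟨I₀, hI₀⟩ := Function.ne_iff.mp hw0
  have : Nonempty {I // w I ≠ 0} := ⟨⟨I₀, hI₀⟩⟩
  -- `p` gives barycentric coordinates of the nearest point `χ`; the functional `lam` found below
  -- cuts out the smallest face of the weight polytope through `χ`.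
  obtain ⟨p, hp0, hp1, hnear⟩ := exists_nearest_point fun I : {I // w I ≠ 0} => cnt I.1
  set χ := ∑ K : {I // w I ≠ 0}, p K • cnt K.1 with hχ
  obtain ⟨c, hc1, hc2⟩ := exists_layer_coeff (Finset.univ.image χ)
  obtain ⟨lam, hlam, hface⟩ := exists_minimal_face fun I : {I // w I ≠ 0} => cnt I.1 - χ
  have hχe : ∀ I : {I // w I ≠ 0}, 0 ≤ χ ⬝ᵥ (cnt I.1 - χ) := fun I => by
    rw [dotProduct_sub, dotProduct_comm χ (cnt _)]; linarith [hnear I]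
  have hχ0 : ∀ I : {I // w I ≠ 0}, lam ⬝ᵥ (cnt I.1 - χ) = 0 → χ ⬝ᵥ (cnt I.1 - χ) = 0 := by
    intro I hI
    have := hface (-χ) (fun J _ => by rw [neg_dotProduct]; linarith [hχe J]) I hI
    rw [neg_dotProduct] at this; linarith
  -- The `p`-average of `cnt I - χ` is zero, so `lam` cannot be strictly negative at all weights.
  have : Nonempty {I : {I // w I ≠ 0} // lam ⬝ᵥ (cnt I.1 - χ) = 0} := by
    by_contra hne
    rw [not_nonempty_iff] at hne
    have hlt : ∀ I : {I // w I ≠ 0}, lam ⬝ᵥ (cnt I.1 - χ) < 0 := fun I =>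
      lt_of_le_of_ne (hlam I) fun h => hne.false ⟨I, h⟩
    have hsum : ∑ I : {I // w I ≠ 0}, p I * (lam ⬝ᵥ (cnt I.1 - χ)) = 0 := by
      have : ∑ I : {I // w I ≠ 0}, p I * (lam ⬝ᵥ (cnt I.1 - χ)) =
          lam ⬝ᵥ (∑ I : {I // w I ≠ 0}, p I • cnt I.1 - (∑ I, p I) • χ) := by
        rw [Finset.sum_smul, ← Finset.sum_sub_distrib, dotProduct_sum]
        refine Finset.sum_congr rfl fun I _ => ?_
        rw [← smul_sub, dotProduct_smul, smul_eq_mul]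
      rw [this, hp1, one_smul, ← hχ, sub_self, dotProduct_zero]
    have hz := (Finset.sum_eq_zero_iff_of_nonpos fun I _ =>
      mul_nonpos_of_nonneg_of_nonpos (hp0 I) (hlam I)).mp hsum
    have : ∑ I, p I = 0 := Finset.sum_eq_zero fun I hI =>
      (mul_eq_zero.mp (hz I hI)).resolve_right (hlt I).ne
    linarith
  -- Minimality of the face is precisely the hypothesis under which the norm has a critical point
  -- along the torus orbit of the face component of `w`.
  obtain ⟨x, hx⟩ := exists_critical_point
    (fun I : {I : {I // w I ≠ 0} // lam ⬝ᵥ (cnt I.1 - χ) = 0} => cnt I.1.1 - χ)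
    (a := fun I => w I.1.1 * w I.1.1) (fun I => mul_self_pos.mpr I.1.2)
    (fun y hy I => hface y (fun J hJ => hy ⟨J, hJ⟩) I.1 I.2)
  -- the refined grading
  obtain ⟨K, hK0, hK⟩ : ∃ K : ℝ, 0 < K ∧ ∀ i j, χ j < χ i → lam i - K * χ i < lam j - K * χ j := by
    refine ⟨1 + ∑ z : Fin N × Fin N, |(lam z.1 - lam z.2) / (χ z.1 - χ z.2)|,
      add_pos_of_pos_of_nonneg one_pos (Finset.sum_nonneg fun _ _ => abs_nonneg _),
      fun i j hij => ?_⟩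
    have h1 : |(lam i - lam j) / (χ i - χ j)| ≤
        ∑ z : Fin N × Fin N, |(lam z.1 - lam z.2) / (χ z.1 - χ z.2)| :=
      Finset.single_le_sum (f := fun z : Fin N × Fin N =>
        |(lam z.1 - lam z.2) / (χ z.1 - χ z.2)|) (fun _ _ => abs_nonneg _) (Finset.mem_univ (i, j))
    have h2 : 0 < χ i - χ j := sub_pos.mpr hij
    have h3 := mul_le_mul_of_nonneg_right ((le_abs_self _).trans h1) h2.le
    rw [div_mul_cancel₀ _ h2.ne'] at h3
    nlinarith
  -- `K` is large enough for larger `χ` to mean smaller `b`, so superlevel sets of `χ` are initial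
  -- segments for `b`. At the same time the weights of `w` of highest `b`-degree are exactly those
  -- on the minimal face.
  set b : Fin N → ℝ := fun i => lam i - K * χ i with hb
  have hbχ : ∀ i j, b i ≤ b j → χ j ≤ χ i := fun i j hij => by
    by_contra h
    exact absurd (hK j i (not_le.mp h)) (not_lt.mpr hij)
  have hbχ' : ∀ i j, b i = b j → χ i = χ j := fun i j hij =>
    le_antisymm (hbχ j i hij.ge) (hbχ i j hij.le)
  have hbe : ∀ I : {I // w I ≠ 0}, wt b I.1 =
      lam ⬝ᵥ (cnt I.1 - χ) - K * (χ ⬝ᵥ (cnt I.1 - χ)) + b ⬝ᵥ χ := by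
    intro I
    have : b = lam - K • χ := rfl
    rw [wt_eq_sum_cnt]
    change cnt I.1 ⬝ᵥ b = _
    rw [dotProduct_comm, this]
    simp only [sub_dotProduct, dotProduct_sub, smul_dotProduct, smul_eq_mul]
    ring
  have hbM : ∀ I, w I ≠ 0 → wt b I ≤ b ⬝ᵥ χ := fun I hI => by
    rw [hbe ⟨I, hI⟩]
    have := mul_nonneg hK0.le (hχe ⟨I, hI⟩)
    linarith [hlam ⟨I, hI⟩]
  have hbS : ∀ I : {I // w I ≠ 0}, wt b I.1 = b ⬝ᵥ χ ↔ lam ⬝ᵥ (cnt I.1 - χ) = 0 := by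
    intro I
    rw [hbe I]
    constructor
    · intro h
      have := mul_nonneg hK0.le (hχe I)
      linarith [hlam I]
    · intro h
      rw [h, hχ0 I h]; ring
  set S : Set (Fin D → Fin N) := {I | wt b I = b ⬝ᵥ χ} with hS
  -- the critical vector
  set x2 : Fin N → ℝ := fun i => x i / 2 with hx2
  set ws : (Fin D → Fin N) → ℝ := S.indicator w with hws
  set v : (Fin D → Fin N) → ℝ := fun I => Real.exp (wt x2 I) * ws I with hv
  have hvv : ∀ I, v I * v I = Real.exp (x ⬝ᵥ χ) * (Real.exp (x ⬝ᵥ (cnt I - χ)) * (ws I * ws I)) := by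
    intro I
    have h1 : wt x2 I + wt x2 I = x ⬝ᵥ χ + x ⬝ᵥ (cnt I - χ) := by
      rw [dotProduct_sub, add_sub_cancel, dotProduct_comm]
      change _ = ∑ i, cnt I i * x i
      rw [← wt_eq_sum_cnt, wt, wt, ← Finset.sum_add_distrib]
      exact Finset.sum_congr rfl fun s _ => by simp [hx2]
    have h2 : v I * v I = Real.exp (wt x2 I + wt x2 I) * (ws I * ws I) := by
      rw [Real.exp_add, hv]; ring
    rw [h2, h1, Real.exp_add, mul_assoc]
  -- Criticality of `x` says that the weights of `v`, averaged with the densities `v_I²`, give `χ`.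
  have hmom1 : ∀ i, ∑ I, cnt I i * (v I * v I) = χ i * (v ⬝ᵥ v) := by
    intro i
    have h1 := hx (Pi.single i 1)
    have h2 : ∑ I, (v I * v I) * (cnt I i - χ i) = 0 := by
      rw [← mul_zero (Real.exp (x ⬝ᵥ χ)), ← h1, Finset.mul_sum]
      symm
      refine Fintype.sum_of_injective
        (fun I : {I : {I // w I ≠ 0} // lam ⬝ᵥ (cnt I.1 - χ) = 0} => I.1.1)
        (fun I J h => Subtype.ext (Subtype.ext h)) _ _ (fun I hI => ?_) (fun I => ?_)
      · have : ws I = 0 := by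
          by_contra h
          have h3 : I ∈ S ∧ w I ≠ 0 := by
            rw [hws, ← ne_eq, Set.indicator_apply_ne_zero] at h; exact h
          exact hI ⟨⟨⟨I, h3.2⟩, (hbS ⟨I, h3.2⟩).mp h3.1⟩, rfl⟩
        simp [hvv, this]
      · have : ws I.1.1 = w I.1.1 := Set.indicator_of_mem (show I.1.1 ∈ S from (hbS I.1).mpr I.2) w
        rw [hvv, this, single_one_dotProduct, Pi.sub_apply]
        ring
    have h3 : ∑ I, (v I * v I) * (cnt I i - χ i) =
        ∑ I, cnt I i * (v I * v I) - χ i * (v ⬝ᵥ v) := by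
      rw [dotProduct, Finset.mul_sum, ← Finset.sum_sub_distrib]
      exact Finset.sum_congr rfl fun I _ => by ring
    linarith
  have hmom : ∀ i j, (tder D (Matrix.single i j 1)).mulVec v ⬝ᵥ v =
      if i = j then χ i * (v ⬝ᵥ v) else 0 := by
    intro i j
    split_ifs with hij
    · subst hij
      rw [tder_single_self_dotProduct, hmom1]
    · refine tder_single_dotProduct_of_homogeneous hδ (m := m) (fun I hI => hw I ?_) hij
      intro h0
      apply hI
      have : ws I = 0 := by
        rw [hws, Set.indicator_apply_eq_zero]; exact fun _ => h0
      simp [hv, this]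
  have hv0 : v ≠ 0 := by
    obtain ⟨⟨I, hI⟩⟩ := ‹Nonempty {I : {I // w I ≠ 0} // lam ⬝ᵥ (cnt I.1 - χ) = 0}›
    intro h
    have h1 := congrFun h I.1
    have h2 : ws I.1 = w I.1 := Set.indicator_of_mem (show I.1 ∈ S from (hbS I).mpr hI) w
    simp only [hv, h2, Pi.zero_apply, mul_eq_zero, Real.exp_ne_zero, false_or] at h1
    exact I.2 h1
  have hvpos : 0 < v ⬝ᵥ v := lt_of_le_of_ne (Finset.sum_nonneg fun i _ => mul_self_nonneg _)
    fun h => hv0 (dotProduct_self_eq_zero.mp h.symm)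
  have hwsv : ws = (tpow D (Matrix.diagonal fun i => Real.exp (-x2 i))).mulVec v := by
    rw [tpow_diagonal_exp]
    funext I
    rw [Matrix.mulVec_diagonal]
    have : wt (fun i => -x2 i) I = -wt x2 I := by simp [wt]
    rw [this, hv, ← mul_assoc, ← Real.exp_add, neg_add_cancel, Real.exp_zero, one_mul]
  set t : ℝ → ℝ := fun y => (∏ i : {i // y ≤ χ i}, Real.exp (-x2 i)) with ht
  have htpos : ∀ y, 0 < t y := fun y => Finset.prod_pos fun i _ => Real.exp_pos _
  obtain ⟨pe, hpe, hpe0⟩ : ∃ pe : (Fin D → Fin N) → ℝ, (∀ I (h : w I ≠ 0), pe I = p ⟨I, h⟩) ∧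
      ∀ I, w I = 0 → pe I = 0 :=
    ⟨fun I => if h : w I ≠ 0 then p ⟨I, h⟩ else 0, fun I h => dif_pos h,
      fun I h => dif_neg (not_not.mpr h)⟩
  refine ⟨pe, χ, c,
    v ⬝ᵥ v * ∏ y ∈ Finset.univ.image χ, (t y * t y) ^ c y, fun I => ?_, fun I hI => ?_, ?_, ?_,
    fun I hI => hnear ⟨I, hI⟩, fun i j hij => ?_, ?_, fun g hg => ?_⟩
  · by_cases h : w I = 0
    · exact (hpe0 I h).ge
    · rw [hpe I h]; exact hp0 _
  · exact fun h => hI (hpe0 I h)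
  · rw [← hp1]
    symm
    refine Fintype.sum_of_injective Subtype.val Subtype.val_injective _ _ (fun I hI => ?_)
      (fun I => (hpe I.1 I.2).symm)
    exact hpe0 I (by_contra fun h => hI ⟨⟨I, h⟩, rfl⟩)
  · rw [hχ]
    refine Fintype.sum_of_injective Subtype.val Subtype.val_injective _ _ (fun I hI => ?_)
      (fun I => by rw [hpe I.1 I.2])
    rw [hpe0 I (by_contra fun h => hI ⟨⟨I, h⟩, rfl⟩), zero_smul]
  · exact hc2 _ (Finset.mem_image_of_mem _ (Finset.mem_univ _))
      ⟨_, Finset.mem_image_of_mem _ (Finset.mem_univ i), hij⟩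
  · exact mul_pos hvpos (Finset.prod_pos fun y _ => Real.rpow_pos_of_pos
      (mul_pos (htpos y) (htpos y)) _)
  -- Both the norm of `g w` and the minors depend only on `gᵀ g`, so `g` may be replaced by the
  -- block triangular `q`, and then `q` by its diagonal blocks `qL` acting on the face component of
  -- `w`.
  · obtain ⟨q, hgq, hq⟩ := exists_blockTriangular_cholesky b
      ((Matrix.isUnit_iff_isUnit_det g).mpr (by rw [hg]; exact isUnit_one))
    have hqdet : q.det ≠ 0 := by
      have := congrArg Matrix.det hgq
      rw [Matrix.det_mul, Matrix.det_mul, Matrix.det_transpose, Matrix.det_transpose, hg] at this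
      intro h0; rw [h0] at this; norm_num at this
    set qL : Matrix (Fin N) (Fin N) ℝ := Matrix.of fun i j => if b i = b j then q i j else 0
      with hqL
    have hqLdet : q.det = qL.det := det_eq_det_diagonalBlocks hq
    have hqLb : ∀ i j, qL i j ≠ 0 → b i = b j := by
      intro i j h
      by_contra hne
      exact h (if_neg hne)
    set Dx : Matrix (Fin N) (Fin N) ℝ := Matrix.diagonal fun i => Real.exp (-x2 i) with hDx
    have hDxdet : Dx.det ≠ 0 := by
      rw [hDx, Matrix.det_diagonal]
      exact Finset.prod_ne_zero_iff.mpr fun i _ => Real.exp_ne_zero _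
    set P : Matrix (Fin N) (Fin N) ℝ := (qL * Dx).transpose * (qL * Dx) with hP
    have hPpos : P.PosDef := by
      have h1 : IsUnit (qL * Dx) := (Matrix.isUnit_iff_isUnit_det _).mpr (by
        rw [Matrix.det_mul, ← hqLdet]; exact (mul_ne_zero hqdet hDxdet).isUnit)
      have := Matrix.PosDef.conjTranspose_mul_self _ (Matrix.mulVec_injective_of_isUnit h1)
      rwa [Matrix.conjTranspose_eq_transpose_of_trivial] at this
    have hPe : ∀ i j, P i j = Real.exp (-x2 i) * (qL.transpose * qL) i j * Real.exp (-x2 j) := by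
      intro i j
      have : P = Dx * (qL.transpose * qL) * Dx := by
        rw [hP, Matrix.transpose_mul, hDx, Matrix.diagonal_transpose]; simp only [mul_assoc]
      rw [this, hDx, Matrix.mul_diagonal, Matrix.diagonal_mul]
    have hPχ : ∀ i j, P i j ≠ 0 → χ i = χ j := by
      intro i j h
      rw [hPe] at h
      have h1 := right_ne_zero_of_mul (left_ne_zero_of_mul h)
      rw [Matrix.mul_apply] at h1
      obtain ⟨k, -, hk⟩ := Finset.exists_ne_zero_of_sum_ne_zero h1
      exact hbχ' i j ((hqLb k i (left_ne_zero_of_mul hk)).symm.trans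
        (hqLb k j (right_ne_zero_of_mul hk)))
    have hmain := prod_det_rpow_le_tpow_dotProduct hv0 hmom hc1 hPpos hPχ
    -- On an initial segment for `b` a Gram minor of `q` is the square of a minor of `q`, which only
    -- depends on the diagonal blocks. The diagonal matrix `Dx` accounts for the factor `t y * t y`.
    have hdetP : ∀ y, (P.submatrix (Subtype.val : {i // y ≤ χ i} → Fin N) Subtype.val).det =
        t y * t y * ((g.transpose * g).submatrix
          (Subtype.val : {i // y ≤ χ i} → Fin N) Subtype.val).det := by
      intro y
      have h1 : P.submatrix (Subtype.val : {i // y ≤ χ i} → Fin N) Subtype.val =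
          Matrix.diagonal (fun i : {i // y ≤ χ i} => Real.exp (-x2 i)) *
            (qL.transpose * qL).submatrix Subtype.val Subtype.val *
            Matrix.diagonal (fun i : {i // y ≤ χ i} => Real.exp (-x2 i)) := by
        ext i j
        rw [Matrix.mul_diagonal, Matrix.diagonal_mul, Matrix.submatrix_apply, hPe,
          Matrix.submatrix_apply]
      have h2 : ((g.transpose * g).submatrix
          (Subtype.val : {i // y ≤ χ i} → Fin N) Subtype.val).det =
          ((qL.transpose * qL).submatrix
            (Subtype.val : {i // y ≤ χ i} → Fin N) Subtype.val).det := by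
        rw [hgq, transpose_mul_self_submatrix, transpose_mul_self_submatrix, Matrix.det_mul,
          Matrix.det_mul, Matrix.det_transpose, Matrix.det_transpose,
          det_eq_det_diagonalBlocks (hq.submatrix (f := (Subtype.val : {i // y ≤ χ i} → Fin N)))]
        · rfl
        · intro k i hki hi
          exact hi.trans (hbχ' k i (hqLb k i hki)).ge
        · intro k i hki hi
          refine hi.trans (hbχ k i ?_)
          by_contra h
          exact hki (hq (not_le.mp h))
      rw [h1, Matrix.det_mul, Matrix.det_mul, Matrix.det_diagonal, h2]
      ring
    have hgpos : ∀ y, 0 ≤ ((g.transpose * g).submatrix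
        (Subtype.val : {i // y ≤ χ i} → Fin N) Subtype.val).det := by
      intro y
      have h1 := (hPpos.submatrix (e := (Subtype.val : {i // y ≤ χ i} → Fin N))
        Subtype.val_injective).det_pos
      rw [hdetP] at h1
      exact (pos_of_mul_pos_right h1 (mul_pos (htpos y) (htpos y)).le).le
    calc _ = v ⬝ᵥ v * ∏ y ∈ Finset.univ.image χ,
          (P.submatrix (Subtype.val : {i // y ≤ χ i} → Fin N) Subtype.val).det ^ c y := by
          rw [mul_assoc, ← Finset.prod_mul_distrib]
          congr 1
          refine Finset.prod_congr rfl fun y _ => ?_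
          rw [hdetP, Real.mul_rpow (mul_pos (htpos y) (htpos y)).le (hgpos y)]
      _ ≤ (tpow D P).mulVec v ⬝ᵥ v := hmain
      _ = (tpow D qL).mulVec ws ⬝ᵥ (tpow D qL).mulVec ws := by
          rw [hP, ← tpow_dotProduct_self, tpow_mul, ← Matrix.mulVec_mulVec, ← hwsv]
      _ ≤ (tpow D q).mulVec w ⬝ᵥ (tpow D q).mulVec w := tpow_diagonalBlocks_le hq hbM
      _ = _ := by rw [tpow_dotProduct_self, tpow_dotProduct_self, hgq]

end KempfNess

end ShrinkingCurves

namespace ShrinkingCurves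

/-! ### The unipotent matrices `1 + rowMat x` and their Gram minors. -/

section RowMatrix

variable {n : ℕ}

/-- The matrix whose only nonzero entries are `x j`, `j ≠ 0`, in row `0`. -/
def rowMat (x : Fin (n + 1) → ℝ) : Matrix (Fin (n + 1)) (Fin (n + 1)) ℝ :=
  Matrix.of fun i j => if i = 0 ∧ j ≠ 0 then x j else 0

theorem rowMat_ne_zero {x : Fin (n + 1) → ℝ} {i j : Fin (n + 1)} (h : rowMat x i j ≠ 0) :
    i = 0 ∧ j ≠ 0 ∧ x j ≠ 0 := by
  rw [rowMat, Matrix.of_apply] at h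
  split_ifs at h with h1
  · exact ⟨h1.1, h1.2, h⟩
  · exact absurd rfl h

theorem rowMat_mul_rowMat (x y : Fin (n + 1) → ℝ) : rowMat x * rowMat y = 0 := by
  ext i j
  rw [Matrix.mul_apply]
  refine Finset.sum_eq_zero fun k _ => ?_
  by_contra h
  exact (rowMat_ne_zero (left_ne_zero_of_mul h)).2.1 (rowMat_ne_zero (right_ne_zero_of_mul h)).1

theorem rowMat_add (x y : Fin (n + 1) → ℝ) : rowMat (x + y) = rowMat x + rowMat y := by
  ext i j
  simp only [rowMat, Matrix.of_apply, Matrix.add_apply]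
  split_ifs <;> simp

theorem one_add_rowMat_mul (x y : Fin (n + 1) → ℝ) :
    (1 + rowMat x) * (1 + rowMat y) = 1 + rowMat (x + y) := by
  rw [rowMat_add, add_mul, mul_add, mul_add, rowMat_mul_rowMat]
  simp only [one_mul, mul_one, add_zero]
  abel

theorem horoMatrix_eq (x : Fin n → ℝ) : horoMatrix x = 1 + rowMat (Fin.cons 0 x) := by
  ext i j
  rw [horoMatrix, Matrix.of_apply, Matrix.add_apply, rowMat, Matrix.of_apply]
  by_cases hi : i = 0
  · subst hi
    refine Fin.cases ?_ (fun j => ?_) j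
    · simp
    · simp [Matrix.one_apply_ne (Fin.succ_ne_zero j).symm]
  · simp [hi, Matrix.one_apply]

theorem rowMat_eq_sum (x : Fin (n + 1) → ℝ) :
    rowMat x = ∑ j, (if j = 0 then 0 else x j) • Matrix.single 0 j (1 : ℝ) := by
  ext i j
  rw [Matrix.sum_apply, Finset.sum_eq_single j]
  · by_cases hi : i = 0 <;> by_cases hj : j = 0 <;>
      simp [rowMat, hi, hj, eq_comm]
  · intro k _ hk
    simp [hk]
  · simp

theorem one_add_rowMat_apply_zero (x : Fin (n + 1) → ℝ) (j : Fin (n + 1)) :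
    (1 + rowMat x) 0 j = if j = 0 then 1 else x j := by
  by_cases hj : j = 0
  · subst hj; simp [rowMat]
  · simp [rowMat, hj, Matrix.one_apply_ne (Ne.symm hj)]

theorem one_add_rowMat_apply_of_ne (x : Fin (n + 1) → ℝ) {i : Fin (n + 1)} (hi : i ≠ 0)
    (j : Fin (n + 1)) : (1 + rowMat x) i j = (1 : Matrix _ _ ℝ) i j := by
  simp [rowMat, hi]

theorem det_one_add_rowMat (x : Fin (n + 1) → ℝ) : (1 + rowMat x).det = 1 := by
  rw [Matrix.det_of_isUpperTriangular]
  · refine Finset.prod_eq_one fun i _ => ?_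
    by_cases h : i = 0
    · subst h; rw [one_add_rowMat_apply_zero, if_pos rfl]
    · rw [one_add_rowMat_apply_of_ne _ h, Matrix.one_apply_eq]
  · intro i j (hij : j < i)
    rw [one_add_rowMat_apply_of_ne _ (Fin.ne_zero_of_lt hij), Matrix.one_apply_ne hij.ne']

/-- Principal minors of the Gram matrix of `diag(a) (1 + rowMat x)` containing the index `0`. -/
theorem gram_det_of_zero_mem {a x : Fin (n + 1) → ℝ} {p : Fin (n + 1) → Prop} [DecidablePred p]
    (h0 : p 0) :
    (((Matrix.diagonal a * (1 + rowMat x)).transpose * (Matrix.diagonal a * (1 + rowMat x))).submatrix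
      (Subtype.val : {i // p i} → Fin (n + 1)) (Subtype.val : {i // p i} → Fin (n + 1))).det =
      (∏ i : {i // p i}, a i) ^ 2 := by
  have hdet : ((Matrix.diagonal a * (1 + rowMat x)).submatrix
      (Subtype.val : {i // p i} → Fin (n + 1)) (Subtype.val : {i // p i} → Fin (n + 1))).det =
      ∏ i : {i // p i}, a i := by
    rw [Matrix.det_of_isUpperTriangular]
    · refine Finset.prod_congr rfl fun i _ => ?_
      rw [Matrix.submatrix_apply, Matrix.diagonal_mul]
      by_cases h : i.1 = 0
      · rw [h, one_add_rowMat_apply_zero, if_pos rfl, mul_one]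
      · rw [one_add_rowMat_apply_of_ne _ h, Matrix.one_apply_eq, mul_one]
    · intro i j (hij : j < i)
      have hij' : j.1 < i.1 := hij
      rw [Matrix.submatrix_apply, Matrix.diagonal_mul,
        one_add_rowMat_apply_of_ne _ (Fin.ne_zero_of_lt hij'), Matrix.one_apply_ne hij'.ne', mul_zero]
  rw [transpose_mul_self_submatrix, Matrix.det_mul, Matrix.det_transpose, hdet, sq]
  intro k i hki hi
  rw [Matrix.diagonal_mul] at hki
  by_cases hk : k = 0
  · rw [hk]; exact h0
  · have := right_ne_zero_of_mul hki
    rw [one_add_rowMat_apply_of_ne _ hk, Matrix.one_apply] at this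
    simp only [ne_eq, ite_eq_right_iff, one_ne_zero, imp_false, not_not] at this
    rw [this]; exact hi

/-- Principal minors of the Gram matrix of `diag(a) (1 + rowMat x)` avoiding the index `0`. -/
theorem gram_det_of_zero_notMem {a x : Fin (n + 1) → ℝ} {p : Fin (n + 1) → Prop} [DecidablePred p]
    (h0 : ¬ p 0) (ha : ∀ i, a i ≠ 0) :
    (((Matrix.diagonal a * (1 + rowMat x)).transpose * (Matrix.diagonal a * (1 + rowMat x))).submatrix
      (Subtype.val : {i // p i} → Fin (n + 1)) (Subtype.val : {i // p i} → Fin (n + 1))).det =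
      (∏ i : {i // p i}, a i ^ 2) * (1 + ∑ i : {i // p i}, (a 0 * x i) ^ 2 / a i ^ 2) := by
  have hne : ∀ i : {i // p i}, i.1 ≠ 0 := fun i h => h0 (h ▸ i.2)
  -- Away from the column `0`, the rows other than row `0` contribute a diagonal matrix and row `0`
  -- a rank-one term, so the matrix determinant lemma applies.
  have h1 : ((Matrix.diagonal a * (1 + rowMat x)).transpose *
      (Matrix.diagonal a * (1 + rowMat x))).submatrix
      (Subtype.val : {i // p i} → Fin (n + 1)) (Subtype.val : {i // p i} → Fin (n + 1)) =
      Matrix.diagonal (fun i : {i // p i} => a i ^ 2) +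
        Matrix.replicateCol Unit (fun i : {i // p i} => a 0 * x i) *
          Matrix.replicateRow Unit (fun i : {i // p i} => a 0 * x i) := by
    ext i j
    have hcr : (Matrix.replicateCol Unit (fun i : {i // p i} => a 0 * x i) *
        Matrix.replicateRow Unit (fun i : {i // p i} => a 0 * x i)) i j =
        a 0 * x i * (a 0 * x j) := by
      simp [Matrix.mul_apply]
    rw [Matrix.submatrix_apply, Matrix.mul_apply, Fin.sum_univ_succ, Matrix.add_apply, hcr]
    simp only [Matrix.transpose_apply, Matrix.diagonal_mul, one_add_rowMat_apply_zero, hne,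
      if_false, one_add_rowMat_apply_of_ne _ (Fin.succ_ne_zero _)]
    rw [add_comm]
    congr 1
    obtain ⟨i', hi'⟩ := Fin.exists_succ_eq.mpr (hne i)
    rw [Finset.sum_eq_single i']
    · rw [hi', Matrix.one_apply_eq, mul_one, Matrix.diagonal_apply]
      by_cases hij : i = j
      · subst hij; simp [sq]
      · rw [if_neg hij, Matrix.one_apply_ne (fun h => hij (Subtype.ext h)), mul_zero, mul_zero]
    · intro k _ hk
      rw [← hi', Matrix.one_apply_ne (fun h => hk (Fin.succ_injective _ h)), mul_zero, zero_mul]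
    · simp
  have hu : IsUnit (Matrix.diagonal fun i : {i // p i} => a i ^ 2).det := by
    rw [Matrix.det_diagonal]
    exact IsUnit.mk0 _ (Finset.prod_ne_zero_iff.mpr fun i _ => pow_ne_zero 2 (ha i.1))
  have hinv : (Matrix.diagonal fun i : {i // p i} => a i ^ 2)⁻¹ =
      Matrix.diagonal fun i : {i // p i} => (a i ^ 2)⁻¹ := by
    refine Matrix.inv_eq_left_inv ?_
    rw [Matrix.diagonal_mul_diagonal, ← Matrix.diagonal_one]
    congr 1
    funext i
    exact inv_mul_cancel₀ (pow_ne_zero 2 (ha i))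
  rw [h1, Matrix.det_add_replicateCol_mul_replicateRow hu, Matrix.det_diagonal, hinv]
  congr 1
  rw [Matrix.det_unique, Matrix.add_apply, Matrix.one_apply_eq, Matrix.mul_apply]
  congr 1
  refine Finset.sum_congr rfl fun i _ => ?_
  rw [Matrix.mul_diagonal, Matrix.replicateRow_apply, Matrix.replicateCol_apply, div_eq_mul_inv]
  ring

end RowMatrix

/-! ### Exponents of the expanding diagonal elements -/

/-- Along the filter `l`, `A` is the logarithm of the diagonal element `a_t` and `L` the logarithm
of the scale `α`. -/
structure Regime {Ω : Type*} (l : Filter Ω) (n n₀ : ℕ) (A : Ω → Fin (n + 1) → ℝ)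
    (t L : Ω → ℝ) : Prop where
  one_le : 1 ≤ n₀
  le : n₀ ≤ n
  zero : ∀ ω, A ω 0 = n * t ω
  sum : ∀ ω, ∑ i, A ω i = 0
  nonpos : ∀ ω i, i ≠ 0 → A ω i ≤ 0
  mono : ∀ ω i j, i ≠ 0 → i ≤ j → A ω i ≤ A ω j
  bot : ∀ i : Fin (n + 1), i ≠ 0 → (i : ℕ) ≤ n₀ → Tendsto (fun ω => A ω i) l atBot
  null : ∀ i : Fin (n + 1), n₀ < (i : ℕ) → Tendsto (fun ω => A ω i) l (𝓝 0)
  nonneg : ∀ ω, 0 ≤ L ω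
  top : Tendsto t l atTop

/-- The matrix `a_t u(κ_i h^i)` at the scale `h = α e^{-t}`. -/
noncomputable def scaledMat {n : ℕ} (A : Fin (n + 1) → ℝ) (c : ℝ) (κ : Fin (n + 1) → ℝ) :
    Matrix (Fin (n + 1)) (Fin (n + 1)) ℝ :=
  Matrix.diagonal (fun i => Real.exp (A i)) *
    (1 + rowMat fun i => κ i * Real.exp (-(i : ℕ) * c))

/-- The principal minor on `{i | p i}` of the Gram matrix of `scaledMat A c κ`. -/
noncomputable def gramMinor {n : ℕ} (A : Fin (n + 1) → ℝ) (c : ℝ) (κ : Fin (n + 1) → ℝ)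
    (p : Fin (n + 1) → Prop) [DecidablePred p] : ℝ :=
  (((scaledMat A c κ).transpose * scaledMat A c κ).submatrix
    (Subtype.val : {i // p i} → Fin (n + 1)) (Subtype.val : {i // p i} → Fin (n + 1))).det

/-! ### Values and lower bounds for the minors of `scaledMat`. -/

section Minors

variable {n : ℕ} {A : Fin (n + 1) → ℝ} {c : ℝ} {κ : Fin (n + 1) → ℝ} {p : Fin (n + 1) → Prop}
  [DecidablePred p]

theorem det_scaledMat (hA : ∑ i, A i = 0) : (scaledMat A c κ).det = 1 := by
  rw [scaledMat, Matrix.det_mul, det_one_add_rowMat, mul_one, Matrix.det_diagonal,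
    ← Real.exp_sum, hA, Real.exp_zero]

theorem sum_subtype_eq_filter (f : Fin (n + 1) → ℝ) :
    ∑ i : {i // p i}, f i = ∑ i with p i, f i :=
  (Finset.sum_subtype _ (by simp) f).symm

theorem gramMinor_of_zero_mem (hA : ∑ i, A i = 0) (h0 : p 0) :
    gramMinor A c κ p = Real.exp (2 * ∑ i with ¬ p i, -A i) := by
  rw [gramMinor, scaledMat, gram_det_of_zero_mem h0, ← Real.exp_sum, ← Real.exp_nat_mul,
    sum_subtype_eq_filter]
  congr 1
  rw [← Finset.sum_filter_add_sum_filter_not _ p] at hA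
  rw [Finset.sum_neg_distrib]
  push_cast
  linarith

theorem exp_le_gramMinor (h0 : ¬ p 0) : Real.exp (2 * ∑ i with p i, A i) ≤ gramMinor A c κ p := by
  rw [gramMinor, scaledMat, gram_det_of_zero_notMem h0 (fun i => Real.exp_ne_zero _)]
  have h1 : ∏ i : {i // p i}, Real.exp (A i) ^ 2 = Real.exp (2 * ∑ i with p i, A i) := by
    rw [← sum_subtype_eq_filter, Finset.mul_sum, Real.exp_sum]
    exact Finset.prod_congr rfl fun i _ => by rw [← Real.exp_nat_mul]; norm_num
  rw [h1]
  refine le_mul_of_one_le_right (Real.exp_pos _).le (le_add_of_nonneg_right ?_)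
  exact Finset.sum_nonneg fun i _ => by positivity

/-- Keep only the rank-one contribution of the index `i₁`: its factor `exp (A i₁)` is exchanged for
`κ i₁ exp (A 0 - i₁ c)`. -/
theorem sq_mul_exp_le_gramMinor (h0 : ¬ p 0) {i₁ : Fin (n + 1)} (hi : p i₁) :
    κ i₁ ^ 2 * Real.exp (2 * (A 0 - i₁ * c + ∑ i with p i ∧ i ≠ i₁, A i)) ≤ gramMinor A c κ p := by
  rw [gramMinor, scaledMat, gram_det_of_zero_notMem h0 (fun i => Real.exp_ne_zero _)]
  have h1 : ∏ i : {i // p i}, Real.exp (A i) ^ 2 =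
      Real.exp (A i₁) ^ 2 * Real.exp (2 * ∑ i with p i ∧ i ≠ i₁, A i) := by
    have : ∏ i : {i // p i}, Real.exp (A i) ^ 2 = Real.exp (2 * ∑ i with p i, A i) := by
      rw [← sum_subtype_eq_filter, Finset.mul_sum, Real.exp_sum]
      exact Finset.prod_congr rfl fun i _ => by rw [← Real.exp_nat_mul]; norm_num
    rw [this, ← Finset.add_sum_erase _ _ (by simpa using hi : i₁ ∈ Finset.univ.filter p), mul_add,
      Real.exp_add, ← Real.exp_nat_mul]
    congr 3
    refine Finset.sum_congr ?_ fun _ _ => rfl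
    ext i
    simp [and_comm]
  have h2 : (Real.exp (A 0) * (κ i₁ * Real.exp (-(i₁ : ℕ) * c))) ^ 2 / Real.exp (A i₁) ^ 2 ≤
      1 + ∑ i : {i // p i}, (Real.exp (A 0) * (κ i * Real.exp (-(i : ℕ) * c))) ^ 2 /
        Real.exp (A i) ^ 2 := by
    have := Finset.single_le_sum (f := fun i : {i // p i} =>
      (Real.exp (A 0) * (κ i * Real.exp (-(i : ℕ) * c))) ^ 2 / Real.exp (A i) ^ 2)
      (fun i _ => by positivity) (Finset.mem_univ ⟨i₁, hi⟩)
    simp only at this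
    linarith
  refine le_trans (le_of_eq ?_) (mul_le_mul_of_nonneg_left h2
    (Finset.prod_nonneg fun i _ => by positivity))
  rw [h1]
  have h3 : Real.exp (2 * (A 0 - i₁ * c + ∑ i with p i ∧ i ≠ i₁, A i)) =
      Real.exp (A 0) ^ 2 * Real.exp (-(i₁ : ℕ) * c) ^ 2 *
        Real.exp (2 * ∑ i with p i ∧ i ≠ i₁, A i) := by
    rw [← Real.exp_nat_mul, ← Real.exp_nat_mul, ← Real.exp_add, ← Real.exp_add]
    congr 1; push_cast; ring
  rw [h3]
  field_simp [Real.exp_ne_zero (A i₁)]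

end Minors

end ShrinkingCurves

namespace ShrinkingCurves

/-! ### Growth of the minors along the filter. -/

namespace Regime

variable {Ω : Type*} {l : Filter Ω} {n n₀ : ℕ} {A : Ω → Fin (n + 1) → ℝ} {t L : Ω → ℝ}

/-- The exponent governing the minors whose smallest index is `i`. -/
def slope {n : ℕ} (A : Fin (n + 1) → ℝ) (t : ℝ) (i : Fin (n + 1)) : ℝ :=
  (n - i) * t + ∑ j ∈ Finset.Ioi i, A j

/-- Because `∑ A = 0`, one has `n * slope i = i ∑_{j > i} (A j - A i) + (n - i) ∑_{1 ≤ j ≤ i} (A i -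
A j)`. All differences are nonnegative by monotonicity. If `i` is not the last index, both
coefficients are at least `1`, and the terms `A n - A i` and `A i - A 1` alone add up to the gap. -/
theorem mul_slope_ge (h : Regime l n n₀ A t L) (ω : Ω) {i : Fin (n + 1)} (hi : i ≠ 0) :
    0 ≤ n * slope (A ω) (t ω) i ∧ ∀ i₁ : Fin (n + 1), (i₁ : ℕ) = 1 → i ≠ Fin.last n →
      A ω (Fin.last n) - A ω i₁ ≤ n * slope (A ω) (t ω) i := by
  have hin : (i : ℕ) ≤ n := Nat.lt_succ_iff.mp i.2
  have hi1 : 1 ≤ (i : ℕ) := Nat.one_le_iff_ne_zero.mpr fun h => hi (Fin.ext h)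
  have hsplit : A ω 0 + ∑ j ∈ Finset.Ioc 0 i, A ω j + ∑ j ∈ Finset.Ioi i, A ω j = 0 := by
    rw [← h.sum ω, ← Finset.sum_filter_add_sum_filter_not Finset.univ (· ≤ i)]
    congr 1
    · rw [← Finset.add_sum_erase _ _ (by simp : (0 : Fin (n + 1)) ∈ Finset.univ.filter (· ≤ i))]
      congr 1
      refine Finset.sum_congr ?_ fun _ _ => rfl
      ext j; simp [Fin.pos_iff_ne_zero]
    · refine Finset.sum_congr ?_ fun _ _ => rfl
      ext j; simp
  have h1 : ∑ j ∈ Finset.Ioi i, (A ω j - A ω i) = ∑ j ∈ Finset.Ioi i, A ω j - (n - i) * A ω i := by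
    rw [Finset.sum_sub_distrib, Finset.sum_const, Fin.card_Ioi, nsmul_eq_mul]
    congr 2
    rw [Nat.cast_sub (by omega)]; push_cast; ring
  have h2 : ∑ j ∈ Finset.Ioc 0 i, (A ω i - A ω j) = i * A ω i - ∑ j ∈ Finset.Ioc 0 i, A ω j := by
    rw [Finset.sum_sub_distrib, Finset.sum_const, Fin.card_Ioc, nsmul_eq_mul]
    simp
  have h1n : ∀ j ∈ Finset.Ioi i, 0 ≤ A ω j - A ω i := fun j hj =>
    sub_nonneg.mpr (h.mono ω i j hi (Finset.mem_Ioi.mp hj).le)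
  have h2n : ∀ j ∈ Finset.Ioc 0 i, 0 ≤ A ω i - A ω j := fun j hj =>
    sub_nonneg.mpr (h.mono ω j i (Fin.pos_iff_ne_zero.mp (Finset.mem_Ioc.mp hj).1)
      (Finset.mem_Ioc.mp hj).2)
  have hS : n * slope (A ω) (t ω) i = i * ∑ j ∈ Finset.Ioi i, (A ω j - A ω i) +
      (n - i) * ∑ j ∈ Finset.Ioc 0 i, (A ω i - A ω j) := by
    have := h.zero ω
    rw [h1, h2, slope]
    linear_combination (n - i : ℝ) * hsplit - (n - i : ℝ) * this
  have hin' : (i : ℝ) ≤ n := by exact_mod_cast hin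
  have hi1' : (1 : ℝ) ≤ i := by exact_mod_cast hi1
  refine ⟨?_, fun i₁ hi₁ hil => ?_⟩
  · rw [hS]
    have := Finset.sum_nonneg h1n
    have := Finset.sum_nonneg h2n
    have : (0 : ℝ) ≤ n - i := by linarith
    positivity
  · have hlt : i < Fin.last n := Fin.lt_last_iff_ne_last.mpr hil
    have e1 := Finset.single_le_sum h1n (Finset.mem_Ioi.mpr hlt)
    have e2 := Finset.single_le_sum h2n (Finset.mem_Ioc.mpr
      ⟨Fin.pos_iff_ne_zero.mpr fun h => by rw [h] at hi₁; simp at hi₁,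
        (by rw [Fin.le_def, hi₁]; exact hi1 : i₁ ≤ i)⟩)
    have hlt' : (1 : ℝ) ≤ n - i := by
      have : (i : ℕ) + 1 ≤ n := hlt
      have : ((i : ℕ) : ℝ) + 1 ≤ n := by exact_mod_cast this
      linarith
    rw [hS]
    have s1 := Finset.sum_nonneg h1n
    have s2 := Finset.sum_nonneg h2n
    nlinarith

theorem slope_nonneg (h : Regime l n n₀ A t L) (ω : Ω) {i : Fin (n + 1)} (hi : i ≠ 0) :
    0 ≤ slope (A ω) (t ω) i := by
  have hn : (0 : ℝ) < n := by exact_mod_cast h.one_le.trans h.le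
  exact nonneg_of_mul_nonneg_right (h.mul_slope_ge ω hi).1 hn

/-- With `i` smallest, the remaining indices of `p` all exceed `i`; adding the missing ones only
lowers the sum, since `A j ≤ 0` for `j ≠ 0`. -/
theorem le_exponent (h : Regime l n n₀ A t L) (ω : Ω) {p : Fin (n + 1) → Prop} [DecidablePred p]
    {i : Fin (n + 1)} (hmin : ∀ j, j < i → ¬ p j) :
    i * L ω + slope (A ω) (t ω) i ≤
      A ω 0 - i * (t ω - L ω) + ∑ j with p j ∧ j ≠ i, A ω j := by
  have h1 : ∑ j ∈ Finset.Ioi i, A ω j ≤ ∑ j with p j ∧ j ≠ i, A ω j := by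
    rw [← neg_le_neg_iff, ← Finset.sum_neg_distrib, ← Finset.sum_neg_distrib]
    refine Finset.sum_le_sum_of_subset_of_nonneg (fun j hj => ?_) (fun j hj _ => ?_)
    · simp only [Finset.mem_filter, Finset.mem_univ, true_and] at hj
      exact Finset.mem_Ioi.mpr (lt_of_le_of_ne (not_lt.mp fun hlt => hmin j hlt hj.1) hj.2.symm)
    · linarith [h.nonpos ω j (Fin.ne_zero_of_lt (Finset.mem_Ioi.mp hj))]
  rw [h.zero ω, slope]
  linarith

variable {κ : Fin (n + 1) → ℝ} {p : Fin (n + 1) → Prop} [DecidablePred p]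

theorem exists_min (h0 : ¬ p 0) {i : Fin (n + 1)} (hi : p i) :
    ∃ j ≤ i, j ≠ 0 ∧ p j ∧ ∀ k, k < j → ¬ p k := by
  classical
  obtain ⟨j, hj1, hj2⟩ := WellFounded.has_min (wellFounded_lt (α := Fin (n + 1))) {j | p j} ⟨i, hi⟩
  exact ⟨j, not_lt.mp (hj2 i hi), fun h => h0 (h ▸ hj1), hj1, fun k hk hpk => hj2 k hpk hk⟩

theorem gramMinor_ge (h : Regime l n n₀ A t L) (ω : Ω) (h0 : ¬ p 0) {i : Fin (n + 1)} (hi : p i)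
    (hmin : ∀ j, j < i → ¬ p j) :
    κ i ^ 2 * Real.exp (2 * (i * L ω + slope (A ω) (t ω) i)) ≤
      gramMinor (A ω) (t ω - L ω) κ p := by
  refine le_trans (mul_le_mul_of_nonneg_left (Real.exp_le_exp.mpr ?_) (sq_nonneg _))
    (sq_mul_exp_le_gramMinor h0 hi)
  linarith [h.le_exponent ω hmin]

/-- Three cases. If `0` is in `p` the minor is at least `1`. If `p` avoids `0` but meets the indices
up to `n₀`, its least index has nonnegative slope and nonzero `κ`. Otherwise `p` only contains
indices beyond `n₀`, where `A` tends to `0`. -/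
theorem exists_pos_le_gramMinor (h : Regime l n n₀ A t L)
    (hκ : ∀ i : Fin (n + 1), i ≠ 0 → (i : ℕ) ≤ n₀ → κ i ≠ 0) :
    ∃ ε > 0, ∀ᶠ ω in l, ε ≤ gramMinor (A ω) (t ω - L ω) κ p := by
  by_cases h0 : p 0
  · refine ⟨1, one_pos, Eventually.of_forall fun ω => ?_⟩
    rw [gramMinor_of_zero_mem (h.sum ω) h0]
    refine Real.one_le_exp (mul_nonneg zero_le_two (Finset.sum_nonneg fun i hi => ?_))
    have : i ≠ 0 := by rintro rfl; simp [h0] at hi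
    linarith [h.nonpos ω i this]
  by_cases hex : ∃ i : Fin (n + 1), (i : ℕ) ≤ n₀ ∧ p i
  · obtain ⟨i, hin, hi⟩ := hex
    obtain ⟨j, hji, hj0, hj, hmin⟩ := exists_min h0 hi
    refine ⟨κ j ^ 2, by have := hκ j hj0 ((Fin.le_def.mp hji).trans hin); positivity,
      Eventually.of_forall fun ω => ?_⟩
    refine le_trans ?_ (h.gramMinor_ge ω h0 hj hmin)
    refine le_mul_of_one_le_right (sq_nonneg _) (Real.one_le_exp ?_)
    have := h.slope_nonneg ω hj0
    have := h.nonneg ω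
    positivity
  · push Not at hex
    have hlim : Tendsto (fun ω => Real.exp (2 * ∑ i with p i, A ω i)) l
        (𝓝 (Real.exp (2 * ∑ i : Fin (n + 1) with p i, (0 : ℝ)))) := by
      refine (Real.continuous_exp.tendsto _).comp (Tendsto.const_mul 2 ?_)
      refine tendsto_finsetSum _ fun i hi => h.null i ?_
      by_contra hle
      exact hex i (not_lt.mp hle) (by simpa using hi)
    simp only [Finset.sum_const_zero, mul_zero, Real.exp_zero] at hlim
    refine ⟨1 / 2, by norm_num, ?_⟩
    filter_upwards [hlim.eventually_const_lt (by norm_num : (1 / 2 : ℝ) < 1)] with ω hω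
    exact hω.le.trans (exp_le_gramMinor h0)

/-- The logarithm of such a minor is twice the sum of `-A` over the missing indices, and `-A i`
alone tends to infinity. -/
theorem tendsto_gramMinor_of_zero_mem (h : Regime l n n₀ A t L) (h0 : p 0) {i : Fin (n + 1)}
    (hin : (i : ℕ) ≤ n₀) (hi : ¬ p i) :
    Tendsto (fun ω => gramMinor (A ω) (t ω - L ω) κ p) l atTop := by
  have hi0 : i ≠ 0 := by rintro rfl; exact hi h0
  have h1 : Tendsto (fun ω => Real.exp (2 * -A ω i)) l atTop :=
    Real.tendsto_exp_atTop.comp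
      (Tendsto.const_mul_atTop zero_lt_two (tendsto_neg_atBot_atTop.comp (h.bot i hi0 hin)))
  refine tendsto_atTop_mono (fun ω => ?_) h1
  rw [gramMinor_of_zero_mem (h.sum ω) h0]
  refine Real.exp_le_exp.mpr (mul_le_mul_of_nonneg_left ?_ zero_le_two)
  refine Finset.single_le_sum (f := fun i => -A ω i) (fun j hj => ?_) (by simpa using hi)
  have : j ≠ 0 := by rintro rfl; simp [h0] at hj
  linarith [h.nonpos ω j this]

theorem tendsto_gramMinor_of_zero_notMem (h : Regime l n n₀ A t L) (h0 : ¬ p 0) {i : Fin (n + 1)}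
    (hi : p i) (hmin : ∀ j, j < i → ¬ p j) (hκ : κ i ≠ 0)
    (hgrow : Tendsto (fun ω => i * L ω + slope (A ω) (t ω) i) l atTop) :
    Tendsto (fun ω => gramMinor (A ω) (t ω - L ω) κ p) l atTop :=
  tendsto_atTop_mono (fun ω => h.gramMinor_ge ω h0 hi hmin)
    (Tendsto.const_mul_atTop (by positivity)
      (Real.tendsto_exp_atTop.comp (Tendsto.const_mul_atTop zero_lt_two hgrow)))

theorem tendsto_slope_of_scale (h : Regime l n n₀ A t L) (hL : Tendsto L l atTop)
    {i : Fin (n + 1)} (hi : i ≠ 0) :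
    Tendsto (fun ω => i * L ω + slope (A ω) (t ω) i) l atTop := by
  have hi1 : (1 : ℝ) ≤ i := by
    exact_mod_cast Nat.one_le_iff_ne_zero.mpr fun h => hi (Fin.ext h)
  refine tendsto_atTop_mono (fun ω => ?_) hL
  nlinarith [h.slope_nonneg ω hi, h.nonneg ω]

theorem tendsto_slope_of_gap (h : Regime l n n₀ A t L) {i₁ : Fin (n + 1)} (hi₁ : (i₁ : ℕ) = 1)
    (hgap : Tendsto (fun ω => A ω (Fin.last n) - A ω i₁) l atTop)
    {i : Fin (n + 1)} (hi : i ≠ 0) (hil : i ≠ Fin.last n) :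
    Tendsto (fun ω => i * L ω + slope (A ω) (t ω) i) l atTop := by
  have hn : (0 : ℝ) < n := by exact_mod_cast h.one_le.trans h.le
  refine tendsto_atTop_mono (fun ω => ?_) (hgap.atTop_div_const hn)
  have := (h.mul_slope_ge ω hi).2 i₁ hi₁ hil
  rw [div_le_iff₀ hn]
  have := h.nonneg ω
  have : 0 ≤ (i : ℝ) * L ω := by positivity
  nlinarith

end Regime

section

variable {Ω : Type*} {l : Filter Ω}

/-- A product of positive powers of functions bounded away from `0` is bounded away from `0`,
and tends to infinity with any of the functions. -/
theorem exists_pos_le_prod_rpow {s : Finset ℝ} {f : ℝ → Ω → ℝ} {c : ℝ → ℝ}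
    (h : ∀ y ∈ s, (∀ ω, f y ω = 1) ∨ (0 < c y ∧ ∃ ε > 0, ∀ᶠ ω in l, ε ≤ f y ω)) :
    ∃ ε > 0, ∀ᶠ ω in l, ε ≤ ∏ y ∈ s, f y ω ^ c y := by
  have h1 : ∀ y, ∃ ε > 0, y ∈ s → ∀ᶠ ω in l, ε ≤ f y ω ^ c y := by
    intro y
    by_cases hy : y ∈ s
    · rcases h y hy with h1 | ⟨hc, ε, hε, h1⟩
      · exact ⟨1, one_pos, fun _ => Eventually.of_forall fun ω => by rw [h1, Real.one_rpow]⟩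
      · exact ⟨ε ^ c y, Real.rpow_pos_of_pos hε _, fun _ => h1.mono fun ω hω =>
          Real.rpow_le_rpow hε.le hω hc.le⟩
    · exact ⟨1, one_pos, fun h => absurd h hy⟩
  choose ε hε h2 using h1
  refine ⟨∏ y ∈ s, ε y, Finset.prod_pos fun y _ => hε y, ?_⟩
  have h3 : ∀ᶠ ω in l, ∀ y ∈ s, ε y ≤ f y ω ^ c y :=
    (Filter.eventually_all_finset s).mpr fun y hy => h2 y hy
  exact h3.mono fun ω hω => Finset.prod_le_prod (fun y _ => (hε y).le) hω

theorem tendsto_prod_rpow {s : Finset ℝ} {f : ℝ → Ω → ℝ} {c : ℝ → ℝ}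
    (h : ∀ y ∈ s, (∀ ω, f y ω = 1) ∨ (0 < c y ∧ ∃ ε > 0, ∀ᶠ ω in l, ε ≤ f y ω)) {y₀ : ℝ}
    (hy₀ : y₀ ∈ s) (hc : 0 < c y₀) (hf : Tendsto (f y₀) l atTop) :
    Tendsto (fun ω => ∏ y ∈ s, f y ω ^ c y) l atTop := by
  obtain ⟨ε, hε, h1⟩ := exists_pos_le_prod_rpow (s := s.erase y₀) (c := c) (l := l)
    fun y hy => h y (Finset.mem_of_mem_erase hy)
  have h2 : Tendsto (fun ω => f y₀ ω ^ c y₀) l atTop := (tendsto_rpow_atTop hc).comp hf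
  refine tendsto_atTop_mono' l ?_ (h2.atTop_mul_const hε)
  filter_upwards [h1, h2.eventually_ge_atTop 0] with ω hω h0
  rw [← Finset.mul_prod_erase s _ hy₀]
  exact mul_le_mul_of_nonneg_left hω h0

end

/-! ### Boundedness of `a_t u(κ_i h^i) w` and the shape of the nearest point. -/

section KempfNessConsequences

variable {Ω : Type*} {l : Filter Ω} {n n₀ D : ℕ} {A : Ω → Fin (n + 1) → ℝ} {t L : Ω → ℝ}
  {κ : Fin (n + 1) → ℝ} {w : (Fin D → Fin (n + 1)) → ℝ} {m : ℝ}

/-- The grading by the sum of the indices. -/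
def idx {n : ℕ} (i : Fin (n + 1)) : ℝ := (i : ℕ)

theorem idx_injective : Function.Injective (idx (n := n)) := fun _ _ h =>
  Fin.ext (Nat.cast_injective (R := ℝ) h)

/-- The coordinates of `a_t u(κ_i h^i) w` for a homogeneous `w`. -/
theorem tpow_scaledMat_apply {A : Fin (n + 1) → ℝ} {c : ℝ} (hw : ∀ I, w I ≠ 0 → wt idx I = m)
    (J : Fin D → Fin (n + 1)) :
    (tpow D (scaledMat A c κ)).mulVec w J =
      Real.exp (wt A J - c * (m - wt idx J)) * (tpow D (1 + rowMat κ)).mulVec w J := by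
  -- The coefficients `κ_i e^{-ic}` arise from `κ_i` by conjugation with `diag(e^{ci})`, and the
  -- inverse of that diagonal matrix acts on the homogeneous `w` by a scalar.
  have hconj : scaledMat A c κ = Matrix.diagonal (fun i => Real.exp (A i)) *
      (Matrix.diagonal (fun i => Real.exp ((c • idx) i)) * (1 + rowMat κ) *
        Matrix.diagonal (fun i => Real.exp ((-c • idx) i))) := by
    rw [scaledMat]
    congr 1
    ext i j
    rw [Matrix.mul_diagonal, Matrix.diagonal_mul]
    by_cases hi : i = 0
    · subst hi
      rw [one_add_rowMat_apply_zero, one_add_rowMat_apply_zero]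
      split_ifs with hj
      · subst hj; simp [idx]
      · simp [idx, mul_comm]
    · rw [one_add_rowMat_apply_of_ne _ hi, one_add_rowMat_apply_of_ne _ hi]
      by_cases hij : i = j
      · subst hij; simp [← Real.exp_add]
      · simp [Matrix.one_apply_ne hij]
  have hw' : (Matrix.diagonal fun I : Fin D → Fin (n + 1) => Real.exp (wt (-c • idx) I)).mulVec w =
      Real.exp (-c * m) • w := by
    funext I
    rw [Matrix.mulVec_diagonal, Pi.smul_apply, smul_eq_mul]
    by_cases h : w I = 0
    · simp [h]
    · rw [wt_smul, hw I h]
  rw [hconj, tpow_mul, tpow_mul, tpow_mul, ← Matrix.mulVec_mulVec, ← Matrix.mulVec_mulVec,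
    ← Matrix.mulVec_mulVec, tpow_diagonal_exp, tpow_diagonal_exp, tpow_diagonal_exp, hw',
    Matrix.mulVec_diagonal, Matrix.mulVec_diagonal, Matrix.mulVec_smul, Pi.smul_apply, smul_eq_mul,
    ← mul_assoc, ← mul_assoc, ← Real.exp_add, ← Real.exp_add, wt_smul]
  congr 2
  ring

theorem tpow_scaledMat_dotProduct_le (hw : ∀ I, w I ≠ 0 → wt idx I = m) {C : ℝ}
    (hC : ∀ J, (tpow D (1 + rowMat κ)).mulVec w J ≠ 0 →
      ∀ᶠ ω in l, Real.exp (wt (A ω) J - (t ω - L ω) * (m - wt idx J)) ≤ C) :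
    ∀ᶠ ω in l, (tpow D (scaledMat (A ω) (t ω - L ω) κ)).mulVec w ⬝ᵥ
      (tpow D (scaledMat (A ω) (t ω - L ω) κ)).mulVec w ≤
      C ^ 2 * ((tpow D (1 + rowMat κ)).mulVec w ⬝ᵥ (tpow D (1 + rowMat κ)).mulVec w) := by
  have h1 : ∀ᶠ ω in l, ∀ J, (tpow D (1 + rowMat κ)).mulVec w J ≠ 0 →
      Real.exp (wt (A ω) J - (t ω - L ω) * (m - wt idx J)) ≤ C := by
    rw [Filter.eventually_all]
    intro J
    by_cases hJ : (tpow D (1 + rowMat κ)).mulVec w J = 0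
    · exact Eventually.of_forall fun ω h => absurd hJ h
    · exact (hC J hJ).mono fun ω h _ => h
  filter_upwards [h1] with ω hω
  rw [dotProduct, dotProduct, Finset.mul_sum]
  refine Finset.sum_le_sum fun J _ => ?_
  rw [tpow_scaledMat_apply hw]
  by_cases hJ : (tpow D (1 + rowMat κ)).mulVec w J = 0
  · simp [hJ]
  · have h2 := hω J hJ
    have h3 := Real.exp_pos (wt (A ω) J - (t ω - L ω) * (m - wt idx J))
    have h4 := pow_le_pow_left₀ h3.le h2 2
    nlinarith [mul_le_mul_of_nonneg_right h4
      (mul_self_nonneg ((tpow D (1 + rowMat κ)).mulVec w J))]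

theorem gramMinor_of_forall {A : Fin (n + 1) → ℝ} {c : ℝ} (hA : ∑ i, A i = 0)
    {p : Fin (n + 1) → Prop} [DecidablePred p] (h : ∀ i, p i) : gramMinor A c κ p = 1 := by
  rw [gramMinor_of_zero_mem hA (h 0)]
  simp [h]

/-- The data produced by the Kempf–Ness bound: `χ` is the point nearest to the origin in the convex
hull of the weights of `w`. -/
structure IsNearest {ι : Type*} [Fintype ι] [DecidableEq ι] {D : ℕ} (w : (Fin D → ι) → ℝ)
    (p : (Fin D → ι) → ℝ) (χ : ι → ℝ) : Prop where
  nonneg : ∀ I, 0 ≤ p I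
  supp : ∀ I, p I ≠ 0 → w I ≠ 0
  sum : ∑ I, p I = 1
  eq : χ = ∑ I, p I • cnt I
  le : ∀ I, w I ≠ 0 → χ ⬝ᵥ χ ≤ cnt I ⬝ᵥ χ

/-- The growth condition bounds the product of powers of minors from above. The minor of the full
index set is `1`, and the other factors have positive exponents and are bounded below, so none of
them can tend to infinity. -/
theorem exists_nearest_of_bounded [l.NeBot] (h : Regime l n n₀ A t L)
    (hκ : ∀ i : Fin (n + 1), i ≠ 0 → (i : ℕ) ≤ n₀ → κ i ≠ 0)
    (hw0 : w ≠ 0) (hw : ∀ I, w I ≠ 0 → wt idx I = m) {C : ℝ}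
    (hC : ∀ J, (tpow D (1 + rowMat κ)).mulVec w J ≠ 0 →
      ∀ᶠ ω in l, wt (A ω) J - (t ω - L ω) * (m - wt idx J) ≤ C) :
    ∃ p χ, IsNearest w p χ ∧ ∀ i j, χ i < χ j →
      ¬ Tendsto (fun ω => gramMinor (A ω) (t ω - L ω) κ fun k => χ j ≤ χ k) l atTop := by
  obtain ⟨p, χ, c, C', h1, h2, h3, h4, h5, h6, hC', h7⟩ :=
    exists_kempf_ness_bound idx_injective hw0 hw
  refine ⟨p, χ, ⟨h1, h2, h3, h4, h5⟩, fun i j hij htop => ?_⟩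
  have hlow : ∀ y ∈ Finset.univ.image χ,
      (∀ ω, gramMinor (A ω) (t ω - L ω) κ (fun k => y ≤ χ k) = 1) ∨ (0 < c y ∧ ∃ ε > 0,
        ∀ᶠ ω in l, ε ≤ gramMinor (A ω) (t ω - L ω) κ fun k => y ≤ χ k) := by
    intro y hy
    by_cases hall : ∀ k, y ≤ χ k
    · exact Or.inl fun ω => gramMinor_of_forall (h.sum ω) hall
    · push Not at hall
      obtain ⟨k, hk⟩ := hall
      obtain ⟨k', -, rfl⟩ := Finset.mem_image.mp hy
      exact Or.inr ⟨h6 k k' hk, h.exists_pos_le_gramMinor hκ⟩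
  have hprod := tendsto_prod_rpow hlow (Finset.mem_image_of_mem χ (Finset.mem_univ j)) (h6 i j hij)
    htop
  have hup := tpow_scaledMat_dotProduct_le (A := A) (t := t) (L := L) (l := l) hw
    (C := Real.exp C) fun J hJ => (hC J hJ).mono fun ω hω => Real.exp_le_exp.mpr hω
  obtain ⟨ω, hω1, hω2⟩ := (((hprod.const_mul_atTop hC').eventually_gt_atTop _).and hup).exists
  exact absurd (h7 _ (det_scaledMat (h.sum ω))) (not_le.mpr (hω2.trans_lt hω1))

/-- This is (A) for homogeneous vectors: under `hC` the norm of `a_t u(κ_i h^i) w` would tend to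
`0`, although the product of minors keeps it away from `0`. -/
theorem not_forall_tendsto_atBot [l.NeBot] (h : Regime l n n₀ A t L)
    (hκ : ∀ i : Fin (n + 1), i ≠ 0 → (i : ℕ) ≤ n₀ → κ i ≠ 0)
    (hw0 : w ≠ 0) (hw : ∀ I, w I ≠ 0 → wt idx I = m)
    (hC : ∀ J, (tpow D (1 + rowMat κ)).mulVec w J ≠ 0 →
      Tendsto (fun ω => wt (A ω) J - (t ω - L ω) * (m - wt idx J)) l atBot) : False := by
  obtain ⟨p, χ, c, C', h1, h2, h3, h4, h5, h6, hC', h7⟩ :=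
    exists_kempf_ness_bound idx_injective hw0 hw
  have hlow : ∀ y ∈ Finset.univ.image χ,
      (∀ ω, gramMinor (A ω) (t ω - L ω) κ (fun k => y ≤ χ k) = 1) ∨ (0 < c y ∧ ∃ ε > 0,
        ∀ᶠ ω in l, ε ≤ gramMinor (A ω) (t ω - L ω) κ fun k => y ≤ χ k) := by
    intro y hy
    by_cases hall : ∀ k, y ≤ χ k
    · exact Or.inl fun ω => gramMinor_of_forall (h.sum ω) hall
    · push Not at hall
      obtain ⟨k, hk⟩ := hall
      obtain ⟨k', -, rfl⟩ := Finset.mem_image.mp hy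
      exact Or.inr ⟨h6 k k' hk, h.exists_pos_le_gramMinor hκ⟩
  obtain ⟨ε, hε, hlow'⟩ := exists_pos_le_prod_rpow hlow
  set z := (tpow D (1 + rowMat κ)).mulVec w ⬝ᵥ (tpow D (1 + rowMat κ)).mulVec w with hz
  have hz0 : 0 ≤ z := Finset.sum_nonneg fun _ _ => mul_self_nonneg _
  obtain ⟨r, hr0, hr⟩ : ∃ r : ℝ, 0 < r ∧ r ^ 2 * z < C' * ε := by
    refine ⟨Real.sqrt (C' * ε / (z + 1)), Real.sqrt_pos.mpr (by positivity), ?_⟩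
    rw [Real.sq_sqrt (by positivity), div_mul_eq_mul_div, div_lt_iff₀ (by positivity)]
    have := mul_pos hC' hε
    nlinarith
  have hup := tpow_scaledMat_dotProduct_le (A := A) (t := t) (L := L) (l := l) hw
    (C := r) fun J hJ => ((Real.tendsto_exp_atBot.comp (hC J hJ)).eventually_le_const hr0)
  obtain ⟨ω, hω1, hω2⟩ := (hlow'.and hup).exists
  have h8 := h7 _ (det_scaledMat (c := t ω - L ω) (κ := κ) (h.sum ω))
  have h9 := mul_le_mul_of_nonneg_left hω1 hC'.le
  exact absurd ((h9.trans h8).trans hω2) (not_le.mpr hr)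

/-- When the scale tends to infinity, or the gap does and `n₀ < n`, the nearest point is constant
on the indices up to `n₀`. -/
theorem nearest_constant (h : Regime l n n₀ A t L)
    (hκ : ∀ i : Fin (n + 1), i ≠ 0 → (i : ℕ) ≤ n₀ → κ i ≠ 0)
    {χ : Fin (n + 1) → ℝ} (hχ : ∀ i j, χ i < χ j →
      ¬ Tendsto (fun ω => gramMinor (A ω) (t ω - L ω) κ fun k => χ j ≤ χ k) l atTop)
    (hgrow : ∀ i : Fin (n + 1), i ≠ 0 → (i : ℕ) ≤ n₀ →
      Tendsto (fun ω => i * L ω + Regime.slope (A ω) (t ω) i) l atTop)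
    {i : Fin (n + 1)} (hi : (i : ℕ) ≤ n₀) : χ i = χ 0 := by
  have key : ∀ i j : Fin (n + 1), (i : ℕ) ≤ n₀ → (j : ℕ) ≤ n₀ → χ j ≤ χ i := by
    intro i j hi hj
    by_contra hlt
    rw [not_le] at hlt
    refine hχ i j hlt ?_
    -- The superlevel set of level `χ j` either contains `0` and misses `i`, or avoids `0` and has
    -- least index at most `n₀`. In both cases its minor tends to infinity.
    by_cases h0 : χ j ≤ χ 0
    · exact h.tendsto_gramMinor_of_zero_mem h0 hi (not_le.mpr hlt)
    · obtain ⟨k, hkj, hk0, hk, hmin⟩ := Regime.exists_min (p := fun k => χ j ≤ χ k) h0 (le_refl (χ j))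
      have hkn : (k : ℕ) ≤ n₀ := (Fin.le_def.mp hkj).trans hj
      exact h.tendsto_gramMinor_of_zero_notMem h0 hk hmin (hκ k hk0 hkn) (hgrow k hk0 hkn)
  exact le_antisymm (key 0 i (by simp) hi) (key i 0 hi (by simp))

/-- When the gap tends to infinity and `n₀ = n`, the nearest point is constant except possibly for
a larger last coordinate. -/
theorem nearest_constant_of_eq (h : Regime l n n A t L)
    (hκ : ∀ i : Fin (n + 1), i ≠ 0 → κ i ≠ 0)
    {χ : Fin (n + 1) → ℝ} (hχ : ∀ i j, χ i < χ j →
      ¬ Tendsto (fun ω => gramMinor (A ω) (t ω - L ω) κ fun k => χ j ≤ χ k) l atTop)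
    (hgrow : ∀ i : Fin (n + 1), i ≠ 0 → i ≠ Fin.last n →
      Tendsto (fun ω => i * L ω + Regime.slope (A ω) (t ω) i) l atTop) :
    (∀ i, i ≠ Fin.last n → χ i = χ 0) ∧ χ 0 ≤ χ (Fin.last n) := by
  have hn : 1 ≤ n := h.one_le
  have key : ∀ i j : Fin (n + 1), χ i < χ j → j = Fin.last n := by
    intro i j hlt
    by_contra hj
    refine hχ i j hlt ?_
    by_cases h0 : χ j ≤ χ 0
    · exact h.tendsto_gramMinor_of_zero_mem h0 (Nat.lt_succ_iff.mp i.2) (not_le.mpr hlt)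
    · obtain ⟨k, hkj, hk0, hk, hmin⟩ := Regime.exists_min (p := fun k => χ j ≤ χ k) h0 (le_refl (χ j))
      have hkl : k ≠ Fin.last n := fun hkl => hj (Fin.last_le_iff.mp (hkl ▸ hkj))
      exact h.tendsto_gramMinor_of_zero_notMem h0 hk hmin (hκ k hk0) (hgrow k hk0 hkl)
  have h0l : (0 : Fin (n + 1)) ≠ Fin.last n := by
    intro h
    have := congrArg Fin.val h
    simp at this
    omega
  refine ⟨fun i hi => le_antisymm ?_ ?_, ?_⟩
  · by_contra hlt; exact hi (key _ _ (not_le.mp hlt))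
  · by_contra hlt; exact h0l (key _ _ (not_le.mp hlt))
  · by_contra hlt; exact h0l (key _ _ (not_le.mp hlt))

end KempfNessConsequences

end ShrinkingCurves

namespace ShrinkingCurves

/-! ### Root vectors annihilating the weights that span the nearest point. -/

section Killing

variable {n D : ℕ}

theorem tder_rowMat_mulVec (κ : Fin (n + 1) → ℝ) (v : (Fin D → Fin (n + 1)) → ℝ) :
    (tder D (rowMat κ)).mulVec v =
      ∑ j, (if j = 0 then 0 else κ j) • (tder D (Matrix.single 0 j 1)).mulVec v := by
  rw [rowMat_eq_sum, tder_sum, Matrix.sum_mulVec]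
  simp only [tder_smul, Matrix.smul_mulVec]

theorem tder_rowMat_transpose_mulVec (κ : Fin (n + 1) → ℝ) (v : (Fin D → Fin (n + 1)) → ℝ) :
    (tder D (rowMat κ).transpose).mulVec v =
      ∑ j, (if j = 0 then 0 else κ j) • (tder D (Matrix.single j 0 1)).mulVec v := by
  rw [rowMat_eq_sum, Matrix.transpose_sum, tder_sum, Matrix.sum_mulVec]
  simp only [Matrix.transpose_smul, Matrix.transpose_single, tder_smul, Matrix.smul_mulVec]

theorem rowMat_transpose_mul_self (κ : Fin (n + 1) → ℝ) :
    (rowMat κ).transpose * (rowMat κ).transpose = 0 := by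
  rw [← Matrix.transpose_mul, rowMat_mul_rowMat, Matrix.transpose_zero]

theorem tpow_one_add_rowMat_eq_self {κ : Fin (n + 1) → ℝ} {v : (Fin D → Fin (n + 1)) → ℝ}
    (h : ∀ j, j ≠ 0 → κ j ≠ 0 → (tder D (Matrix.single 0 j 1)).mulVec v = 0) :
    (tpow D (1 + rowMat κ)).mulVec v = v := by
  refine tpow_one_add_mulVec_eq_self (rowMat_mul_rowMat κ κ) ?_
  rw [tder_rowMat_mulVec]
  refine Finset.sum_eq_zero fun j _ => ?_
  by_cases hj : j = 0
  · simp [hj]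
  · by_cases hκ : κ j = 0
    · simp [hκ]
    · rw [h j hj hκ, smul_zero]

theorem tder_rowMat_transpose_eq_zero {κ : Fin (n + 1) → ℝ} {v : (Fin D → Fin (n + 1)) → ℝ}
    (h : ∀ j, j ≠ 0 → κ j ≠ 0 → (tder D (Matrix.single j 0 1)).mulVec v = 0) :
    (tder D (rowMat κ).transpose).mulVec v = 0 := by
  rw [tder_rowMat_transpose_mulVec]
  refine Finset.sum_eq_zero fun j _ => ?_
  by_cases hj : j = 0
  · simp [hj]
  · by_cases hκ : κ j = 0
    · simp [hκ]
    · rw [h j hj hκ, smul_zero]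

theorem idx_zero : idx (0 : Fin (n + 1)) = 0 := by simp [idx]

theorem idx_pos {i : Fin (n + 1)} (hi : i ≠ 0) : 1 ≤ idx i := by
  have := Nat.one_le_iff_ne_zero.mpr fun h => hi (Fin.ext h)
  unfold idx
  exact_mod_cast this

theorem idx_nonneg (i : Fin (n + 1)) : 0 ≤ idx i := Nat.cast_nonneg _

theorem idx_lt {i j : Fin (n + 1)} (h : i < j) : idx i < idx j := by
  unfold idx
  exact_mod_cast h

theorem idx_le {i j : Fin (n + 1)} (h : i ≤ j) : idx i ≤ idx j := by
  unfold idx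
  exact_mod_cast h

/-- The component of `u(κ) w` in the top degree of a homogeneous vector `w` is `w`. -/
theorem tpow_one_add_rowMat_apply_top {κ : Fin (n + 1) → ℝ} {w : (Fin D → Fin (n + 1)) → ℝ}
    {m : ℝ} (hw : ∀ I, w I ≠ 0 → wt idx I = m) {J : Fin D → Fin (n + 1)} (hJ : wt idx J = m) :
    (tpow D (1 + rowMat κ)).mulVec w J = w J := by
  have hs : ∀ I, (Pi.single J 1 : (Fin D → Fin (n + 1)) → ℝ) I ≠ 0 → I = J := fun I hI => by
    by_contra h; exact hI (by simp [h])
  have hneg : ∀ I : Fin D → Fin (n + 1), wt (-idx) I = -wt idx I := fun I => by simp [wt]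
  have h1 := dotProduct_tpow_one_add (rowMat_mul_rowMat κ κ) (f := -idx) (a := 1) (ν := -m)
    (q := Pi.single J 1) (y := w) zero_le_one (fun i j hij => by
      obtain ⟨rfl, hj, -⟩ := rowMat_ne_zero hij
      have := idx_pos hj
      simp only [Pi.neg_apply, idx_zero]; linarith)
    (fun I hI => by rw [hneg, hw I hI]) (fun I hI => by
      rw [hs I hI, hneg, hJ]; linarith)
  have h2 : (tder D (rowMat κ)).mulVec w J = 0 := by
    by_contra h
    obtain ⟨I, h3, h4⟩ := exists_of_mulVec_ne_zero h
    obtain ⟨i, j, hij, h5⟩ := wt_of_tder_ne_zero h3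
    obtain ⟨rfl, hj, -⟩ := rowMat_ne_zero hij
    have h6 := h5 idx
    have := idx_pos hj
    rw [hJ, hw I h4, idx_zero] at h6
    linarith
  simpa [h2] using h1

/-- Moving a lower triangular unipotent past `tder E₀ᵢ`. -/
theorem tpow_transpose_tder_single {κ : Fin (n + 1) → ℝ} {i : Fin (n + 1)} (hi : i ≠ 0)
    (hκi : κ i = 0) {v : (Fin D → Fin (n + 1)) → ℝ}
    (h : ∀ j, j ≠ 0 → κ j ≠ 0 → (tder D (Matrix.single j 0 1)).mulVec v = 0) :
    (tpow D (1 + rowMat κ).transpose).mulVec ((tder D (Matrix.single 0 i 1)).mulVec v) =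
      (tder D (Matrix.single 0 i 1)).mulVec v +
        (tder D ((rowMat κ).transpose * Matrix.single 0 i 1)).mulVec v := by
  have h0 : (1 + rowMat κ).transpose = 1 + (rowMat κ).transpose := by
    rw [Matrix.transpose_add, Matrix.transpose_one]
  have h1 : Matrix.single 0 i 1 * (rowMat κ).transpose = 0 := by
    ext a b
    rw [Matrix.mul_apply, Matrix.zero_apply]
    refine Finset.sum_eq_zero fun k _ => ?_
    by_cases hk : k = i
    · subst hk
      have : (rowMat κ).transpose k b = 0 := by
        by_contra hne
        exact (rowMat_ne_zero hne).2.2 hκi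
      rw [this, mul_zero]
    · rw [Matrix.single_apply_of_ne _ _ _ _ _ (fun h => hk h.2.symm), zero_mul]
  -- Since `κ i = 0`, the product `E_{0i} (rowMat κ)ᵀ` vanishes, so only the commutator on the other
  -- side remains.
  have h2 : (1 + (rowMat κ).transpose) * Matrix.single 0 i 1 =
      (Matrix.single 0 i 1 + (rowMat κ).transpose * Matrix.single 0 i 1) *
        (1 + (rowMat κ).transpose) := by
    simp only [add_mul, mul_add, one_mul, mul_one, mul_assoc, h1, mul_zero, add_zero]
  rw [h0, Matrix.mulVec_mulVec, tpow_mul_tder h2, ← Matrix.mulVec_mulVec,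
    tpow_one_add_mulVec_eq_self (rowMat_transpose_mul_self κ) (tder_rowMat_transpose_eq_zero h),
    tder_add, Matrix.add_mulVec]

theorem rowMat_transpose_mul_single_ne_zero {κ : Fin (n + 1) → ℝ} {i a b : Fin (n + 1)}
    (h : ((rowMat κ).transpose * Matrix.single 0 i 1 : Matrix _ _ ℝ) a b ≠ 0) : b = i ∧ a ≠ 0 ∧ κ a ≠ 0 := by
  rw [Matrix.mul_apply] at h
  obtain ⟨k, -, hk⟩ := Finset.exists_ne_zero_of_sum_ne_zero h
  have h1 := rowMat_ne_zero (left_ne_zero_of_mul hk)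
  refine ⟨?_, h1.2.1, h1.2.2⟩
  by_contra hb
  exact right_ne_zero_of_mul hk (Matrix.single_apply_of_ne _ _ _ _ _ fun h => hb h.2.symm)

theorem dotProduct_self_nonneg' {m : Type*} [Fintype m] (v : m → ℝ) : 0 ≤ v ⬝ᵥ v :=
  Finset.sum_nonneg fun _ _ => mul_self_nonneg _

theorem dotProduct_self_pos' {m : Type*} [Fintype m] {v : m → ℝ} (h : v ≠ 0) : 0 < v ⬝ᵥ v :=
  lt_of_le_of_ne (dotProduct_self_nonneg' v) fun h0 => h (dotProduct_self_eq_zero.mp h0.symm)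

theorem wpart_cnt_ne_zero {w : (Fin D → Fin (n + 1)) → ℝ} {I : Fin D → Fin (n + 1)} (h : w I ≠ 0) :
    wpart (cnt I) w ≠ 0 := fun h0 => h (by
  have := congrFun h0 I
  rwa [wpart, Set.indicator_of_mem (by exact rfl)] at this)

/-- The pairing of `tder E_ab w_χ` with a vector satisfying the growth condition vanishes. -/
theorem tder_single_wpart_dotProduct_eq_zero {Ω : Type*} {l : Filter Ω} [l.NeBot]
    {B : Ω → Fin (n + 1) → ℝ} {c : Ω → ℝ} {m C C' : ℝ} {χ : Fin (n + 1) → ℝ}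
    {w z : (Fin D → Fin (n + 1)) → ℝ} (hχm : ∑ k, χ k * idx k = m)
    (hz : ∀ J, z J ≠ 0 → ∀ᶠ ω in l, wt (B ω) J - c ω * (m - wt idx J) ≤ C)
    (hB : ∀ᶠ ω in l, C' ≤ ∑ k, χ k * B ω k) {a b : Fin (n + 1)}
    (hgrow : Tendsto (fun ω => B ω a - B ω b - c ω * (idx b - idx a)) l atTop) :
    (tder D (Matrix.single a b 1)).mulVec (wpart χ w) ⬝ᵥ z = 0 := by
  refine dotProduct_eq_zero_of_disjoint fun J h1 h2 => ?_
  have h3 := wt_of_tder_single_wpart_ne_zero h1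
  -- At a common coordinate `J` the exponent is `∑ χ B` plus the growth rate of `E_ab`; the first is
  -- bounded below and the second unbounded, against the upper bound `C`.
  obtain ⟨ω, ⟨h4, h5⟩, h6⟩ := ((hB.and (hz J h2)).and (hgrow.eventually_gt_atTop (C - C'))).exists
  rw [h3, h3, hχm] at h5
  have : c ω * (m - (m + idx a - idx b)) = c ω * (idx b - idx a) := by ring
  rw [this] at h5
  linarith

/-- Weights of a vector satisfying the growth condition, in the minimal face, are killed. -/
theorem killed_of_nearest {Ω : Type*} {l : Filter Ω} [l.NeBot] {k : ℕ}
    {B : Ω → Fin (n + 1) → ℝ} {c : Ω → ℝ} {m C C' : ℝ} {κ χ : Fin (n + 1) → ℝ}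
    {w p : (Fin D → Fin (n + 1)) → ℝ} (hp : IsNearest w p χ)
    (hw : ∀ I, w I ≠ 0 → wt idx I = m)
    (hκ : ∀ i : Fin (n + 1), i ≠ 0 → (i : ℕ) ≤ k → κ i ≠ 0)
    (hz : ∀ J, (tpow D (1 + rowMat κ)).mulVec w J ≠ 0 →
      ∀ᶠ ω in l, wt (B ω) J - c ω * (m - wt idx J) ≤ C)
    (hχ : ∀ i : Fin (n + 1), (i : ℕ) ≤ k → χ i = χ 0)
    (hBχ : ∀ᶠ ω in l, C' ≤ ∑ i, χ i * B ω i)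
    (hgrow : ∀ i : Fin (n + 1), i ≠ 0 → (i : ℕ) ≤ k →
      Tendsto (fun ω => B ω 0 - B ω i - c ω * idx i) l atTop) :
    ∀ i : Fin (n + 1), i ≠ 0 → (i : ℕ) ≤ k → ∀ I, p I ≠ 0 →
      (tder D (Matrix.single 0 i 1)).mulVec (wpart (cnt I) w) = 0 ∧
      (tder D (Matrix.single i 0 1)).mulVec (wpart (cnt I) w) = 0 := by
  -- Every weight used by `p` has its exponent bounded above, because `u(κ) w` agrees with `w` in
  -- the top degree. Their `p`-average is bounded below by `hBχ`, so each exponent is bounded below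
  -- as well.
  have hlow : ∀ I, p I ≠ 0 → ∃ C'', ∀ᶠ ω in l, C'' ≤ ∑ k, cnt I k * B ω k := by
    intro I₀ hI₀
    have hup : ∀ᶠ ω in l, ∀ I, p I ≠ 0 → wt (B ω) I ≤ C := by
      rw [Filter.eventually_all]
      intro I
      by_cases hI : p I = 0
      · exact Eventually.of_forall fun ω h => absurd hI h
      · have hwI := hp.supp I hI
        refine (hz I ?_).mono fun ω hω _ => ?_
        · rwa [tpow_one_add_rowMat_apply_top hw (hw I hwI)]
        · rwa [hw I hwI, sub_self, mul_zero, sub_zero] at hω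
    refine ⟨(C' - |C|) / p I₀, ?_⟩
    filter_upwards [hup, hBχ] with ω h1 h2
    have hpos : 0 < p I₀ := lt_of_le_of_ne (hp.nonneg I₀) (Ne.symm hI₀)
    have h3 : ∑ i, χ i * B ω i = ∑ I, p I * wt (B ω) I := by
      rw [hp.eq]
      simp only [Finset.sum_apply, Pi.smul_apply, smul_eq_mul, Finset.sum_mul, wt_eq_sum_cnt (B ω),
        Finset.mul_sum, mul_assoc]
      exact Finset.sum_comm
    rw [h3, ← Finset.add_sum_erase _ _ (Finset.mem_univ I₀)] at h2
    have h4 : ∑ I ∈ Finset.univ.erase I₀, p I * wt (B ω) I ≤ |C| := by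
      calc _ ≤ ∑ I ∈ Finset.univ.erase I₀, p I * |C| := by
            refine Finset.sum_le_sum fun I _ => ?_
            by_cases hI : p I = 0
            · simp [hI]
            · exact mul_le_mul_of_nonneg_left ((h1 I hI).trans (le_abs_self C)) (hp.nonneg I)
        _ ≤ ∑ I, p I * |C| := Finset.sum_le_sum_of_subset_of_nonneg (Finset.erase_subset _ _)
            fun I _ _ => mul_nonneg (hp.nonneg I) (abs_nonneg C)
        _ = |C| := by rw [← Finset.sum_mul, hp.sum, one_mul]
    rw [div_le_iff₀ hpos, ← wt_eq_sum_cnt]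
    linarith
  intro i
  -- Induction on `i`: the vanishing of `E_{a0}` for `a < i` is needed to remove the terms of `u(κ)`
  -- of index below `i`.
  induction i using WellFoundedLT.induction with
  | ind i ih =>
  intro hi hik
  have hihj : ∀ j, j < i → j ≠ 0 → ∀ I, p I ≠ 0 →
      (tder D (Matrix.single j 0 1)).mulVec (wpart (cnt I) w) = 0 := fun j hj hj0 I hI =>
    (ih j hj hj0 ((Fin.le_def.mp hj.le).trans hik) I hI).2
  have first : ∀ I, p I ≠ 0 → (tder D (Matrix.single 0 i 1)).mulVec (wpart (cnt I) w) = 0 := by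
    intro I hI
    have hwI := hp.supp I hI
    have hχm : ∑ k, cnt I k * idx k = m := by rw [← wt_eq_sum_cnt, hw I hwI]
    obtain ⟨C'', hC''⟩ := hlow I hI
    set q := (tder D (Matrix.single 0 i 1)).mulVec (wpart (cnt I) w) with hq
    -- The same pairing is computed a second time in `h5` as `κ i * (q ⬝ᵥ q)`; comparing the two
    -- gives `q = 0`.
    have h1 : q ⬝ᵥ (tpow D (1 + rowMat κ)).mulVec w = 0 :=
      tder_single_wpart_dotProduct_eq_zero hχm hz hC'' (by
        simpa [idx_zero] using hgrow i hi hik)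
    set κ' : Fin (n + 1) → ℝ := fun j => if j < i then κ j else 0 with hκ'
    set κ'' : Fin (n + 1) → ℝ := fun j => if j < i then 0 else κ j with hκ''
    have hsum : κ = κ' + κ'' := by
      funext j
      simp only [hκ', hκ'', Pi.add_apply]
      split_ifs <;> simp
    have hκ'lt : ∀ j, κ' j ≠ 0 → j < i := fun j hj => by
      by_contra h; exact hj (if_neg h)
    have hκ''le : ∀ j, κ'' j ≠ 0 → i ≤ j := fun j hj => by
      by_contra h; exact hj (if_pos (not_le.mp h))
    set Z := (tder D ((rowMat κ').transpose * Matrix.single 0 i 1)).mulVec (wpart (cnt I) w) with hZ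
    -- The terms of index below `i` are moved to the other side of the pairing. The induction
    -- hypothesis leaves only the commutators `E_{ai}` of `E_{a0}` with `E_{0i}`, collected in `Z`.
    have hbq : (tpow D (1 + rowMat κ').transpose).mulVec q = q + Z :=
      tpow_transpose_tder_single hi (if_neg (lt_irrefl i)) fun j hj hκj =>
        hihj j (hκ'lt j hκj) hj I hI
    have hqs : ∀ J, q J ≠ 0 → wt idx J = m - idx i := fun J hJ => by
      rw [wt_of_tder_single_wpart_ne_zero hJ, hχm, idx_zero, add_zero]
    have hZs : ∀ J, Z J ≠ 0 → ∃ a, a ≠ 0 ∧ a < i ∧ wt idx J = m + idx a - idx i := fun J hJ => by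
      obtain ⟨K, h2, h3⟩ := exists_of_mulVec_ne_zero hJ
      obtain ⟨a, b, hab, h4⟩ := wt_of_tder_ne_zero h2
      obtain ⟨rfl, ha, hκa⟩ := rowMat_transpose_mul_single_ne_zero hab
      exact ⟨a, ha, hκ'lt a hκa, by rw [h4, hw K (wpart_ne_zero h3).2]⟩
    have hbqs : ∀ J, (q + Z) J ≠ 0 → ∃ a, a < i ∧ wt idx J = m + idx a - idx i := fun J hJ => by
      by_cases h : Z J = 0
      · refine ⟨0, Fin.pos_iff_ne_zero.mpr hi, ?_⟩
        rw [Pi.add_apply, h, add_zero] at hJ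
        rw [hqs J hJ, idx_zero]; ring
      · obtain ⟨a, -, h2, h3⟩ := hZs J h
        exact ⟨a, h2, h3⟩
    have hneg : ∀ I : Fin D → Fin (n + 1), wt (-idx) I = -wt idx I := fun I => by simp [wt]
    have hipos := idx_pos hi
    have h2 : (q + Z) ⬝ᵥ (tpow D (1 + rowMat κ'')).mulVec w =
        (q + Z) ⬝ᵥ w + (q + Z) ⬝ᵥ (tder D (rowMat κ'')).mulVec w := by
      refine dotProduct_tpow_one_add (rowMat_mul_rowMat _ _) (f := -idx) (a := idx i) (ν := -m)
        (idx_nonneg i) (fun a b hab => ?_) (fun J hJ => by rw [hneg, hw J hJ]) fun J hJ => ?_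
      · obtain ⟨rfl, hb, hκb⟩ := rowMat_ne_zero hab
        have := idx_le (hκ''le b hκb)
        simp only [Pi.neg_apply, idx_zero]; linarith
      · obtain ⟨a, -, ha⟩ := hbqs J hJ
        have := idx_nonneg a
        rw [hneg, ha]; linarith
    have h3 : (q + Z) ⬝ᵥ w = 0 := by
      refine dotProduct_eq_zero_of_disjoint fun J hJ hwJ => ?_
      obtain ⟨a, ha, ha'⟩ := hbqs J hJ
      have := idx_lt ha
      rw [hw J hwJ] at ha'; linarith
    -- Degrees separate the terms: `q` and `E_{0i} w` lie in degree `m - i`, the vector `Z` in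
    -- strictly higher degrees, and `E_{0j} w` with `j > i` in strictly lower ones.
    have h4 : (q + Z) ⬝ᵥ (tder D (rowMat κ'')).mulVec w = κ i * (q ⬝ᵥ q) := by
      have hE : ∀ j J, (tder D (Matrix.single 0 j 1)).mulVec w J ≠ 0 → wt idx J = m - idx j := by
        intro j J hJ
        obtain ⟨K, h5, h6⟩ := exists_of_mulVec_ne_zero hJ
        rw [cnt_of_tder_single_ne_zero h5, hw K h6, idx_zero, add_zero]
      rw [tder_rowMat_mulVec, dotProduct_sum, Finset.sum_eq_single i]
      · rw [if_neg hi, dotProduct_smul, add_dotProduct, dotProduct_tder_single_wpart]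
        have : Z ⬝ᵥ (tder D (Matrix.single 0 i 1)).mulVec w = 0 := by
          refine dotProduct_eq_zero_of_disjoint fun J hJ hJ' => ?_
          obtain ⟨a, ha0, -, ha⟩ := hZs J hJ
          have := idx_pos ha0
          rw [hE i J hJ'] at ha; linarith
        have hκi : κ'' i = κ i := if_neg (lt_irrefl i)
        rw [this, add_zero, smul_eq_mul, hκi]
      · intro j _ hji
        by_cases hj : j = 0
        · rw [if_pos hj, zero_smul, dotProduct_zero]
        by_cases hκj : κ'' j = 0
        · rw [hκj, ite_self, zero_smul, dotProduct_zero]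
        · rw [dotProduct_smul]
          have : (q + Z) ⬝ᵥ (tder D (Matrix.single 0 j 1)).mulVec w = 0 := by
            refine dotProduct_eq_zero_of_disjoint fun J hJ hJ' => ?_
            obtain ⟨a, -, ha⟩ := hbqs J hJ
            have h5 := idx_lt (lt_of_le_of_ne (hκ''le j hκj) (Ne.symm hji))
            have := idx_nonneg a
            rw [hE j J hJ'] at ha; linarith
          rw [this, smul_zero]
      · simp
    have h5 : q ⬝ᵥ (tpow D (1 + rowMat κ)).mulVec w = κ i * (q ⬝ᵥ q) := by
      have h6 : q ⬝ᵥ (tpow D (1 + rowMat κ)).mulVec w =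
          (tpow D (1 + rowMat κ').transpose).mulVec q ⬝ᵥ (tpow D (1 + rowMat κ'')).mulVec w := by
        rw [tpow_dotProduct, Matrix.transpose_transpose, Matrix.mulVec_mulVec, ← tpow_mul,
          one_add_rowMat_mul, ← hsum]
      rw [h6, hbq, h2, h3, h4, zero_add]
    rw [h1] at h5
    exact dotProduct_self_eq_zero.mp ((mul_eq_zero.mp h5.symm).resolve_left (hκ i hi hik))
  intro I hI
  refine ⟨first I hI, ?_⟩
  have hself : ∀ I, p I ≠ 0 →
      (tder D (Matrix.single i 0 1)).mulVec (wpart (cnt I) w) ⬝ᵥ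
        (tder D (Matrix.single i 0 1)).mulVec (wpart (cnt I) w) =
        (cnt I 0 - cnt I i) * (wpart (cnt I) w ⬝ᵥ wpart (cnt I) w) := by
    intro I hI
    rw [tder_single_dotProduct_self (fun J hJ => (wpart_ne_zero hJ).1) hi, first I hI]
    simp
  have hge : ∀ I, 0 ≤ p I * (cnt I 0 - cnt I i) := by
    intro I
    by_cases hI : p I = 0
    · simp [hI]
    · refine mul_nonneg (hp.nonneg I) ?_
      refine nonneg_of_mul_nonneg_left (?_ : 0 ≤ _ * (wpart (cnt I) w ⬝ᵥ wpart (cnt I) w))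
        (dotProduct_self_pos' (wpart_cnt_ne_zero (hp.supp I hI)))
      rw [← hself I hI]
      exact dotProduct_self_nonneg' _
  -- By the `sl₂` relation every summand is nonnegative, and the sum is `χ 0 - χ i = 0`. So every
  -- summand vanishes, and with it `E_{i0}` on each of these weights.
  have hsum0 : ∑ I, p I * (cnt I 0 - cnt I i) = 0 := by
    have h1 : ∀ j, χ j = ∑ I, p I * cnt I j := fun j => by
      rw [hp.eq]; simp
    simp only [mul_sub, Finset.sum_sub_distrib, ← h1]
    rw [hχ i hik, sub_self]
  have hz0 := (Finset.sum_eq_zero_iff_of_nonneg fun I _ => hge I).mp hsum0 I (Finset.mem_univ I)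
  have h1 := hself I hI
  rw [(mul_eq_zero.mp hz0).resolve_left hI, zero_mul] at h1
  exact dotProduct_self_eq_zero.mp h1

end Killing

end ShrinkingCurves

namespace ShrinkingCurves

/-! ### All low weights are annihilated: the block up to `n₀`, then the columns beyond it. -/

section Stages

variable {n n₀ D : ℕ} {Ω : Type*} {l : Filter Ω} {A : Ω → Fin (n + 1) → ℝ} {t L : Ω → ℝ}

/-- As `∑ A = 0`, the constant `χ 0` can be subtracted from `χ`; what is left lives on indices
beyond `n₀`, where `A` tends to `0`. -/
theorem Regime.tendsto_dot (h : Regime l n n₀ A t L) {χ : Fin (n + 1) → ℝ}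
    (hχ : ∀ i : Fin (n + 1), (i : ℕ) ≤ n₀ → χ i = χ 0) :
    Tendsto (fun ω => ∑ i, χ i * A ω i) l (𝓝 0) := by
  have h1 : ∀ ω, ∑ i, χ i * A ω i = ∑ i, (χ i - χ 0) * A ω i := fun ω => by
    simp only [sub_mul, Finset.sum_sub_distrib, ← Finset.mul_sum, h.sum ω, mul_zero, sub_zero]
  simp only [h1]
  have : Tendsto (fun ω => ∑ i, (χ i - χ 0) * A ω i) l (𝓝 (∑ i : Fin (n + 1), (0 : ℝ))) := by
    refine tendsto_finsetSum _ fun i _ => ?_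
    by_cases hi : (i : ℕ) ≤ n₀
    · simp only [hχ i hi, sub_self, zero_mul]
      exact tendsto_const_nhds
    · have := (h.null i (not_le.mp hi)).const_mul (χ i - χ 0)
      rwa [mul_zero] at this
  simpa using this

theorem Regime.eventually_le_dot (h : Regime l n n₀ A t L) {χ : Fin (n + 1) → ℝ}
    (hχ : ∀ i : Fin (n + 1), (i : ℕ) ≤ n₀ → χ i = χ 0) :
    ∀ᶠ ω in l, -1 ≤ ∑ i, χ i * A ω i :=
  ((h.tendsto_dot hχ).eventually_const_lt (by norm_num : (-1 : ℝ) < 0)).mono fun _ h => h.le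

theorem Regime.tendsto_sub_of_le (h : Regime l n n₀ A t L) {i : Fin (n + 1)} (hi : i ≠ 0)
    (hin : (i : ℕ) ≤ n₀) :
    Tendsto (fun ω => A ω 0 - A ω i - (t ω - L ω) * idx i) l atTop := by
  refine tendsto_atTop_mono' l ?_ (tendsto_neg_atBot_atTop.comp (h.bot i hi hin))
  filter_upwards [h.top.eventually_ge_atTop 0] with ω ht
  have h1 : idx i ≤ n := by
    unfold idx; exact_mod_cast hin.trans h.le
  have h2 := mul_nonneg ht (sub_nonneg.mpr h1)
  have h3 := mul_nonneg (h.nonneg ω) (idx_nonneg i)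
  rw [h.zero ω]
  simp only [Function.comp]
  nlinarith

/-- The weight `χ` of `w` is annihilated by the root vectors of the block of indices up to `n₀`. -/
def BlockKilled (k : ℕ) (χ : Fin (n + 1) → ℝ) (w : (Fin D → Fin (n + 1)) → ℝ) : Prop :=
  ∀ i : Fin (n + 1), i ≠ 0 → (i : ℕ) ≤ k →
    (tder D (Matrix.single 0 i 1)).mulVec (wpart χ w) = 0 ∧
      (tder D (Matrix.single i 0 1)).mulVec (wpart χ w) = 0

/-- In the `sl₂` relation both squared norms vanish, so the difference of the counts does too. -/
theorem BlockKilled.eq {k : ℕ} {w : (Fin D → Fin (n + 1)) → ℝ} {I : Fin D → Fin (n + 1)}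
    (h : BlockKilled k (cnt I) w) (hI : w I ≠ 0) {i : Fin (n + 1)} (hi : (i : ℕ) ≤ k) :
    cnt I i = cnt I 0 := by
  by_cases hi0 : i = 0
  · rw [hi0]
  have h1 := tder_single_dotProduct_self (χ := cnt I) (v := wpart (cnt I) w)
    (fun J hJ => (wpart_ne_zero hJ).1) hi0
  rw [(h i hi0 hi).1, (h i hi0 hi).2, zero_dotProduct, zero_add] at h1
  have h2 := (mul_eq_zero.mp h1.symm).resolve_right (dotProduct_self_pos' (wpart_cnt_ne_zero hI)).ne'
  linarith

theorem tder_mulVec_eq_zero_of_wpart {X : Matrix (Fin (n + 1)) (Fin (n + 1)) ℝ}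
    {w : (Fin D → Fin (n + 1)) → ℝ}
    (h : ∀ I, w I ≠ 0 → (tder D X).mulVec (wpart (cnt I) w) = 0) : (tder D X).mulVec w = 0 := by
  classical
  have hw : w = ∑ χ ∈ Finset.univ.image (fun I : Fin D → Fin (n + 1) => cnt I), wpart χ w := by
    funext I
    rw [Finset.sum_apply, Finset.sum_eq_single (cnt I)]
    · rw [wpart, Set.indicator_of_mem (by exact rfl)]
    · intro χ _ hχ
      rw [wpart, Set.indicator_of_notMem]
      exact fun h => hχ h.symm
    · intro h
      exact absurd (Finset.mem_image_of_mem _ (Finset.mem_univ I)) h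
  rw [hw, Matrix.mulVec_sum]
  refine Finset.sum_eq_zero fun χ hχ => ?_
  by_cases h0 : wpart χ w = 0
  · rw [h0, Matrix.mulVec_zero]
  · obtain ⟨I, hI⟩ := Function.ne_iff.mp h0
    obtain ⟨h1, h2⟩ := wpart_ne_zero hI
    rw [← h1]; exact h I h2

/-- All the weights of a homogeneous vector satisfying the growth condition are killed. -/
theorem blockKilled_of_bounded [l.NeBot] (h : Regime l n n₀ A t L) {κ : Fin (n + 1) → ℝ}
    (hκ : ∀ i : Fin (n + 1), i ≠ 0 → (i : ℕ) ≤ n₀ → κ i ≠ 0)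
    (hκ0 : ∀ i : Fin (n + 1), n₀ < (i : ℕ) → κ i = 0)
    (hslope : ∀ i : Fin (n + 1), i ≠ 0 → (i : ℕ) ≤ n₀ →
      Tendsto (fun ω => i * L ω + Regime.slope (A ω) (t ω) i) l atTop)
    {w : (Fin D → Fin (n + 1)) → ℝ} {m C : ℝ} (hw : ∀ I, w I ≠ 0 → wt idx I = m)
    (hz : ∀ J, (tpow D (1 + rowMat κ)).mulVec w J ≠ 0 →
      ∀ᶠ ω in l, wt (A ω) J - (t ω - L ω) * (m - wt idx J) ≤ C) :
    ∀ I, w I ≠ 0 → BlockKilled n₀ (cnt I) w := by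
  -- Split `w` into the part `wf` of weights already annihilated and the rest `w'`. If `w'` were
  -- nonzero, its nearest point would supply a further annihilated weight.
  set K : Set (Fin D → Fin (n + 1)) := {I | BlockKilled n₀ (cnt I) w} with hK
  set w' := Kᶜ.indicator w with hw'
  set wf := K.indicator w with hwf
  have hadd : w = wf + w' := (Set.indicator_self_add_compl K w).symm
  have hw'm : ∀ I, w' I ≠ 0 → wt idx I = m := fun I hI =>
    hw I (Set.indicator_apply_ne_zero.mp hI).2
  by_cases hw'0 : w' = 0
  · intro I hI
    by_contra hk
    have := congrFun hw'0 I
    rw [hw', Set.indicator_of_mem (show I ∈ Kᶜ from hk)] at this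
    exact hI this
  exfalso
  have hwfp : ∀ I, wf I ≠ 0 → wpart (cnt I) wf = wpart (cnt I) w := by
    intro I hI
    have hIK : BlockKilled n₀ (cnt I) w := (Set.indicator_apply_ne_zero.mp hI).1
    funext J
    by_cases hJ : cnt J = cnt I
    · rw [wpart, wpart, Set.indicator_of_mem (by exact hJ), Set.indicator_of_mem (by exact hJ), hwf,
        Set.indicator_of_mem (by rw [hK, Set.mem_ofPred_eq, hJ]; exact hIK)]
    · rw [wpart, wpart, Set.indicator_of_notMem (by exact hJ), Set.indicator_of_notMem (by exact hJ)]
  have hfix : (tpow D (1 + rowMat κ)).mulVec wf = wf := by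
    refine tpow_one_add_rowMat_eq_self fun j hj hκj => tder_mulVec_eq_zero_of_wpart fun I hI => ?_
    rw [hwfp I hI]
    refine ((Set.indicator_apply_ne_zero.mp hI).1 j hj ?_).1
    by_contra hlt
    exact hκj (hκ0 j (not_le.mp hlt))
  -- `w'` inherits the growth condition. `u(κ)` fixes `wf`, which lives in degree `m`; there `u(κ)
  -- w'` equals `w'`, whose support is disjoint from that of `wf`, so no cancellation occurs.
  have hz' : ∀ J, (tpow D (1 + rowMat κ)).mulVec w' J ≠ 0 →
      ∀ᶠ ω in l, wt (A ω) J - (t ω - L ω) * (m - wt idx J) ≤ C := by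
    intro J hJ
    refine hz J ?_
    rw [hadd, Matrix.mulVec_add, hfix, Pi.add_apply]
    by_cases hJf : wf J = 0
    · rwa [hJf, zero_add]
    · exfalso
      obtain ⟨hJK, hwJ⟩ := Set.indicator_apply_ne_zero.mp hJf
      rw [tpow_one_add_rowMat_apply_top hw'm (hw J hwJ), hw',
        Set.indicator_of_notMem (not_not.mpr hJK)] at hJ
      exact hJ rfl
  obtain ⟨p, χ, hp, hχ⟩ := exists_nearest_of_bounded h hκ hw'0 hw'm hz'
  have hχc : ∀ i : Fin (n + 1), (i : ℕ) ≤ n₀ → χ i = χ 0 := fun i hi =>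
    nearest_constant h hκ hχ hslope hi
  have hkill := killed_of_nearest hp hw'm hκ hz' hχc (h.eventually_le_dot hχc)
    fun i hi hin => h.tendsto_sub_of_le hi hin
  obtain ⟨I, hI⟩ : ∃ I, p I ≠ 0 := by
    by_contra! h0
    have := hp.sum
    simp [h0] at this
  obtain ⟨hIK, -⟩ := Set.indicator_apply_ne_zero.mp (hp.supp I hI)
  apply hIK
  have hpart : wpart (cnt I) w' = wpart (cnt I) w := by
    funext J
    by_cases hJ : cnt J = cnt I
    · rw [wpart, wpart, Set.indicator_of_mem (by exact hJ), Set.indicator_of_mem (by exact hJ), hw',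
        Set.indicator_of_mem (by
          rw [hK, Set.mem_compl_iff, Set.mem_ofPred_eq, hJ]; exact hIK)]
    · rw [wpart, wpart, Set.indicator_of_notMem (by exact hJ), Set.indicator_of_notMem (by exact hJ)]
  intro i hi hin
  rw [← hpart]
  exact hkill i hi hin I hI

/-- The number of indices up to `n₀`. -/
def low (n n₀ : ℕ) (i : Fin (n + 1)) : ℝ := if (i : ℕ) ≤ n₀ then 1 else 0

/-- The low part of `u(κ) w` is `u(κ')` applied to the low part of `w`, where `κ'` is the truncation
of `κ`. -/
theorem tpow_one_add_rowMat_apply_low {κ : Fin (n + 1) → ℝ} {w : (Fin D → Fin (n + 1)) → ℝ} {ν : ℝ}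
    (hν : ∀ I, w I ≠ 0 → ν ≤ wt (low n n₀) I) {J : Fin D → Fin (n + 1)}
    (hJ : wt (low n n₀) J = ν) :
    (tpow D (1 + rowMat κ)).mulVec w J =
      (tpow D (1 + rowMat fun i => if (i : ℕ) ≤ n₀ then κ i else 0)).mulVec
        (Set.indicator {I | wt (low n n₀) I = ν} w) J := by
  -- `E_{0j}` with `j > n₀` increases the number of low indices, and the other terms preserve it. So
  -- the lowest degree is reached only from the lowest part of `w` and only through indices up to
  -- `n₀`.
  have hmono : ∀ i j, (1 + rowMat κ) i j ≠ 0 → low n n₀ j ≤ low n n₀ i := by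
    intro i j hij
    by_cases h : i = j
    · rw [h]
    · have : rowMat κ i j ≠ 0 := fun h0 => hij (by simp [h, h0])
      obtain ⟨rfl, -, -⟩ := rowMat_ne_zero this
      simp only [low]
      split_ifs <;> simp_all
  refine Finset.sum_congr rfl fun I _ => ?_
  show tpow D _ J I * _ = tpow D _ J I * _
  by_cases hI0 : w I = 0
  · simp [Set.indicator_apply, hI0]
  by_cases hI : wt (low n n₀) I = ν
  · rw [Set.indicator_of_mem (by exact hI)]
    congr 1
    have hent : ∀ i j : Fin (n + 1), low n n₀ i = low n n₀ j →
        (1 + rowMat κ) i j = (1 + rowMat fun i : Fin (n + 1) => if (i : ℕ) ≤ n₀ then κ i else 0) i j := by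
      intro i j hij
      rw [Matrix.add_apply, Matrix.add_apply]
      congr 1
      simp only [rowMat, Matrix.of_apply]
      by_cases hc : i = 0 ∧ j ≠ 0
      · rw [if_pos hc, if_pos hc, if_pos]
        by_contra hj
        rw [hc.1] at hij
        simp [low, hj] at hij
      · rw [if_neg hc, if_neg hc]
    by_cases hall : ∀ s, low n n₀ (J s) = low n n₀ (I s)
    · rw [tpow_apply, tpow_apply]
      exact Finset.prod_congr rfl fun s _ => hent _ _ (hall s)
    · push Not at hall
      obtain ⟨s, hs⟩ := hall
      have hs' : low n n₀ (I s) < low n n₀ (J s) ∨ low n n₀ (J s) < low n n₀ (I s) :=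
        lt_or_gt_of_ne (Ne.symm hs)
      have e1 : tpow D (1 + rowMat κ) J I = 0 := by
        by_contra hne
        rw [tpow_apply, ← ne_eq, Finset.prod_ne_zero_iff] at hne
        have hle : ∀ s ∈ Finset.univ, low n n₀ (I s) ≤ low n n₀ (J s) := fun s hs => hmono _ _ (hne s hs)
        exact hs ((Finset.sum_eq_sum_iff_of_le hle).mp (hI.trans hJ.symm) s (Finset.mem_univ s)).symm
      have e2 : tpow D (1 + rowMat fun i : Fin (n + 1) => if (i : ℕ) ≤ n₀ then κ i else 0) J I = 0 := by
        refine Finset.prod_eq_zero (Finset.mem_univ s) ?_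
        by_contra hne
        have hIJ : J s ≠ I s := fun h => hs (by rw [h])
        rw [Matrix.add_apply, Matrix.one_apply_ne hIJ, zero_add] at hne
        obtain ⟨h1, -, h2⟩ := rowMat_ne_zero hne
        have : (I s : ℕ) ≤ n₀ := by by_contra hlt; exact h2 (if_neg hlt)
        apply hs
        simp [low, h1, this]
      rw [e1, e2]
  · rw [Set.indicator_of_notMem (by exact hI), mul_zero]
    have : tpow D (1 + rowMat κ) J I = 0 := by
      by_contra hne
      have := wt_le_of_tpow_ne_zero hmono hne
      exact hI (le_antisymm (this.trans hJ.le) (hν I hI0))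
    rw [this, zero_mul]

/-- The low weights are also annihilated by `E₀ⱼ` with `j > n₀`. -/
theorem high_killed [l.NeBot] (h : Regime l n n₀ A t L) {κ : Fin (n + 1) → ℝ}
    (hκ : ∀ i : Fin (n + 1), i ≠ 0 → κ i ≠ 0)
    {w : (Fin D → Fin (n + 1)) → ℝ} {m ν C : ℝ} (hw : ∀ I, w I ≠ 0 → wt idx I = m)
    (hν : ∀ I, w I ≠ 0 → ν ≤ wt (low n n₀) I)
    (hz : ∀ J, (tpow D (1 + rowMat κ)).mulVec w J ≠ 0 →
      ∀ᶠ ω in l, wt (A ω) J - (t ω - L ω) * (m - wt idx J) ≤ C)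
    {wl : (Fin D → Fin (n + 1)) → ℝ} (hwl : wl = Set.indicator {I | wt (low n n₀) I = ν} w)
    (hkill : ∀ I, wl I ≠ 0 → BlockKilled n₀ (cnt I) wl)
    {I : Fin D → Fin (n + 1)} (hI : wl I ≠ 0) {j : Fin (n + 1)} (hj : n₀ < (j : ℕ))
    (hgrow : Tendsto (fun ω => A ω 0 - A ω j - (t ω - L ω) * idx j) l atTop) :
    (tder D (Matrix.single 0 j 1)).mulVec (wpart (cnt I) wl) = 0 := by
  have hj0 : j ≠ 0 := by rintro rfl; simp at hj
  have hwlν : ∀ I, wl I ≠ 0 → wt (low n n₀) I = ν ∧ w I ≠ 0 := fun I hI => by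
    rw [hwl] at hI; exact Set.indicator_apply_ne_zero.mp hI
  have hχm : ∑ k, cnt I k * idx k = m := by rw [← wt_eq_sum_cnt, hw I (hwlν I hI).2]
  have hχν : ∑ k, cnt I k * low n n₀ k = ν := by rw [← wt_eq_sum_cnt, (hwlν I hI).1]
  set q := (tder D (Matrix.single 0 j 1)).mulVec (wpart (cnt I) wl) with hq
  have h1 : q ⬝ᵥ (tpow D (1 + rowMat κ)).mulVec w = 0 :=
    tder_single_wpart_dotProduct_eq_zero hχm hz
      (h.eventually_le_dot fun i hi => (hkill I hI).eq hI hi) (by simpa [idx_zero] using hgrow)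
  set κ' : Fin (n + 1) → ℝ := fun i => if (i : ℕ) ≤ n₀ then κ i else 0 with hκ'
  set κ'' : Fin (n + 1) → ℝ := fun i => if (i : ℕ) ≤ n₀ then 0 else κ i with hκ''
  have hsum : κ'' + κ' = κ := by
    funext i
    simp only [hκ', hκ'', Pi.add_apply]
    split_ifs <;> simp
  have hκ'le : ∀ i, κ' i ≠ 0 → (i : ℕ) ≤ n₀ := fun i hi => by
    by_contra h; exact hi (if_neg h)
  have hκ''lt : ∀ i, κ'' i ≠ 0 → n₀ < (i : ℕ) := fun i hi => by
    by_contra h; exact hi (if_pos (not_lt.mp h))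
  set b : (Fin D → Fin (n + 1)) → ℝ := (tpow D (1 + rowMat κ')).mulVec w with hb
  have hlow0 : low n n₀ 0 = 1 := by simp [low]
  have hlowj : ∀ i : Fin (n + 1), n₀ < (i : ℕ) → low n n₀ i = 0 := fun i hi => if_neg (not_le.mpr hi)
  have hlow1 : ∀ i : Fin (n + 1), (i : ℕ) ≤ n₀ → low n n₀ i = 1 := fun i hi => if_pos hi
  have hbpres : ∀ i k, (1 + rowMat κ') i k ≠ 0 → low n n₀ k = low n n₀ i := by
    intro i k hik
    by_cases he : i = k
    · rw [he]
    · rw [Matrix.add_apply, Matrix.one_apply_ne he, zero_add] at hik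
      obtain ⟨rfl, -, h2⟩ := rowMat_ne_zero hik
      rw [hlow0, hlow1 k (hκ'le k h2)]
  have hqlow : ∀ J, q J ≠ 0 → wt (low n n₀) J = ν + 1 := fun J hJ => by
    rw [wt_of_tder_single_wpart_ne_zero hJ, hχν, hlow0, hlowj j hj]; ring
  have hqidx : ∀ J, q J ≠ 0 → wt idx J = m - idx j := fun J hJ => by
    rw [wt_of_tder_single_wpart_ne_zero hJ, hχm, idx_zero, add_zero]
  -- `q` has exactly one low index more than the minimum `ν`, so `u(κ'')` contributes to at most
  -- first order.
  have h2 : q ⬝ᵥ (tpow D (1 + rowMat κ)).mulVec w = q ⬝ᵥ b + q ⬝ᵥ (tder D (rowMat κ'')).mulVec b := by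
    have : (tpow D (1 + rowMat κ)).mulVec w = (tpow D (1 + rowMat κ'')).mulVec b := by
      rw [hb, Matrix.mulVec_mulVec, ← tpow_mul, one_add_rowMat_mul, hsum]
    rw [this]
    refine dotProduct_tpow_one_add (rowMat_mul_rowMat _ _) (f := low n n₀) (a := 1) (ν := ν)
      zero_le_one (fun i k hik => ?_) (fun J hJ => ?_) fun J hJ => ?_
    · obtain ⟨rfl, -, h3⟩ := rowMat_ne_zero hik
      rw [hlow0, hlowj k (hκ''lt k h3), zero_add]
    · obtain ⟨K, h3, h4⟩ := exists_of_mulVec_ne_zero hJ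
      rw [← wt_eq_of_tpow_ne_zero hbpres h3]; exact hν K h4
    · rw [hqlow J hJ]; linarith
  have h3 : q ⬝ᵥ b = 0 := by
    have : q ⬝ᵥ b = (tpow D (1 + rowMat κ').transpose).mulVec q ⬝ᵥ w := by
      rw [tpow_dotProduct, Matrix.transpose_transpose]
    rw [this, tpow_transpose_tder_single hj0 (if_neg (not_le.mpr hj)) fun i hi hκi =>
      (hkill I hI i hi (hκ'le i hκi)).2]
    refine dotProduct_eq_zero_of_disjoint fun J hJ hwJ => ?_
    have hmJ := hw J hwJ
    by_cases h0 : (tder D ((rowMat κ').transpose * Matrix.single 0 j 1)).mulVec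
        (wpart (cnt I) wl) J = 0
    · rw [Pi.add_apply, h0, add_zero] at hJ
      have := hqidx J hJ
      have := idx_pos hj0
      linarith
    · obtain ⟨K, h4, h5⟩ := exists_of_mulVec_ne_zero h0
      obtain ⟨a, c, hac, h6⟩ := wt_of_tder_ne_zero h4
      obtain ⟨rfl, -, hκa⟩ := rowMat_transpose_mul_single_ne_zero hac
      have h7 := h6 idx
      have h8 : idx a < idx c := idx_lt (Fin.lt_def.mpr (lt_of_le_of_lt (hκ'le a hκa) hj))
      rw [hmJ, hw K (hwlν K (wpart_ne_zero h5).2).2] at h7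
      linarith
  have hbl : (tpow D (1 + rowMat κ')).mulVec wl = wl := by
    refine tpow_one_add_rowMat_eq_self fun i hi hκi => tder_mulVec_eq_zero_of_wpart fun I hI => ?_
    exact (hkill I hI i hi (hκ'le i hκi)).1
  have h4 : q ⬝ᵥ (tder D (rowMat κ'')).mulVec b = q ⬝ᵥ (tder D (rowMat κ'')).mulVec wl := by
    rw [← sub_eq_zero, ← dotProduct_sub, ← Matrix.mulVec_sub]
    refine dotProduct_eq_zero_of_disjoint fun J hJ hJ' => ?_
    obtain ⟨K, h5, h6⟩ := exists_of_mulVec_ne_zero hJ'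
    obtain ⟨a, c, hac, h7⟩ := wt_of_tder_ne_zero h5
    obtain ⟨rfl, -, hκc⟩ := rowMat_ne_zero hac
    have h8 : wt (low n n₀) K = ν := by
      have := h7 (low n n₀)
      rw [hqlow J hJ, hlow0, hlowj c (hκ''lt c hκc)] at this
      linarith
    have h9 : b - wl = (tpow D (1 + rowMat κ')).mulVec (w - wl) := by
      rw [Matrix.mulVec_sub, hbl]
    rw [h9] at h6
    obtain ⟨K', h10, h11⟩ := exists_of_mulVec_ne_zero h6
    have h12 := wt_eq_of_tpow_ne_zero hbpres h10
    apply h11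
    rw [hwl, Pi.sub_apply, Set.indicator_of_mem (by exact h12.trans h8), sub_self]
  have h5 : q ⬝ᵥ (tder D (rowMat κ'')).mulVec wl = κ j * (q ⬝ᵥ q) := by
    rw [tder_rowMat_mulVec, dotProduct_sum, Finset.sum_eq_single j]
    · have hκj : κ'' j = κ j := if_neg (not_le.mpr hj)
      rw [if_neg hj0, dotProduct_smul, dotProduct_tder_single_wpart, smul_eq_mul, hκj]
    · intro i _ hij
      rw [dotProduct_smul]
      have : q ⬝ᵥ (tder D (Matrix.single 0 i 1)).mulVec wl = 0 := by
        refine dotProduct_eq_zero_of_disjoint fun J hJ hJ' => ?_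
        obtain ⟨K, h6, h7⟩ := exists_of_mulVec_ne_zero hJ'
        have h8 := cnt_of_tder_single_ne_zero h6 idx
        rw [hqidx J hJ, hw K (hwlν K h7).2, idx_zero] at h8
        exact hij (idx_injective (by linarith))
      rw [this, smul_zero]
    · simp
  rw [h1, h3, h4, h5, zero_add] at h2
  exact dotProduct_self_eq_zero.mp ((mul_eq_zero.mp h2.symm).resolve_left (hκ j hj0))

end Stages

end ShrinkingCurves

namespace ShrinkingCurves

/-! ### The non-uniform case at scale one with `n₀ = n`: exchanging the indices `0` and `n`. -/

section Gap

variable {n D : ℕ} {Ω : Type*} {l : Filter Ω} {A : Ω → Fin (n + 1) → ℝ} {t : Ω → ℝ}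

/-- The matrix `(1 + x⁻¹ Eₙ₀) (1 - x E₀ₙ)`. -/
noncomputable def flip (x : ℝ) : Matrix (Fin (n + 1)) (Fin (n + 1)) ℝ :=
  (1 + Matrix.single (Fin.last n) 0 x⁻¹) * (1 + rowMat (Pi.single (Fin.last n) (-x)))

theorem last_ne_zero' (hn : 1 ≤ n) : Fin.last n ≠ 0 := fun h => by
  have := congrArg Fin.val h
  simp at this
  omega

/-- The `(n, n)` entry is `1 - x⁻¹ x = 0`, so nothing in position `n` stays there: `flip x` sends
`n` to `0`, and `0` to a combination of `0` and `n`. -/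
theorem flip_apply_ne_zero (hn : 1 ≤ n) {x : ℝ} (hx : x ≠ 0) {i j : Fin (n + 1)}
    (h : flip (n := n) x i j ≠ 0) :
    (i = j ∧ i ≠ Fin.last n) ∨ (i = 0 ∧ j = Fin.last n) ∨ (i = Fin.last n ∧ j = 0) := by
  have hl := last_ne_zero' hn
  by_contra hcon
  push Not at hcon
  obtain ⟨h1, h2, h3⟩ := hcon
  apply h
  rw [flip, add_mul, one_mul, Matrix.add_apply, Matrix.add_apply]
  by_cases hi : i = Fin.last n
  · subst hi
    rw [Matrix.single_mul_apply_same, one_add_rowMat_apply_zero, if_neg (h3 rfl)]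
    by_cases hj : j = Fin.last n
    · subst hj
      simp [rowMat, hl, hx]
    · simp [rowMat, hl, hj, Matrix.one_apply_ne (Ne.symm hj)]
  · rw [Matrix.single_mul_apply_of_ne _ _ _ _ _ hi, add_zero]
    by_cases hi0 : i = 0
    · subst hi0
      have hj : j ≠ 0 := fun hj => hi (h1 hj.symm)
      have hjl := h2 rfl
      simp [rowMat, hj, hjl, Matrix.one_apply_ne (Ne.symm hj)]
    · have hij : i ≠ j := fun hij => hi (h1 hij)
      simp [rowMat, hi0, Matrix.one_apply_ne hij]

/-- The exponents governing the flipped vector. -/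
noncomputable def flipExp (A : Fin (n + 1) → ℝ) (i : Fin (n + 1)) : ℝ :=
  if i = 0 then A 0 + A (Fin.last n) else if i = Fin.last n then 0 else A i

/-- `flipExp` moves `A n` from the last index to index `0`: its last entry is zero and the other
entries add up to `∑ A = 0`. The last coordinate of `χ` therefore becomes irrelevant. -/
theorem sum_mul_flipExp (hn : 1 ≤ n) {A χ : Fin (n + 1) → ℝ} (hA : ∑ i, A i = 0)
    (hχ : ∀ i : Fin (n + 1), (i : ℕ) ≤ n - 1 → χ i = χ 0) : ∑ i, χ i * flipExp A i = 0 := by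
  have hl := last_ne_zero' hn
  have h1 : ∀ i, χ i * flipExp A i = χ 0 * flipExp A i := fun i => by
    by_cases hi : i = Fin.last n
    · simp [flipExp, hi, hl]
    · rw [hχ i]
      have := Fin.val_lt_last hi
      omega
  have h2 : ∀ i, flipExp A i = A i + (if i = 0 then A (Fin.last n) else 0) -
      (if i = Fin.last n then A (Fin.last n) else 0) := fun i => by
    unfold flipExp
    by_cases hi : i = 0
    · subst hi; simp [hl.symm]
    · by_cases hi' : i = Fin.last n
      · simp [hi', hl]
      · simp [hi, hi']
  rw [Finset.sum_congr rfl fun i _ => h1 i, ← Finset.mul_sum, Finset.sum_congr rfl fun i _ => h2 i,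
    Finset.sum_sub_distrib, Finset.sum_add_distrib, hA]
  simp

/-- For each possibly nonzero entry `(i, j)` of `flip x`, the value of `flipExp + t idx` at `i` is
at most the value of `A + t idx` at `j`, using `A 0 = n t` and `A n ≤ 0`; summing over the tensor
factors gives the claim. -/
theorem flip_growth (hn : 1 ≤ n) {x : ℝ} (hx : x ≠ 0) (h : Regime l n n A t fun _ => 0)
    {z : (Fin D → Fin (n + 1)) → ℝ} {m C : ℝ}
    (hz : ∀ J, z J ≠ 0 → ∀ᶠ ω in l, wt (A ω) J - t ω * (m - wt idx J) ≤ C)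
    {J : Fin D → Fin (n + 1)} (hJ : (tpow D (flip x)).mulVec z J ≠ 0) :
    ∀ᶠ ω in l, wt (flipExp (A ω)) J - t ω * (m - wt idx J) ≤ C := by
  have hl := last_ne_zero' hn
  have hil : idx (Fin.last n) = n := by simp [idx]
  obtain ⟨I, hJI, hI⟩ := exists_of_mulVec_ne_zero hJ
  filter_upwards [hz I hI] with ω hω
  rw [tpow_apply, Finset.prod_ne_zero_iff] at hJI
  have h1 : wt (flipExp (A ω) + t ω • idx) J ≤ wt (A ω + t ω • idx) I := by
    refine Finset.sum_le_sum fun s hs => ?_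
    have h0 := h.zero ω
    have hlast := h.nonpos ω (Fin.last n) hl
    simp only [Pi.add_apply, Pi.smul_apply, smul_eq_mul, flipExp]
    obtain ⟨h2, h3⟩ | ⟨h2, h3⟩ | ⟨h2, h3⟩ := flip_apply_ne_zero hn hx (hJI s hs)
    · rw [← h2, if_neg h3]
      split_ifs with h4
      · rw [h4]; linarith
      · exact le_rfl
    · rw [h2, h3, if_pos rfl, idx_zero, hil]; linarith
    · rw [h2, h3, if_neg hl, if_pos rfl, idx_zero, hil]; linarith
  rw [wt_add, wt_smul, wt_add, wt_smul] at h1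
  linarith

/-- In the lowest degree of `cnt · n`, the flipped vector agrees with `u(κ')` applied to the part of
`w` of that degree. -/
theorem mulVec_eq_of_min (hn : 1 ≤ n) {κ' : Fin (n + 1) → ℝ} (hκ' : κ' (Fin.last n) = 0) {x ν : ℝ}
    {w : (Fin D → Fin (n + 1)) → ℝ} (hν : ∀ I, w I ≠ 0 → ν ≤ cnt I (Fin.last n))
    {J : Fin D → Fin (n + 1)} (hJ : cnt J (Fin.last n) = ν) :
    (tpow D (1 + Matrix.single (Fin.last n) 0 x)).mulVec ((tpow D (1 + rowMat κ')).mulVec w) J =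
      (tpow D (1 + rowMat κ')).mulVec (Set.indicator {I | cnt I (Fin.last n) = ν} w) J := by
  have hl := last_ne_zero' hn
  have hpres : ∀ i j, (1 + rowMat κ') i j ≠ 0 →
      (Pi.single (Fin.last n) 1 : Fin (n + 1) → ℝ) j = (Pi.single (Fin.last n) 1 : Fin (n + 1) → ℝ) i := by
    intro i j hij
    by_cases he : i = j
    · rw [he]
    · rw [Matrix.add_apply, Matrix.one_apply_ne he, zero_add] at hij
      obtain ⟨rfl, -, h2⟩ := rowMat_ne_zero hij
      have hj : j ≠ Fin.last n := fun h => h2 (h ▸ hκ')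
      simp [hj, hl.symm]
  have hmono : ∀ i j, (1 + Matrix.single (Fin.last n) 0 x : Matrix _ _ ℝ) i j ≠ 0 → i ≠ j →
      i = Fin.last n ∧ j = 0 := by
    intro i j hij he
    rw [Matrix.add_apply, Matrix.one_apply_ne he, zero_add] at hij
    by_contra h3
    exact hij (Matrix.single_apply_of_ne _ _ _ _ _ fun h => h3 ⟨h.1.symm, h.2.symm⟩)
  set b := (tpow D (1 + rowMat κ')).mulVec w with hb
  have hbν : ∀ K, b K ≠ 0 → ν ≤ cnt K (Fin.last n) := fun K hK => by
    obtain ⟨I, h1, h2⟩ := exists_of_mulVec_ne_zero hK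
    exact (hν I h2).trans (wt_eq_of_tpow_ne_zero hpres h1).le
  have e1 : (tpow D (1 + Matrix.single (Fin.last n) 0 x)).mulVec b J = b J := by
    refine (Finset.sum_eq_single J (fun K _ hKJ => ?_) (by simp)).trans ?_
    · by_contra hne
      have h1 := left_ne_zero_of_mul hne
      have h2 := hbν K (right_ne_zero_of_mul hne)
      change tpow D _ J K ≠ 0 at h1
      rw [tpow_apply, Finset.prod_ne_zero_iff] at h1
      obtain ⟨s, hs⟩ := Function.ne_iff.mp hKJ
      have hle : ∀ s ∈ Finset.univ, (Pi.single (Fin.last n) 1 : Fin (n + 1) → ℝ) (K s) ≤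
          (Pi.single (Fin.last n) 1 : Fin (n + 1) → ℝ) (J s) := by
        intro s hs
        by_cases he : J s = K s
        · rw [he]
        · obtain ⟨h3, h4⟩ := hmono _ _ (h1 s hs) he
          rw [h3, h4]; simp [hl.symm]
      have := (Finset.sum_eq_sum_iff_of_le hle).mp
        (le_antisymm (Finset.sum_le_sum hle) (hJ.le.trans h2)) s (Finset.mem_univ s)
      obtain ⟨h3, h4⟩ := hmono _ _ (h1 s (Finset.mem_univ s)) (Ne.symm hs)
      rw [h3, h4] at this
      simp [hl.symm] at this
    · show tpow D _ J J * b J = b J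
      rw [tpow_apply, Finset.prod_eq_one, one_mul]
      intro s _
      rw [Matrix.add_apply, Matrix.one_apply_eq, Matrix.single_apply_of_ne, add_zero]
      rintro ⟨h1, h2⟩
      exact hl (h1.trans h2.symm)
  rw [e1]
  refine Finset.sum_congr rfl fun I _ => ?_
  show tpow D _ J I * _ = tpow D _ J I * _
  by_cases h0 : tpow D (1 + rowMat κ') J I = 0
  · rw [h0, zero_mul, zero_mul]
  · rw [Set.indicator_of_mem (by exact (wt_eq_of_tpow_ne_zero hpres h0).trans hJ)]

/-- `E_{n0}` commutes with the `E_{j0}`, so a vector annihilated by the latter stays annihilated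
after applying `E_{n0}`. -/
theorem tpow_rowMat_transpose_single_last {κ' : Fin (n + 1) → ℝ}
    (hn : 1 ≤ n) {v : (Fin D → Fin (n + 1)) → ℝ}
    (h : ∀ j, j ≠ 0 → κ' j ≠ 0 → (tder D (Matrix.single j 0 1)).mulVec v = 0) :
    (tpow D (1 + rowMat κ').transpose).mulVec ((tder D (Matrix.single (Fin.last n) 0 1)).mulVec v) =
      (tder D (Matrix.single (Fin.last n) 0 1)).mulVec v := by
  have hl := last_ne_zero' hn
  have h1 : (rowMat κ').transpose * Matrix.single (Fin.last n) (0 : Fin (n + 1)) (1 : ℝ) = 0 := by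
    ext a b
    rw [Matrix.mul_apply, Matrix.zero_apply]
    refine Finset.sum_eq_zero fun k _ => ?_
    by_contra hne
    have h2 := rowMat_ne_zero (left_ne_zero_of_mul hne)
    apply right_ne_zero_of_mul hne
    rw [Matrix.single_apply_of_ne]
    rintro ⟨h3, -⟩
    exact hl (h3.trans h2.1)
  have h2 : Matrix.single (Fin.last n) (0 : Fin (n + 1)) (1 : ℝ) * (rowMat κ').transpose = 0 := by
    ext a b
    rw [Matrix.mul_apply, Matrix.zero_apply]
    refine Finset.sum_eq_zero fun k _ => ?_
    by_contra hne
    have h2 := rowMat_ne_zero (right_ne_zero_of_mul hne)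
    apply left_ne_zero_of_mul hne
    rw [Matrix.single_apply_of_ne]
    rintro ⟨-, h3⟩
    exact h2.2.1 h3.symm
  rw [Matrix.transpose_add, Matrix.transpose_one]
  refine tpow_one_add_mulVec_eq_self (rowMat_transpose_mul_self κ') ?_
  rw [Matrix.mulVec_mulVec, tder_mul_tder (rowMat_transpose_mul_self κ'), h1, h2, sub_zero,
    show tder D (0 : Matrix (Fin (n + 1)) (Fin (n + 1)) ℝ) = 0 from map_zero (tderₗ D), add_zero, ← Matrix.mulVec_mulVec, tder_rowMat_transpose_eq_zero h,
    Matrix.mulVec_zero]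

/-- When the gap tends to infinity, some weight of a homogeneous vector satisfying the growth
condition is annihilated by the root vectors of `Q`. -/
theorem exists_killed_of_gap [l.NeBot] (h : Regime l n n A t fun _ => 0) {i₁ : Fin (n + 1)}
    (hi₁ : (i₁ : ℕ) = 1) (hgap : Tendsto (fun ω => A ω (Fin.last n) - A ω i₁) l atTop)
    {κ : Fin (n + 1) → ℝ} (hκ : ∀ i : Fin (n + 1), i ≠ 0 → κ i ≠ 0)
    {w : (Fin D → Fin (n + 1)) → ℝ} {m C : ℝ} (hw0 : w ≠ 0) (hw : ∀ I, w I ≠ 0 → wt idx I = m)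
    (hz : ∀ J, (tpow D (1 + rowMat κ)).mulVec w J ≠ 0 →
      ∀ᶠ ω in l, wt (A ω) J - t ω * (m - wt idx J) ≤ C) :
    ∃ I, w I ≠ 0 ∧ BlockKilled (n - 1) (cnt I) w ∧
      (tder D (Matrix.single (Fin.last n) 0 1)).mulVec (wpart (cnt I) w) = 0 := by
  have hn : 1 ≤ n := h.one_le
  have hl := last_ne_zero' hn
  have hz' : ∀ J, (tpow D (1 + rowMat κ)).mulVec w J ≠ 0 →
      ∀ᶠ ω in l, wt (A ω) J - (t ω - (fun _ => 0) ω) * (m - wt idx J) ≤ C := by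
    simpa only [sub_zero] using hz
  obtain ⟨p, χ, hp, hχ⟩ := exists_nearest_of_bounded h (fun i hi _ => hκ i hi) hw0 hw hz'
  obtain ⟨hχc, hχl⟩ := nearest_constant_of_eq h hκ hχ fun i hi hil =>
    h.tendsto_slope_of_gap hi₁ hgap hi hil
  obtain ⟨I, hI⟩ : ∃ I, p I ≠ 0 := by
    by_contra! h0
    have := hp.sum
    simp [h0] at this
  -- If `χ` is constant the previous argument gives everything. If the last coordinate is strictly
  -- larger, the flipped vector is used.
  rcases hχl.eq_or_lt with hχl | hχl
  · have hc : ∀ i : Fin (n + 1), (i : ℕ) ≤ n → χ i = χ 0 := fun i _ => by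
      by_cases hi : i = Fin.last n
      · rw [hi, hχl]
      · exact hχc i hi
    have hk := killed_of_nearest hp hw (fun i hi _ => hκ i hi) hz' hc (h.eventually_le_dot hc)
      fun i hi hin => h.tendsto_sub_of_le hi hin
    exact ⟨I, hp.supp I hI, fun i hi hin => hk i hi (Nat.lt_succ_iff.mp i.2) I hI,
      (hk _ hl le_rfl I hI).2⟩
  have hlt : ∀ i : Fin (n + 1), (i : ℕ) ≤ n - 1 → i ≠ Fin.last n := fun i hi he => by
    rw [he, Fin.val_last] at hi; omega
  -- the weights with the smallest last coordinate
  have hdot : ∀ χ' : Fin (n + 1) → ℝ,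
      χ' ⬝ᵥ χ = χ 0 * ∑ i, χ' i + (χ (Fin.last n) - χ 0) * χ' (Fin.last n) := fun χ' => by
    rw [dotProduct, Fin.sum_univ_castSucc, Fin.sum_univ_castSucc (f := χ'), mul_add, Finset.mul_sum]
    have : ∀ i : Fin n, χ' i.castSucc * χ i.castSucc = χ 0 * χ' i.castSucc := fun i => by
      rw [hχc i.castSucc (Fin.castSucc_lt_last i).ne, mul_comm]
    simp only [this]
    ring
  have hsumχ : ∑ i, χ i = D := by
    rw [hp.eq]
    simp only [Finset.sum_apply, Pi.smul_apply, smul_eq_mul]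
    rw [Finset.sum_comm]
    simp only [← Finset.mul_sum, sum_cnt, ← Finset.sum_mul, hp.sum, one_mul]
  -- All weights have coordinate sum `D`, and `χ` is constant off the last index, so the
  -- nearest-point inequality only compares last coordinates.
  have hge : ∀ I, w I ≠ 0 → χ (Fin.last n) ≤ cnt I (Fin.last n) := fun I hI => by
    have := hp.le I hI
    rw [hdot, hdot, hsumχ, sum_cnt, add_le_add_iff_left] at this
    exact le_of_mul_le_mul_left this (sub_pos.mpr hχl)
  have hpe : ∀ I, p I ≠ 0 → cnt I (Fin.last n) = χ (Fin.last n) := by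
    have h1 : ∑ I, p I * (cnt I (Fin.last n) - χ (Fin.last n)) = 0 := by
      simp only [mul_sub, Finset.sum_sub_distrib, ← Finset.sum_mul, hp.sum, one_mul]
      have : χ (Fin.last n) = ∑ I, p I * cnt I (Fin.last n) := by
        conv_lhs => rw [hp.eq]
        simp
      rw [← this, sub_self]
    intro I hI
    have h2 := (Finset.sum_eq_zero_iff_of_nonneg fun I _ => ?_).mp h1 I (Finset.mem_univ I)
    · exact sub_eq_zero.mp ((mul_eq_zero.mp h2).resolve_left hI)
    · by_cases hI : p I = 0
      · simp [hI]
      · exact mul_nonneg (hp.nonneg I) (sub_nonneg.mpr (hge I (hp.supp I hI)))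
  set wb := Set.indicator {I | cnt I (Fin.last n) = χ (Fin.last n)} w with hwb
  have hwbs : ∀ I, wb I ≠ 0 → cnt I (Fin.last n) = χ (Fin.last n) ∧ w I ≠ 0 := fun I hI =>
    Set.indicator_apply_ne_zero.mp hI
  have hpb : IsNearest wb p χ := ⟨hp.nonneg, fun I hI => Set.indicator_apply_ne_zero.mpr
    ⟨hpe I hI, hp.supp I hI⟩, hp.sum, hp.eq, fun I hI => hp.le I (hwbs I hI).2⟩
  have hpart : ∀ I, p I ≠ 0 → wpart (cnt I) wb = wpart (cnt I) w := fun I hI => by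
    funext J
    by_cases hJ : cnt J = cnt I
    · rw [wpart, wpart, Set.indicator_of_mem (by exact hJ), Set.indicator_of_mem (by exact hJ), hwb,
        Set.indicator_of_mem (by rw [Set.mem_ofPred_eq, hJ]; exact hpe I hI)]
    · rw [wpart, wpart, Set.indicator_of_notMem (by exact hJ), Set.indicator_of_notMem (by exact hJ)]
  set x := κ (Fin.last n) with hx
  have hx0 : x ≠ 0 := hκ _ hl
  set κ' : Fin (n + 1) → ℝ := Function.update κ (Fin.last n) 0 with hκ'
  have hκ'l : κ' (Fin.last n) = 0 := by simp [hκ']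
  have hκ'e : ∀ i, i ≠ Fin.last n → κ' i = κ i := fun i hi => by simp [hκ', hi]
  set b := (tpow D (1 + rowMat κ')).mulVec w with hb
  set y := (tpow D (1 + Matrix.single (Fin.last n) 0 x⁻¹)).mulVec b with hy
  -- The factor `1 - x E_{0n}` of `flip x` cancels the last term of `u(κ)`, leaving `u(κ')`.
  have hyz : y = (tpow D (flip x)).mulVec ((tpow D (1 + rowMat κ)).mulVec w) := by
    rw [hy, hb, Matrix.mulVec_mulVec, Matrix.mulVec_mulVec, ← tpow_mul, ← tpow_mul, flip, mul_assoc,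
      one_add_rowMat_mul]
    congr 5
    funext i
    by_cases hi : i = Fin.last n
    · subst hi; simp [hκ'l, hx]
    · simp [hκ'e i hi, hi]
  have hygrow : ∀ J, y J ≠ 0 → ∀ᶠ ω in l, wt (flipExp (A ω)) J - t ω * (m - wt idx J) ≤ C := by
    intro J hJ
    rw [hyz] at hJ
    exact flip_growth hn hx0 h hz hJ
  have hcnt : ∀ i j : Fin (n + 1), (1 + rowMat κ') i j ≠ 0 →
      (Pi.single (Fin.last n) 1 : Fin (n + 1) → ℝ) j = (Pi.single (Fin.last n) 1 : Fin (n + 1) → ℝ) i := by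
    intro i j hij
    by_cases he : i = j
    · rw [he]
    · rw [Matrix.add_apply, Matrix.one_apply_ne he, zero_add] at hij
      obtain ⟨rfl, -, h2⟩ := rowMat_ne_zero hij
      have hj : j ≠ Fin.last n := fun h => h2 (h ▸ hκ'l)
      simp [hj, hl.symm]
  have hbgrow : ∀ J, (tpow D (1 + rowMat κ')).mulVec wb J ≠ 0 →
      ∀ᶠ ω in l, wt (flipExp (A ω)) J - t ω * (m - wt idx J) ≤ C := by
    intro J hJ
    refine hygrow J ?_
    obtain ⟨I, h1, h2⟩ := exists_of_mulVec_ne_zero hJ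
    rw [hy, hb, mulVec_eq_of_min hn hκ'l hge]
    · exact hJ
    · exact (wt_eq_of_tpow_ne_zero hcnt h1).symm.trans (hwbs I h2).1
  have hflip0 : ∀ χ' : Fin (n + 1) → ℝ, (∀ i : Fin (n + 1), (i : ℕ) ≤ n - 1 → χ' i = χ' 0) →
      ∀ ω, ∑ i, χ' i * flipExp (A ω) i = 0 := by
    intro χ' hχ' ω
    exact sum_mul_flipExp hn (h.sum ω) hχ'
  -- The lemma is applied to the part `wb` with smallest last count, the exponents `flipExp` and the
  -- indices below `n`. There `χ` is constant, `∑ χ · flipExp = 0`, and the growth rates are at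
  -- least `(n - i) t ≥ t`.
  have hk := killed_of_nearest (k := n - 1) (C' := 0) hpb (fun J hJ => hw J (hwbs J hJ).2)
    (fun i hi hin => by rw [hκ'e i (hlt i hin)]; exact hκ i hi) hbgrow
    (fun i hi => hχc i (hlt i hi))
    (Eventually.of_forall fun ω => (hflip0 χ (fun i hi => hχc i (hlt i hi)) ω).ge)
    (fun i hi hin => by
      have hil := hlt i hin
      refine tendsto_atTop_mono' l ?_ h.top
      filter_upwards [h.top.eventually_ge_atTop 0] with ω ht
      have h1 := h.mono ω i (Fin.last n) hi (Fin.le_last i)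
      have h2 := h.zero ω
      have h3 : idx i + 1 ≤ n := by
        unfold idx
        have := Fin.val_lt_last hil
        exact_mod_cast this
      simp only [flipExp, if_true, if_neg hi, if_neg hil]
      nlinarith)
  have hwI := hp.supp I hI
  have hBK : BlockKilled (n - 1) (cnt I) w := fun i hi hin => by
    rw [← hpart I hI]; exact hk i hi hin I hI
  refine ⟨I, hwI, hBK, ?_⟩
  set q := (tder D (Matrix.single (Fin.last n) 0 1)).mulVec (wpart (cnt I) w) with hq
  have hχm : ∑ k, cnt I k * idx k = m := by rw [← wt_eq_sum_cnt, hw I hwI]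
  have hil : idx (Fin.last n) = n := by simp [idx]
  -- For the flipped exponents `E_{n0}` grows at rate `-A n`, which tends to infinity because `n₀ =
  -- n`.
  have h1 : q ⬝ᵥ y = 0 := by
    refine tder_single_wpart_dotProduct_eq_zero hχm hygrow (C' := 0)
      (Eventually.of_forall fun ω => (hflip0 (cnt I) (fun i hi => hBK.eq hwI hi) ω).ge) ?_
    refine (tendsto_neg_atBot_atTop.comp (h.bot _ hl le_rfl)).congr fun ω => ?_
    have := h.zero ω
    simp only [flipExp, if_true, if_neg hl, idx_zero, hil, Function.comp]
    linarith
  have hsq : Matrix.single (Fin.last n) (0 : Fin (n + 1)) x⁻¹ *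
      Matrix.single (Fin.last n) (0 : Fin (n + 1)) x⁻¹ = 0 :=
    Matrix.single_mul_single_of_ne _ _ _ _ hl.symm _
  have hqidx : ∀ J, q J ≠ 0 → wt idx J = m + n := fun J hJ => by
    rw [wt_of_tder_single_wpart_ne_zero hJ, hχm, idx_zero, hil, sub_zero]
  have hqcnt : ∀ J, q J ≠ 0 → cnt J (Fin.last n) = χ (Fin.last n) + 1 := fun J hJ => by
    rw [cnt, wt_of_tder_single_wpart_ne_zero hJ, ← wt_eq_sum_cnt]
    change cnt I (Fin.last n) + _ - _ = _
    rw [hpe I hI]; simp [hl.symm]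
  have h2 : q ⬝ᵥ y = q ⬝ᵥ b + q ⬝ᵥ (tder D (Matrix.single (Fin.last n) 0 x⁻¹)).mulVec b := by
    refine dotProduct_tpow_one_add hsq (f := Pi.single (Fin.last n) 1) (a := 1)
      (ν := χ (Fin.last n)) zero_le_one (fun i j hij => ?_) (fun K hK => ?_) fun J hJ => ?_
    · have : Fin.last n = i ∧ 0 = j := by
        by_contra h3
        exact hij (Matrix.single_apply_of_ne _ _ _ _ _ h3)
      rw [← this.1, ← this.2]; simp [hl.symm]
    · obtain ⟨I, h3, h4⟩ := exists_of_mulVec_ne_zero hK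
      exact (hge I h4).trans (wt_eq_of_tpow_ne_zero hcnt h3).le
    · have := hqcnt J hJ
      unfold cnt at this
      rw [this]; linarith
  have hn' : (1 : ℝ) ≤ n := by exact_mod_cast hn
  have h3 : q ⬝ᵥ b = 0 := by
    have : q ⬝ᵥ b = (tpow D (1 + rowMat κ').transpose).mulVec q ⬝ᵥ w := by
      rw [tpow_dotProduct, Matrix.transpose_transpose]
    rw [this, tpow_rowMat_transpose_single_last hn fun j hj hκj => (hBK j hj ?_).2]
    · refine dotProduct_eq_zero_of_disjoint fun J hJ hwJ => ?_
      have := hqidx J hJ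
      rw [hw J hwJ] at this
      linarith
    · have : j ≠ Fin.last n := fun h => hκj (h ▸ hκ'l)
      have := Fin.val_lt_last this
      omega
  -- `q` lies in degree `m + n`, which `E_{n0}` reaches only from degree `m`, and there `b` agrees
  -- with `w`.
  have h4 : q ⬝ᵥ (tder D (Matrix.single (Fin.last n) 0 x⁻¹)).mulVec b = x⁻¹ * (q ⬝ᵥ q) := by
    have e1 : Matrix.single (Fin.last n) (0 : Fin (n + 1)) x⁻¹ =
        x⁻¹ • Matrix.single (Fin.last n) 0 1 := by simp
    rw [e1, tder_smul, Matrix.smul_mulVec, dotProduct_smul, smul_eq_mul]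
    congr 1
    rw [← dotProduct_tder_single_wpart, ← sub_eq_zero, ← dotProduct_sub, ← Matrix.mulVec_sub]
    refine dotProduct_eq_zero_of_disjoint fun J hJ hJ' => ?_
    obtain ⟨K, h5, h6⟩ := exists_of_mulVec_ne_zero hJ'
    have h7 := cnt_of_tder_single_ne_zero h5 idx
    rw [hqidx J hJ, idx_zero, hil] at h7
    apply h6
    rw [Pi.sub_apply, hb, tpow_one_add_rowMat_apply_top hw (by linarith), sub_self]
  rw [h1, h3, h4, zero_add] at h2
  exact dotProduct_self_eq_zero.mp ((mul_eq_zero.mp h2.symm).resolve_left (inv_ne_zero hx0))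

end Gap

end ShrinkingCurves

namespace ShrinkingCurves

/-! ### From annihilation by root vectors to invariance under block subgroups. -/

section Fixed

variable {ι : Type*} [Fintype ι] [DecidableEq ι] {D : ℕ} {u : (Fin D → ι) → ℝ}

/-- The root vector `E_ij` annihilates `u`. -/
def Killed (u : (Fin D → ι) → ℝ) (i j : ι) : Prop := (tder D (Matrix.single i j 1)).mulVec u = 0

/-- `E_ik` is the commutator of `E_ij` and `E_jk`. -/
theorem Killed.trans {i j k : ι} (h1 : Killed u i j) (h2 : Killed u j k) (hij : i ≠ j) (hik : i ≠ k) :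
    Killed u i k := by
  have h3 := congrArg (fun M => M.mulVec u) (tder_mul_tder (D := D) (X := Matrix.single j k 1)
    (Matrix.single_mul_single_of_ne _ _ _ _ hij.symm _ : Matrix.single i j (1 : ℝ) * Matrix.single i j 1 = 0))
  simp only [Matrix.add_mulVec, ← Matrix.mulVec_mulVec] at h3
  rw [h1, h2, Matrix.mulVec_zero, Matrix.mulVec_zero, zero_add,
    Matrix.single_mul_single_same, Matrix.single_mul_single_of_ne _ _ _ _ hik.symm, sub_zero,
    one_mul] at h3
  exact h3.symm

theorem tder_mulVec_eq_zero {Y : Matrix ι ι ℝ} (h : ∀ i j, Y i j ≠ 0 → Killed u i j) :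
    (tder D Y).mulVec u = 0 := by
  rw [Matrix.matrix_eq_sum_single Y, tder_sum, Matrix.sum_mulVec]
  refine Finset.sum_eq_zero fun i _ => ?_
  rw [tder_sum, Matrix.sum_mulVec]
  refine Finset.sum_eq_zero fun j _ => ?_
  have : Matrix.single i j (Y i j) = Y i j • Matrix.single i j 1 := by simp
  rw [this, tder_smul, Matrix.smul_mulVec]
  by_cases hY : Y i j = 0
  · rw [hY, zero_smul]
  · rw [h i j hY, smul_zero]

theorem cnt_eq_card (I : Fin D → ι) (i : ι) :
    cnt I i = ((Finset.univ.filter fun s => I s = i).card : ℝ) := by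
  rw [cnt, wt, Finset.card_filter]
  push_cast
  exact Finset.sum_congr rfl fun s _ => by rw [Pi.single_apply]

variable {p : ι → Prop} [DecidablePred p]

/-- A matrix on the block `p`, extended by the identity. -/
def blockExtend (p : ι → Prop) [DecidablePred p] (C : Matrix {i // p i} {i // p i} ℝ) :
    Matrix ι ι ℝ :=
  (Matrix.fromBlocks C 0 0 1).submatrix (Equiv.sumCompl p).symm (Equiv.sumCompl p).symm

theorem blockExtend_mul (C C' : Matrix {i // p i} {i // p i} ℝ) :
    blockExtend p (C * C') = blockExtend p C * blockExtend p C' := by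
  rw [blockExtend, blockExtend, blockExtend, Matrix.submatrix_mul_equiv, Matrix.fromBlocks_multiply]
  simp

theorem det_blockExtend (C : Matrix {i // p i} {i // p i} ℝ) : (blockExtend p C).det = C.det := by
  rw [blockExtend, Matrix.det_submatrix_equiv_self, Matrix.det_fromBlocks_zero₂₁, Matrix.det_one,
    mul_one]

theorem blockExtend_apply_of_pos (C : Matrix {i // p i} {i // p i} ℝ) {i j : ι} (hi : p i) (hj : p j) :
    blockExtend p C i j = C ⟨i, hi⟩ ⟨j, hj⟩ := by
  rw [blockExtend, Matrix.submatrix_apply, Equiv.sumCompl_symm_apply_of_pos hi,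
    Equiv.sumCompl_symm_apply_of_pos hj, Matrix.fromBlocks_apply₁₁]

theorem blockExtend_apply_left (C : Matrix {i // p i} {i // p i} ℝ) {i j : ι} (hi : ¬ p i) :
    blockExtend p C i j = (1 : Matrix ι ι ℝ) i j := by
  rw [blockExtend, Matrix.submatrix_apply, Equiv.sumCompl_symm_apply_of_neg hi]
  by_cases hj : p j
  · rw [Equiv.sumCompl_symm_apply_of_pos hj, Matrix.fromBlocks_apply₂₁, Matrix.one_apply_ne]
    · rfl
    · rintro rfl; exact hi hj
  · rw [Equiv.sumCompl_symm_apply_of_neg hj, Matrix.fromBlocks_apply₂₂, Matrix.one_apply,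
      Matrix.one_apply]
    simp only [Subtype.mk.injEq]

theorem blockExtend_apply_right (C : Matrix {i // p i} {i // p i} ℝ) {i j : ι} (hj : ¬ p j) :
    blockExtend p C i j = (1 : Matrix ι ι ℝ) i j := by
  by_cases hi : p i
  · rw [blockExtend, Matrix.submatrix_apply, Equiv.sumCompl_symm_apply_of_neg hj,
      Equiv.sumCompl_symm_apply_of_pos hi, Matrix.fromBlocks_apply₁₂, Matrix.one_apply_ne]
    · rfl
    · rintro rfl; exact hj hi
  · exact blockExtend_apply_left C hi

theorem blockExtend_diagonal (d : {i // p i} → ℝ) :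
    blockExtend p (Matrix.diagonal d) =
      Matrix.diagonal fun i => if h : p i then d ⟨i, h⟩ else 1 := by
  ext i j
  by_cases hi : p i
  · by_cases hj : p j
    · rw [blockExtend_apply_of_pos _ hi hj, Matrix.diagonal_apply, Matrix.diagonal_apply]
      simp [hi]
    · rw [blockExtend_apply_right _ hj, Matrix.one_apply, Matrix.diagonal_apply]
      by_cases hij : i = j
      · subst hij; simp [hj]
      · simp [hij]
  · rw [blockExtend_apply_left _ hi, Matrix.one_apply, Matrix.diagonal_apply]
    simp [hi]

/-- A vector annihilated by the root vectors of a block, all of whose weights are constant on the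
block, is fixed by the special linear group of the block. -/
theorem tpow_blockExtend_eq_self (hk : ∀ i j, p i → p j → i ≠ j → Killed u i j)
    (hc : ∀ I, u I ≠ 0 → ∀ i j, p i → p j → cnt I i = cnt I j)
    {C : Matrix {i // p i} {i // p i} ℝ} (hC : C.det = 1) :
    (tpow D (blockExtend p C)).mulVec u = u := by
  refine Matrix.diagonal_transvection_induction
    (fun C => (tpow D (blockExtend p C)).mulVec u = u) C (fun d hd => ?_) (fun T => ?_) ?_
  -- A diagonal matrix multiplies a coordinate whose counts are all equal on the block by a power of
  -- its determinant, and the determinant is `1` here.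
  · rw [hC, Matrix.det_diagonal] at hd
    rw [blockExtend_diagonal, tpow_diagonal]
    funext I
    rw [Matrix.mulVec_diagonal]
    by_cases hI : u I = 0
    · rw [hI, mul_zero]
    · rw [Finset.prod_comp (fun i => if h : p i then d ⟨i, h⟩ else 1) I,
        Finset.prod_subset (Finset.subset_univ _) fun i _ hi => by
          rw [Finset.filter_eq_empty_iff.mpr, Finset.card_empty, pow_zero]
          rintro s - rfl
          exact hi (Finset.mem_image_of_mem _ (Finset.mem_univ s))]
      convert one_mul _
      by_cases hp : ∃ i₀, p i₀
      · obtain ⟨i₀, hi₀⟩ := hp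
        refine Eq.trans ?_ ((congrArg (· ^ (Finset.univ.filter fun s => I s = i₀).card) hd).trans
          (one_pow _))
        rw [← Finset.prod_pow, ← Finset.prod_filter_mul_prod_filter_not Finset.univ p,
          Finset.prod_eq_one (s := Finset.univ.filter fun i => ¬ p i), mul_one]
        · rw [Finset.prod_subtype (p := p) _ (by simp)]
          refine Finset.prod_congr rfl fun i _ => ?_
          have := hc I hI i i₀ i.2 hi₀
          rw [cnt_eq_card, cnt_eq_card, Nat.cast_inj] at this
          rw [dif_pos i.2, this]
        · intro i hi
          rw [dif_neg (Finset.mem_filter.mp hi).2, one_pow]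
      · exact Finset.prod_eq_one fun i _ => by rw [dif_neg fun h => hp ⟨i, h⟩, one_pow]
  · have hij : T.i.1 ≠ T.j.1 := fun h => T.hij (Subtype.ext h)
    have : blockExtend p T.toMatrix = 1 + Matrix.single T.i.1 T.j.1 T.c := by
      rw [Matrix.TransvectionStruct.toMatrix, Matrix.transvection]
      ext i j
      rw [Matrix.add_apply]
      by_cases hi : p i
      · by_cases hj : p j
        · rw [blockExtend_apply_of_pos _ hi hj, Matrix.add_apply, Matrix.one_apply, Matrix.one_apply,
            Matrix.single_apply, Matrix.single_apply]
          simp only [Subtype.ext_iff]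
        · rw [blockExtend_apply_right _ hj, Matrix.single_apply_of_ne, add_zero]
          rintro ⟨-, rfl⟩; exact hj T.j.2
      · rw [blockExtend_apply_left _ hi, Matrix.single_apply_of_ne, add_zero]
        rintro ⟨rfl, -⟩; exact hi T.i.2
    rw [this]
    refine tpow_one_add_mulVec_eq_self (Matrix.single_mul_single_of_ne _ _ _ _ hij.symm _)
      (tder_mulVec_eq_zero fun i j hne => ?_)
    have : T.i.1 = i ∧ T.j.1 = j := by
      by_contra h3
      exact hne (Matrix.single_apply_of_ne _ _ _ _ _ h3)
    rw [← this.1, ← this.2]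
    exact hk _ _ T.i.2 T.j.2 hij
  · intro A B hA hB
    rw [blockExtend_mul, tpow_mul, ← Matrix.mulVec_mulVec, hB, hA]

/-- The Levi decomposition of the block parabolic: `Y` is the off-diagonal block of `g` and `C` its
diagonal block on `p`. -/
theorem exists_eq_one_add_mul_blockExtend {g : Matrix ι ι ℝ} (hg : g.det = 1)
    (hrow : ∀ i, ¬ p i → ∀ j, g i j = (1 : Matrix ι ι ℝ) i j) :
    ∃ (Y : Matrix ι ι ℝ) (C : Matrix {i // p i} {i // p i} ℝ), g = (1 + Y) * blockExtend p C ∧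
      C.det = 1 ∧ Y * Y = 0 ∧ ∀ i j, Y i j ≠ 0 → p i ∧ ¬ p j ∧ g i j ≠ 0 := by
  set Y : Matrix ι ι ℝ := Matrix.of fun i j => if p i ∧ ¬ p j then g i j else 0 with hY
  have hYne : ∀ i j, Y i j ≠ 0 → p i ∧ ¬ p j ∧ g i j ≠ 0 := fun i j h => by
    rw [hY, Matrix.of_apply] at h
    split_ifs at h with h1
    · exact ⟨h1.1, h1.2, h⟩
    · exact absurd rfl h
  have hYY : Y * Y = 0 := by
    ext i j
    refine Finset.sum_eq_zero fun k _ => ?_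
    by_contra h
    exact (hYne _ _ (left_ne_zero_of_mul h)).2.1 (hYne _ _ (right_ne_zero_of_mul h)).1
  set C : Matrix {i // p i} {i // p i} ℝ := g.submatrix Subtype.val Subtype.val with hC
  have hgC : g = (1 + Y) * blockExtend p C := by
    ext i j
    rw [add_mul, one_mul, Matrix.add_apply, Matrix.mul_apply]
    by_cases hi : p i
    · have h1 : ∀ k, Y i k * blockExtend p C k j = if k = j then Y i j else 0 := fun k => by
        by_cases hk : p k
        · have : ∀ j, p j → Y i j = 0 := fun j hj => by
            by_contra h; exact (hYne _ _ h).2.1 hj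
          rw [this k hk, zero_mul]
          split_ifs with h
          · rw [← h, this k hk]
          · rfl
        · rw [blockExtend_apply_left _ hk, Matrix.one_apply]
          split_ifs with h
          · rw [h, mul_one]
          · rw [mul_zero]
      simp only [h1, Finset.sum_ite_eq', Finset.mem_univ, if_true]
      by_cases hj : p j
      · rw [blockExtend_apply_of_pos _ hi hj, hY]
        simp [hC, hj]
      · rw [blockExtend_apply_right _ hj, Matrix.one_apply_ne, hY]
        · simp [hi, hj]
        · rintro rfl; exact hj hi
    · rw [blockExtend_apply_left _ hi, hrow i hi, Finset.sum_eq_zero, add_zero]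
      intro k _
      have : Y i k = 0 := by by_contra h; exact hi (hYne _ _ h).1
      rw [this, zero_mul]
  have hCdet : C.det = 1 := by
    have hupper : (1 + Y).det = 1 := by
      have : (1 + Y) = (Matrix.fromBlocks 1 (Matrix.of fun (i : {i // p i}) (j : {j // ¬ p j}) => g i j) 0
          1).submatrix (Equiv.sumCompl p).symm (Equiv.sumCompl p).symm := by
        ext i j
        rw [Matrix.add_apply, Matrix.submatrix_apply, hY, Matrix.of_apply]
        by_cases hi : p i <;> by_cases hj : p j <;>
          simp [Equiv.sumCompl_symm_apply_of_pos, Equiv.sumCompl_symm_apply_of_neg, hi, hj,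
            Matrix.one_apply]
        · rintro rfl; exact absurd hi hj
        · rintro rfl; exact absurd hj hi
      rw [this, Matrix.det_submatrix_equiv_self, Matrix.det_fromBlocks_zero₂₁, Matrix.det_one,
        Matrix.det_one, mul_one]
    rw [hgC, Matrix.det_mul, hupper, det_blockExtend, one_mul] at hg
    exact hg
  exact ⟨Y, C, hgC, hCdet, hYY, hYne⟩

theorem tpow_eq_self_of_rows {g : Matrix ι ι ℝ} (hg : g.det = 1)
    (hrow : ∀ i, ¬ p i → ∀ j, g i j = (1 : Matrix ι ι ℝ) i j)
    (hk : ∀ i j, p i → p j → i ≠ j → Killed u i j)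
    (hc : ∀ I, u I ≠ 0 → ∀ i j, p i → p j → cnt I i = cnt I j)
    (hk' : ∀ i j, p i → ¬ p j → g i j ≠ 0 → Killed u i j) :
    (tpow D g).mulVec u = u := by
  obtain ⟨Y, C, hgC, hCdet, hYY, hYne⟩ := exists_eq_one_add_mul_blockExtend hg hrow
  rw [hgC, tpow_mul, ← Matrix.mulVec_mulVec, tpow_blockExtend_eq_self hk hc hCdet]
  exact tpow_one_add_mulVec_eq_self hYY (tder_mulVec_eq_zero fun i j h =>
    hk' i j (hYne i j h).1 (hYne i j h).2.1 (hYne i j h).2.2)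

theorem blockExtend_transpose (C : Matrix {i // p i} {i // p i} ℝ) :
    (blockExtend p C).transpose = blockExtend p C.transpose := by
  rw [blockExtend, blockExtend, Matrix.transpose_submatrix, Matrix.fromBlocks_transpose]
  simp

theorem tpow_eq_self_of_cols {g : Matrix ι ι ℝ} (hg : g.det = 1)
    (hcol : ∀ j, ¬ p j → ∀ i, g i j = (1 : Matrix ι ι ℝ) i j)
    (hk : ∀ i j, p i → p j → i ≠ j → Killed u i j)
    (hc : ∀ I, u I ≠ 0 → ∀ i j, p i → p j → cnt I i = cnt I j)
    (hk' : ∀ i j, ¬ p i → p j → Killed u i j) :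
    (tpow D g).mulVec u = u := by
  obtain ⟨Y, C, hgC, hCdet, hYY, hYne⟩ := exists_eq_one_add_mul_blockExtend (p := p)
    (g := g.transpose) (by rw [Matrix.det_transpose, hg]) fun i hi j => by
      rw [Matrix.transpose_apply, hcol i hi, Matrix.one_apply, Matrix.one_apply]
      simp only [eq_comm]
  have h1 : g = blockExtend p C.transpose * (1 + Y.transpose) := by
    rw [← Matrix.transpose_transpose g, hgC, Matrix.transpose_mul, blockExtend_transpose,
      Matrix.transpose_add, Matrix.transpose_one]
  have h2 : Y.transpose * Y.transpose = 0 := by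
    rw [← Matrix.transpose_mul, hYY, Matrix.transpose_zero]
  rw [h1, tpow_mul, ← Matrix.mulVec_mulVec, tpow_one_add_mulVec_eq_self h2
    (tder_mulVec_eq_zero fun i j h => hk' i j (hYne j i h).2.1 (hYne j i h).1)]
  exact tpow_blockExtend_eq_self hk hc (by rw [Matrix.det_transpose, hCdet])

end Fixed

end ShrinkingCurves

namespace ShrinkingCurves

/-! ### Invariance of annihilated weight components under `G_{n₀}` and `Q`. -/

section FixedSubgroups

variable {n D k : ℕ} {w : (Fin D → Fin (n + 1)) → ℝ} {I : Fin D → Fin (n + 1)}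

theorem BlockKilled.killed (h : BlockKilled k (cnt I) w) {i j : Fin (n + 1)} (hi : (i : ℕ) ≤ k)
    (hj : (j : ℕ) ≤ k) (hij : i ≠ j) : Killed (wpart (cnt I) w) i j := by
  by_cases hi0 : i = 0
  · subst hi0; exact (h j hij.symm hj).1
  by_cases hj0 : j = 0
  · subst hj0; exact (h i hij hi).2
  · exact Killed.trans (h i hi0 hi).2 (h j hj0 hj).1 hi0 hij

theorem BlockKilled.cnt_eq (h : BlockKilled k (cnt I) w) (hI : w I ≠ 0) {J : Fin D → Fin (n + 1)}
    (hJ : wpart (cnt I) w J ≠ 0) {i j : Fin (n + 1)} (hi : (i : ℕ) ≤ k) (hj : (j : ℕ) ≤ k) :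
    cnt J i = cnt J j := by
  rw [(wpart_ne_zero hJ).1, h.eq hI hi, h.eq hI hj]

theorem BlockKilled.killed_row (h : BlockKilled k (cnt I) w) {i j : Fin (n + 1)} (hi : (i : ℕ) ≤ k)
    (hj : k < (j : ℕ)) (h0 : Killed (wpart (cnt I) w) 0 j) : Killed (wpart (cnt I) w) i j := by
  by_cases hi0 : i = 0
  · rwa [hi0]
  · exact Killed.trans (h i hi0 hi).2 h0 hi0 (by rintro rfl; omega)

theorem tpow_eq_self_of_mem_subgroupG (h : BlockKilled k (cnt I) w) (hI : w I ≠ 0)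
    {g : Matrix.SpecialLinearGroup (Fin (n + 1)) ℝ} (hg : g ∈ subgroupG n k)
    (h0 : ∀ j : Fin (n + 1), k < (j : ℕ) → (∃ i : Fin (n + 1), (i : ℕ) ≤ k ∧ g.1 i j ≠ 0) →
      Killed (wpart (cnt I) w) 0 j) :
    (tpow D g.1).mulVec (wpart (cnt I) w) = wpart (cnt I) w :=
  tpow_eq_self_of_rows (p := fun i : Fin (n + 1) => (i : ℕ) ≤ k) g.2
    (fun i hi => hg i (not_le.mp hi)) (fun _ _ hi hj hij => h.killed hi hj hij)
    (fun _ hJ _ _ hi hj => h.cnt_eq hI hJ hi hj)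
    fun i j hi hj hne => h.killed_row hi (not_le.mp hj) (h0 j (not_le.mp hj) ⟨i, hi, hne⟩)

theorem tpow_eq_self_of_mem_subgroupQ (hn : 1 ≤ n) (h : BlockKilled (n - 1) (cnt I) w) (hI : w I ≠ 0)
    (h0 : Killed (wpart (cnt I) w) (Fin.last n) 0)
    {g : Matrix.SpecialLinearGroup (Fin (n + 1)) ℝ} (hg : g ∈ subgroupQ n) :
    (tpow D g.1).mulVec (wpart (cnt I) w) = wpart (cnt I) w := by
  have hlast : ∀ j : Fin (n + 1), ¬ (j : ℕ) ≤ n - 1 → j = Fin.last n := fun j hj =>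
    Fin.ext (by rw [Fin.val_last]; omega)
  refine tpow_eq_self_of_cols (p := fun i : Fin (n + 1) => (i : ℕ) ≤ n - 1) g.2
    (fun j hj i => ?_) (fun _ _ hi hj hij => h.killed hi hj hij)
    (fun _ hJ _ _ hi hj => h.cnt_eq hI hJ hi hj) fun i j hi hj => ?_
  · rw [hlast j hj]; exact hg i
  · rw [hlast i hi]
    by_cases hj0 : j = 0
    · rwa [hj0]
    · refine Killed.trans h0 (h j hj0 hj).1 (last_ne_zero' hn) ?_
      rintro rfl
      rw [Fin.val_last] at hj; omega

end FixedSubgroups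

/-! ### Annihilated weight components have bounded trajectories. -/

section Bounded

variable {n n₀ D : ℕ} {Ω : Type*} {l : Filter Ω} {A : Ω → Fin (n + 1) → ℝ} {t L : Ω → ℝ}

/-- The matrix `a u(x)`. -/
noncomputable def diagRow (A x : Fin (n + 1) → ℝ) : Matrix (Fin (n + 1)) (Fin (n + 1)) ℝ :=
  Matrix.diagonal (fun i => Real.exp (A i)) * (1 + rowMat x)

theorem abs_tpow_mulVec_le {ι : Type*} [Fintype ι] [DecidableEq ι] {N : Matrix ι ι ℝ} {B : ℝ}
    (hB : ∀ i j, |N i j| ≤ B) (u : (Fin D → ι) → ℝ) (J : Fin D → ι) :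
    |(tpow D N).mulVec u J| ≤ B ^ D * ∑ I, |u I| := by
  rw [Finset.mul_sum]
  refine (Finset.abs_sum_le_sum_abs _ _).trans (Finset.sum_le_sum fun I _ => ?_)
  rw [abs_mul]
  refine mul_le_mul_of_nonneg_right ?_ (abs_nonneg _)
  change |tpow D N J I| ≤ _
  rw [tpow_apply, Finset.abs_prod]
  exact (Finset.prod_le_prod (fun _ _ => abs_nonneg _) fun s _ => hB _ _).trans_eq (by simp)

/-- A weight vector whose weight is constant up to `n₀` has bounded image under the diagonal. -/
theorem Regime.abs_exp_mul_le (h : Regime l n n₀ A t L) {χ : Fin (n + 1) → ℝ}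
    (hχ : ∀ i : Fin (n + 1), (i : ℕ) ≤ n₀ → χ i = χ 0) {u : (Fin D → Fin (n + 1)) → ℝ}
    (hu : ∀ I, u I ≠ 0 → cnt I = χ) :
    ∀ᶠ ω in l, ∀ J, Real.exp (wt (A ω) J) * |u J| ≤ Real.exp 1 * |u J| := by
  filter_upwards [(h.tendsto_dot hχ).eventually_le_const (by norm_num : (0 : ℝ) < 1)] with ω hω J
  by_cases hJ : u J = 0
  · simp [hJ]
  · refine mul_le_mul_of_nonneg_right (Real.exp_le_exp.mpr ?_) (abs_nonneg _)
    rwa [wt_of_cnt_eq (hu J hJ)]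

theorem one_add_single_mul_diagonal_exp (A : Fin (n + 1) → ℝ) (j : Fin (n + 1)) (x : ℝ) :
    Matrix.diagonal (fun i => Real.exp (A i)) * (1 + rowMat (Pi.single j x)) =
      (1 + rowMat (Pi.single j (Real.exp (A 0 - A j) * x))) *
        Matrix.diagonal (fun i => Real.exp (A i)) := by
  ext a b
  rw [Matrix.diagonal_mul, Matrix.mul_diagonal, Matrix.add_apply, Matrix.add_apply, rowMat, rowMat,
    Matrix.of_apply, Matrix.of_apply]
  by_cases hb : b = j
  · subst hb
    by_cases ha : a = 0 ∧ b ≠ 0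
    · rw [if_pos ha, if_pos ha, ha.1, Matrix.one_apply_ne ha.2.symm, Pi.single_eq_same,
        Pi.single_eq_same, Real.exp_sub]
      field_simp [Real.exp_ne_zero]
      ring
    · rw [if_neg ha, if_neg ha, add_zero, Matrix.one_apply]
      split_ifs with hab
      · rw [hab, mul_comm]
      · simp
  · rw [Pi.single_eq_of_ne hb, Pi.single_eq_of_ne hb, ite_self, add_zero, Matrix.one_apply]
    split_ifs with hab
    · rw [hab, mul_comm]
    · simp

theorem tpow_one_add_rowMat_split {u : (Fin D → Fin (n + 1)) → ℝ} {j : Fin (n + 1)}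
    (x : Fin (n + 1) → ℝ) (h : ∀ i, i ≠ 0 → i ≠ j → Killed u 0 i) :
    (tpow D (1 + rowMat x)).mulVec u = (tpow D (1 + rowMat (Pi.single j (x j)))).mulVec u := by
  have : (1 + rowMat x) = (1 + rowMat (Pi.single j (x j))) * (1 + rowMat (Function.update x j 0)) := by
    rw [one_add_rowMat_mul]
    congr 2
    funext i
    by_cases hi : i = j
    · subst hi; simp
    · simp [hi]
  rw [this, tpow_mul, ← Matrix.mulVec_mulVec, tpow_one_add_rowMat_eq_self fun i hi hxi => h i hi ?_]
  rintro rfl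
  exact hxi (by simp)

/-- The image under `a u(x)` of a weight vector annihilated by `E₀ᵢ`, `i ≠ j`. -/
theorem abs_tpow_diagRow_le {u : (Fin D → Fin (n + 1)) → ℝ} {j : Fin (n + 1)}
    {A x : Fin (n + 1) → ℝ} (h : ∀ i, i ≠ 0 → i ≠ j → Killed u 0 i) {B : ℝ}
    (hx : |Real.exp (A 0 - A j) * x j| ≤ B) (hu : ∀ J, Real.exp (wt A J) * |u J| ≤ Real.exp 1 * |u J|)
    (J : Fin D → Fin (n + 1)) :
    |(tpow D (diagRow A x)).mulVec u J| ≤ (1 + B) ^ D * ∑ I, Real.exp 1 * |u I| := by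
  have hB : 0 ≤ B := (abs_nonneg _).trans hx
  -- Only `E_{0j}` acts nontrivially on `u`. Moving it past the diagonal matrix multiplies its
  -- coefficient by `exp (A 0 - A j)`, and the remaining unipotent has bounded entries.
  have h1 : (tpow D (diagRow A x)).mulVec u =
      (tpow D (1 + rowMat (Pi.single j (Real.exp (A 0 - A j) * x j)))).mulVec
        ((tpow D (Matrix.diagonal fun i => Real.exp (A i))).mulVec u) := by
    rw [diagRow, tpow_mul, ← Matrix.mulVec_mulVec, tpow_one_add_rowMat_split x h,
      Matrix.mulVec_mulVec, Matrix.mulVec_mulVec, ← tpow_mul, ← tpow_mul,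
      one_add_single_mul_diagonal_exp]
  rw [h1]
  refine (abs_tpow_mulVec_le (B := 1 + B) (fun a b => ?_) _ J).trans ?_
  · rw [Matrix.add_apply, Matrix.one_apply, rowMat, Matrix.of_apply]
    refine (abs_add_le _ _).trans (add_le_add ?_ ?_)
    · split_ifs <;> simp
    · split_ifs
      · by_cases hb : b = j
        · rw [hb, Pi.single_eq_same]; exact hx
        · rw [Pi.single_eq_of_ne hb, abs_zero]; exact hB
      · rw [abs_zero]; exact hB
  · refine mul_le_mul_of_nonneg_left (Finset.sum_le_sum fun I _ => ?_) (by positivity)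
    rw [tpow_diagonal_exp, Matrix.mulVec_diagonal, abs_mul, abs_of_pos (Real.exp_pos _)]
    exact hu I

/-- The image under `a u(x)` of a weight vector fixed by `Q`. -/
theorem abs_tpow_diagRow_le_of_last (hn : 1 ≤ n) {u : (Fin D → Fin (n + 1)) → ℝ}
    {A x : Fin (n + 1) → ℝ} (hA : ∑ i, A i = 0)
    {χ : Fin (n + 1) → ℝ} (hχ : ∀ i : Fin (n + 1), (i : ℕ) ≤ n - 1 → χ i = χ 0)
    (hu : ∀ J, u J ≠ 0 → cnt J = χ)
    (h : ∀ i, i ≠ 0 → i ≠ Fin.last n → Killed u 0 i) (h0 : Killed u (Fin.last n) 0) {B : ℝ}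
    (hx0 : x (Fin.last n) ≠ 0) (hAl : A (Fin.last n) ≤ 0)
    (hx : |Real.exp (A 0) * x (Fin.last n)| ≤ B) (hx' : |Real.exp (A 0) * x (Fin.last n)|⁻¹ ≤ B)
    (J : Fin D → Fin (n + 1)) :
    |(tpow D (diagRow A x)).mulVec u J| ≤ (1 + B) ^ D * ∑ I, |u I| := by
  have hl := last_ne_zero' hn
  have hB : 0 ≤ B := (abs_nonneg _).trans hx
  set y := x (Fin.last n) with hy
  set b := Real.exp (A 0) * y with hb
  have hb0 : b ≠ 0 := mul_ne_zero (Real.exp_ne_zero _) hx0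
  set N : Matrix (Fin (n + 1)) (Fin (n + 1)) ℝ := Matrix.of fun i j =>
    if i = 0 then (if j = Fin.last n then b else 0)
    else if i = Fin.last n then
      (if j = 0 then -b⁻¹ else if j = Fin.last n then Real.exp (A (Fin.last n)) else 0)
    else (1 : Matrix _ _ ℝ) i j with hN
  have hNb : ∀ i j, |N i j| ≤ 1 + B := by
    intro i j
    simp only [hN, Matrix.of_apply, Matrix.one_apply]
    have h3 : |Real.exp (A (Fin.last n))| ≤ 1 := by
      rw [abs_of_pos (Real.exp_pos _)]; exact Real.exp_le_one_iff.mpr hAl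
    split_ifs
    · linarith
    · rw [abs_zero]; linarith
    · rw [abs_neg, abs_inv]; linarith
    · linarith
    · rw [abs_zero]; linarith
    · rw [abs_one]; linarith
    · rw [abs_zero]; linarith
  -- The factor `1 - y⁻¹ E_{n0}`, which fixes `u`, is chosen to cancel the `(0, 0)` entry. The rest
  -- factors as a bounded matrix `N` times a diagonal matrix of exponents `flipExp`, which also
  -- fixes `u`. Bounding `N` requires `exp (A 0) y` to stay away from `0` as well as from infinity.
  have hmat : Matrix.diagonal (fun i => Real.exp (A i)) *
      ((1 + rowMat (Pi.single (Fin.last n) y)) * (1 + Matrix.single (Fin.last n) 0 (-y⁻¹))) =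
      N * Matrix.diagonal (fun i => Real.exp (flipExp A i)) := by
    ext i j
    rw [Matrix.diagonal_mul, Matrix.mul_diagonal, mul_add, mul_one, Matrix.add_apply]
    have hs : ((1 + rowMat (Pi.single (Fin.last n) y)) *
        Matrix.single (Fin.last n) (0 : Fin (n + 1)) (-y⁻¹) : Matrix _ _ ℝ) i j =
        if j = 0 then (1 + rowMat (Pi.single (Fin.last n) y)) i (Fin.last n) * -y⁻¹ else 0 := by
      split_ifs with hj
      · subst hj; rw [Matrix.mul_single_apply_same]
      · rw [Matrix.mul_single_apply_of_ne _ _ _ _ _ hj]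
    rw [hs]
    simp only [hN, Matrix.of_apply, flipExp]
    by_cases hi : i = 0
    · subst hi
      rw [one_add_rowMat_apply_zero, one_add_rowMat_apply_zero, if_neg hl, if_pos rfl]
      by_cases hj : j = 0
      · subst hj
        simp [hl.symm, hx0]
      · by_cases hj' : j = Fin.last n
        · simp [hj', hl, hb]
        · simp [hj, hj']
    · rw [one_add_rowMat_apply_of_ne _ hi, one_add_rowMat_apply_of_ne _ hi, if_neg hi]
      by_cases hi' : i = Fin.last n
      · subst hi'
        rw [if_pos rfl, Matrix.one_apply_eq, Matrix.one_apply]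
        by_cases hj : j = 0
        · subst hj
          rw [if_neg hl, if_pos rfl, if_pos rfl, if_pos rfl, Real.exp_add, hb]
          have := Real.exp_ne_zero (A 0)
          field_simp
          ring
        · by_cases hj' : j = Fin.last n
          · simp [hj', hl]
          · simp [hj, hj', Ne.symm hj']
      · rw [if_neg hi', Matrix.one_apply_ne hi', zero_mul, ite_self, add_zero, Matrix.one_apply]
        split_ifs with hij h1 h2
        · exact absurd (hij.trans h1) hi
        · exact absurd (hij.trans h2) hi'
        · rw [hij, mul_comm]
        · simp
        · simp
        · simp
  have hflip : (tpow D (Matrix.diagonal fun i => Real.exp (flipExp A i))).mulVec u = u := by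
    rw [tpow_diagonal_exp]
    funext I
    rw [Matrix.mulVec_diagonal]
    by_cases hI : u I = 0
    · simp [hI]
    · rw [wt_of_cnt_eq (hu I hI), sum_mul_flipExp hn hA hχ, Real.exp_zero, one_mul]
  have hlow : (tpow D (1 + Matrix.single (Fin.last n) 0 (-y⁻¹))).mulVec u = u := by
    refine tpow_one_add_mulVec_eq_self (Matrix.single_mul_single_of_ne _ _ _ _ hl.symm _)
      (tder_mulVec_eq_zero fun i j hne => ?_)
    have : Fin.last n = i ∧ 0 = j := by
      by_contra h3
      exact hne (Matrix.single_apply_of_ne _ _ _ _ _ h3)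
    rw [← this.1, ← this.2]; exact h0
  have h1 : (tpow D (diagRow A x)).mulVec u = (tpow D N).mulVec u := by
    rw [diagRow, tpow_mul, ← Matrix.mulVec_mulVec, tpow_one_add_rowMat_split x h]
    conv_lhs => rw [← hlow]
    rw [Matrix.mulVec_mulVec, Matrix.mulVec_mulVec, ← tpow_mul, ← tpow_mul, ← hy, mul_assoc, hmat, tpow_mul,
      ← Matrix.mulVec_mulVec, hflip]
  rw [h1]
  exact abs_tpow_mulVec_le hNb u J

end Bounded

end ShrinkingCurves

namespace ShrinkingCurves

/-! ### Coordinates along the curve as polynomials, and the growth condition. -/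

section Coefficients

open Polynomial

/-- The coefficients of a polynomial of bounded degree are controlled by its values. -/
theorem exists_abs_coeff_le (K : ℕ) {c d : ℝ} (hcd : c < d) : ∃ C : ℝ, 0 < C ∧ ∀ p : ℝ[X],
    p.natDegree ≤ K → ∀ M : ℝ, (∀ η ∈ Set.Icc c d, |p.eval η| ≤ M) → ∀ j, |p.coeff j| ≤ C * M := by
  -- `K + 1` equally spaced nodes in the interval: Lagrange interpolation expresses every
  -- coefficient through the values at the nodes.
  set x : ℕ → ℝ := fun i => c + (d - c) * (i / (K + 1)) with hx
  have hinj : Function.Injective x := fun i j hij => by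
    simp only [hx, add_right_inj] at hij
    have h1 := mul_left_cancel₀ (sub_pos.mpr hcd).ne' hij
    have h2 : (K : ℝ) + 1 ≠ 0 := by positivity
    exact_mod_cast (div_left_inj' h2).mp h1
  have hmem : ∀ i ∈ Finset.range (K + 1), x i ∈ Set.Icc c d := fun i hi => by
    have h1 : (i : ℝ) / (K + 1) ≤ 1 := by
      rw [div_le_one (by positivity)]
      exact_mod_cast (Finset.mem_range.mp hi).le
    have h2 : (0 : ℝ) ≤ i / (K + 1) := by positivity
    constructor <;> simp only [hx] <;> nlinarith
  set S : ℝ := ∑ j ∈ Finset.range (K + 1), ∑ i ∈ Finset.range (K + 1),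
    |(Lagrange.basis (Finset.range (K + 1)) x i).coeff j| with hS
  have hS0 : 0 ≤ S := Finset.sum_nonneg fun _ _ => Finset.sum_nonneg fun _ _ => abs_nonneg _
  refine ⟨1 + S, by positivity, fun p hp M hM j => ?_⟩
  have hM0 : 0 ≤ M := (abs_nonneg _).trans (hM c ⟨le_rfl, hcd.le⟩)
  by_cases hj : j < K + 1
  · have h1 : p = Lagrange.interpolate (Finset.range (K + 1)) x fun i => p.eval (x i) :=
      Lagrange.eq_interpolate hinj.injOn (by
        rw [Finset.card_range]
        exact (Polynomial.degree_le_natDegree).trans_lt (by exact_mod_cast Nat.lt_succ_of_le hp))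
    rw [h1, Lagrange.interpolate_apply, Polynomial.finsetSum_coeff]
    simp only [Polynomial.coeff_C_mul]
    calc _ ≤ ∑ i ∈ Finset.range (K + 1), M * |(Lagrange.basis (Finset.range (K + 1)) x i).coeff j| := by
          refine (Finset.abs_sum_le_sum_abs _ _).trans (Finset.sum_le_sum fun i hi => ?_)
          rw [abs_mul]
          exact mul_le_mul_of_nonneg_right (hM _ (hmem i hi)) (abs_nonneg _)
      _ = M * ∑ i ∈ Finset.range (K + 1), |(Lagrange.basis (Finset.range (K + 1)) x i).coeff j| := by
          rw [Finset.mul_sum]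
      _ ≤ M * S := mul_le_mul_of_nonneg_left (Finset.single_le_sum
          (f := fun j => ∑ i ∈ Finset.range (K + 1),
            |(Lagrange.basis (Finset.range (K + 1)) x i).coeff j|)
          (fun _ _ => Finset.sum_nonneg fun _ _ => abs_nonneg _) (Finset.mem_range.mpr hj)) hM0
      _ ≤ (1 + S) * M := by nlinarith
  · rw [Polynomial.coeff_eq_zero_of_natDegree_lt (by omega), abs_zero]
    positivity

variable {n D : ℕ}

/-- The curve `y ↦ (y^i g_i(y))_i`. -/
noncomputable def curveVec (g : Fin (n + 1) → ℝ[X]) (y : ℝ) (i : Fin (n + 1)) : ℝ :=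
  y ^ (i : ℕ) * (g i).eval y

/-- The entries of `1 + rowMat (curveVec g y)`, up to powers of `y`. -/
noncomputable def rowPoly (g : Fin (n + 1) → ℝ[X]) (i j : Fin (n + 1)) : ℝ[X] :=
  if i = 0 ∧ j ≠ 0 then g j else if i = j then 1 else 0

theorem rowPoly_ne_zero {g : Fin (n + 1) → ℝ[X]} {i j : Fin (n + 1)} (h : rowPoly g i j ≠ 0) :
    i ≤ j := by
  unfold rowPoly at h
  split_ifs at h with h1 h2
  · rw [h1.1]; exact Fin.zero_le j
  · exact h2.le
  · exact absurd rfl h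

theorem rowPoly_eval (g : Fin (n + 1) → ℝ[X]) (y : ℝ) (i j : Fin (n + 1)) :
    (1 + rowMat (curveVec g y)) i j = (rowPoly g i j).eval y * y ^ ((j : ℕ) - i) := by
  rw [Matrix.add_apply, rowMat, Matrix.of_apply, rowPoly, Matrix.one_apply]
  by_cases h : i = 0 ∧ j ≠ 0
  · rw [if_pos h, if_pos h, h.1, if_neg (Ne.symm h.2), zero_add, curveVec, mul_comm]
    simp
  · rw [if_neg h, if_neg h, add_zero]
    split_ifs with hij
    · simp [hij]
    · simp

theorem rowPoly_coeff_zero (g : Fin (n + 1) → ℝ[X]) (i j : Fin (n + 1)) :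
    (rowPoly g i j).coeff 0 = (1 + rowMat fun i => (g i).coeff 0) i j := by
  rw [Matrix.add_apply, rowMat, Matrix.of_apply, rowPoly, Matrix.one_apply]
  by_cases h : i = 0 ∧ j ≠ 0
  · rw [if_pos h, if_pos h, h.1, if_neg (Ne.symm h.2), zero_add]
  · rw [if_neg h, if_neg h, add_zero]
    split_ifs <;> simp

/-- The total increase of the indices from `J` to `I`. -/
def rise (I J : Fin D → Fin (n + 1)) : ℕ := ∑ s, ((I s : ℕ) - J s)

/-- The coordinates of `u(curveVec g y) v` as polynomials in `y`. -/
noncomputable def coordPoly (g : Fin (n + 1) → ℝ[X]) (v : (Fin D → Fin (n + 1)) → ℝ)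
    (J : Fin D → Fin (n + 1)) : ℝ[X] :=
  ∑ I, (∏ s, rowPoly g (J s) (I s)) * X ^ rise I J * C (v I)

theorem coordPoly_eval (g : Fin (n + 1) → ℝ[X]) (v : (Fin D → Fin (n + 1)) → ℝ)
    (J : Fin D → Fin (n + 1)) (y : ℝ) :
    (coordPoly g v J).eval y = (tpow D (1 + rowMat (curveVec g y))).mulVec v J := by
  rw [coordPoly, Polynomial.eval_finsetSum]
  refine Finset.sum_congr rfl fun I _ => ?_
  change _ = tpow D _ J I * v I
  rw [tpow_apply, Polynomial.eval_mul, Polynomial.eval_mul, Polynomial.eval_C, Polynomial.eval_pow,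
    Polynomial.eval_X, Polynomial.eval_prod, rise, ← Finset.prod_pow_eq_pow_sum,
    ← Finset.prod_mul_distrib]
  congr 1
  exact Finset.prod_congr rfl fun s _ => (rowPoly_eval g y _ _).symm

theorem natDegree_coordPoly_le {g : Fin (n + 1) → ℝ[X]} {K : ℕ} (hg : ∀ i, (g i).natDegree ≤ K)
    (v : (Fin D → Fin (n + 1)) → ℝ) (J : Fin D → Fin (n + 1)) :
    (coordPoly g v J).natDegree ≤ D * K + D * n := by
  refine Polynomial.natDegree_sum_le_of_forall_le _ _ fun I _ => ?_
  refine (Polynomial.natDegree_mul_C_le _ _).trans (Polynomial.natDegree_mul_le.trans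
    (add_le_add ?_ ?_))
  · refine (Polynomial.natDegree_prod_le _ _).trans ((Finset.sum_le_card_nsmul _ _ K fun s _ => ?_).trans_eq
      (by simp))
    unfold rowPoly
    split_ifs
    · exact hg _
    · simp
    · simp
  · refine (Polynomial.natDegree_X_pow_le _).trans ((Finset.sum_le_card_nsmul _ _ n fun s _ => ?_).trans_eq
      (by simp))
    have := (I s).2
    omega

theorem coordPoly_coeff (g : Fin (n + 1) → ℝ[X]) (v : (Fin D → Fin (n + 1)) → ℝ)
    (J : Fin D → Fin (n + 1)) (j : ℕ) :
    (coordPoly g v J).coeff j = ∑ I, (if rise I J ≤ j then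
      (∏ s, rowPoly g (J s) (I s)).coeff (j - rise I J) else 0) * v I := by
  rw [coordPoly, Polynomial.finsetSum_coeff]
  exact Finset.sum_congr rfl fun I _ => by
    rw [Polynomial.coeff_mul_C, Polynomial.coeff_mul_X_pow']

theorem wt_idx_eq_add_rise {I J : Fin D → Fin (n + 1)} (h : ∀ s, J s ≤ I s) :
    wt idx I = wt idx J + rise I J := by
  rw [rise, wt, wt]
  push_cast
  rw [← Finset.sum_add_distrib]
  refine Finset.sum_congr rfl fun s _ => ?_
  rw [Nat.cast_sub (h s)]
  unfold idx
  ring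

/-- The leading coefficients of the coordinates of `u(curveVec g y) v`. -/
theorem coordPoly_coeff_of_min (g : Fin (n + 1) → ℝ[X]) {v : (Fin D → Fin (n + 1)) → ℝ} {m : ℝ}
    (hm : ∀ I, v I ≠ 0 → m ≤ wt idx I) {J : Fin D → Fin (n + 1)} {j : ℕ}
    (hj : m = wt idx J + j) :
    (coordPoly g v J).coeff j = (tpow D (1 + rowMat fun i => (g i).coeff 0)).mulVec
      (Set.indicator {I | wt idx I = m} v) J := by
  rw [coordPoly_coeff]
  refine Finset.sum_congr rfl fun I _ => ?_
  change _ = tpow D _ J I * _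
  have hcoeff : (∏ s, rowPoly g (J s) (I s)).coeff 0 =
      tpow D (1 + rowMat fun i => (g i).coeff 0) J I := by
    rw [tpow_apply, Polynomial.coeff_zero_prod]
    exact Finset.prod_congr rfl fun s _ => rowPoly_coeff_zero g _ _
  by_cases hv : v I = 0
  · simp [Set.indicator_apply, hv]
  by_cases hV : ∏ s, rowPoly g (J s) (I s) = 0
  · rw [← hcoeff, hV]; simp
  · rw [← ne_eq, Finset.prod_ne_zero_iff] at hV
    -- A nonzero product forces all indices to increase from `J` to `I`, so `rise I J` is the
    -- difference of degrees. It is at least `j`, and equals `j` exactly when `I` has degree `m`;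
    -- only constant terms contribute then.
    have h1 := wt_idx_eq_add_rise fun s => rowPoly_ne_zero (hV s (Finset.mem_univ s))
    have h2 := hm I hv
    have h3 : j ≤ rise I J := by
      have : (j : ℝ) ≤ rise I J := by linarith
      exact_mod_cast this
    by_cases h4 : rise I J = j
    · rw [Set.indicator_of_mem (by rw [Set.mem_ofPred_eq, h1, h4, hj]), if_pos h4.le, h4,
        Nat.sub_self, hcoeff]
    · rw [Set.indicator_of_notMem, if_neg (by omega), mul_zero, zero_mul]
      rw [Set.mem_ofPred_eq]
      intro h5
      apply h4
      have : (rise I J : ℝ) = j := by linarith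
      exact_mod_cast this

variable {Ω : Type*} {l : Filter Ω}

theorem tendsto_coeff_prod {σ : Type*} (s : Finset σ) {f : Ω → σ → ℝ[X]} {p : σ → ℝ[X]}
    (h : ∀ i j, Tendsto (fun ω => (f ω i).coeff j) l (𝓝 ((p i).coeff j))) (j : ℕ) :
    Tendsto (fun ω => (∏ i ∈ s, f ω i).coeff j) l (𝓝 ((∏ i ∈ s, p i).coeff j)) := by
  classical
  induction s using Finset.induction_on generalizing j with
  | empty => exact tendsto_const_nhds
  | insert i s hi ih =>
    simp only [Finset.prod_insert hi, Polynomial.coeff_mul]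
    exact tendsto_finsetSum _ fun x _ => (h i x.1).mul (ih x.2)

theorem tendsto_coordPoly_coeff {g : Ω → Fin (n + 1) → ℝ[X]} {g' : Fin (n + 1) → ℝ[X]}
    (hg : ∀ i j, Tendsto (fun ω => (g ω i).coeff j) l (𝓝 ((g' i).coeff j)))
    {v : Ω → (Fin D → Fin (n + 1)) → ℝ} {v' : (Fin D → Fin (n + 1)) → ℝ}
    (hv : Tendsto v l (𝓝 v')) (J : Fin D → Fin (n + 1)) (j : ℕ) :
    Tendsto (fun ω => (coordPoly (g ω) (v ω) J).coeff j) l (𝓝 ((coordPoly g' v' J).coeff j)) := by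
  simp only [coordPoly_coeff]
  refine tendsto_finsetSum _ fun I _ => Tendsto.mul ?_ (tendsto_pi_nhds.mp hv I)
  split_ifs
  · refine tendsto_coeff_prod _ (fun s j => ?_) _
    unfold rowPoly
    split_ifs
    · exact hg _ _
    · exact tendsto_const_nhds
    · exact tendsto_const_nhds
  · exact tendsto_const_nhds

variable {A : Ω → Fin (n + 1) → ℝ} {c : Ω → ℝ}

/-- Bounds on `a u(R) v` translate into growth conditions on the leading part. -/
theorem exists_growth {g : Ω → Fin (n + 1) → ℝ[X]} {g' : Fin (n + 1) → ℝ[X]} {K : ℕ}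
    (hdeg : ∀ ω i, (g ω i).natDegree ≤ K)
    (hg : ∀ i j, Tendsto (fun ω => (g ω i).coeff j) l (𝓝 ((g' i).coeff j)))
    {v : Ω → (Fin D → Fin (n + 1)) → ℝ} {v' : (Fin D → Fin (n + 1)) → ℝ}
    (hv : Tendsto v l (𝓝 v')) {m : ℝ} (hm : ∀ I, v' I ≠ 0 → m ≤ wt idx I) {a b : ℝ} (hab : a < b)
    {M : Ω → ℝ} (hM : ∀ᶠ ω in l, ∀ η ∈ Set.Icc a b, ∀ J,
      |(tpow D (diagRow (A ω) (curveVec (g ω) (Real.exp (-c ω) * η)))).mulVec (v ω) J| ≤ M ω) :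
    ∃ C : ℝ, 0 < C ∧ ∀ J, (tpow D (1 + rowMat fun i => (g' i).coeff 0)).mulVec
        (Set.indicator {I | wt idx I = m} v') J ≠ 0 →
      ∀ᶠ ω in l, Real.exp (wt (A ω) J - c ω * (m - wt idx J)) ≤ C * M ω := by
  obtain ⟨C₀, hC₀, hC⟩ := exists_abs_coeff_le (D * K + D * n) hab
  set z := (tpow D (1 + rowMat fun i => (g' i).coeff 0)).mulVec
        (Set.indicator {I | wt idx I = m} v') with hz
  have hS0 : ∀ J, 0 ≤ 2 * C₀ / |z J| := fun J => by positivity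
  refine ⟨1 + ∑ J, 2 * C₀ / |z J|, by
    have := Finset.sum_nonneg fun J (_ : J ∈ Finset.univ) => hS0 J
    linarith, fun J hJ => ?_⟩
  obtain ⟨j, hj⟩ : ∃ j : ℕ, m = wt idx J + j := by
    obtain ⟨I, h1, h2⟩ := exists_of_mulVec_ne_zero hJ
    obtain ⟨h3, -⟩ := Set.indicator_apply_ne_zero.mp h2
    rw [tpow_apply, Finset.prod_ne_zero_iff] at h1
    refine ⟨rise I J, (Eq.symm h3).trans (wt_idx_eq_add_rise fun s => rowPoly_ne_zero (g := g') ?_)⟩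
    intro h0
    apply h1 s (Finset.mem_univ s)
    rw [← rowPoly_coeff_zero, h0, Polynomial.coeff_zero]
  have hlim := tendsto_coordPoly_coeff hg hv J j
  rw [coordPoly_coeff_of_min g' hm hj, ← hz] at hlim
  have hpos : 0 < |z J| := abs_pos.mpr hJ
  have hev := hlim.abs.eventually_const_le (half_lt_self hpos)
  filter_upwards [hM, hev] with ω h1 h2
  have hM0 : 0 ≤ M ω := (abs_nonneg _).trans (h1 a ⟨le_rfl, hab.le⟩ J)
  -- The coefficient bound is applied to this polynomial in `η` rather than in `y = e^{-c} η`; the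
  -- substitution multiplies the `j`-th coefficient by `e^{-cj}`, which is the exponential in the
  -- conclusion.
  have h3 := hC (Polynomial.C (Real.exp (wt (A ω) J)) *
    (coordPoly (g ω) (v ω) J).comp (Polynomial.C (Real.exp (-c ω)) * Polynomial.X))
    ((Polynomial.natDegree_C_mul_le _ _).trans (Polynomial.natDegree_comp_le.trans
      ((Nat.mul_le_mul (natDegree_coordPoly_le (hdeg ω) _ _)
        (Polynomial.natDegree_C_mul_le _ _)).trans (by simp)))) (M ω) (fun η hη => by
      rw [Polynomial.eval_mul, Polynomial.eval_C, Polynomial.eval_comp, Polynomial.eval_mul,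
        Polynomial.eval_C, Polynomial.eval_X, coordPoly_eval]
      have := h1 η hη J
      rwa [diagRow, tpow_mul, ← Matrix.mulVec_mulVec, tpow_diagonal_exp, Matrix.mulVec_diagonal] at this) j
  rw [Polynomial.coeff_C_mul, Polynomial.comp_C_mul_X_coeff, abs_mul, abs_mul,
    abs_of_pos (Real.exp_pos _), abs_of_pos (pow_pos (Real.exp_pos _) _)] at h3
  have h4 : Real.exp (wt (A ω) J - c ω * (m - wt idx J)) =
      Real.exp (wt (A ω) J) * Real.exp (-c ω) ^ j := by
    rw [← Real.exp_nat_mul, ← Real.exp_add]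
    congr 1
    rw [hj]; ring
  have h5 : 0 < Real.exp (wt (A ω) J) * Real.exp (-c ω) ^ j := by positivity
  have h6 : Real.exp (wt (A ω) J) * Real.exp (-c ω) ^ j * (|z J| / 2) ≤ C₀ * M ω := by
    refine le_trans (mul_le_mul_of_nonneg_left h2 h5.le) (le_trans (le_of_eq ?_) h3)
    ring
  have h7 : Real.exp (wt (A ω) J) * Real.exp (-c ω) ^ j ≤ 2 * C₀ / |z J| * M ω := by
    rw [div_mul_eq_mul_div, le_div_iff₀ hpos]
    linarith
  rw [h4]
  refine h7.trans (mul_le_mul_of_nonneg_right ?_ hM0)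
  have := Finset.single_le_sum (fun J _ => hS0 J) (Finset.mem_univ J)
  linarith

end Coefficients

end ShrinkingCurves

namespace ShrinkingCurves

/-! ### Bounded trajectories in tensor powers: the lower bound and the invariance statements. -/

section Core

open Polynomial

variable {n n₀ D K : ℕ} {Ω : Type*} {l : Filter Ω} {A : Ω → Fin (n + 1) → ℝ} {t L : Ω → ℝ}
  {g : Ω → Fin (n + 1) → ℝ[X]} {g' : Fin (n + 1) → ℝ[X]} {a b : ℝ}

/-- A converging family of curves `y ↦ (y^i g_i(y))_i` with nonzero leading coefficients. -/
structure CurveFamily (l : Filter Ω) (K : ℕ) (g : Ω → Fin (n + 1) → ℝ[X])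
    (g' : Fin (n + 1) → ℝ[X]) : Prop where
  natDegree_le : ∀ ω i, (g ω i).natDegree ≤ K
  tendsto : ∀ i j, Tendsto (fun ω => (g ω i).coeff j) l (𝓝 ((g' i).coeff j))
  zero : ∀ ω, g ω 0 = 0
  ne : ∀ i, i ≠ 0 → (g' i).coeff 0 ≠ 0

/-- The vectors `a u(R(e^{-c} η)) v` are bounded by `M` for `η ∈ [a, b]`. -/
def ShrinkBound (A : Fin (n + 1) → ℝ) (c : ℝ) (g : Fin (n + 1) → ℝ[X]) (a b : ℝ)
    (v : (Fin D → Fin (n + 1)) → ℝ) (M : ℝ) : Prop :=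
  ∀ η ∈ Set.Icc a b, ∀ J, |(tpow D (diagRow A (curveVec g (Real.exp (-c) * η)))).mulVec v J| ≤ M

theorem ShrinkBound.sub {A : Fin (n + 1) → ℝ} {c : ℝ} {g : Fin (n + 1) → ℝ[X]}
    {v v' : (Fin D → Fin (n + 1)) → ℝ} {M M' : ℝ} (h : ShrinkBound A c g a b v M)
    (h' : ShrinkBound A c g a b v' M') : ShrinkBound A c g a b (v - v') (M + M') := fun η hη J => by
  rw [Matrix.mulVec_sub, Pi.sub_apply]
  exact (abs_sub _ _).trans (add_le_add (h η hη J) (h' η hη J))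

theorem exists_min_degree {v : (Fin D → Fin (n + 1)) → ℝ} (hv : v ≠ 0) (f : Fin (n + 1) → ℝ) :
    ∃ I, v I ≠ 0 ∧ ∀ J, v J ≠ 0 → wt f I ≤ wt f J := by
  obtain ⟨I₀, hI₀⟩ := Function.ne_iff.mp hv
  obtain ⟨I, hI, hmin⟩ := Finset.exists_min_image (Finset.univ.filter fun I => v I ≠ 0) (wt f)
    ⟨I₀, by simpa using hI₀⟩
  exact ⟨I, by simpa using hI, fun J hJ => hmin J (by simpa using hJ)⟩

/-- Bounds tending to `0` send every exponent attached to the lowest-degree component of the limit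
to minus infinity, which `not_forall_tendsto_atBot` excludes. -/
theorem not_shrinkBound_of_tendsto_zero [l.NeBot] (h : Regime l n n₀ A t L)
    (hg : CurveFamily l K g g') (hab : a < b) {v : Ω → (Fin D → Fin (n + 1)) → ℝ}
    {v' : (Fin D → Fin (n + 1)) → ℝ} (hv : Tendsto v l (𝓝 v')) (hv' : v' ≠ 0) {M : Ω → ℝ}
    (hM : Tendsto M l (𝓝 0))
    (hbd : ∀ᶠ ω in l, ShrinkBound (A ω) (t ω - L ω) (g ω) a b (v ω) (M ω)) : False := by
  obtain ⟨I, hI, hmin⟩ := exists_min_degree hv' idx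
  obtain ⟨C, -, hC⟩ := exists_growth hg.natDegree_le hg.tendsto hv hmin hab hbd
  refine not_forall_tendsto_atBot h (κ := fun i => (g' i).coeff 0) (fun i hi _ => hg.ne i hi)
    (w := Set.indicator {J | wt idx J = wt idx I} v') (m := wt idx I) (fun h0 => hI ?_)
    (fun J hJ => (Set.indicator_apply_ne_zero.mp hJ).1) fun J hJ => ?_
  · have := congrFun h0 I
    rwa [Set.indicator_of_mem (by exact rfl)] at this
  · rw [← Real.tendsto_exp_comp_nhds_zero]
    have h0 : Tendsto (fun ω => C * M ω) l (𝓝 0) := by simpa using hM.const_mul C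
    exact tendsto_of_tendsto_of_tendsto_of_le_of_le' tendsto_const_nhds h0
      (Eventually.of_forall fun ω => (Real.exp_pos _).le) (hC J hJ)

theorem exists_growth_le (hg : CurveFamily l K g g') (hab : a < b)
    {v : Ω → (Fin D → Fin (n + 1)) → ℝ} {v' : (Fin D → Fin (n + 1)) → ℝ}
    (hv : Tendsto v l (𝓝 v')) {m : ℝ} (hm : ∀ I, v' I ≠ 0 → m ≤ wt idx I) {M : ℝ} {c : Ω → ℝ}
    (hbd : ∀ᶠ ω in l, ShrinkBound (A ω) (c ω) (g ω) a b (v ω) M) :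
    ∃ C : ℝ, ∀ J, (tpow D (1 + rowMat fun i => (g' i).coeff 0)).mulVec
        (Set.indicator {I | wt idx I = m} v') J ≠ 0 →
      ∀ᶠ ω in l, wt (A ω) J - c ω * (m - wt idx J) ≤ C := by
  obtain ⟨C, hC, h⟩ := exists_growth hg.natDegree_le hg.tendsto hv hm hab hbd
  refine ⟨Real.log (C * M), fun J hJ => ?_⟩
  filter_upwards [h J hJ] with ω hω
  exact (Real.le_log_iff_exp_le ((Real.exp_pos _).trans_le hω)).mpr hω

theorem wpart_indicator {S : Set (Fin D → Fin (n + 1))} {v : (Fin D → Fin (n + 1)) → ℝ}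
    {I : Fin D → Fin (n + 1)} (hS : ∀ J, cnt J = cnt I → J ∈ S) :
    wpart (cnt I) (S.indicator v) = wpart (cnt I) v := by
  funext J
  by_cases hJ : cnt J = cnt I
  · simp [wpart, hJ, hS J hJ]
  · rw [wpart, wpart, Set.indicator_of_notMem (by exact hJ), Set.indicator_of_notMem (by exact hJ)]

theorem wpart_indicator_wt {v : (Fin D → Fin (n + 1)) → ℝ} {f : Fin (n + 1) → ℝ} {ν : ℝ}
    {I : Fin D → Fin (n + 1)} (hI : wt f I = ν) :
    wpart (cnt I) (Set.indicator {J | wt f J = ν} v) = wpart (cnt I) v :=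
  wpart_indicator fun J hJ => by
    rw [Set.mem_ofPred_eq, ← hI, wt_of_cnt_eq hJ, wt_of_cnt_eq rfl]

/-- Some weight of a limit of bounded vectors is annihilated by the block up to `n₀`, and by the
root vectors `E₀ⱼ` that expand fast enough. -/
theorem exists_blockKilled [l.NeBot] (h : Regime l n n₀ A t L) (hg : CurveFamily l K g g')
    (hab : a < b)
    (hslope : ∀ i : Fin (n + 1), i ≠ 0 → (i : ℕ) ≤ n₀ →
      Tendsto (fun ω => i * L ω + Regime.slope (A ω) (t ω) i) l atTop)
    {v : Ω → (Fin D → Fin (n + 1)) → ℝ} {v' : (Fin D → Fin (n + 1)) → ℝ}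
    (hv : Tendsto v l (𝓝 v')) (hv' : v' ≠ 0) {M : ℝ}
    (hbd : ∀ᶠ ω in l, ShrinkBound (A ω) (t ω - L ω) (g ω) a b (v ω) M) :
    ∃ I, v' I ≠ 0 ∧ BlockKilled n₀ (cnt I) v' ∧ ∀ j : Fin (n + 1), n₀ < (j : ℕ) →
      Tendsto (fun ω => A ω 0 - A ω j - (t ω - L ω) * idx j) l atTop →
        Killed (wpart (cnt I) v') 0 j := by
  obtain ⟨I₁, hI₁, hmin⟩ := exists_min_degree hv' idx
  set m := wt idx I₁ with hm
  set w := Set.indicator {J | wt idx J = m} v' with hw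
  have hws : ∀ I, w I ≠ 0 → wt idx I = m ∧ v' I ≠ 0 := fun I hI => Set.indicator_apply_ne_zero.mp hI
  have hw0 : w ≠ 0 := fun h0 => hI₁ (by
    have := congrFun h0 I₁
    rwa [hw, Set.indicator_of_mem (by exact rfl)] at this)
  obtain ⟨C, hC⟩ := exists_growth_le hg hab hv hmin hbd
  rw [← hw] at hC
  -- Within the lowest `idx`-degree, pass to the part with fewest indices up to `n₀`: there `u(κ)`
  -- acts through its truncation `κ'`.
  obtain ⟨I, hI, hminl⟩ := exists_min_degree hw0 (low n n₀)
  set ν := wt (low n n₀) I with hν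
  set wl := Set.indicator {J | wt (low n n₀) J = ν} w with hwl
  have hwls : ∀ I, wl I ≠ 0 → wt (low n n₀) I = ν ∧ w I ≠ 0 := fun I hI =>
    Set.indicator_apply_ne_zero.mp hI
  set κ : Fin (n + 1) → ℝ := fun i => (g' i).coeff 0 with hκ
  set κ' : Fin (n + 1) → ℝ := fun i => if (i : ℕ) ≤ n₀ then κ i else 0 with hκ'
  have hlowpres : ∀ i k, (1 + rowMat κ') i k ≠ 0 → low n n₀ k = low n n₀ i := by
    intro i k hik
    by_cases he : i = k
    · rw [he]
    · rw [Matrix.add_apply, Matrix.one_apply_ne he, zero_add] at hik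
      obtain ⟨rfl, -, h2⟩ := rowMat_ne_zero hik
      have hk : (k : ℕ) ≤ n₀ := by by_contra hk; exact h2 (if_neg hk)
      simp [low, hk]
  have hkill : ∀ I, wl I ≠ 0 → BlockKilled n₀ (cnt I) wl := by
    refine blockKilled_of_bounded h (κ := κ') (fun i hi hin => ?_) (fun i hi => if_neg (not_le.mpr hi))
      hslope (fun J hJ => (hws J (hwls J hJ).2).1) (C := C) fun J hJ => hC J ?_
    · rw [hκ']
      simp only [hin, if_true]
      exact hg.ne i hi
    · obtain ⟨J', h1, h2⟩ := exists_of_mulVec_ne_zero hJ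
      rwa [tpow_one_add_rowMat_apply_low hminl
        ((wt_eq_of_tpow_ne_zero hlowpres h1).symm.trans (hwls J' h2).1)]
  have hIl : wl I ≠ 0 := Set.indicator_apply_ne_zero.mpr ⟨rfl, hI⟩
  have hpart : wpart (cnt I) wl = wpart (cnt I) v' :=
    (wpart_indicator_wt rfl).trans (wpart_indicator_wt (hws I hI).1)
  refine ⟨I, (hws I hI).2, fun i hi hin => ?_, fun j hj hgrow => ?_⟩
  · rw [← hpart]; exact hkill I hIl i hi hin
  · rw [Killed, ← hpart]
    exact high_killed h hg.ne (fun J hJ => (hws J hJ).1) hminl hC hwl hkill hIl hj hgrow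

/-- If some weight component of every limit of bounded vectors is bounded and fixed, then all limits
of bounded vectors are fixed. -/
theorem fixed_of_step {c : Ω → ℝ} {S : Set (Matrix (Fin (n + 1)) (Fin (n + 1)) ℝ)}
    (step : ∀ (v : Ω → (Fin D → Fin (n + 1)) → ℝ) (v' : (Fin D → Fin (n + 1)) → ℝ),
      Tendsto v l (𝓝 v') → v' ≠ 0 → ∀ M : ℝ,
      (∀ᶠ ω in l, ShrinkBound (A ω) (c ω) (g ω) a b (v ω) M) →
      ∃ I, v' I ≠ 0 ∧ (∀ x ∈ S, (tpow D x).mulVec (wpart (cnt I) v') = wpart (cnt I) v') ∧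
        ∃ M' : ℝ, ∀ᶠ ω in l, ShrinkBound (A ω) (c ω) (g ω) a b (wpart (cnt I) v') M')
    (v : Ω → (Fin D → Fin (n + 1)) → ℝ) (v' : (Fin D → Fin (n + 1)) → ℝ)
    (hv : Tendsto v l (𝓝 v')) (M : ℝ)
    (hbd : ∀ᶠ ω in l, ShrinkBound (A ω) (c ω) (g ω) a b (v ω) M) :
    ∀ x ∈ S, (tpow D x).mulVec v' = v' := by
  classical
  -- Induction on the support of the limit. The component found by `step` is subtracted both from
  -- the limit and from the family; it is fixed, and its own bounded trajectory keeps the difference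
  -- bounded.
  induction hN : (Finset.univ.filter fun I => v' I ≠ 0).card using Nat.strong_induction_on
    generalizing v v' M with
  | _ N ih =>
  by_cases h0 : v' = 0
  · intro x _; rw [h0, Matrix.mulVec_zero]
  obtain ⟨I, hI, hfix, M', hM'⟩ := step v v' hv h0 M hbd
  intro x hx
  have hlt : (Finset.univ.filter fun J => (v' - wpart (cnt I) v') J ≠ 0).card < N := by
    rw [← hN]
    refine Finset.card_lt_card (Finset.ssubset_iff_of_subset ?_ |>.mpr ⟨I, by simpa using hI, ?_⟩)
    · intro J hJ
      rw [Finset.mem_filter] at hJ ⊢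
      refine ⟨Finset.mem_univ _, fun hJ0 => hJ.2 ?_⟩
      rw [Pi.sub_apply, hJ0, wpart, Set.indicator_apply, hJ0, ite_self, sub_zero]
    · rw [Finset.mem_filter, not_and, not_not]
      intro _
      rw [Pi.sub_apply, wpart, Set.indicator_of_mem (by exact rfl), sub_self]
  have := ih _ hlt (fun ω => v ω - wpart (cnt I) v') (v' - wpart (cnt I) v')
    (hv.sub tendsto_const_nhds) (M + M') (by
      filter_upwards [hbd, hM'] with ω h1 h2
      exact h1.sub h2) rfl x hx
  rw [Matrix.mulVec_sub, hfix x hx, sub_left_inj] at this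
  exact this

theorem fixed_of_scale [l.NeBot] (h : Regime l n n₀ A t L) (hg : CurveFamily l K g g') (hab : a < b)
    (hL : Tendsto L l atTop)
    {v : Ω → (Fin D → Fin (n + 1)) → ℝ} {v' : (Fin D → Fin (n + 1)) → ℝ}
    (hv : Tendsto v l (𝓝 v')) {M : ℝ}
    (hbd : ∀ᶠ ω in l, ShrinkBound (A ω) (t ω - L ω) (g ω) a b (v ω) M)
    {x : Matrix.SpecialLinearGroup (Fin (n + 1)) ℝ} (hx : x ∈ subgroupG n n₀) :
    (tpow D x.1).mulVec v' = v' := by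
  refine fixed_of_step (S := Subtype.val '' (subgroupG n n₀ : Set (Matrix.SpecialLinearGroup (Fin (n + 1)) ℝ))) ?_ v v' hv M hbd x.1
    ⟨x, hx, rfl⟩
  intro v v' hv hv' M hbd
  obtain ⟨I, hI, hBK, hhigh⟩ := exists_blockKilled h hg hab
    (fun i hi _ => h.tendsto_slope_of_scale hL hi) hv hv' hbd
  -- The growth rate `(n - j) t + j L - A j` is eventually at least `L`, even for `j = n`.
  have hhigh' : ∀ j : Fin (n + 1), n₀ < (j : ℕ) → Killed (wpart (cnt I) v') 0 j := fun j hj => by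
    refine hhigh j hj (tendsto_atTop_mono' l ?_ hL)
    filter_upwards [h.top.eventually_ge_atTop 0] with ω ht
    have hj0 : j ≠ 0 := by rintro rfl; simp at hj
    have h1 := h.nonpos ω j hj0
    have h2 := idx_pos hj0
    have h3 : idx j ≤ n := by
      unfold idx; exact_mod_cast Nat.lt_succ_iff.mp j.2
    have h4 := h.nonneg ω
    have h5 := h.zero ω
    nlinarith
  have hall : ∀ i : Fin (n + 1), i ≠ 0 → Killed (wpart (cnt I) v') 0 i := fun i hi => by
    by_cases hin : (i : ℕ) ≤ n₀
    · exact (hBK i hi hin).1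
    · exact hhigh' i (not_le.mp hin)
  refine ⟨I, hI, ?_, (1 + 0) ^ D * ∑ J, Real.exp 1 * |wpart (cnt I) v' J|, ?_⟩
  · rintro _ ⟨x, hx, rfl⟩
    exact tpow_eq_self_of_mem_subgroupG hBK hI hx fun j hj _ => hhigh' j hj
  · filter_upwards [h.abs_exp_mul_le (χ := cnt I) (u := wpart (cnt I) v') (fun i hi => hBK.eq hI hi)
      (fun J hJ => (wpart_ne_zero hJ).1)] with ω hω η _ J
    -- All `E_{0i}` annihilate the component, so no exceptional index is needed; `j = 0` is a dummy,
    -- where the curve vanishes.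
    refine abs_tpow_diagRow_le (j := 0) (B := 0) (fun i hi _ => hall i hi) ?_ hω J
    simp [curveVec, hg.zero ω]

theorem eventually_abs_eval {p : ℝ[X]} (hp : p.coeff 0 ≠ 0) (ha : 0 ≤ a)
    (ht : Tendsto t l atTop) :
    ∀ᶠ ω in l, ∀ η ∈ Set.Icc a b, |p.coeff 0| / 2 ≤ |p.eval (Real.exp (-t ω) * η)| ∧
      |p.eval (Real.exp (-t ω) * η)| ≤ 2 * |p.coeff 0| := by
  have hpos := abs_pos.mpr hp
  have hcont : Tendsto (fun y => |p.eval y|) (𝓝 0) (𝓝 |p.coeff 0|) := by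
    rw [Polynomial.coeff_zero_eq_eval_zero]
    exact p.continuous.abs.tendsto 0
  obtain ⟨δ, hδ, hball⟩ := Metric.eventually_nhds_iff.mp
    ((hcont.eventually_const_le (half_lt_self hpos)).and
      (hcont.eventually_le_const (by linarith : |p.coeff 0| < 2 * |p.coeff 0|)))
  have hexp : Tendsto (fun ω => Real.exp (-t ω) * b) l (𝓝 0) := by
    simpa using (Real.tendsto_exp_atBot.comp (tendsto_neg_atTop_atBot.comp ht)).mul_const b
  filter_upwards [hexp.eventually_lt_const hδ] with ω hω η hη
  refine hball ?_
  rw [Real.dist_eq, sub_zero, abs_of_nonneg (mul_nonneg (Real.exp_pos _).le (ha.trans hη.1))]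
  exact (mul_le_mul_of_nonneg_left hη.2 (Real.exp_pos _).le).trans_lt hω

theorem exp_mul_curveVec_last (g : Fin (n + 1) → ℝ[X]) (t η : ℝ) :
    Real.exp (n * t) * curveVec g (Real.exp (-t) * η) (Fin.last n) =
      η ^ n * (g (Fin.last n)).eval (Real.exp (-t) * η) := by
  rw [curveVec, Fin.val_last, mul_pow, ← Real.exp_nat_mul, ← mul_assoc, ← mul_assoc, ← Real.exp_add,
    show (n : ℝ) * t + n * -t = 0 by ring, Real.exp_zero, one_mul]

/-- At scale one `E_{0n}` grows only at the rate `-A n`, which tends to `0` when `n₀ < n`, so it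
need not annihilate anything. Elements of `Q` do not involve it, and in the trajectory its
coefficient `exp (A 0 - A n) R_n` stays bounded. -/
theorem fixed_of_gap_of_lt [l.NeBot] (h : Regime l n n₀ A t fun _ => 0)
    (hg : CurveFamily l K (fun _ => g') g') (ha : 0 < a) (hab : a < b) (hn₀ : n₀ < n)
    {i₁ : Fin (n + 1)} (hi₁ : (i₁ : ℕ) = 1)
    (hgap : Tendsto (fun ω => A ω (Fin.last n) - A ω i₁) l atTop)
    {v : Ω → (Fin D → Fin (n + 1)) → ℝ} {v' : (Fin D → Fin (n + 1)) → ℝ}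
    (hv : Tendsto v l (𝓝 v')) {M : ℝ}
    (hbd : ∀ᶠ ω in l, ShrinkBound (A ω) (t ω) g' a b (v ω) M)
    {x : Matrix.SpecialLinearGroup (Fin (n + 1)) ℝ} (hx : x ∈ subgroupQn n n₀) :
    (tpow D x.1).mulVec v' = v' := by
  have hn : 1 ≤ n := h.one_le.trans h.le
  have hl := last_ne_zero' hn
  refine fixed_of_step (S := Subtype.val '' (subgroupQn n n₀ : Set (Matrix.SpecialLinearGroup (Fin (n + 1)) ℝ))) ?_ v v' hv M hbd x.1
    ⟨x, hx, rfl⟩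
  intro v v' hv hv' M hbd
  obtain ⟨I, hI, hBK, hhigh⟩ := exists_blockKilled h hg hab
    (fun i hi hin => h.tendsto_slope_of_gap hi₁ hgap hi (by
      rintro rfl; rw [Fin.val_last] at hin; omega)) hv hv' (by simpa only [sub_zero] using hbd)
  have hhigh' : ∀ j : Fin (n + 1), n₀ < (j : ℕ) → j ≠ Fin.last n →
      Killed (wpart (cnt I) v') 0 j := fun j hj hjl => by
    refine hhigh j hj (tendsto_atTop_mono' l ?_ h.top)
    filter_upwards [h.top.eventually_ge_atTop 0] with ω ht
    have hj0 : j ≠ 0 := by rintro rfl; simp at hj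
    have h1 := h.nonpos ω j hj0
    have h3 : idx j + 1 ≤ n := by
      unfold idx; exact_mod_cast Fin.val_lt_last hjl
    have h5 := h.zero ω
    simp only [sub_zero]
    nlinarith
  have hall : ∀ i : Fin (n + 1), i ≠ 0 → i ≠ Fin.last n → Killed (wpart (cnt I) v') 0 i :=
    fun i hi hil => by
      by_cases hin : (i : ℕ) ≤ n₀
      · exact (hBK i hi hin).1
      · exact hhigh' i (not_le.mp hin) hil
  refine ⟨I, hI, ?_, (1 + Real.exp 1 * (b ^ n * (2 * |(g' (Fin.last n)).coeff 0|))) ^ D * 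
    ∑ J, Real.exp 1 * |wpart (cnt I) v' J|, ?_⟩
  · rintro _ ⟨x, hx, rfl⟩
    refine tpow_eq_self_of_mem_subgroupG hBK hI hx.2 fun j hj ⟨i, hi, hne⟩ => hhigh' j hj ?_
    rintro rfl
    apply hne
    rw [hx.1 i, Matrix.one_apply_ne]
    rintro rfl
    omega
  · have hnull := (h.null (Fin.last n) (by rwa [Fin.val_last])).eventually_const_le
      (by norm_num : (-1 : ℝ) < 0)
    filter_upwards [h.abs_exp_mul_le (χ := cnt I) (u := wpart (cnt I) v') (fun i hi => hBK.eq hI hi)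
      (fun J hJ => (wpart_ne_zero hJ).1), hnull,
      eventually_abs_eval (hg.ne _ hl) ha.le h.top] with ω hω hA heval η hη J
    refine abs_tpow_diagRow_le (j := Fin.last n)
      (B := Real.exp 1 * (b ^ n * (2 * |(g' (Fin.last n)).coeff 0|))) hall ?_ hω J
    have hη0 : 0 ≤ η := ha.le.trans hη.1
    rw [sub_eq_neg_add, Real.exp_add, mul_assoc, h.zero ω, exp_mul_curveVec_last, abs_mul,
      abs_of_pos (Real.exp_pos _), abs_mul, abs_of_nonneg (pow_nonneg hη0 n)]
    exact mul_le_mul (Real.exp_le_exp.mpr (by linarith)) (mul_le_mul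
      (pow_le_pow_left₀ hη0 hη.2 n) (heval η hη).2 (abs_nonneg _)
      (pow_nonneg (ha.trans hab).le n)) (by positivity) (Real.exp_pos _).le

/-- `exists_killed_of_gap` applies to the lowest-degree component. Boundedness of the trajectory of
the resulting weight component needs `exp (A 0) R_n ≈ κ_n η^n` bounded away from `0`; this is where
`0 < a` enters. -/
theorem fixed_of_gap_of_eq [l.NeBot] (h : Regime l n n A t fun _ => 0)
    (hg : CurveFamily l K (fun _ => g') g') (ha : 0 < a) (hab : a < b)
    {i₁ : Fin (n + 1)} (hi₁ : (i₁ : ℕ) = 1)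
    (hgap : Tendsto (fun ω => A ω (Fin.last n) - A ω i₁) l atTop)
    {v : Ω → (Fin D → Fin (n + 1)) → ℝ} {v' : (Fin D → Fin (n + 1)) → ℝ}
    (hv : Tendsto v l (𝓝 v')) {M : ℝ}
    (hbd : ∀ᶠ ω in l, ShrinkBound (A ω) (t ω) g' a b (v ω) M)
    {x : Matrix.SpecialLinearGroup (Fin (n + 1)) ℝ} (hx : x ∈ subgroupQ n) :
    (tpow D x.1).mulVec v' = v' := by
  have hn : 1 ≤ n := h.one_le
  have hl := last_ne_zero' hn
  refine fixed_of_step (S := Subtype.val '' (subgroupQ n : Set (Matrix.SpecialLinearGroup (Fin (n + 1)) ℝ))) ?_ v v' hv M hbd x.1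
    ⟨x, hx, rfl⟩
  intro v v' hv hv' M hbd
  obtain ⟨I₁, hI₁, hmin⟩ := exists_min_degree hv' idx
  set w := Set.indicator {J | wt idx J = wt idx I₁} v' with hw
  have hws : ∀ I, w I ≠ 0 → wt idx I = wt idx I₁ ∧ v' I ≠ 0 := fun I hI =>
    Set.indicator_apply_ne_zero.mp hI
  have hw0 : w ≠ 0 := fun h0 => hI₁ (by
    have := congrFun h0 I₁
    rwa [hw, Set.indicator_of_mem (by exact rfl)] at this)
  obtain ⟨C, hC⟩ := exists_growth_le hg hab hv hmin hbd
  obtain ⟨I, hIw, hBK, hlast⟩ := exists_killed_of_gap h hi₁ hgap hg.ne hw0 (fun J hJ => (hws J hJ).1)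
    hC
  have hpart : wpart (cnt I) w = wpart (cnt I) v' := wpart_indicator_wt (hws I hIw).1
  have hI := (hws I hIw).2
  have hBK' : BlockKilled (n - 1) (cnt I) v' := fun i hi hin => by
    rw [← hpart]; exact hBK i hi hin
  have h0 : Killed (wpart (cnt I) v') (Fin.last n) 0 := by
    rw [Killed, ← hpart]; exact hlast
  refine ⟨I, hI, ?_, (1 + max (b ^ n * (2 * |(g' (Fin.last n)).coeff 0|))
    (a ^ n * (|(g' (Fin.last n)).coeff 0| / 2))⁻¹) ^ D * ∑ J, |wpart (cnt I) v' J|, ?_⟩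
  · rintro _ ⟨x, hx, rfl⟩
    exact tpow_eq_self_of_mem_subgroupQ hn hBK' hI h0 hx
  · have hκ := abs_pos.mpr (hg.ne _ hl)
    have hb : 0 < b := ha.trans hab
    filter_upwards [eventually_abs_eval (hg.ne _ hl) ha.le h.top] with ω heval η hη J
    have hη0 : 0 < η := ha.trans_le hη.1
    obtain ⟨h1, h2⟩ := heval η hη
    have e1 : |Real.exp (A ω 0) * curveVec g' (Real.exp (-t ω) * η) (Fin.last n)| =
        η ^ n * |(g' (Fin.last n)).eval (Real.exp (-t ω) * η)| := by
      rw [h.zero ω, exp_mul_curveVec_last, abs_mul, abs_of_pos (pow_pos hη0 n)]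
    have hlow : a ^ n * (|(g' (Fin.last n)).coeff 0| / 2) ≤
        |Real.exp (A ω 0) * curveVec g' (Real.exp (-t ω) * η) (Fin.last n)| := by
      rw [e1]
      exact mul_le_mul (pow_le_pow_left₀ ha.le hη.1 n) h1 (by positivity) (by positivity)
    have hlow0 : 0 < a ^ n * (|(g' (Fin.last n)).coeff 0| / 2) := by positivity
    refine abs_tpow_diagRow_le_of_last (u := wpart (cnt I) v') hn (h.sum ω) (χ := cnt I) (fun i hi => hBK'.eq hI hi)
      (fun J hJ => (wpart_ne_zero hJ).1) (fun i hi hil => (hBK' i hi ?_).1) h0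
      (B := max (b ^ n * (2 * |(g' (Fin.last n)).coeff 0|))
        (a ^ n * (|(g' (Fin.last n)).coeff 0| / 2))⁻¹) ?_ (h.nonpos ω _ hl) ?_ ?_ J
    · have := Fin.val_lt_last hil
      omega
    · intro h3
      rw [h3, mul_zero, abs_zero] at hlow
      linarith
    · refine le_max_of_le_left ?_
      rw [e1]
      exact mul_le_mul (pow_le_pow_left₀ hη0.le hη.2 n) h2 (abs_nonneg _) (by positivity)
    · exact le_max_of_le_right (inv_anti₀ hlow0 hlow)

end Core

end ShrinkingCurves

namespace ShrinkingCurves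

/-! ### Continuous unipotent one-parameter groups are polynomial. -/

section Unipotent

open Polynomial

variable {d : Type*} [Fintype d] [DecidableEq d]

/-- Polynomials taking the values `k choose j` at the natural numbers `k`. -/
theorem exists_polynomial_choose (j : ℕ) : ∃ p : ℝ[X], ∀ k : ℕ, p.eval (k : ℝ) = k.choose j := by
  refine ⟨C ((j.factorial : ℝ)⁻¹) * descPochhammer ℝ j, fun k => ?_⟩
  rw [Polynomial.eval_mul, Polynomial.eval_C, descPochhammer_eval_eq_descFactorial,
    Nat.descFactorial_eq_factorial_mul_choose]
  push_cast
  rw [inv_mul_cancel_left₀ (by positivity)]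

theorem one_add_pow_eq_of_nilpotent {N : Matrix d d ℝ} {m : ℕ} (hN : N ^ m = 0) (k : ℕ) :
    (N + 1) ^ k = ∑ j ∈ Finset.range m, (k.choose j : ℝ) • N ^ j := by
  have h1 : (N + 1) ^ k = ∑ j ∈ Finset.range (k + 1), (k.choose j : ℝ) • N ^ j := by
    rw [(Commute.one_right N).add_pow]
    refine Finset.sum_congr rfl fun j _ => ?_
    rw [one_pow, mul_one, ← Nat.cast_comm, ← nsmul_eq_mul, Nat.cast_smul_eq_nsmul]
  have h2 : ∀ a b : ℕ, (∀ j, a ≤ j → (k.choose j : ℝ) • N ^ j = 0) →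
      ∑ j ∈ Finset.range a, (k.choose j : ℝ) • N ^ j =
        ∑ j ∈ Finset.range (a + b), (k.choose j : ℝ) • N ^ j := fun a b h => by
    refine Finset.sum_subset (Finset.range_mono (Nat.le_add_right a b)) fun j _ hj => h j ?_
    simpa using hj
  rw [h1, h2 (k + 1) m fun j hj => by
    rw [Nat.choose_eq_zero_of_lt hj, Nat.cast_zero, zero_smul], h2 m (k + 1) fun j hj => by
    rw [pow_eq_zero_of_le hj hN, smul_zero], add_comm m]

variable {U : ℝ → Matrix d d ℝ}

/-- The characteristic polynomial of `U (a² s)` does not depend on `a > 0`, and as `a → 0` it tends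
to that of the identity. Cayley–Hamilton concludes. -/
theorem sub_one_pow_eq_zero (hU : Continuous U) (h0 : U 0 = 1)
    (hconj : ∀ s a : ℝ, 0 < a → ∃ T T' : Matrix d d ℝ, T * T' = 1 ∧ U (a ^ 2 * s) = T * U s * T')
    (s : ℝ) : (U s - 1) ^ Fintype.card d = 0 := by
  have hdet : ∀ x : ℝ, (Matrix.scalar d x - U s).det = (x - 1) ^ Fintype.card d := by
    intro x
    have h1 : ∀ a : ℝ, 0 < a → (Matrix.scalar d x - U (a ^ 2 * s)).det = (Matrix.scalar d x - U s).det := by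
      intro a ha
      obtain ⟨T, T', hT, hTU⟩ := hconj s a ha
      have : Matrix.scalar d x - U (a ^ 2 * s) = T * (Matrix.scalar d x - U s) * T' := by
        have hc := (Matrix.scalar_commute x (fun _ => Commute.all _ _) T).eq
        rw [hTU, mul_sub, sub_mul, ← hc, mul_assoc _ T T', hT, mul_one]
      rw [this, Matrix.det_mul, Matrix.det_mul, mul_right_comm, ← Matrix.det_mul, hT,
        Matrix.det_one, one_mul]
    have h2 : Tendsto (fun a : ℝ => (Matrix.scalar d x - U (a ^ 2 * s)).det) (𝓝[>] 0)
        (𝓝 (Matrix.scalar d x - U (0 ^ 2 * s)).det) := by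
      have hc : Continuous fun a : ℝ => (Matrix.scalar d x - U (a ^ 2 * s)).det :=
        (continuous_const.sub (hU.comp (by fun_prop))).matrix_det
      exact (hc.tendsto 0).mono_left nhdsWithin_le_nhds
    have h3 : Tendsto (fun a : ℝ => (Matrix.scalar d x - U (a ^ 2 * s)).det) (𝓝[>] 0)
        (𝓝 (Matrix.scalar d x - U s).det) :=
      tendsto_const_nhds.congr' (eventually_nhdsWithin_of_forall fun a ha => (h1 a ha).symm)
    rw [tendsto_nhds_unique h3 h2]
    have : (0 : ℝ) ^ 2 * s = 0 := by simp
    rw [this, h0, ← map_one (Matrix.scalar d), ← map_sub, Matrix.scalar_apply, Matrix.det_diagonal]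
    simp
  have hchar : (U s).charpoly = (X - 1) ^ Fintype.card d := by
    refine Polynomial.funext fun x => ?_
    rw [Matrix.eval_charpoly, hdet]
    simp
  have := Matrix.aeval_self_charpoly (U s)
  rw [hchar] at this
  simpa using this

/-- A continuous one-parameter group whose elements are conjugate to those arbitrarily close to the
identity is polynomial. -/
theorem exists_polynomial_of_conj (hU : Continuous U) (hadd : ∀ s t, U (s + t) = U s * U t)
    (h0 : U 0 = 1)
    (hconj : ∀ s a : ℝ, 0 < a → ∃ T T' : Matrix d d ℝ, T * T' = 1 ∧ U (a ^ 2 * s) = T * U s * T') :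
    ∃ P : d → d → ℝ[X], ∀ s a b, U s a b = (P a b).eval s := by
  have hpow : ∀ (h : ℝ) (k : ℕ), U (k * h) = U h ^ k := by
    intro h k
    induction k with
    | zero => simp [h0]
    | succ k ih => rw [Nat.cast_succ, add_mul, one_mul, hadd, ih, pow_succ]
  -- Since `U h - 1` is nilpotent, the binomial expansion of `U h ^ k` has boundedly many terms,
  -- each polynomial in `k`.
  have hpoly : ∀ h : ℝ, ∃ P : d → d → ℝ[X], ∀ (k : ℕ) a b, U (k * h) a b = (P a b).eval (k : ℝ) := by
    intro h
    choose q hq using exists_polynomial_choose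
    refine ⟨fun a b => ∑ j ∈ Finset.range (Fintype.card d), q j * C (((U h - 1) ^ j) a b),
      fun k a b => ?_⟩
    have := one_add_pow_eq_of_nilpotent (sub_one_pow_eq_zero hU h0 hconj h) k
    rw [sub_add_cancel] at this
    rw [hpow, this, Matrix.sum_apply, Polynomial.eval_finsetSum]
    refine Finset.sum_congr rfl fun j _ => ?_
    rw [Polynomial.eval_mul, Polynomial.eval_C, hq, Matrix.smul_apply, smul_eq_mul]
  choose Q hQ using hpoly
  -- The polynomials for the steps `1` and `1 / m` agree, after rescaling, at infinitely many
  -- integers. Continuity then extends the formula from nonnegative rationals to nonnegative reals.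
  have hrat : ∀ (k m : ℕ), 0 < m → ∀ a b, U (k / m) a b = (Q 1 a b).eval ((k : ℝ) / m) := by
    intro k m hm a b
    have hm' : (m : ℝ) ≠ 0 := by exact_mod_cast hm.ne'
    have h1 : (Q (1 / m) a b).comp (C (m : ℝ) * X) = Q 1 a b := by
      refine Polynomial.eq_of_infinite_eval_eq _ _ (Set.infinite_of_injective_forall_mem
        (f := fun k : ℕ => (k : ℝ)) Nat.cast_injective fun k => ?_)
      have h2 := hQ (1 / m) (m * k) a b
      rw [Set.mem_ofPred_eq, Polynomial.eval_comp, ← hQ 1 k a b]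
      simp only [Polynomial.eval_mul, Polynomial.eval_C, Polynomial.eval_X]
      have h3 : ((m * k : ℕ) : ℝ) * (1 / m) = k * 1 := by
        push_cast
        field_simp
      rw [← Nat.cast_mul, ← h2, h3]
    have h2 := hQ (1 / m) k a b
    rw [mul_one_div] at h2
    rw [h2, ← h1, Polynomial.eval_comp]
    simp only [Polynomial.eval_mul, Polynomial.eval_C, Polynomial.eval_X]
    rw [mul_div_cancel₀ _ hm']
  have hcont : ∀ a b, Continuous fun s => U s a b := fun a b => hU.matrix_elem a b
  have hpos : ∀ s : ℝ, 0 ≤ s → ∀ a b, U s a b = (Q 1 a b).eval s := by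
    intro s hs a b
    have h1 : Tendsto (fun m : ℕ => ((⌊s * m⌋₊ : ℕ) : ℝ) / m) atTop (𝓝 s) :=
      (tendsto_nat_floor_mul_div_atTop hs).comp tendsto_natCast_atTop_atTop
    have h2 := ((hcont a b).tendsto s).comp h1
    have h3 := ((Q 1 a b).continuous.tendsto s).comp h1
    refine tendsto_nhds_unique h2 (h3.congr' ?_)
    filter_upwards [eventually_gt_atTop 0] with m hm
    exact (hrat _ m hm a b).symm
  refine ⟨Q 1, fun s a b => ?_⟩
  obtain ⟨r, hr⟩ := exists_nat_ge (-s)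
  -- For negative `s`, write `U s = U (-r) U (s + r)` with `s + r ≥ 0`; the resulting polynomial
  -- agrees with `Q 1` at all natural numbers, hence everywhere.
  set R : ℝ[X] := ∑ c, C (U (-r) a c) * (Q 1 c b).comp (X + C (r : ℝ)) with hR
  have hRe : ∀ y : ℝ, 0 ≤ y + r → U y a b = R.eval y := by
    intro y hy
    have : y = -r + (y + r) := by ring
    rw [this, hadd, Matrix.mul_apply, ← this, hR, Polynomial.eval_finsetSum]
    refine Finset.sum_congr rfl fun c _ => ?_
    rw [Polynomial.eval_mul, Polynomial.eval_C, Polynomial.eval_comp, hpos _ hy]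
    simp
  have hRQ : R = Q 1 a b := by
    refine Polynomial.eq_of_infinite_eval_eq _ _ (Set.infinite_of_injective_forall_mem
        (f := fun k : ℕ => (k : ℝ)) Nat.cast_injective fun k => ?_)
    rw [Set.mem_ofPred_eq, ← hRe k (by positivity), hpos k (by positivity)]
  rw [hRe s (by linarith), hRQ]

end Unipotent

/-! ### Continuous homomorphisms are polynomial on root subgroups. -/

section Transvection

open Polynomial Matrix.SpecialLinearGroup

variable {ι d : Type*} [Fintype ι] [DecidableEq ι] [Fintype d] [DecidableEq d]

/-- A homomorphism that is polynomial on every root subgroup. -/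
def PolynomialOnRoots (ρ : Matrix.SpecialLinearGroup ι ℝ →* Matrix d d ℝ) : Prop :=
  ∀ (i j : ι) (h : i ≠ j), ∃ P : d → d → ℝ[X], ∀ s a b,
    ρ (transvection h s) a b = (P a b).eval s

theorem polynomialOnRoots_of_continuous {ρ : Matrix.SpecialLinearGroup ι ℝ →* Matrix d d ℝ}
    (hρ : Continuous ρ) : PolynomialOnRoots ρ := by
  intro i j h
  have hadd : ∀ s t : ℝ, transvection h (s + t) = transvection h s * transvection h t := fun s t =>
    Subtype.ext (Matrix.transvection_mul_transvection_same _ _ h s t).symm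
  refine exists_polynomial_of_conj (U := fun s => ρ (transvection h s)) ?_
    (fun s t => by rw [hadd, map_mul]) ?_ fun s a ha => ?_
  · refine hρ.comp (Continuous.subtype_mk ?_ _)
    change Continuous fun s : ℝ => (1 : Matrix ι ι ℝ) + Matrix.single i j s
    refine continuous_const.add (continuous_matrix fun k l => ?_)
    simp only [Matrix.single_apply]
    split_ifs
    · exact continuous_id
    · exact continuous_const
  · have : transvection h (0 : ℝ) = 1 := Subtype.ext (Matrix.transvection_zero i j)
    rw [this, map_one]
  -- Conjugation by this diagonal element multiplies the parameter of the transvection by `a²`.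
  · refine ⟨ρ (diag2n h a ha.ne'), ρ (diag2n h a ha.ne')⁻¹, by rw [← map_mul, mul_inv_cancel, map_one],
      ?_⟩
    rw [← map_mul, ← map_mul]
    congr 1
    rw [eq_mul_inv_iff_mul_eq]
    refine Subtype.ext ?_
    rw [Matrix.SpecialLinearGroup.coe_mul, Matrix.SpecialLinearGroup.coe_mul, diag2n_coe]
    ext k l
    have hT : ∀ c : ℝ, (transvection h c).1 = 1 + Matrix.single i j c := fun c => rfl
    rw [hT, hT, Matrix.mul_diagonal, Matrix.diagonal_mul, Matrix.add_apply, Matrix.add_apply,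
      Matrix.one_apply, Matrix.single_apply, Matrix.single_apply]
    by_cases hkl : k = l
    · subst hkl
      have : ¬ (i = k ∧ j = k) := fun hh => h (hh.1.trans hh.2.symm)
      rw [if_neg this, if_neg this, add_zero]
      ring
    · by_cases hh : i = k ∧ j = l
      · obtain ⟨rfl, rfl⟩ := hh
        simp only [if_neg hkl, and_self, if_true, if_neg (Ne.symm hkl)]
        field_simp
        ring
      · rw [if_neg hkl, if_neg hh, if_neg hh]
        ring

end Transvection

end ShrinkingCurves

namespace ShrinkingCurves

/-! ### Families of matrices with entries in an algebra of functions; denominators. -/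

section Entries

variable {X d : Type*} [Fintype d] [DecidableEq d]

/-- All matrix entries of the family `F` belong to the function algebra `𝒜`. -/
def EntriesIn (𝒜 : Subalgebra ℝ (X → ℝ)) (F : X → Matrix d d ℝ) : Prop :=
  ∀ a b, (fun x => F x a b) ∈ 𝒜

variable {𝒜 : Subalgebra ℝ (X → ℝ)} {F F' : X → Matrix d d ℝ}

theorem const_mem_functions (c : ℝ) : (fun _ : X => c) ∈ 𝒜 := 𝒜.algebraMap_mem c

theorem sum_mem_functions {β : Type*} {s : Finset β} {f : β → X → ℝ} (h : ∀ b ∈ s, f b ∈ 𝒜) :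
    (fun x => ∑ b ∈ s, f b x) ∈ 𝒜 := by
  have := 𝒜.sum_mem h
  rwa [← Finset.sum_fn] at *

theorem EntriesIn.mul (h : EntriesIn 𝒜 F) (h' : EntriesIn 𝒜 F') :
    EntriesIn 𝒜 fun x => F x * F' x := fun a b => by
  simp only [Matrix.mul_apply]
  exact sum_mem_functions fun c _ => 𝒜.mul_mem (h a c) (h' c b)

theorem entriesIn_const (M : Matrix d d ℝ) : EntriesIn 𝒜 fun _ => M := fun a b =>
  const_mem_functions (M a b)

theorem EntriesIn.det (h : EntriesIn 𝒜 F) : (fun x => (F x).det) ∈ 𝒜 := by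
  simp only [Matrix.det_apply']
  refine sum_mem_functions fun σ _ => 𝒜.mul_mem (const_mem_functions _) ?_
  have := 𝒜.prod_mem (t := Finset.univ) (f := fun i x => F x (σ i) i) fun i _ => h (σ i) i
  convert this using 1
  ext x
  simp

theorem EntriesIn.adjugate (h : EntriesIn 𝒜 F) : EntriesIn 𝒜 fun x => (F x).adjugate := fun a b => by
  simp only [Matrix.adjugate_apply]
  refine EntriesIn.det (F := fun x => (F x).updateRow b (Pi.single a 1)) fun i j => ?_
  simp only [Matrix.updateRow_apply]
  split_ifs
  · exact const_mem_functions _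
  · exact h i j

/-- The algebra of functions `f` on `{q ≠ 0}` such that `f qᵏ` extends to an element of `𝒜`. -/
def awayAlgebra (𝒜 : Subalgebra ℝ (X → ℝ)) {q : X → ℝ} (hq : q ∈ 𝒜) :
    Subalgebra ℝ ({x // q x ≠ 0} → ℝ) where
  carrier := {f | ∃ (k : ℕ) (a : X → ℝ), a ∈ 𝒜 ∧ ∀ x : {x // q x ≠ 0}, f x * q x ^ k = a x}
  mul_mem' := by
    rintro f f' ⟨k, a, ha, h⟩ ⟨k', a', ha', h'⟩
    refine ⟨k + k', a * a', 𝒜.mul_mem ha ha', fun x => ?_⟩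
    rw [Pi.mul_apply, Pi.mul_apply, ← h, ← h', pow_add]
    ring
  add_mem' := by
    rintro f f' ⟨k, a, ha, h⟩ ⟨k', a', ha', h'⟩
    refine ⟨k + k', a * q ^ k' + a' * q ^ k, 𝒜.add_mem (𝒜.mul_mem ha (𝒜.pow_mem hq _))
      (𝒜.mul_mem ha' (𝒜.pow_mem hq _)), fun x => ?_⟩
    simp only [Pi.mul_apply, Pi.add_apply, Pi.pow_apply, ← h, ← h', pow_add]
    ring
  algebraMap_mem' := fun c => ⟨0, fun _ => c, const_mem_functions c, fun x => by simp⟩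

theorem restrict_mem_awayAlgebra {q f : X → ℝ} (hq : q ∈ 𝒜) (hf : f ∈ 𝒜) :
    (fun x : {x // q x ≠ 0} => f x) ∈ awayAlgebra 𝒜 hq :=
  ⟨0, f, hf, fun x => by simp⟩

theorem inv_mem_awayAlgebra {q : X → ℝ} (hq : q ∈ 𝒜) :
    (fun x : {x // q x ≠ 0} => (q x)⁻¹) ∈ awayAlgebra 𝒜 hq :=
  ⟨1, 1, 𝒜.one_mem, fun x => by simp [inv_mul_cancel₀ x.2]⟩

/-- The ideal of denominators of the function `f`. -/
def denominatorIdeal (𝒜 : Subalgebra ℝ (X → ℝ)) (f : X → ℝ) : Ideal 𝒜 where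
  carrier := {b | b.1 * f ∈ 𝒜}
  add_mem' := fun {a b} ha hb => by
    have := 𝒜.add_mem ha hb
    rwa [← add_mul] at this
  zero_mem' := by simp
  smul_mem' := fun c b hb => by
    have := 𝒜.mul_mem c.2 hb
    rwa [← mul_assoc] at this

/-- One extra factor `q` makes the identity `q^(k+1) f = a q` valid also on the zero set of `q`,
where nothing is known about `f`. -/
theorem mem_radical_denominatorIdeal {q f : X → ℝ} (hq : q ∈ 𝒜)
    (hf : (fun x : {x // q x ≠ 0} => f x) ∈ awayAlgebra 𝒜 hq) :
    (⟨q, hq⟩ : 𝒜) ∈ (denominatorIdeal 𝒜 f).radical := by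
  obtain ⟨k, a, ha, h⟩ := hf
  refine ⟨k + 1, ?_⟩
  change q ^ (k + 1) * f ∈ 𝒜
  have : q ^ (k + 1) * f = a * q := by
    ext x
    by_cases hx : q x = 0
    · simp [hx]
    · have := h ⟨x, hx⟩
      simp only [Pi.mul_apply, Pi.pow_apply]
      rw [← this]
      ring
  rw [this]
  exact 𝒜.mul_mem ha hq

theorem mem_of_radical_denominatorIdeal_eq_top {f : X → ℝ}
    (h : (denominatorIdeal 𝒜 f).radical = ⊤) : f ∈ 𝒜 := by
  have h1 := (Ideal.eq_top_iff_one _).mp (Ideal.radical_eq_top.mp h)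
  have h2 : (1 : X → ℝ) * f ∈ 𝒜 := h1
  rwa [one_mul] at h2

end Entries

/-! ### Gaussian elimination over an algebra of functions. -/

section Regular

open Matrix.SpecialLinearGroup (transvection)

variable {X ι d : Type*} [Fintype ι] [DecidableEq ι] [Fintype d] [DecidableEq d]
  {𝒜 : Subalgebra ℝ (X → ℝ)} {ρ : Matrix.SpecialLinearGroup ι ℝ →* Matrix d d ℝ}
  {γ : X → Matrix.SpecialLinearGroup ι ℝ}

theorem entriesIn_inv (h : EntriesIn 𝒜 fun x => (γ x).1) : EntriesIn 𝒜 fun x => ((γ x)⁻¹).1 := by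
  simp only [Matrix.SpecialLinearGroup.coe_inv]
  exact h.adjugate

theorem entriesIn_coe_mul {γ' : X → Matrix.SpecialLinearGroup ι ℝ} (h : EntriesIn 𝒜 fun x => (γ x).1)
    (h' : EntriesIn 𝒜 fun x => (γ' x).1) : EntriesIn 𝒜 fun x => (γ x * γ' x).1 := by
  simp only [Matrix.SpecialLinearGroup.coe_mul]
  exact h.mul h'

theorem entriesIn_transvection (hρ : PolynomialOnRoots ρ) {i j : ι} (h : i ≠ j) {c : X → ℝ}
    (hc : c ∈ 𝒜) : EntriesIn 𝒜 fun x => ρ (transvection h (c x)) := by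
  obtain ⟨P, hP⟩ := hρ i j h
  intro a b
  simp only [hP]
  convert (Polynomial.aeval (⟨c, hc⟩ : 𝒜) (P a b)).2 using 1
  ext x
  have h1 := Polynomial.aeval_algHom_apply 𝒜.val (⟨c, hc⟩ : 𝒜) (P a b)
  have h2 := Polynomial.aeval_algHom_apply (Pi.evalAlgHom ℝ (fun _ : X => ℝ) x) c (P a b)
  have h3 : ((Polynomial.aeval (⟨c, hc⟩ : 𝒜) (P a b)).1 : X → ℝ) = Polynomial.aeval c (P a b) :=
    h1.symm
  rw [h3]
  change _ = Pi.evalAlgHom ℝ (fun _ : X => ℝ) x (Polynomial.aeval c (P a b))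
  rw [← h2]
  exact (Polynomial.coe_aeval_eq_eval (c x) ▸ rfl)

theorem coe_transvection_entriesIn {i j : ι} (h : i ≠ j) {c : X → ℝ} (hc : c ∈ 𝒜) :
    EntriesIn 𝒜 fun x => (transvection h (c x)).1 := fun a b => by
  have h1 : ∀ x, (transvection h (c x)).1 a b =
      (1 : Matrix ι ι ℝ) a b + c x * Matrix.single i j (1 : ℝ) a b := fun x => by
    rw [Matrix.SpecialLinearGroup.transvection_coe]
    simp [Matrix.single_apply]
  simp only [h1]
  exact 𝒜.add_mem (const_mem_functions _) (𝒜.mul_mem hc (const_mem_functions _))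

theorem transvection_inv' {i j : ι} (h : i ≠ j) (c : ℝ) :
    (transvection h c)⁻¹ = transvection h (-c) :=
  inv_eq_of_mul_eq_one_right (Matrix.SpecialLinearGroup.transvection_mul_neg h c)

theorem entriesIn_of_transvection_mul (hρ : PolynomialOnRoots ρ) {i j : ι} (h : i ≠ j) {c : X → ℝ}
    (hc : c ∈ 𝒜) (hγ : EntriesIn 𝒜 fun x => ρ (transvection h (c x) * γ x)) :
    EntriesIn 𝒜 fun x => ρ (γ x) := by
  have h1 : ∀ x, ρ (γ x) = ρ (transvection h ((-c) x)) * ρ (transvection h (c x) * γ x) := fun x => by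
    rw [← map_mul, Pi.neg_apply, ← transvection_inv', inv_mul_cancel_left]
  simp only [h1]
  exact (entriesIn_transvection hρ h (𝒜.neg_mem hc)).mul hγ

/-- Unipotent elements supported on commuting roots. -/
theorem exists_unipotent_entriesIn (hρ : PolynomialOnRoots ρ) (S : Finset (ι × ι))
    (hS : ∀ p ∈ S, ∀ q ∈ S, p.2 ≠ q.1) {c : ι × ι → X → ℝ} (hc : ∀ p, c p ∈ 𝒜) :
    ∃ η : X → Matrix.SpecialLinearGroup ι ℝ,
      (∀ x, (η x).1 = 1 + ∑ p ∈ S, Matrix.single p.1 p.2 (c p x)) ∧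
      (EntriesIn 𝒜 fun x => ρ (η x)) ∧ EntriesIn 𝒜 fun x => ρ (η x)⁻¹ := by
  induction S using Finset.induction_on with
  | empty =>
    refine ⟨fun _ => 1, fun x => by simp, ?_, ?_⟩
    · exact entriesIn_const _
    · exact entriesIn_const _
  | insert q S hq ih =>
    obtain ⟨η, h1, h2, h3⟩ := ih fun p hp q' hq' =>
      hS p (Finset.mem_insert_of_mem hp) q' (Finset.mem_insert_of_mem hq')
    have hqq : q.1 ≠ q.2 := (hS q (Finset.mem_insert_self _ _) q (Finset.mem_insert_self _ _)).symm
    refine ⟨fun x => η x * transvection hqq (c q x), fun x => ?_, ?_, ?_⟩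
    · rw [Matrix.SpecialLinearGroup.coe_mul, h1, Matrix.SpecialLinearGroup.transvection_coe, mul_add,
        mul_one, add_mul, one_mul, Finset.sum_insert hq, Finset.sum_mul, Finset.sum_eq_zero (f := fun p =>
          Matrix.single p.1 p.2 (c p x) * Matrix.single q.1 q.2 (c q x)), add_zero, add_assoc,
        add_comm (∑ p ∈ S, _)]
      intro p hp
      exact Matrix.single_mul_single_of_ne _ _ _ _
        (hS p (Finset.mem_insert_of_mem hp) q (Finset.mem_insert_self _ _)) _
    · simp only [map_mul]
      exact h2.mul (entriesIn_transvection hρ hqq (hc q))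
    · simp only [mul_inv_rev, map_mul, transvection_inv']
      exact EntriesIn.mul (entriesIn_transvection hρ hqq (𝒜.neg_mem (hc q))) h3

/-- The embedding of `SL` of a block. -/
def blockHom (p : ι → Prop) [DecidablePred p] :
    Matrix.SpecialLinearGroup {i // p i} ℝ →* Matrix.SpecialLinearGroup ι ℝ where
  toFun g := ⟨blockExtend p g.1, by rw [det_blockExtend, g.2]⟩
  map_one' := Subtype.ext (by
    ext i j
    change blockExtend p 1 i j = (1 : Matrix ι ι ℝ) i j
    by_cases hi : p i
    · by_cases hj : p j
      · rw [blockExtend_apply_of_pos _ hi hj, Matrix.one_apply, Matrix.one_apply]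
        simp
      · exact blockExtend_apply_right _ hj
    · exact blockExtend_apply_left _ hi)
  map_mul' g g' := Subtype.ext (blockExtend_mul g.1 g'.1)

theorem PolynomialOnRoots.comp_blockHom (hρ : PolynomialOnRoots ρ) (p : ι → Prop) [DecidablePred p] :
    PolynomialOnRoots (ρ.comp (blockHom p)) := by
  intro i j h
  have h' : (i : ι) ≠ j := fun hh => h (Subtype.ext hh)
  obtain ⟨P, hP⟩ := hρ i j h'
  refine ⟨P, fun s a b => ?_⟩
  rw [← hP]
  have : blockHom p (transvection h s) = transvection h' s := by
    refine Subtype.ext ?_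
    ext k l
    change blockExtend p (transvection h s).1 k l = (transvection h' s).1 k l
    rw [Matrix.SpecialLinearGroup.transvection_coe, Matrix.SpecialLinearGroup.transvection_coe,
      Matrix.add_apply, Matrix.single_apply]
    by_cases hk : p k
    · by_cases hl : p l
      · rw [blockExtend_apply_of_pos _ hk hl, Matrix.add_apply, Matrix.single_apply,
          Matrix.one_apply, Matrix.one_apply]
        simp [Subtype.ext_iff]
      · rw [blockExtend_apply_right _ hl, if_neg, add_zero]
        rintro ⟨-, rfl⟩
        exact hl j.2
    · rw [blockExtend_apply_left _ hk, if_neg, add_zero]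
      rintro ⟨rfl, -⟩
      exact hk i.2
  rw [MonoidHom.comp_apply, this]

theorem blockExtend_submatrix_eq {p : ι → Prop} [DecidablePred p] {M : Matrix ι ι ℝ}
    (hr : ∀ i, ¬ p i → ∀ j, M i j = (1 : Matrix ι ι ℝ) i j)
    (hcol : ∀ j, ¬ p j → ∀ i, M i j = (1 : Matrix ι ι ℝ) i j) :
    blockExtend p (M.submatrix Subtype.val Subtype.val) = M := by
  ext i j
  by_cases hi : p i
  · by_cases hj : p j
    · rw [blockExtend_apply_of_pos _ hi hj]
      rfl
    · rw [blockExtend_apply_right _ hj, hcol j hj]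
  · rw [blockExtend_apply_left _ hi, hr i hi]

/-- With pivot `1`, clearing its column from the left and its row from the right factors `γ` as `η ν
ζ`: the outer factors are products of transvections, and `ν` comes from the smaller block, where
`ih` applies. -/
theorem entriesIn_of_pivot_eq_one (hρ : PolynomialOnRoots ρ) {i₀ : ι}
    (ih : ∀ δ : X → Matrix.SpecialLinearGroup {i // i ≠ i₀} ℝ, (EntriesIn 𝒜 fun x => (δ x).1) →
      EntriesIn 𝒜 fun x => ρ (blockHom (· ≠ i₀) (δ x)))
    (hγ : EntriesIn 𝒜 fun x => (γ x).1) (h1 : ∀ x, (γ x).1 i₀ i₀ = 1) :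
    EntriesIn 𝒜 fun x => ρ (γ x) := by
  obtain ⟨η, hη, hη1, -⟩ := exists_unipotent_entriesIn hρ ((Finset.univ.erase i₀).image (·, i₀))
    (by simp only [Finset.mem_image]; rintro _ ⟨a, -, rfl⟩ _ ⟨b, hb, rfl⟩; exact (Finset.ne_of_mem_erase hb).symm)
    (c := fun p x => (γ x).1 p.1 p.2) (fun p => hγ p.1 p.2)
  obtain ⟨ζ, hζ, hζ1, -⟩ := exists_unipotent_entriesIn hρ ((Finset.univ.erase i₀).image (i₀, ·))
    (by simp only [Finset.mem_image]; rintro _ ⟨a, ha, rfl⟩ _ ⟨b, hb, rfl⟩; exact Finset.ne_of_mem_erase ha)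
    (c := fun p x => (γ x).1 p.1 p.2) (fun p => hγ p.1 p.2)
  have hηe : ∀ x i j, (η x).1 i j = if j = i₀ then (γ x).1 i i₀ else (1 : Matrix ι ι ℝ) i j := by
    intro x i j
    rw [hη, Finset.sum_image (by simp), Matrix.add_apply, Matrix.sum_apply]
    simp only [Matrix.single_apply]
    by_cases hj : j = i₀
    · subst hj
      by_cases hi : i = j
      · subst hi
        rw [if_pos rfl, h1, Matrix.one_apply_eq, Finset.sum_eq_zero, add_zero]
        intro a ha
        rw [if_neg]
        exact fun h => Finset.ne_of_mem_erase ha h.1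
      · rw [if_pos rfl, Matrix.one_apply_ne hi, zero_add, Finset.sum_eq_single i]
        · simp
        · intro b _ hb; simp [hb]
        · intro h; exact absurd (Finset.mem_erase.mpr ⟨hi, Finset.mem_univ _⟩) h
    · rw [if_neg hj, Finset.sum_eq_zero, add_zero]
      intro a _
      rw [if_neg]
      exact fun h => hj h.2.symm
  have hζe : ∀ x i j, (ζ x).1 i j = if i = i₀ then (γ x).1 i₀ j else (1 : Matrix ι ι ℝ) i j := by
    intro x i j
    rw [hζ, Finset.sum_image (by simp), Matrix.add_apply, Matrix.sum_apply]
    simp only [Matrix.single_apply]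
    by_cases hi : i = i₀
    · subst hi
      by_cases hj : j = i
      · subst hj
        rw [if_pos rfl, h1, Matrix.one_apply_eq, Finset.sum_eq_zero, add_zero]
        intro a ha
        rw [if_neg]
        exact fun h => Finset.ne_of_mem_erase ha h.2
      · rw [if_pos rfl, Matrix.one_apply_ne (Ne.symm hj), zero_add, Finset.sum_eq_single j]
        · simp
        · intro b _ hb; simp [hb]
        · intro h; exact absurd (Finset.mem_erase.mpr ⟨hj, Finset.mem_univ _⟩) h
    · rw [if_neg hi, Finset.sum_eq_zero, add_zero]
      intro a _
      rw [if_neg]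
      exact fun h => hi h.1.symm
  have hηA : EntriesIn 𝒜 fun x => (η x).1 := fun i j => by
    simp only [hηe]
    split_ifs
    · exact hγ _ _
    · exact const_mem_functions _
  have hζA : EntriesIn 𝒜 fun x => (ζ x).1 := fun i j => by
    simp only [hζe]
    split_ifs
    · exact hγ _ _
    · exact const_mem_functions _
  set μ : X → Matrix.SpecialLinearGroup ι ℝ := fun x => (η x)⁻¹ * γ x with hμ
  set ν : X → Matrix.SpecialLinearGroup ι ℝ := fun x => μ x * (ζ x)⁻¹ with hν
  have hνA : EntriesIn 𝒜 fun x => (ν x).1 :=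
    entriesIn_coe_mul (entriesIn_coe_mul (entriesIn_inv hηA) hγ) (entriesIn_inv hζA)
  have hημ : ∀ x, (η x).1 * (μ x).1 = (γ x).1 := fun x => by
    rw [← Matrix.SpecialLinearGroup.coe_mul, hμ, mul_inv_cancel_left]
  have hνζ : ∀ x, (ν x).1 * (ζ x).1 = (μ x).1 := fun x => by
    rw [← Matrix.SpecialLinearGroup.coe_mul, hν, inv_mul_cancel_right]
  have hμr : ∀ x j, (μ x).1 i₀ j = (γ x).1 i₀ j := fun x j => by
    rw [← hημ, Matrix.mul_apply, Finset.sum_eq_single i₀]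
    · simp [hηe, h1]
    · intro b _ hb; simp [hηe, hb, Matrix.one_apply_ne hb.symm]
    · simp
  have hμc : ∀ x i, (μ x).1 i i₀ = (1 : Matrix ι ι ℝ) i i₀ := fun x i => by
    have : (1 : Matrix ι ι ℝ) = ((η x)⁻¹).1 * (η x).1 := by
      rw [← Matrix.SpecialLinearGroup.coe_mul, inv_mul_cancel]; rfl
    rw [this, hμ, Matrix.SpecialLinearGroup.coe_mul, Matrix.mul_apply, Matrix.mul_apply]
    exact Finset.sum_congr rfl fun b _ => by rw [hηe, if_pos rfl]
  have hνc : ∀ x i, (ν x).1 i i₀ = (1 : Matrix ι ι ℝ) i i₀ := fun x i => by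
    rw [← hμc x, ← hνζ, Matrix.mul_apply, Finset.sum_eq_single i₀]
    · simp [hζe, h1]
    · intro b _ hb; simp [hζe, hb, Matrix.one_apply_ne hb]
    · simp
  have hνr : ∀ x j, (ν x).1 i₀ j = (1 : Matrix ι ι ℝ) i₀ j := fun x j => by
    have : (1 : Matrix ι ι ℝ) = (ζ x).1 * ((ζ x)⁻¹).1 := by
      rw [← Matrix.SpecialLinearGroup.coe_mul, mul_inv_cancel]; rfl
    rw [this, hν, Matrix.SpecialLinearGroup.coe_mul, Matrix.mul_apply, Matrix.mul_apply]
    exact Finset.sum_congr rfl fun b _ => by rw [hζe, if_pos rfl, hμr]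
  have hblock : ∀ x, blockExtend (· ≠ i₀) ((ν x).1.submatrix Subtype.val Subtype.val) = (ν x).1 :=
    fun x => blockExtend_submatrix_eq
      (fun i hi j => by rw [not_not.mp hi]; exact hνr x j)
      (fun j hj i => by rw [not_not.mp hj]; exact hνc x i)
  set δ : X → Matrix.SpecialLinearGroup {i // i ≠ i₀} ℝ := fun x =>
    ⟨(ν x).1.submatrix Subtype.val Subtype.val, by rw [← det_blockExtend, hblock, (ν x).2]⟩ with hδ
  have hδν : ∀ x, blockHom (· ≠ i₀) (δ x) = ν x := fun x => Subtype.ext (hblock x)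
  have h2 := ih δ fun a b => hνA a b
  simp only [hδν] at h2
  have h3 : ∀ x, ρ (γ x) = ρ (η x) * ρ (ν x) * ρ (ζ x) := fun x => by
    rw [← map_mul, ← map_mul, mul_assoc, hν, inv_mul_cancel_right, hμ, mul_inv_cancel_left]
  simp only [h3]
  exact (hη1.mul h2).mul hζ1

theorem transvection_mul_apply {i j : ι} (h : i ≠ j) (c : ℝ) (g : Matrix.SpecialLinearGroup ι ℝ)
    (b : ι) : (transvection h c * g).1 i b = g.1 i b + c * g.1 j b := by
  rw [Matrix.SpecialLinearGroup.coe_mul]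
  exact Matrix.transvection_mul_apply_same _ _ b c g.1

/-- A row operation with coefficient in `𝒜` makes the pivot equal to `1`, provided the invertible
entry lies in another row. If it lies in the pivot row itself, an entry `1` is first created in the
row `j₁`. -/
theorem entriesIn_of_isUnit_entry (hρ : PolynomialOnRoots ρ) {i₀ : ι}
    (ih : ∀ δ : X → Matrix.SpecialLinearGroup {i // i ≠ i₀} ℝ, (EntriesIn 𝒜 fun x => (δ x).1) →
      EntriesIn 𝒜 fun x => ρ (blockHom (· ≠ i₀) (δ x)))
    (hγ : EntriesIn 𝒜 fun x => (γ x).1) {j₁ : ι} (hj₁ : j₁ ≠ i₀) {j₀ : ι} {u : X → ℝ} (hu : u ∈ 𝒜)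
    (h1 : ∀ x, u x * (γ x).1 j₀ i₀ = 1) :
    EntriesIn 𝒜 fun x => ρ (γ x) := by
  have key : ∀ {γ : X → Matrix.SpecialLinearGroup ι ℝ} {j : ι} {u : X → ℝ} (_ : j ≠ i₀) (_ : u ∈ 𝒜)
      (_ : EntriesIn 𝒜 fun x => (γ x).1) (_ : ∀ x, u x * (γ x).1 j i₀ = 1),
      EntriesIn 𝒜 fun x => ρ (γ x) := by
    intro γ j u hj hu hγ h1
    have hc : (fun x => (1 - (γ x).1 i₀ i₀) * u x) ∈ 𝒜 :=
      𝒜.mul_mem (𝒜.sub_mem 𝒜.one_mem (hγ _ _)) hu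
    refine entriesIn_of_transvection_mul hρ hj.symm hc (entriesIn_of_pivot_eq_one hρ ih
      (entriesIn_coe_mul (coe_transvection_entriesIn hj.symm hc) hγ) fun x => ?_)
    rw [transvection_mul_apply, mul_assoc, h1]
    ring
  by_cases hj₀ : j₀ = i₀
  · subst hj₀
    have hc : (fun x => (1 - (γ x).1 j₁ j₀) * u x) ∈ 𝒜 :=
      𝒜.mul_mem (𝒜.sub_mem 𝒜.one_mem (hγ _ _)) hu
    refine entriesIn_of_transvection_mul hρ hj₁ hc (key hj₁ 𝒜.one_mem
      (entriesIn_coe_mul (coe_transvection_entriesIn hj₁ hc) hγ) fun x => ?_)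
    rw [transvection_mul_apply, mul_assoc, h1, Pi.one_apply]
    ring
  · exact key hj₀ hu hγ h1

end Regular

/-! ### Polynomiality of matrix coefficients. -/

section Main

variable {d : Type*} [Fintype d] [DecidableEq d]

/-- A homomorphism which is polynomial on the root subgroups has polynomial matrix coefficients. -/
theorem PolynomialOnRoots.entriesIn {X ι : Type*} [Fintype ι] [DecidableEq ι]
    {𝒜 : Subalgebra ℝ (X → ℝ)} {ρ : Matrix.SpecialLinearGroup ι ℝ →* Matrix d d ℝ}
    {γ : X → Matrix.SpecialLinearGroup ι ℝ} (hρ : PolynomialOnRoots ρ)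
    (hγ : EntriesIn 𝒜 fun x => (γ x).1) : EntriesIn 𝒜 fun x => ρ (γ x) := by
  -- The domain `X` must vary in the induction, because the smaller block is treated on the locus
  -- where a pivot does not vanish.
  induction hm : Fintype.card ι generalizing X ι with
  | zero =>
    have := Fintype.card_eq_zero_iff.mp hm
    have h1 : ∀ x, γ x = 1 := fun x => Subsingleton.elim _ _
    simp only [h1]
    exact entriesIn_const _
  | succ m ih =>
    rcases subsingleton_or_nontrivial ι with hι | hι
    · have h1 : ∀ x, γ x = 1 := fun x => Subsingleton.elim _ _
      simp only [h1]
      exact entriesIn_const _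
    · obtain ⟨i₀, j₁, hij⟩ := exists_pair_ne ι
      intro a b
      refine mem_of_radical_denominatorIdeal_eq_top ((Ideal.eq_top_iff_one _).mpr ?_)
      -- Where the entry `(j, i₀)` is nonzero it is a unit of the localised algebra, so elimination
      -- applies there; a power of this entry therefore clears the denominators of the coefficient.
      have hrad : ∀ j, (⟨fun x => (γ x).1 j i₀, hγ j i₀⟩ : 𝒜) ∈
          (denominatorIdeal 𝒜 fun x => ρ (γ x) a b).radical := by
        intro j
        refine mem_radical_denominatorIdeal (hγ j i₀) ?_
        refine entriesIn_of_isUnit_entry (γ := fun x : {x // (γ x).1 j i₀ ≠ 0} => γ x) hρ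
          (fun δ hδ => ?_) (fun k l => restrict_mem_awayAlgebra _ (hγ k l)) hij.symm
          (inv_mem_awayAlgebra (hγ j i₀)) (fun x => inv_mul_cancel₀ x.2) a b
        have hcard : Fintype.card {i // i ≠ i₀} = m := by
          rw [Fintype.card_subtype_compl, hm]
          simp
        exact ih (ρ := ρ.comp (blockHom (· ≠ i₀))) (hρ.comp_blockHom (· ≠ i₀)) hδ hcard
      -- A column of an invertible matrix generates the unit ideal, so the local statements glue.
      have h1 : (1 : 𝒜) = ∑ j, (⟨fun x => ((γ x)⁻¹).1 i₀ j, entriesIn_inv hγ i₀ j⟩ : 𝒜) *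
          ⟨fun x => (γ x).1 j i₀, hγ j i₀⟩ := by
        refine Subtype.ext ?_
        ext x
        have : (((γ x)⁻¹).1 * (γ x).1) i₀ i₀ = 1 := by
          rw [← Matrix.SpecialLinearGroup.coe_mul, inv_mul_cancel]
          simp
        rw [Matrix.mul_apply] at this
        simp [← this]
      rw [h1]
      exact Ideal.sum_mem _ fun j _ => Ideal.mul_mem_left _ _ (hrad j)

end Main

end ShrinkingCurves

namespace ShrinkingCurves

/-! ### Polynomial functions on `SL` and their coefficients in tensor powers. -/

section Monomials

variable {ι : Type*} [Fintype ι] [DecidableEq ι]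

/-- The product of matrix entries prescribed by two multi-indices. -/
def entryMonomial (z : Σ D : ℕ, (Fin D → ι) × (Fin D → ι)) (g : Matrix.SpecialLinearGroup ι ℝ) : ℝ :=
  tpow z.1 g.1 z.2.1 z.2.2

/-- The pairs of multi-indices of degree less than `d`. -/
abbrev MonomialIndex (ι : Type*) (d : ℕ) : Type _ := Σ D : Fin d, (Fin D → ι) × (Fin D → ι)

/-- The linear combination of entry monomials with given coefficients. -/
def polyFun (d : ℕ) :
    EuclideanSpace ℝ (MonomialIndex ι d) →ₗ[ℝ] (Matrix.SpecialLinearGroup ι ℝ → ℝ) where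
  toFun ξ g := ∑ z : MonomialIndex ι d, entryMonomial ⟨z.1, z.2⟩ g * ξ z
  map_add' ξ ξ' := by ext g; simp [mul_add, Finset.sum_add_distrib]
  map_smul' c ξ := by ext g; simp [Finset.mul_sum, mul_left_comm]

theorem entryMonomial_mem_range {d : ℕ} (z : Σ D : ℕ, (Fin D → ι) × (Fin D → ι)) (h : z.1 < d) :
    entryMonomial z ∈ LinearMap.range (polyFun (ι := ι) d) := by
  refine ⟨EuclideanSpace.single (⟨⟨z.1, h⟩, z.2⟩ : MonomialIndex ι d) 1, ?_⟩
  ext g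
  simp only [polyFun, LinearMap.coe_mk, AddHom.coe_mk]
  rw [Finset.sum_eq_single (⟨⟨z.1, h⟩, z.2⟩ : MonomialIndex ι d)]
  · simp
  · intro b _ hb
    simp [hb]
  · simp

theorem range_polyFun_mono {d d' : ℕ} (h : d ≤ d') :
    LinearMap.range (polyFun (ι := ι) d) ≤ LinearMap.range (polyFun (ι := ι) d') := by
  rintro _ ⟨ξ, rfl⟩
  have : polyFun d ξ = ∑ z : MonomialIndex ι d, ξ z • entryMonomial ⟨z.1, z.2⟩ := by
    ext g
    simp [polyFun, mul_comm]
  rw [this]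
  exact Submodule.sum_mem _ fun z _ => Submodule.smul_mem _ _
    (entryMonomial_mem_range _ (z.1.2.trans_le h))

theorem exists_mem_range_polyFun {f : Matrix.SpecialLinearGroup ι ℝ → ℝ}
    (hf : f ∈ Algebra.adjoin ℝ (Set.range fun (p : ι × ι) (g : Matrix.SpecialLinearGroup ι ℝ) =>
      g.1 p.1 p.2)) : ∃ d, f ∈ LinearMap.range (polyFun (ι := ι) d) := by
  rw [← Subalgebra.mem_toSubmodule, Algebra.adjoin_eq_span] at hf
  induction hf using Submodule.span_induction with
  | mem f hf =>
    have : ∃ z : Σ D : ℕ, (Fin D → ι) × (Fin D → ι), entryMonomial z = f := by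
      induction hf using Submonoid.closure_induction with
      | mem f hf =>
        obtain ⟨p, rfl⟩ := hf
        refine ⟨⟨1, fun _ => p.1, fun _ => p.2⟩, ?_⟩
        ext g
        simp [entryMonomial, tpow_apply]
      | one =>
        refine ⟨⟨0, Fin.elim0, Fin.elim0⟩, ?_⟩
        ext g
        simp [entryMonomial, tpow_apply]
      | mul f f' _ _ h h' =>
        obtain ⟨⟨D, R, I⟩, rfl⟩ := h
        obtain ⟨⟨D', R', I'⟩, rfl⟩ := h'
        refine ⟨⟨D + D', Fin.append R R', Fin.append I I'⟩, ?_⟩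
        ext g
        simp [entryMonomial, tpow_apply, Fin.prod_univ_add]
    obtain ⟨z, rfl⟩ := this
    exact ⟨z.1 + 1, entryMonomial_mem_range z (Nat.lt_succ_self _)⟩
  | zero => exact ⟨0, Submodule.zero_mem _⟩
  | add f f' _ _ h h' =>
    obtain ⟨d, h⟩ := h
    obtain ⟨d', h'⟩ := h'
    exact ⟨max d d', Submodule.add_mem _ (range_polyFun_mono (le_max_left _ _) h)
      (range_polyFun_mono (le_max_right _ _) h')⟩
  | smul c f _ h =>
    obtain ⟨d, h⟩ := h
    exact ⟨d, Submodule.smul_mem _ _ h⟩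

/-- The block of `ξ` with given degree and given first multi-index. -/
def blockOf {d : ℕ} (D : Fin d) (R : Fin D → ι) :
    EuclideanSpace ℝ (MonomialIndex ι d) →ₗ[ℝ] ((Fin D → ι) → ℝ) where
  toFun ξ I := ξ ⟨D, R, I⟩
  map_add' _ _ := rfl
  map_smul' _ _ := rfl

/-- The action of a matrix on coefficients, by its tensor powers on every block. -/
def blockAction (d : ℕ) (M : Matrix ι ι ℝ) :
    EuclideanSpace ℝ (MonomialIndex ι d) →ₗ[ℝ] EuclideanSpace ℝ (MonomialIndex ι d) where
  toFun ξ := WithLp.toLp 2 fun z => ((tpow z.1 M).mulVec (blockOf z.1 z.2.1 ξ)) z.2.2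
  map_add' ξ ξ' := by ext z; simp [Matrix.mulVec_add]
  map_smul' c ξ := by ext z; simp [Matrix.mulVec_smul]

theorem blockOf_blockAction {d : ℕ} (D : Fin d) (R : Fin D → ι) (M : Matrix ι ι ℝ)
    (ξ : EuclideanSpace ℝ (MonomialIndex ι d)) :
    blockOf D R (blockAction d M ξ) = (tpow D M).mulVec (blockOf D R ξ) := rfl

theorem polyFun_apply {d : ℕ} (ξ : EuclideanSpace ℝ (MonomialIndex ι d))
    (g : Matrix.SpecialLinearGroup ι ℝ) :
    polyFun d ξ g = ∑ D : Fin d, ∑ R : Fin D → ι, ((tpow D g.1).mulVec (blockOf D R ξ)) R := by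
  simp only [polyFun, LinearMap.coe_mk, AddHom.coe_mk]
  rw [Fintype.sum_sigma]
  refine Finset.sum_congr rfl fun D _ => ?_
  rw [Fintype.sum_prod_type]
  rfl

/-- Right translation of polynomial functions is thus induced by tensor powers acting on the
coefficients. -/
theorem polyFun_blockAction {d : ℕ} (ξ : EuclideanSpace ℝ (MonomialIndex ι d))
    (h g : Matrix.SpecialLinearGroup ι ℝ) : polyFun d (blockAction d h.1 ξ) g = polyFun d ξ (g * h) := by
  simp only [polyFun_apply, blockOf_blockAction, Matrix.SpecialLinearGroup.coe_mul, tpow_mul,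
    Matrix.mulVec_mulVec]

theorem inner_blockAction {d : ℕ} (M : Matrix ι ι ℝ)
    (ξ ξ' : EuclideanSpace ℝ (MonomialIndex ι d)) :
    inner ℝ (blockAction d M ξ) ξ' = inner ℝ ξ (blockAction d M.transpose ξ') := by
  have h : ∀ ξ ξ' : EuclideanSpace ℝ (MonomialIndex ι d), inner ℝ ξ ξ' =
      ∑ D : Fin d, ∑ R : Fin D → ι, (blockOf D R ξ) ⬝ᵥ (blockOf D R ξ') := by
    intro ξ ξ'
    rw [PiLp.inner_apply, Fintype.sum_sigma]
    refine Finset.sum_congr rfl fun D _ => ?_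
    rw [Fintype.sum_prod_type]
    refine Finset.sum_congr rfl fun R _ => Finset.sum_congr rfl fun I _ => ?_
    exact mul_comm _ _
  simp only [h, blockOf_blockAction, tpow_dotProduct]

/-- The adjoint of the action of `h` is the action of `hᵀ`, which again belongs to `SL`. -/
theorem blockAction_mem_orthogonal {d : ℕ} {K : Submodule ℝ (EuclideanSpace ℝ (MonomialIndex ι d))}
    (hK : ∀ h : Matrix.SpecialLinearGroup ι ℝ, ∀ ξ ∈ K, blockAction d h.1 ξ ∈ K)
    (h : Matrix.SpecialLinearGroup ι ℝ) {ξ : EuclideanSpace ℝ (MonomialIndex ι d)} (hξ : ξ ∈ Kᗮ) :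
    blockAction d h.1 ξ ∈ Kᗮ := by
  rw [Submodule.mem_orthogonal] at hξ ⊢
  intro κ hκ
  have := hξ _ (hK h.transpose κ hκ)
  rwa [inner_blockAction, Matrix.SpecialLinearGroup.coe_transpose, Matrix.transpose_transpose] at this

end Monomials

/-! ### Equivariant maps from a continuous representation to tensor powers. -/

section Embedding

variable {ι : Type*} [Fintype ι] [DecidableEq ι]
  {V : Type*} [NormedAddCommGroup V] [NormedSpace ℝ V] [FiniteDimensional ℝ V]
  {ρ : Representation ℝ (Matrix.SpecialLinearGroup ι ℝ) V}

/-- Matrix coefficients of a continuous representation are polynomial. -/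
theorem matrixCoeff_mem_adjoin (hρ : ∀ v, Continuous fun g => ρ g v) (ℓ : V →ₗ[ℝ] ℝ) (v : V) :
    (fun g => ℓ (ρ g v)) ∈ Algebra.adjoin ℝ (Set.range
      fun (p : ι × ι) (g : Matrix.SpecialLinearGroup ι ℝ) => g.1 p.1 p.2) := by
  set b := Module.finBasis ℝ V
  set R : Matrix.SpecialLinearGroup ι ℝ →* Matrix _ _ ℝ :=
    (LinearMap.toMatrixAlgEquiv b).toMulEquiv.toMonoidHom.comp ρ with hR
  have hRe : ∀ g i j, R g i j = b.repr (ρ g (b j)) i := fun g i j =>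
    LinearMap.toMatrixAlgEquiv_apply b (ρ g) i j
  have hc : Continuous R := by
    refine continuous_matrix fun i j => ?_
    simp only [hRe]
    exact (LinearMap.continuous_of_finiteDimensional (b.coord i)).comp (hρ (b j))
  have h := (polynomialOnRoots_of_continuous hc).entriesIn (X := Matrix.SpecialLinearGroup ι ℝ)
    (γ := fun g => g) (𝒜 := Algebra.adjoin ℝ (Set.range
      fun (p : ι × ι) (g : Matrix.SpecialLinearGroup ι ℝ) => g.1 p.1 p.2))
    fun i j => Algebra.subset_adjoin ⟨(i, j), rfl⟩
  have h1 : (fun g => ℓ (ρ g v)) = fun g => ∑ j, ∑ i, R g i j * (b.repr v j * ℓ (b i)) := by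
    ext g
    conv_lhs => rw [← b.sum_repr v, map_sum, map_sum]
    refine Finset.sum_congr rfl fun j _ => ?_
    rw [map_smul, map_smul, ← b.sum_repr (ρ g (b j)), map_sum, Finset.smul_sum]
    refine Finset.sum_congr rfl fun i _ => ?_
    rw [map_smul, hRe, smul_eq_mul, smul_eq_mul]
    ring
  rw [h1]
  exact sum_mem_functions fun j _ => sum_mem_functions fun i _ =>
    Subalgebra.mul_mem _ (h i j) (const_mem_functions _)

/-- A continuous representation of `SL` maps to tensor powers of the standard representation, and
these maps separate points. -/
theorem exists_equivariant_ne_zero (hρ : ∀ v, Continuous fun g => ρ g v) {x : V} (hx : x ≠ 0) :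
    ∃ (D : ℕ) (Φ : V →ₗ[ℝ] ((Fin D → ι) → ℝ)), (∀ g v, Φ (ρ g v) = (tpow D g.1).mulVec (Φ v)) ∧
      Φ x ≠ 0 := by
  obtain ⟨ℓ, hℓ⟩ : ∃ ℓ : V →ₗ[ℝ] ℝ, ℓ x ≠ 0 := by
    by_contra! h
    exact hx ((Module.forall_dual_apply_eq_zero_iff ℝ x).mp h)
  set b := Module.finBasis ℝ V
  choose e he using fun v => exists_mem_range_polyFun (matrixCoeff_mem_adjoin hρ ℓ v)
  set d := ∑ j, e (b j) with hd
  have hb : ∀ j, ∃ ξ, polyFun d ξ = fun g => ℓ (ρ g (b j)) := fun j =>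
    range_polyFun_mono (Finset.single_le_sum (f := fun j => e (b j)) (fun _ _ => Nat.zero_le _)
      (Finset.mem_univ j)) (he (b j))
  choose ξ₀ hξ₀ using hb
  set ξ : V →ₗ[ℝ] EuclideanSpace ℝ (MonomialIndex ι d) := b.constr ℝ ξ₀ with hξ
  have hξe : ∀ v g, polyFun d (ξ v) g = ℓ (ρ g v) := by
    intro v g
    rw [hξ, Module.Basis.constr_apply_fintype, map_sum, Finset.sum_apply]
    conv_rhs => rw [← b.sum_repr v, map_sum, map_sum]
    refine Finset.sum_congr rfl fun j _ => ?_
    rw [map_smul, map_smul, map_smul, Pi.smul_apply, hξ₀]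
    rfl
  -- Monomials may satisfy relations as functions on `SL`, so the coefficient map `ξ` is only known
  -- to be equivariant modulo `K`. Projecting to the invariant complement `Kᗮ` repairs this.
  set K := LinearMap.ker (polyFun (ι := ι) d) with hK
  have hKs : ∀ h : Matrix.SpecialLinearGroup ι ℝ, ∀ ζ ∈ K, blockAction d h.1 ζ ∈ K := by
    intro h ζ hζ
    rw [hK, LinearMap.mem_ker] at hζ ⊢
    ext g
    rw [polyFun_blockAction, hζ]
    rfl
  have hKo : ∀ (h : Matrix.SpecialLinearGroup ι ℝ) {ζ}, ζ ∈ Kᗮ → blockAction d h.1 ζ ∈ Kᗮ :=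
    fun h ζ => blockAction_mem_orthogonal hKs h
  have hP : ∀ ζ ∈ K, Kᗮ.starProjection ζ = 0 := fun ζ hζ => by
    refine Submodule.eq_starProjection_of_mem_orthogonal (Submodule.zero_mem _) ?_
    rw [sub_zero]
    exact Submodule.le_orthogonal_orthogonal K hζ
  have hPT : ∀ (h : Matrix.SpecialLinearGroup ι ℝ) ζ,
      Kᗮ.starProjection (blockAction d h.1 ζ) = blockAction d h.1 (Kᗮ.starProjection ζ) := by
    intro h ζ
    refine Submodule.eq_starProjection_of_mem_orthogonal (hKo h (Submodule.starProjection_apply_mem _ _)) ?_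
    rw [← map_sub]
    exact blockAction_mem_orthogonal (fun h ζ hζ => hKo h hζ) h
      (Submodule.sub_starProjection_mem_orthogonal ζ)
  have hequi : ∀ (g : Matrix.SpecialLinearGroup ι ℝ) v,
      Kᗮ.starProjection (ξ (ρ g v)) = blockAction d g.1 (Kᗮ.starProjection (ξ v)) := by
    intro g v
    rw [← hPT, ← sub_eq_zero, ← map_sub]
    refine hP _ ?_
    rw [hK, LinearMap.mem_ker, map_sub, sub_eq_zero]
    ext h
    rw [polyFun_blockAction, hξe, hξe, map_mul]
    rfl
  have hne : Kᗮ.starProjection (ξ x) ≠ 0 := by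
    intro h0
    have h1 := Submodule.sub_starProjection_mem_orthogonal (K := Kᗮ) (ξ x)
    rw [h0, sub_zero, Submodule.orthogonal_orthogonal, hK, LinearMap.mem_ker] at h1
    have h2 := hξe x 1
    rw [h1, map_one] at h2
    exact hℓ h2.symm
  obtain ⟨⟨D, R, I⟩, hz⟩ : ∃ z, Kᗮ.starProjection (ξ x) z ≠ 0 := by
    by_contra! h
    exact hne (by ext z; exact h z)
  refine ⟨D, (blockOf D R).comp ((Kᗮ.starProjection : _ →ₗ[ℝ] _).comp ξ), fun g v => ?_, fun h => ?_⟩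
  · simp only [LinearMap.comp_apply, ContinuousLinearMap.coe_coe]
    rw [hequi, blockOf_blockAction]
  · exact hz (congrFun h I)

end Embedding

end ShrinkingCurves

namespace ShrinkingCurves

/-! ### Continuity of the adapted frame and of the coefficients `κ_{i,j}`. -/

section Frame

variable {n : ℕ} {φ : ℝ → Fin n → ℝ} {s : ℝ}

theorem continuousAt_iteratedDeriv {k j : ℕ} (hφ : ContDiffAt ℝ k φ s) (hj : j ≤ k) :
    ContinuousAt (iteratedDeriv j φ) s := by
  rw [iteratedDeriv_eq_equiv_comp]
  exact (LinearIsometryEquiv.continuous _).continuousAt.comp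
    (hφ.continuousAt_iteratedFDeriv (by exact_mod_cast hj))

/-- The matrix whose first `m` rows are the derivatives `φ⁽¹⁾(s), …, φ⁽ᵐ⁾(s)` and whose other rows are
those of the identity. -/
noncomputable def derivMatrix (φ : ℝ → Fin n → ℝ) (m : ℕ) (s : ℝ) : Matrix (Fin n) (Fin n) ℝ :=
  Matrix.of fun i l => if (i : ℕ) < m then iteratedDeriv ((i : ℕ) + 1) φ s l else (1 : Matrix _ _ ℝ) i l

theorem continuousAt_derivMatrix {k : ℕ} (hφ : ContDiffAt ℝ k φ s) (hk : n ≤ k) (m : ℕ) :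
    ContinuousAt (derivMatrix φ m) s := by
  refine continuousAt_pi.mpr fun i => continuousAt_pi.mpr fun l => ?_
  simp only [derivMatrix, Matrix.of_apply]
  split_ifs
  · exact (continuous_apply l).continuousAt.comp
      (continuousAt_iteratedDeriv hφ (Nat.succ_le_iff.mpr (i.2.trans_le hk)))
  · exact continuousAt_const

theorem OrderedRegularAt.det_derivMatrix_ne_zero (h : OrderedRegularAt φ s) {m : ℕ} (hm : m ≤ n) :
    (derivMatrix φ m s).det ≠ 0 := by
  intro h0
  obtain ⟨x, hx, hx0⟩ := Matrix.exists_mulVec_eq_zero_iff.mpr h0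
  refine hx (h.eq_zero hm x (fun l hl => ?_) fun i => ?_)
  · have := congrFun hx0 l
    simpa [Matrix.mulVec, dotProduct, derivMatrix, not_lt.mpr hl, Matrix.one_apply] using this
  · have := congrFun hx0 (Fin.castLE hm i)
    simpa [Matrix.mulVec, derivMatrix, dotProduct] using this

theorem orderedRegularAt_of_det_ne_zero (h : ∀ m ≤ n, (derivMatrix φ m s).det ≠ 0) :
    OrderedRegularAt φ s := by
  intro m hm
  rw [eq_top_iff]
  intro w _
  set w' : Fin n → ℝ := fun l => if hl : (l : ℕ) < m then w ⟨l, hl⟩ else 0 with hw'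
  have hu : IsUnit (derivMatrix φ m s).det := isUnit_iff_ne_zero.mpr (h m hm)
  set y := Matrix.vecMul w' (derivMatrix φ m s)⁻¹ with hy
  have hyw : Matrix.vecMul y (derivMatrix φ m s) = w' := by
    rw [hy, Matrix.vecMul_vecMul, Matrix.nonsing_inv_mul _ hu, Matrix.vecMul_one]
  refine ⟨∑ i : Fin m, y (Fin.castLE hm i) • iteratedDeriv ((i : ℕ) + 1) φ s,
    Submodule.sum_mem _ fun i _ => Submodule.smul_mem _ _ (Submodule.subset_span ⟨i, rfl⟩), ?_⟩
  funext l
  have h1 := congrFun hyw (Fin.castLE hm l)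
  have h2 : w' (Fin.castLE hm l) = w l := by simp [hw']
  rw [h2, Matrix.vecMul, dotProduct] at h1
  rw [LinearMap.funLeft_apply, Finset.sum_apply, ← h1]
  refine Fintype.sum_of_injective (Fin.castLE hm) (Fin.castLE_injective hm) _ _ ?_ ?_
  · intro i hi
    have hi' : ¬ (i : ℕ) < m := fun hlt => hi ⟨⟨i, hlt⟩, rfl⟩
    rw [derivMatrix, Matrix.of_apply, if_neg hi', Matrix.one_apply_ne, mul_zero]
    rintro rfl
    exact hi' l.2
  · intro i
    simp [derivMatrix]

theorem OrderedRegularAt.eventually {k : ℕ} (h : OrderedRegularAt φ s) (hφ : ContDiffAt ℝ k φ s)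
    (hk : n ≤ k) : ∀ᶠ s' in 𝓝 s, OrderedRegularAt φ s' := by
  have h1 : ∀ m : Fin (n + 1), ∀ᶠ s' in 𝓝 s, (derivMatrix φ m s').det ≠ 0 := fun m => by
    have : ContinuousAt (fun s' => (derivMatrix φ m s').det) s :=
      (Continuous.matrix_det continuous_id).continuousAt.comp (continuousAt_derivMatrix hφ hk m)
    exact this.eventually_ne (h.det_derivMatrix_ne_zero (Nat.lt_succ_iff.mp m.2))
  filter_upwards [eventually_all.mpr h1] with s' hs'
  exact orderedRegularAt_of_det_ne_zero fun m hm => hs' ⟨m, Nat.lt_succ_iff.mpr hm⟩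

/-- In `0`-based indexing, column `j` of `B(s)⁻¹` is orthogonal to the first `j` derivatives, has
entry `1` in row `j` and zeros below. This is a square linear system with matrix `derivMatrix φ j
s`, so its solution depends continuously on the derivatives. -/
theorem OrderedRegularAt.adaptedFrame_inv_apply (h : OrderedRegularAt φ s) (l j : Fin n) :
    (adaptedFrame φ s)⁻¹ l j = (derivMatrix φ j s)⁻¹ l j := by
  obtain ⟨h1, h2, h3⟩ := h.isAdaptedFrame
  obtain ⟨-, hd, ht⟩ := unipotent_inv h1 h2
  have hu : IsUnit (derivMatrix φ j s).det :=
    isUnit_iff_ne_zero.mpr (h.det_derivMatrix_ne_zero j.2.le)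
  have key : (derivMatrix φ j s).mulVec (fun l => (adaptedFrame φ s)⁻¹ l j) = Pi.single j 1 := by
    funext i
    by_cases hij : (i : ℕ) < j
    · rw [Pi.single_eq_of_ne (by rintro rfl; exact lt_irrefl _ hij)]
      have h4 := (h3 i).2 j hij
      rw [taylorVec, Matrix.smul_vecMul] at h4
      have h5 := (mul_eq_zero.mp h4).resolve_left (inv_ne_zero (by positivity))
      have hij' : i < j := hij
      simpa [Matrix.mulVec, Matrix.vecMul, dotProduct, derivMatrix, hij'] using h5
    · have h4 : (derivMatrix φ j s).mulVec (fun l => (adaptedFrame φ s)⁻¹ l j) i =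
          (adaptedFrame φ s)⁻¹ i j := by
        have hij' : ¬ i < j := hij
        simp [Matrix.mulVec, dotProduct, derivMatrix, hij', Matrix.one_apply]
      rw [h4]
      by_cases he : i = j
      · rw [he, hd, Pi.single_eq_same]
      · rw [Pi.single_eq_of_ne he]
        exact ht i j (lt_of_le_of_ne (not_lt.mp hij) (Ne.symm he))
  have h6 := congrArg ((derivMatrix φ j s)⁻¹).mulVec key
  rw [Matrix.mulVec_mulVec, Matrix.nonsing_inv_mul _ hu, Matrix.one_mulVec] at h6
  have h7 := congrFun h6 l
  simpa using h7

theorem OrderedRegularAt.continuousAt_adaptedCoeff {k : ℕ} (h : OrderedRegularAt φ s)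
    (hφ : ContDiffAt ℝ k φ s) (hk : n ≤ k) (i : Fin n) {j : ℕ} (hj : j ≤ k) :
    ContinuousAt (fun s' => adaptedCoeff φ s' i j) s := by
  have h1 : ContinuousAt (fun s' => ∑ l, taylorVec φ s' j l * (derivMatrix φ i s')⁻¹ l i) s := by
    refine tendsto_finsetSum _ fun l _ => Tendsto.mul ?_ ?_
    · exact ((continuousAt_pi.mp (continuousAt_iteratedDeriv hφ hj) l).const_mul _)
    · have hc := continuousAt_derivMatrix hφ hk i
      have hdet : ContinuousAt (fun s' => (derivMatrix φ i s').det) s :=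
        (Continuous.matrix_det continuous_id).continuousAt.comp hc
      have hadj : ContinuousAt (fun s' => (derivMatrix φ i s').adjugate l i) s :=
        (Continuous.matrix_elem (Continuous.matrix_adjugate continuous_id) l i).continuousAt.comp hc
      simp only [Matrix.inv_def, Matrix.smul_apply, Ring.inverse_eq_inv', smul_eq_mul]
      exact (hdet.inv₀ (h.det_derivMatrix_ne_zero i.2.le)).mul hadj
  refine h1.congr ?_
  filter_upwards [h.eventually hφ hk] with s' hs'
  rw [adaptedCoeff, Matrix.vecMul, dotProduct]
  exact Finset.sum_congr rfl fun l _ => by rw [hs'.adaptedFrame_inv_apply]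

theorem OrderedRegularAt.adaptedCoeff_ne_zero (h : OrderedRegularAt φ s) (i : Fin n) :
    adaptedCoeff φ s i ((i : ℕ) + 1) ≠ 0 :=
  (h.isAdaptedFrame.2.2 i).1

end Frame

/-! ### The Taylor curves as a converging family of polynomial curves. -/

section TaylorPolynomial

open Polynomial

variable {n : ℕ}

/-- The polynomials `g` such that the curve `R_s` is `h ↦ (hⁱ gᵢ(h))ᵢ`. -/
noncomputable def taylorPoly (φ : ℝ → Fin n → ℝ) (k : ℕ) (s : ℝ) : Fin (n + 1) → ℝ[X] :=
  Fin.cons 0 fun i => ∑ j ∈ Finset.Icc ((i : ℕ) + 1) k,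
    C (adaptedCoeff φ s i j) * X ^ (j - ((i : ℕ) + 1))

theorem cons_taylorCurve (φ : ℝ → Fin n → ℝ) (k : ℕ) (s h : ℝ) :
    (Fin.cons 0 (taylorCurve φ k s h) : Fin (n + 1) → ℝ) = curveVec (taylorPoly φ k s) h := by
  funext i
  refine Fin.cases ?_ (fun i => ?_) i
  · simp [curveVec, taylorPoly]
  · rw [Fin.cons_succ, curveVec, taylorPoly, Fin.cons_succ, Polynomial.eval_finsetSum, Finset.mul_sum,
      taylorCurve]
    refine Finset.sum_congr rfl fun j hj => ?_
    rw [Polynomial.eval_mul, Polynomial.eval_C, Polynomial.eval_pow, Polynomial.eval_X, Fin.val_succ,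
      mul_left_comm, ← pow_add, Nat.add_sub_cancel' (Finset.mem_Icc.mp hj).1]

theorem coeff_taylorPoly_succ (φ : ℝ → Fin n → ℝ) (k : ℕ) (s : ℝ) (i : Fin n) (j : ℕ) :
    (taylorPoly φ k s i.succ).coeff j =
      if (i : ℕ) + 1 + j ≤ k then adaptedCoeff φ s i ((i : ℕ) + 1 + j) else 0 := by
  rw [taylorPoly, Fin.cons_succ, Polynomial.finsetSum_coeff]
  simp only [Polynomial.coeff_C_mul, Polynomial.coeff_X_pow]
  split_ifs with h
  · rw [Finset.sum_eq_single ((i : ℕ) + 1 + j)]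
    · simp
    · intro b hb hne
      rw [if_neg, mul_zero]
      have := (Finset.mem_Icc.mp hb).1
      omega
    · intro hn
      exact absurd (Finset.mem_Icc.mpr ⟨Nat.le_add_right _ _, h⟩) hn
  · refine Finset.sum_eq_zero fun b hb => ?_
    rw [if_neg, mul_zero]
    have := Finset.mem_Icc.mp hb
    omega

theorem curveFamily_taylorPoly {Ω : Type*} {l : Filter Ω} {φ : ℝ → Fin n → ℝ} {k : ℕ} {s₀ : ℝ}
    (h : OrderedRegularAt φ s₀) (hφ : ContDiffAt ℝ k φ s₀) (hk : n ≤ k) {s : Ω → ℝ}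
    (hs : Tendsto s l (𝓝 s₀)) :
    CurveFamily l k (fun ω => taylorPoly φ k (s ω)) (taylorPoly φ k s₀) where
  natDegree_le ω i := by
    refine Fin.cases (by simp [taylorPoly]) (fun i => ?_) i
    rw [Polynomial.natDegree_le_iff_coeff_eq_zero]
    intro j hj
    rw [coeff_taylorPoly_succ, if_neg (by omega)]
  tendsto i j := by
    refine Fin.cases (by simpa [taylorPoly] using tendsto_const_nhds) (fun i => ?_) i
    simp only [coeff_taylorPoly_succ]
    split_ifs with hj
    · exact (h.continuousAt_adaptedCoeff hφ hk i hj).tendsto.comp hs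
    · exact tendsto_const_nhds
  zero ω := rfl
  ne i hi := by
    obtain ⟨i, rfl⟩ := Fin.exists_succ_eq.mpr hi
    rw [coeff_taylorPoly_succ, if_pos (by have := i.2; omega), add_zero]
    exact h.adaptedCoeff_ne_zero i

end TaylorPolynomial

end ShrinkingCurves

namespace ShrinkingCurves

/-! ### From the data of the theorem to the regime and the bounds in tensor powers. -/

section Transfer

variable {n : ℕ}

/-- The logarithm of the diagonal element `a_t`. -/
def expVec (τ : ℝ) (r : Fin n → ℝ) : Fin (n + 1) → ℝ := Fin.cons (n * τ) fun i => -r i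

theorem coe_expandingDiag_mul_horo {τ : ℝ} {r : Fin n → ℝ} (h : ∑ i, r i = n * τ) (φ : ℝ → Fin n → ℝ)
    (k : ℕ) (s y : ℝ) : (expandingDiag τ r h * horo (taylorCurve φ k s y)).1 =
      diagRow (expVec τ r) (curveVec (taylorPoly φ k s) y) := by
  rw [Matrix.SpecialLinearGroup.coe_mul, ← cons_taylorCurve, diagRow, ← horoMatrix_eq]
  congr 1
  change Matrix.diagonal _ = Matrix.diagonal _
  congr 1
  funext i
  refine Fin.cases ?_ (fun i => ?_) i <;> simp [expVec]

theorem regime_of_tendsto {ι Ω : Type*} [Preorder ι] {l : Filter Ω} {τ : ι → ℝ}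
    (hτ : Tendsto τ atTop atTop) {r : ι → Fin n → ℝ} (hr_anti : ∀ t, Antitone (r t))
    (hr_nonneg : ∀ t i, 0 ≤ r t i) (hr_sum : ∀ t, ∑ i, r t i = n * τ t) {n₀ : ℕ} (hn₀ : 1 ≤ n₀)
    (hn₀n : n₀ ≤ n)
    (hr_top : ∀ i : Fin n, (i : ℕ) + 1 = n₀ → Tendsto (fun t => r t i) atTop atTop)
    (hr_zero : ∀ i : Fin n, n₀ < (i : ℕ) + 1 → Tendsto (fun t => r t i) atTop (𝓝 0))
    {α : ι → ℝ} (hα : ∀ t, 1 ≤ α t) {p : Ω → ι} (hp : Tendsto p l atTop) :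
    Regime l n n₀ (fun ω => expVec (τ (p ω)) (r (p ω))) (fun ω => τ (p ω))
      fun ω => Real.log (α (p ω)) where
  one_le := hn₀
  le := hn₀n
  zero ω := rfl
  sum ω := by simp [expVec, Fin.sum_univ_succ, hr_sum]
  nonpos ω i hi := by
    obtain ⟨i, rfl⟩ := Fin.exists_succ_eq.mpr hi
    simpa [expVec] using hr_nonneg (p ω) i
  mono ω i j hi hij := by
    obtain ⟨i, rfl⟩ := Fin.exists_succ_eq.mpr hi
    have hj : j ≠ 0 := by
      rintro rfl
      exact hi (Fin.le_zero_iff.mp hij)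
    obtain ⟨j, rfl⟩ := Fin.exists_succ_eq.mpr hj
    simpa [expVec] using hr_anti (p ω) (Fin.succ_le_succ_iff.mp hij)
  bot i hi hin := by
    obtain ⟨i, rfl⟩ := Fin.exists_succ_eq.mpr hi
    rw [Fin.val_succ] at hin
    simp only [expVec, Fin.cons_succ]
    refine tendsto_neg_atTop_atBot.comp (tendsto_atTop_mono (fun ω => ?_)
      ((hr_top ⟨n₀ - 1, by omega⟩ (Nat.sub_add_cancel hn₀)).comp hp))
    exact hr_anti (p ω) (Fin.le_def.mpr (by simp only; omega))
  null i hi := by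
    have hi0 : i ≠ 0 := by
      rintro rfl
      simp at hi
    obtain ⟨i, rfl⟩ := Fin.exists_succ_eq.mpr hi0
    rw [Fin.val_succ] at hi
    simpa [expVec] using ((hr_zero i hi).comp hp).neg
  nonneg ω := Real.log_nonneg (hα _)
  top := hτ.comp hp

variable {V : Type*} [NormedAddCommGroup V] [NormedSpace ℝ V] [FiniteDimensional ℝ V]
  {ρ : Representation ℝ (Matrix.SpecialLinearGroup (Fin (n + 1)) ℝ) V}

theorem continuous_horo_taylorCurve (φ : ℝ → Fin n → ℝ) (k : ℕ) (s : ℝ) :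
    Continuous fun y => horo (taylorCurve φ k s y) := by
  refine Continuous.subtype_mk (continuous_matrix fun i j => ?_) _
  simp only [horoMatrix, Matrix.of_apply]
  split_ifs
  · refine Fin.cases ?_ (fun j => ?_) j
    · simpa using continuous_const
    · simp only [Fin.cons_succ, taylorCurve]
      fun_prop
  · exact continuous_const
  · exact continuous_const

/-- Continuity on the compact interval makes the family bounded above; without this the real
supremum would take its default value `0` and control nothing. -/
theorem norm_le_iSup_orbit (hρ : ∀ v, Continuous fun g => ρ g v)
    (a : Matrix.SpecialLinearGroup (Fin (n + 1)) ℝ) (φ : ℝ → Fin n → ℝ) (k : ℕ) (s y c d : ℝ) (v : V)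
    (η : Set.Icc c d) : ‖ρ (a * horo (taylorCurve φ k s (y * η))) v‖ ≤
      ⨆ η : Set.Icc c d, ‖ρ (a * horo (taylorCurve φ k s (y * η))) v‖ := by
  have hc : Continuous fun η : Set.Icc c d => ‖ρ (a * horo (taylorCurve φ k s (y * η))) v‖ :=
    ((hρ v).comp (continuous_const.mul ((continuous_horo_taylorCurve φ k s).comp
      (continuous_const.mul continuous_subtype_val)))).norm
  exact le_ciSup (f := fun η : Set.Icc c d => ‖ρ (a * horo (taylorCurve φ k s (y * η))) v‖)
    (isCompact_range hc).bddAbove η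

variable {D : ℕ} {Φ : V →ₗ[ℝ] ((Fin D → Fin (n + 1)) → ℝ)}

theorem exists_abs_apply_le (Φ : V →ₗ[ℝ] ((Fin D → Fin (n + 1)) → ℝ)) :
    ∃ C : ℝ, 0 ≤ C ∧ ∀ v J, |Φ v J| ≤ C * ‖v‖ := by
  refine ⟨‖LinearMap.toContinuousLinearMap Φ‖, norm_nonneg _, fun v J => ?_⟩
  rw [← Real.norm_eq_abs]
  exact (norm_le_pi_norm (Φ v) J).trans ((LinearMap.toContinuousLinearMap Φ).le_opNorm v)

theorem shrinkBound_of_iSup_le (hρ : ∀ v, Continuous fun g => ρ g v)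
    (hΦ : ∀ g v, Φ (ρ g v) = (tpow D g.1).mulVec (Φ v)) {C : ℝ} (hC0 : 0 ≤ C)
    (hC : ∀ v J, |Φ v J| ≤ C * ‖v‖) {τ : ℝ} {r : Fin n → ℝ} (h : ∑ i, r i = n * τ)
    {φ : ℝ → Fin n → ℝ} {k : ℕ} {s α c d M : ℝ} (hα : 1 ≤ α) {v : V}
    (hM : ⨆ η : Set.Icc c d, ‖ρ (expandingDiag τ r h *
      horo (taylorCurve φ k s (α * Real.exp (-τ) * η))) v‖ ≤ M) :
    ShrinkBound (expVec τ r) (τ - Real.log α) (taylorPoly φ k s) c d (Φ v) (C * M) := by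
  intro η hη J
  have h1 : Real.exp (-(τ - Real.log α)) * η = α * Real.exp (-τ) * η := by
    rw [neg_sub, sub_eq_add_neg, Real.exp_add, Real.exp_log (zero_lt_one.trans_le hα)]
  rw [h1, ← coe_expandingDiag_mul_horo h, ← hΦ]
  exact (hC _ _).trans (mul_le_mul_of_nonneg_left
    ((norm_le_iSup_orbit hρ _ φ k s _ c d v ⟨η, hη⟩).trans hM) hC0)

end Transfer

end ShrinkingCurves

/-! ### The theorem. -/

open ShrinkingCurves in
theorem mainTheorem7
    {n : ℕ} (hn : 0 < n)
    -- the net of times `τ t`, `t → ∞`, and the exponents `r₁ ≥ ⋯ ≥ rₙ ≥ 0`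
    {ι : Type*} [Preorder ι] [IsDirectedOrder ι] [Nonempty ι]
    (τ : ι → ℝ) (hτ₀ : ∀ t, 0 ≤ τ t) (hτ : Tendsto τ atTop atTop)
    (r : ι → Fin n → ℝ) (hr_anti : ∀ t, Antitone (r t)) (hr_nonneg : ∀ t i, 0 ≤ r t i)
    (hr_sum : ∀ t, ∑ i, r t i = n * τ t)
    (n₀ : ℕ) (hn₀ : 1 ≤ n₀) (hn₀n : n₀ ≤ n)
    (hr_top : ∀ i : Fin n, (i : ℕ) + 1 = n₀ → Tendsto (fun t => r t i) atTop atTop)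
    (hr_zero : ∀ i : Fin n, n₀ < (i : ℕ) + 1 → Tendsto (fun t => r t i) atTop (𝓝 0))
    -- the curve
    (k : ℕ) (hk : n ≤ k) (φ : ℝ → Fin n → ℝ) (s₀ : ℝ) (hs₀ : s₀ ∈ Set.Ioo (0 : ℝ) 1)
    (hφ : ContDiffAt ℝ k φ s₀) (hreg : OrderedRegularAt φ s₀)
    -- the shrinking scale and the base points
    (α : ι → ℝ) (hα : ∀ t, 1 ≤ α t)
    (s : ι → ℝ) (hs : ∀ t, s t ∈ Set.Ioo (0 : ℝ) 1) (hs_lim : Tendsto s atTop (𝓝 s₀))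
    (hscale : (∀ t, α t = 1 ∧ s t = s₀) ∨
      (Tendsto α atTop atTop ∧ Tendsto (fun t => α t * Real.exp (-τ t)) atTop (𝓝 0)))
    -- the representation
    {V : Type*} [NormedAddCommGroup V] [NormedSpace ℝ V] [FiniteDimensional ℝ V]
    (ρ : Representation ℝ (Matrix.SpecialLinearGroup (Fin (n + 1)) ℝ) V)
    (hρ : ∀ v, Continuous fun g => ρ g v)
    -- the compact interval `J = [c, d]`
    (c d : ℝ) (hc : 0 < c) (hcd : c < d) :
    (∃ D₂ : ℝ, 0 < D₂ ∧ ∃ T : ι, ∀ v : V, ∀ t, T ≤ t →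
      D₂ * ‖v‖ ≤ ⨆ η : Set.Icc c d,
        ‖ρ (expandingDiag (τ t) (r t) (hr_sum t) *
          horo (taylorCurve φ k (s t) (α t * Real.exp (-τ t) * η))) v‖) ∧
    (∀ {κ : Type*} [Preorder κ] [IsDirectedOrder κ] [Nonempty κ]
      (σ : κ → ι) (_ : Tendsto σ atTop atTop)
      (w : κ → V) (v : V) (_ : Tendsto w atTop (𝓝 v)) (M : ℝ) (_ : 0 < M)
      (_ : ∀ i, ⨆ η : Set.Icc c d,
        ‖ρ (expandingDiag (τ (σ i)) (r (σ i)) (hr_sum (σ i)) *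
          horo (taylorCurve φ k (s (σ i)) (α (σ i) * Real.exp (-τ (σ i)) * η))) (w i)‖ ≤ M),
      (Tendsto (fun i => α (σ i)) atTop atTop → ∀ g ∈ subgroupG n n₀, ρ g v = v) ∧
      (NonUniform hn r → ∀ g ∈ subgroupQn n n₀, ρ g v = v)) := by
  refine ⟨?_, ?_⟩
  · by_contra! hcon
    -- Failure of (A) is used with every threshold `x.1` and the constants `1 / (x.2 + 1)`; the
    -- pairs `x` index a new net.
    have hcon' : ∀ x : ι × ℕ, ∃ v : V, ∃ t, x.1 ≤ t ∧ (⨆ η : Set.Icc c d,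
        ‖ρ (expandingDiag (τ t) (r t) (hr_sum t) *
          horo (taylorCurve φ k (s t) (α t * Real.exp (-τ t) * η))) v‖) < 1 / ((x.2 : ℝ) + 1) * ‖v‖ :=
      fun x => hcon (1 / ((x.2 : ℝ) + 1)) (by positivity) x.1
    choose v p hp hv using hcon'
    have hv0 : ∀ x, 0 < ‖v x‖ := fun x => by
      rw [norm_pos_iff]
      intro h0
      have := hv x
      rw [h0] at this
      simp at this
    set w : ι × ℕ → V := fun x => ‖v x‖⁻¹ • v x with hw
    have hw1 : ∀ x, w x ∈ Metric.sphere (0 : V) 1 := fun x => by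
      rw [mem_sphere_zero_iff_norm, hw, norm_smul, norm_inv, norm_norm, inv_mul_cancel₀ (hv0 x).ne']
    have hwb : ∀ x, (⨆ η : Set.Icc c d, ‖ρ (expandingDiag (τ (p x)) (r (p x)) (hr_sum (p x)) *
        horo (taylorCurve φ k (s (p x)) (α (p x) * Real.exp (-τ (p x)) * η))) (w x)‖) ≤
        1 / ((x.2 : ℝ) + 1) := fun x => by
      simp only [hw, map_smul, norm_smul, norm_inv, norm_norm]
      rw [← Real.mul_iSup_of_nonneg (inv_nonneg.mpr (norm_nonneg _)), inv_mul_le_iff₀ (hv0 x), mul_comm ‖v x‖]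
      exact (hv x).le
    -- Along an ultrafilter the normalised vectors converge on the compact unit sphere, so no subnet
    -- has to be extracted.
    set l : Filter (ι × ℕ) := (Ultrafilter.of (atTop ×ˢ atTop : Filter (ι × ℕ)) : Filter (ι × ℕ))
    have hl : l ≤ atTop ×ˢ atTop := Ultrafilter.of_le _
    have hpl : Tendsto p l atTop :=
      tendsto_atTop_mono hp (tendsto_fst.mono_left hl)
    obtain ⟨w', hw', hwt⟩ := (isCompact_sphere (0 : V) 1).ultrafilter_le_nhds
      ((Ultrafilter.of (atTop ×ˢ atTop : Filter (ι × ℕ))).map w)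
      (tendsto_principal.mpr (Eventually.of_forall hw1))
    have hw'0 : w' ≠ 0 := by
      rintro rfl
      simp at hw'
    obtain ⟨D, Φ, hΦ, hΦ0⟩ := exists_equivariant_ne_zero hρ hw'0
    obtain ⟨C, hC0, hC⟩ := exists_abs_apply_le Φ
    have hM : Tendsto (fun x : ι × ℕ => C * (1 / ((x.2 : ℝ) + 1))) l (𝓝 0) := by
      have := (tendsto_one_div_add_atTop_nhds_zero_nat (𝕜 := ℝ)).comp
        (tendsto_snd.mono_left hl : Tendsto Prod.snd l atTop)
      simpa using this.const_mul C
    exact not_shrinkBound_of_tendsto_zero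
      (regime_of_tendsto hτ hr_anti hr_nonneg hr_sum hn₀ hn₀n hr_top hr_zero hα hpl)
      (curveFamily_taylorPoly hreg hφ hk (hs_lim.comp hpl)) hcd
      (((LinearMap.continuous_of_finiteDimensional Φ).tendsto w').comp hwt) hΦ0 hM
      (Eventually.of_forall fun x => shrinkBound_of_iSup_le hρ hΦ hC0 hC (hr_sum (p x)) (hα (p x))
        (hwb x))
  · intro κ _ _ _ σ hσ w v hw M _ hM
    -- Invariance can be tested on tensor powers: otherwise some equivariant map would be nonzero at
    -- `ρ g v - v`.
    have hfix : ∀ g, (∀ (D : ℕ) (Φ : V →ₗ[ℝ] ((Fin D → Fin (n + 1)) → ℝ)),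
        (∀ g v, Φ (ρ g v) = (tpow D g.1).mulVec (Φ v)) → (tpow D g.1).mulVec (Φ v) = Φ v) →
        ρ g v = v := by
      intro g hg
      by_contra hne
      obtain ⟨D, Φ, hΦ, hΦ0⟩ := exists_equivariant_ne_zero hρ (sub_ne_zero.mpr hne)
      exact hΦ0 (by rw [map_sub, hΦ, hg D Φ hΦ, sub_self])
    have hreg' := regime_of_tendsto hτ hr_anti hr_nonneg hr_sum hn₀ hn₀n hr_top hr_zero hα hσ
    have hcurve := curveFamily_taylorPoly hreg hφ hk (hs_lim.comp hσ)
    have hscaled : Tendsto (fun i => α (σ i)) atTop atTop → ∀ g ∈ subgroupG n n₀, ρ g v = v := by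
      intro hασ g hg
      refine hfix g fun D Φ hΦ => ?_
      obtain ⟨C, hC0, hC⟩ := exists_abs_apply_le Φ
      exact fixed_of_scale hreg' hcurve hcd (Real.tendsto_log_atTop.comp hασ)
        (((LinearMap.continuous_of_finiteDimensional Φ).tendsto v).comp hw)
        (Eventually.of_forall fun i => shrinkBound_of_iSup_le hρ hΦ hC0 hC (hr_sum (σ i)) (hα (σ i))
          (hM i)) hg
    refine ⟨hscaled, fun hnon g hg => ?_⟩
    -- If `α → ∞`, the claim follows from the first one because `Q_{n₀}` is contained in `G_{n₀}`.
    -- The gap argument is needed only for `α = 1`, where the curve does not depend on `t`.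
    rcases hscale with hone | ⟨hα', -⟩
    · refine hfix g fun D Φ hΦ => ?_
      obtain ⟨C, hC0, hC⟩ := exists_abs_apply_le Φ
      have hlog : (fun i => Real.log (α (σ i))) = fun _ => 0 := by
        funext i
        rw [(hone _).1, Real.log_one]
      rw [hlog] at hreg'
      have hbd : ∀ i, ShrinkBound (expVec (τ (σ i)) (r (σ i))) (τ (σ i)) (taylorPoly φ k s₀) c d
          (Φ (w i)) (C * M) := fun i => by
        have := shrinkBound_of_iSup_le hρ hΦ hC0 hC (hr_sum (σ i)) (hα (σ i)) (hM i)
        rwa [(hone _).1, (hone _).2, Real.log_one, sub_zero] at this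
      have hcurve' : CurveFamily atTop k (fun _ : κ => taylorPoly φ k s₀) (taylorPoly φ k s₀) :=
        curveFamily_taylorPoly hreg hφ hk tendsto_const_nhds
      have hgap : Tendsto (fun i => expVec (τ (σ i)) (r (σ i)) (Fin.last n) -
          expVec (τ (σ i)) (r (σ i)) (Fin.succ ⟨0, hn⟩)) atTop atTop := by
        have hlast : Fin.last n = Fin.succ ⟨n - 1, Nat.sub_lt hn one_pos⟩ :=
          Fin.ext (Nat.sub_add_cancel hn).symm
        refine (hnon.comp hσ).congr fun i => ?_
        rw [hlast]
        simp only [expVec, Fin.cons_succ, Function.comp_apply]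
        ring
      have hΦw := ((LinearMap.continuous_of_finiteDimensional Φ).tendsto v).comp hw
      rcases hn₀n.lt_or_eq with hlt | rfl
      · exact fixed_of_gap_of_lt hreg' hcurve' hc hcd hlt rfl hgap hΦw (Eventually.of_forall hbd) hg
      · exact fixed_of_gap_of_eq hreg' hcurve' hc hcd rfl hgap hΦw (Eventually.of_forall hbd) hg.1
    · exact hscaled (hα'.comp hσ) g hg.2
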